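/- Let $N=2M+1$ with $M\ge 1$, let $\omega$ be a primitive $N$-th root of unity and $q=\omega^{M+1}$ (so $q^2=\omega$, $q^N=1$). For $L\ge1$, $0\le m\le M$ and $c_0^*,\dots,c_{L-1}^*\in\mathbb C$ consider the Baxter $T$-$Q$ polynomial equation $$\Lambda_m(x)Q(x)=q^{-m}\prod_{j=0}^{L-1}(1-xc_j^*q^{-1})\,Q(xq^{-1})+q^{m}\prod_{j=0}^{L-1}(1+xc_j^*)\,Q(xq)$$ for polynomials $Q,\Lambda_m\in\mathbb C[x]$ with $\deg Q\le ML-m$, $\deg\Lambda_m\le 2\lfloor L/2\rfloor$, $\Lambda_m(x)=\Lambda_m(-x)$, $\Lambda_m(0)=q^m+q^{-m}$. Such a $\Lambda_m$ is an eigenvalue if there is a solution $Q\neq0$; its eigenspace is the space of all solutions $Q$. On $\mathbb C^N$ with coordinates $(v_k)_{k\in\mathbb Z/N}$ let $(Zv)_k=\omega^kv_k$, $(Xv)_k=v_{k-1}$, $Y=ZX$. For $h_j=[a_j:b_j:c_j:d_j]$ let $L_{h_j}(x)=\begin{pmatrix}a_jY&xb_jX\\ xc_jZ&d_j\end{pmatrix}$,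 let $T(x)=(\prod_jd_j)^{-1}\,\mathrm{tr}_{\rm aux}\bigl(L_{h_0}(x)\otimes\cdots\otimes L_{h_{L-1}}(x)\bigr)$ be the normalized transfer matrix on $(\mathbb C^N)^{\otimes L}$, and $D=q^{-L}Y^{\otimes L}$, $D^{1/2}=D^{M+1}$, $D^{-1/2}=D^{M}$, $T^*(x)=T(x)D^{-1/2}$. The parameters are called rational (with square roots $r_j$) if all $a_j,b_j,c_j,d_j$ are non-zero, $r_{j+1}^2=b_jd_j/(a_jc_j)$, and for all $x\in\mathbb C$, $l\in\mathbb Z/N$ the point $\xi_j=r_jq^l$ lies on the spectral curve $\xi_j^N(\xi_{j+1}^Nx^Nc_j^N-d_j^N)=(-1)^N(\xi_{j+1}^Na_j^N-x^Nb_j^N)$ (indices modulo $L$); then $c_j^*:=d_j^{-1}c_jr_{j+1}$. (i) Let $L=3$. For generic $(c_0^*,c_1^*,c_2^*)$ (outside the zero set of some non-zero polynomial) and every $0\le m\le M$ the equation has exactly $N$ distinct eigenvalues $\Lambda_m(x)$, each of which has a one-dimensional eigenspace, generated by a monic $Q$ of degree $3M-m$ with $Q(0)\ne0$. For all rational parameters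 with these $c_j^*$, the corresponding Hamiltonian, the coefficient of $x^2$ in $T^*(x)$, is of Hofstadter type $$\mu(\alpha U+\alpha^{-1}U^{-1})+\nu(\beta V+\beta^{-1}V^{-1})+\rho(\gamma W+\gamma^{-1}W^{-1})\quad\text{with }\alpha=\beta=\gamma=1,$$ for some $\mu,\nu,\rho\in\mathbb C$ and unitary $U,V,W$ with $UV=\omega VU$, $VW=\omega WV$, $WU=\omega UW$, $U^N=V^N=W^N=1$, and $T^*(x)$ has no terms other than those in $x^0$ and $x^2$. The correspondence is that an even $\Lambda_m$ of degree $\le2$ with $\Lambda_m(0)=q^m+q^{-m}$ is an eigenvalue of the $T$-$Q$ equation if and only if $q^m\Lambda_m(x)$ is the eigenvalue of some common (left) eigenvector of the $T(x)$, $x\in\mathbb C$, and if and only if $q^{-m}\Lambda_m(x)$ is. (ii) Let $L=4$, $qa_j=d_j=1$, and $-b_j=c_j=k^{-1/2}$ for $j$ even, $-b_j=c_j=k^{1/2}$ for $j$ odd, with $k\ne0$ generic (outside a finite set) and rational with some $r_j$. Consider the symmetric $T$-$Q$ equation, that is, with reciprocal $\Lambda_m(x)=q^m+q^{-m}+\lambda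 x^2+(q^m+q^{-m})x^4$. For every $0\le m\le M$ there are exactly $N$ distinct eigenvalues $\Lambda_m(x)$, each of which has a one-dimensional eigenspace, generated by a monic $Q$ of degree $4M-2m$ with $Q(0)\neq0$ and $Q^\dagger=\pm Q$, where $Q^\dagger(x)=x^{\deg Q}Q(x^{-1})$. Exactly $M+1$ of these monic $Q$ satisfy $Q^\dagger=Q$, and exactly $M$ satisfy $Q^\dagger=-Q$. Moreover, let $C=Z\otimes X\otimes Z\otimes X$, $U_1=Z\otimes X\otimes1\otimes1$, $U_2=1\otimes Z\otimes X\otimes1$, $U_3=1\otimes1\otimes Z\otimes X$, $U_4=X\otimes1\otimes1\otimes Z$, $V_1=1\otimes Z\otimes Y\otimes X$, $V_4=Z\otimes Y\otimes X\otimes 1$. The $T$-$Q$ equation of the discrete sine-Gordon model is described by the sector $C=1$, for all $m$: on $C=1$ one has $D^{-1/2}U_2=D^{1/2}U_4^{-1}$ and $T^*(x)=(1+x^4)(D^{1/2}+D^{-1/2})-x^2H_{SG}$ with $$\begin{aligned}H_{SG}={}&\tfrac{kc_0d_2d_3}{c_1}D^{-1/2}U_1+\tfrac{c_1d_0d_3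}{kc_2}D^{-1/2}U_2+\tfrac{kc_2d_0d_1}{c_3}D^{-1/2}U_3+\tfrac{c_3d_1d_2}{kc_0}D^{-1/2}U_4\\&+\tfrac{c_1}{kc_0d_2d_3}D^{1/2}U_1^{-1}+\tfrac{kc_2}{c_1d_0d_3}D^{1/2}U_2^{-1}+\tfrac{c_3}{kc_2d_0d_1}D^{1/2}U_3^{-1}+\tfrac{kc_0}{c_3d_1d_2}D^{1/2}U_4^{-1}\\&+\tfrac{kc_1d_0}{qc_3d_2}D^{-1/2}V_1+\tfrac{kqc_3d_2}{c_1d_0}D^{1/2}V_1^{-1}+\tfrac{c_0d_3}{kqc_2d_1}D^{-1/2}V_4+\tfrac{qc_2d_1}{kc_0d_3}D^{1/2}V_4^{-1},\end{aligned}$$ and a reciprocal $\Lambda_m$ as above is an eigenvalue of the $T$-$Q$ equation if and only if $q^m\Lambda_m(x)$ is the eigenvalue of a common (left) eigenvector of the $T(x)$ in the sector $C=1$, and if and only if $q^{-m}\Lambda_m(x)$ is. The discrete quantum pendulum is the sector $C=1$, $m=0$: on $C=D=1$ one has $U_2=U_4^{-1}=:Q_{n-1}$, $U_1^{-1}=U_3=:Q_n$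 and $T^*(x)=2(1+x^4)-x^2H_{DQP}$ with $$H_{DQP}=2(Q_n+Q_n^{-1}+Q_{n-1}+Q_{n-1}^{-1})+k(qQ_{n-1}Q_n+q^{-1}Q_n^{-1}Q_{n-1}^{-1})+k^{-1}(qQ_nQ_{n-1}^{-1}+q^{-1}Q_{n-1}Q_n^{-1}),$$ and a reciprocal $\Lambda_0$ is an eigenvalue of the $T$-$Q$ equation if and only if it is the eigenvalue of a common (left) eigenvector of the $T(x)$ in the sector $C=D=1$. -/

import Mathlib

open Polynomial Matrix

namespace BaxterTQ

noncomputable section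

/-! ### The T-Q polynomial equation -/

/-- `Q` solves the Baxter T-Q polynomial equation in the sector `m` with the parameters `cs j`:
`Λ(x) Q(x) = q⁻ᵐ ∏ⱼ (1 - x cⱼ q⁻¹) Q(x q⁻¹) + qᵐ ∏ⱼ (1 + x cⱼ) Q(x q)`. -/
def TQEquation {L : ℕ} (q : ℂ) (m : ℕ) (cs : Fin L → ℂ) (Λ Q : ℂ[X]) : Prop :=
  Λ * Q =
    C ((q ^ m)⁻¹) * (∏ j, (1 - C (cs j * q⁻¹) * X)) * Q.comp (C q⁻¹ * X) +
      C (q ^ m) * (∏ j, (1 + C (cs j) * X)) * Q.comp (C q * X)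

/-- The eigenspace of `Λ`: all solutions `Q` of the T-Q polynomial equation with
`deg Q ≤ M L - m`. -/
def tqEigenspace {L : ℕ} (M : ℕ) (q : ℂ) (m : ℕ) (cs : Fin L → ℂ) (Λ : ℂ[X]) :
    Submodule ℂ ℂ[X] where
  carrier := {Q | Q.natDegree ≤ M * L - m ∧ TQEquation q m cs Λ Q}
  zero_mem' := by simp [TQEquation]
  add_mem' := by
    rintro P Q ⟨hP, hP'⟩ ⟨hQ, hQ'⟩
    refine ⟨natDegree_add_le_of_degree_le hP hQ, ?_⟩
    unfold TQEquation at *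
    rw [mul_add, hP', hQ', add_comp, add_comp]
    ring
  smul_mem' := by
    rintro a P ⟨hP, hP'⟩
    refine ⟨(natDegree_smul_le a P).trans hP, ?_⟩
    unfold TQEquation at *
    rw [mul_smul_comm, hP', smul_comp, smul_comp, smul_eq_C_mul, smul_eq_C_mul, smul_eq_C_mul]
    ring

/-- The constraints on `Λ_m`: degree at most `2 ⌊L/2⌋`, even, and `Λ_m(0) = qᵐ + q⁻ᵐ`. -/
def Admissible (L : ℕ) (q : ℂ) (m : ℕ) (Λ : ℂ[X]) : Prop :=
  Λ.natDegree ≤ 2 * (L / 2) ∧ Λ.comp (-X) = Λ ∧ Λ.eval 0 = q ^ m + (q ^ m)⁻¹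

/-- The reciprocal form `Λ_m(x) = (qᵐ + q⁻ᵐ) + λ x² + (qᵐ + q⁻ᵐ) x⁴` for `L = 4`. -/
def Reciprocal (q : ℂ) (m : ℕ) (Λ : ℂ[X]) : Prop :=
  ∃ lam : ℂ, Λ = C (q ^ m + (q ^ m)⁻¹) + C lam * X ^ 2 + C (q ^ m + (q ^ m)⁻¹) * X ^ 4

/-- The eigenvalues `Λ_m(x)` of the T-Q polynomial equation. -/
def tqEigenvalues {L : ℕ} (M : ℕ) (q : ℂ) (m : ℕ) (cs : Fin L → ℂ) : Set ℂ[X] :=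
  {Λ | Admissible L q m Λ ∧ tqEigenspace M q m cs Λ ≠ ⊥}

/-- The eigenvalues of the symmetric T-Q polynomial equation (`L = 4`). -/
def symTQEigenvalues (M : ℕ) (q : ℂ) (m : ℕ) (cs : Fin 4 → ℂ) : Set ℂ[X] :=
  {Λ | Reciprocal q m Λ ∧ tqEigenspace M q m cs Λ ≠ ⊥}

/-- The monic eigen-polynomials of the symmetric T-Q polynomial equation (`L = 4`). -/
def symTQEigenpolynomials (M : ℕ) (q : ℂ) (m : ℕ) (cs : Fin 4 → ℂ) : Set ℂ[X] :=
  {Q | Q.Monic ∧ ∃ Λ ∈ symTQEigenvalues M q m cs, Q ∈ tqEigenspace M q m cs Λ}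

/-! ### Weyl operators, the L-operator and the transfer matrix

The quantum space is `⊗^L ℂ^N`, with the basis `|k₀, …, k_{L-1}⟩` indexed by `Fin L → ZMod N`,
`N = 2 M + 1`. -/

/-- Operators on `ℂ^N`. -/
abbrev SiteOp (M : ℕ) := Matrix (ZMod (2 * M + 1)) (ZMod (2 * M + 1)) ℂ

/-- Operators on `⊗^L ℂ^N`. -/
abbrev ChainOp (L M : ℕ) :=
  Matrix (Fin L → ZMod (2 * M + 1)) (Fin L → ZMod (2 * M + 1)) ℂ

/-- `(Z v)ₖ = ωᵏ vₖ`. -/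
def weylZ (M : ℕ) (ω : ℂ) : SiteOp M := Matrix.diagonal fun k => ω ^ k.val

/-- `(X v)ₖ = v_{k-1}`. -/
def weylX (M : ℕ) : SiteOp M := Matrix.of fun i j => if j = i - 1 then 1 else 0

/-- `Y = Z X`. -/
def weylY (M : ℕ) (ω : ℂ) : SiteOp M := weylZ M ω * weylX M

/-- The tensor product `A₀ ⊗ ⋯ ⊗ A_{L-1}` of operators. -/
def tensorOp {L M : ℕ} (A : Fin L → SiteOp M) : ChainOp L M :=
  Matrix.of fun i j => ∏ l, A l (i l) (j l)

/-- Representatives of the parameters `h = [a : b : c : d]` of the L-operator. -/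
structure Params where
  a : ℂ
  b : ℂ
  c : ℂ
  d : ℂ

/-- The L-operator `L_h(x) = ((a Y, x b X), (x c Z, d))`. -/
def LOp (M : ℕ) (ω : ℂ) (h : Params) (x : ℂ) : Matrix (Fin 2) (Fin 2) (SiteOp M) :=
  !![h.a • weylY M ω, (x * h.b) • weylX M; (x * h.c) • weylZ M ω, h.d • (1 : SiteOp M)]

/-- The transfer matrix `T_h(x) = tr_aux (L_{h₀}(x) ⊗ ⋯ ⊗ L_{h_{L-1}}(x))` with periodic boundary
condition: the matrix product and the trace over the auxiliary space are written out as a sum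
over the auxiliary indices `s₀, …, s_{L-1}`, with `s_L = s₀`. -/
def transfer {L : ℕ} [NeZero L] (M : ℕ) (ω : ℂ) (h : Fin L → Params) (x : ℂ) : ChainOp L M :=
  ∑ s : Fin L → Fin 2, tensorOp fun j => LOp M ω (h j) x (s j) (s (j + 1))

/-- The normalized transfer matrix `(d₀ ⋯ d_{L-1})⁻¹ T(x)`. -/
def normTransfer {L : ℕ} [NeZero L] (M : ℕ) (ω : ℂ) (h : Fin L → Params) (x : ℂ) :
    ChainOp L M :=
  (∏ j, (h j).d)⁻¹ • transfer M ω h x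

/-- `D = q^{-L} Y ⊗ ⋯ ⊗ Y`, an operator with `D^N = 1`. -/
def opD (L M : ℕ) (ω q : ℂ) : ChainOp L M :=
  (q ^ L)⁻¹ • tensorOp fun _ : Fin L => weylY M ω

/-- `D^{1/2} := D^{M+1}`, the square root of `D` with `N`-th power `1`. -/
def sqrtD (L M : ℕ) (ω q : ℂ) : ChainOp L M := opD L M ω q ^ (M + 1)

/-- `D^{-1/2} := D^M`, the inverse of `D^{1/2}`. -/
def invSqrtD (L M : ℕ) (ω q : ℂ) : ChainOp L M := opD L M ω q ^ M

/-- `T*(x) = T(x) D^{-1/2}` (normalized). -/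
def transferStar {L : ℕ} [NeZero L] (M : ℕ) (ω q : ℂ) (h : Fin L → Params) (x : ℂ) :
    ChainOp L M :=
  normTransfer M ω h x * invSqrtD L M ω q

/-- The row vector `φ` is a common eigenvector of all the normalized `T(x)`, with the eigenvalue
`Λ(x)`. -/
def IsEigenvector {L : ℕ} [NeZero L] (M : ℕ) (ω : ℂ) (h : Fin L → Params)
    (φ : (Fin L → ZMod (2 * M + 1)) → ℂ) (Λ : ℂ[X]) : Prop :=
  φ ≠ 0 ∧ ∀ x : ℂ, φ ᵥ* normTransfer M ω h x = Λ.eval x • φ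

/-! ### Rational spectral curves -/

/-- `(x, ξ₀, …, ξ_{L-1})` lies on the spectral curve: `ξⱼᴺ = (-1)ᴺ (ξ_{j+1}ᴺ aⱼᴺ - xᴺ bⱼᴺ) /
(ξ_{j+1}ᴺ xᴺ cⱼᴺ - dⱼᴺ)`, with the denominators cleared. -/
def OnSpectralCurve {L : ℕ} [NeZero L] (N : ℕ) (h : Fin L → Params) (x : ℂ)
    (ξ : Fin L → ℂ) : Prop :=
  ∀ j, ξ j ^ N * (ξ (j + 1) ^ N * x ^ N * (h j).c ^ N - (h j).d ^ N) =
    (-1) ^ N * (ξ (j + 1) ^ N * (h j).a ^ N - x ^ N * (h j).b ^ N)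

/-- The spectral curve is totally degenerate: for the square roots
`r_{j+1} = (bⱼ dⱼ / (aⱼ cⱼ))^{1/2}`, it contains the rational curves
`{(x, r₀ q^l, …, r_{L-1} q^l)}`, on which the `ξⱼ` do not depend on `x`. -/
def IsRational {L : ℕ} [NeZero L] (M : ℕ) (q : ℂ) (h : Fin L → Params) (r : Fin L → ℂ) : Prop :=
  (∀ j, (h j).a ≠ 0 ∧ (h j).b ≠ 0 ∧ (h j).c ≠ 0 ∧ (h j).d ≠ 0) ∧
  (∀ j, r (j + 1) ^ 2 = (h j).b * (h j).d / ((h j).a * (h j).c)) ∧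
  ∀ (x : ℂ) (l : ℕ), OnSpectralCurve (2 * M + 1) h x fun j => r j * q ^ l

/-- `cⱼ* = dⱼ⁻¹ cⱼ r_{j+1}`. -/
def cStar {L : ℕ} [NeZero L] (h : Fin L → Params) (r : Fin L → ℂ) (j : Fin L) : ℂ :=
  (h j).c * r (j + 1) / (h j).d

/-- For `L = 4`: `q aⱼ = dⱼ = 1` and `-bⱼ = cⱼ = k^{-1/2}` for `j` even, `k^{1/2}` for `j` odd;
here `κ` stands for `k^{1/2}`. -/
def params4 (q κ : ℂ) : Fin 4 → Params :=
  ![⟨q⁻¹, -κ⁻¹, κ⁻¹, 1⟩, ⟨q⁻¹, -κ, κ, 1⟩, ⟨q⁻¹, -κ⁻¹, κ⁻¹, 1⟩, ⟨q⁻¹, -κ, κ, 1⟩]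

/-! ### Hamiltonians -/

/-- The Hofstadter type Hamiltonian. -/
def hofstadter {n : Type*} [Fintype n] [DecidableEq n] (μ ν ρ α β γ : ℂ)
    (U V W : Matrix n n ℂ) : Matrix n n ℂ :=
  μ • (α • U + α⁻¹ • U⁻¹) + ν • (β • V + β⁻¹ • V⁻¹) + ρ • (γ • W + γ⁻¹ • W⁻¹)

/-- `U, V, W` are unitary Weyl operators: `UV = ω VU`, `VW = ω WV`, `WU = ω UW` and
`U^N = V^N = W^N = 1`. -/
def IsWeylTriple {n : Type*} [Fintype n] [DecidableEq n] (N : ℕ) (ω : ℂ)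
    (U V W : Matrix n n ℂ) : Prop :=
  U ∈ unitaryGroup n ℂ ∧ V ∈ unitaryGroup n ℂ ∧ W ∈ unitaryGroup n ℂ ∧
  U * V = ω • (V * U) ∧ V * W = ω • (W * V) ∧ W * U = ω • (U * W) ∧
  U ^ N = 1 ∧ V ^ N = 1 ∧ W ^ N = 1

/-- `C = Z ⊗ X ⊗ Z ⊗ X`. -/
def opC (M : ℕ) (ω : ℂ) : ChainOp 4 M := tensorOp ![weylZ M ω, weylX M, weylZ M ω, weylX M]

/-- `U₁ = Z ⊗ X ⊗ 1 ⊗ 1`. -/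
def opU1 (M : ℕ) (ω : ℂ) : ChainOp 4 M := tensorOp ![weylZ M ω, weylX M, 1, 1]

/-- `U₂ = 1 ⊗ Z ⊗ X ⊗ 1`. -/
def opU2 (M : ℕ) (ω : ℂ) : ChainOp 4 M := tensorOp ![1, weylZ M ω, weylX M, 1]

/-- `U₃ = 1 ⊗ 1 ⊗ Z ⊗ X`. -/
def opU3 (M : ℕ) (ω : ℂ) : ChainOp 4 M := tensorOp ![1, 1, weylZ M ω, weylX M]

/-- `U₄ = X ⊗ 1 ⊗ 1 ⊗ Z`. -/
def opU4 (M : ℕ) (ω : ℂ) : ChainOp 4 M := tensorOp ![weylX M, 1, 1, weylZ M ω]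

/-- `V₁ = 1 ⊗ Z ⊗ Y ⊗ X`. -/
def opV1 (M : ℕ) (ω : ℂ) : ChainOp 4 M := tensorOp ![1, weylZ M ω, weylY M ω, weylX M]

/-- `V₄ = Z ⊗ Y ⊗ X ⊗ 1`. -/
def opV4 (M : ℕ) (ω : ℂ) : ChainOp 4 M := tensorOp ![weylZ M ω, weylY M ω, weylX M, 1]

/-- The discrete sine-Gordon Hamiltonian, with the parameters `cⱼ`, `dⱼ` and `k`. -/
def sineGordon (M : ℕ) (ω q k : ℂ) (c d : Fin 4 → ℂ) : ChainOp 4 M :=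
  let P := sqrtD 4 M ω q
  let R := invSqrtD 4 M ω q
  (k * c 0 * d 2 * d 3 / c 1) • (R * opU1 M ω) +
  (c 1 * d 0 * d 3 / (k * c 2)) • (R * opU2 M ω) +
  (k * c 2 * d 0 * d 1 / c 3) • (R * opU3 M ω) +
  (c 3 * d 1 * d 2 / (k * c 0)) • (R * opU4 M ω) +
  (c 1 / (k * c 0 * d 2 * d 3)) • (P * (opU1 M ω)⁻¹) +
  (k * c 2 / (c 1 * d 0 * d 3)) • (P * (opU2 M ω)⁻¹) +
  (c 3 / (k * c 2 * d 0 * d 1)) • (P * (opU3 M ω)⁻¹) +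
  (k * c 0 / (c 3 * d 1 * d 2)) • (P * (opU4 M ω)⁻¹) +
  (k * c 1 * d 0 / (q * c 3 * d 2)) • (R * opV1 M ω) +
  (k * q * c 3 * d 2 / (c 1 * d 0)) • (P * (opV1 M ω)⁻¹) +
  (c 0 * d 3 / (k * q * c 2 * d 1)) • (R * opV4 M ω) +
  (q * c 2 * d 1 / (k * c 0 * d 3)) • (P * (opV4 M ω)⁻¹)

/-- The Hamiltonian of the discrete quantum pendulum in the operators `A = Q_{n-1}`,
`B = Q_n`. -/
def pendulum {n : Type*} [Fintype n] [DecidableEq n] (q k : ℂ) (A B : Matrix n n ℂ) :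
    Matrix n n ℂ :=
  (2 : ℂ) • (B + B⁻¹ + A + A⁻¹) +
  k • (q • (A * B) + q⁻¹ • (B⁻¹ * A⁻¹)) +
  k⁻¹ • (q • (B * A⁻¹) + q⁻¹ • (A * B⁻¹))

end

end BaxterTQ

namespace BaxterTQ

/-! ### Adjugates of singular matrices and simple spectra. -/

section LinearAlgebra

variable {n : Type*} [Fintype n] [DecidableEq n]

/-! Write `N = 2M + 1` and `u = q^m`. Along an orbit `{x q^k}` the T-Q equation says that the values
of `Q` form a kernel vector of the periodic tridiagonal matrix `tqMat`. Its determinant has degree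
at most `4N` in `x` and is invariant under `x ↦ q x` and `x ↦ -x`, so only `x^0`, `x^{2N}`, `x^{4N}`
can occur. The outer two drop out because `1` and `x⁻²` are formal solutions at `0` and at infinity.
Hence the determinant is `f(λ) x^{2N}`, where `λ` is the unknown coefficient of `x²` in `Λ` and `f`
has degree `N` (`det_tqMat`). A non-zero polynomial solution exists exactly when `f(λ) = 0`
(`exists_isTQ_ne_zero`, `det_tqMat_eq_zero_of_isTQ`).

The same `f` governs the chain. Eigenvectors of an `N × N` matrix `redHam` embed as left
eigenvectors of all `T(x)` (`embed4_vecMul_transfer`, `embed3_vecMul_transfer`). Conversely, `T(x)`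
acts on Baxter's product vectors by a two-term relation, and pairing any left eigenvector with them
gives a kernel vector on an orbit, so `f(λ) = 0` (`det_cyc_of_eigenvector`). For generic parameters
a comparison of monic polynomials of degree `N` shows that `f` is, up to scaling of the variable,
the characteristic polynomial of `redHam`; as a polynomial identity this holds for all parameters
(`eval_charpoly_redHam`). The case `L = 3` is `L = 4` with one parameter zero.

At a simple root `λ` the adjugate of `tqMat` has rank one and factors through `Q(x)` and `Q(-x)`.
This bounds the degree of a minimal solution from both sides (`exists_isTQ_structure`), and the
equation for the leading coefficient then fixes it. A solution vanishing at `0` is divisible by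
`x^N`, unless the equation with `u⁻¹` in place of `u` has a solution with non-zero constant term;
when that is excluded the eigenspace is a line.

Both requirements, simple roots and no such solution, are non-vanishing conditions on polynomials in
the parameters, so one good point suffices for each. Simplicity for `L = 3` comes from parameters
that cut the cycle into a Hermitian Jacobi matrix (`separable_charpoly_redHam`). In the symmetric
family it comes from three real parameter choices whose characteristic polynomials differ by
constants, and from Laguerre's inequality (`separable_charpoly_redHam_pair`). The other condition is
tested at `(1, 0, 0, 0)` and at `(r, 0, r, 0)` with `r² = -q`.

For the signs of the reflection, the `N` eigenpolynomials restrict to a basis of the functions on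
the orbit of `1`. There `x ↦ x⁻¹` has trace one, so the signs split as `M + 1` and `M`
(`sum_reflection_sign_eq_one`). Rational parameters are brought to `a = d = 1`, `b = c` by a gauge
transformation with characters (`normTransfer_gauge`), and the statements on Hamiltonians are
computations with symmetrically ordered Weyl operators. -/

theorem derivative_det (A : Matrix n n ℂ[X]) :
    derivative A.det = ∑ i, (A.updateRow i fun j => derivative (A i j)).det := by
  simp only [det_apply', derivative_sum]
  rw [Finset.sum_comm]
  refine Finset.sum_congr rfl fun σ _ => ?_
  have hs : derivative ((((Equiv.Perm.sign σ : ℤˣ) : ℤ) : ℂ[X])) = 0 := derivative_intCast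
  rw [derivative_mul, hs, zero_mul, zero_add, derivative_prod_finset, Finset.mul_sum]
  refine Eq.trans (Finset.sum_congr rfl fun i _ => ?_) (Equiv.sum_comp σ _)
  congr 1
  rw [← Finset.mul_prod_erase Finset.univ _ (Finset.mem_univ i), updateRow_self, mul_comm]
  congr 1
  refine Finset.prod_congr rfl fun j hj => ?_
  rw [updateRow_ne]
  exact fun h => (Finset.ne_of_mem_erase hj) (σ.injective h)

/-- Jacobi's formula for the pencil `B + z diag d`. At a simple root of `f` it makes the weighted
trace of the adjugate non-zero. -/
theorem sum_mul_adjugate_of_det_eq (B : Matrix n n ℂ) (d : n → ℂ) (f : ℂ[X])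
    (hf : ∀ z, (B + z • diagonal d).det = f.eval z) (z : ℂ) :
    ∑ i, d i * adjugate (B + z • diagonal d) i i = (derivative f).eval z := by
  set A : Matrix n n ℂ[X] := B.map C + (X : ℂ[X]) • (diagonal d).map C with hA
  have hev : ∀ w, A.map (eval w) = B + w • diagonal d := fun w => by
    ext i j
    by_cases hij : i = j
    · subst hij; simp [hA]; ring
    · simp [hA, hij]
  have hdet : A.det = f := by
    refine Polynomial.funext fun w => ?_
    rw [← hf, ← hev, ← coe_evalRingHom, ← RingHom.mapMatrix_apply, ← RingHom.map_det]
  rw [← hdet, derivative_det, eval_finsetSum]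
  refine Finset.sum_congr rfl fun i _ => ?_
  rw [← coe_evalRingHom, RingHom.map_det, RingHom.mapMatrix_apply, adjugate_apply]
  -- Differentiating row `i` of the pencil leaves `d i` times a unit vector, so its determinant is a
  -- cofactor.
  have : (A.updateRow i fun j => derivative (A i j)).map (evalRingHom z) =
      (B + z • diagonal d).updateRow i (d i • Pi.single i 1) := by
    rw [← hev z]
    ext k l
    by_cases hk : k = i
    · subst hk
      by_cases hl : k = l
      · subst hl; simp [hA]
      · simp [hA, diagonal_apply_ne _ hl, Pi.single_eq_of_ne (Ne.symm hl)]
    · simp [updateRow_ne hk]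
  rw [this, det_updateRow_smul]

/-- The entry is the determinant of `B` with row `j` replaced by the unit vector at `i`, and `v` is
still in the kernel of that matrix. -/
theorem adjugate_apply_eq_zero {B : Matrix n n ℂ} {v : n → ℂ} (hv : v ≠ 0) (hB : B *ᵥ v = 0)
    {i : n} (hi : v i = 0) (j : n) : B.adjugate i j = 0 := by
  rw [adjugate_apply, ← exists_mulVec_eq_zero_iff]
  refine ⟨v, hv, ?_⟩
  ext k
  by_cases hk : k = j
  · subst hk
    simp [mulVec, hi]
  · have := congrFun hB k
    simpa [mulVec, updateRow_ne hk] using this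

/-- A non-zero cofactor means corank at most one: subtracting a multiple of `v` kills the coordinate
`i`, and `adjugate_apply_eq_zero` applies. -/
theorem eq_smul_of_adjugate_ne_zero {B : Matrix n n ℂ} (hB : B.adjugate ≠ 0) {v w : n → ℂ}
    (hv : B *ᵥ v = 0) (hv0 : v ≠ 0) (hw : B *ᵥ w = 0) : ∃ a : ℂ, w = a • v := by
  have : ∃ i j, B.adjugate i j ≠ 0 := by
    by_contra! h
    exact hB (by ext i j; simpa using h i j)
  obtain ⟨i, j, hij⟩ := this
  have hvi : v i ≠ 0 := fun h => hij (adjugate_apply_eq_zero hv0 hv h j)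
  refine ⟨w i / v i, ?_⟩
  by_contra h
  refine hij (adjugate_apply_eq_zero (v := w - (w i / v i) • v) (sub_ne_zero.mpr h) ?_ ?_ j)
  · rw [mulVec_sub, mulVec_smul, hv, hw]; simp
  · simp [hvi]

/-- The adjugate of a singular matrix is a multiple of `v uᵀ`. Contracting with `d` on both sides
eliminates the unknown multiple without a division. -/
theorem adjugate_mul_sum_eq {B : Matrix n n ℂ} {v u : n → ℂ} (hv : B *ᵥ v = 0) (hv0 : v ≠ 0)
    (hu : u ᵥ* B = 0) (hu0 : u ≠ 0) (d : n → ℂ) (k l : n) :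
    B.adjugate k l * ∑ i, d i * (u i * v i) =
      (∑ i, d i * B.adjugate i i) * (v k * u l) := by
  by_cases hB : B.adjugate = 0
  · simp [hB]
  have hdet : B.det = 0 := exists_mulVec_eq_zero_iff.mp ⟨v, hv0, hv⟩
  have hcol : ∀ j, ∃ a : ℂ, (fun i => B.adjugate i j) = a • v := fun j => by
    refine eq_smul_of_adjugate_ne_zero hB hv hv0 ?_
    have := congrArg (fun A : Matrix n n ℂ => fun i => A i j) (mul_adjugate B)
    rw [hdet, zero_smul] at this
    exact this
  have hrow : ∀ i, ∃ a : ℂ, (fun j => B.adjugate i j) = a • u := fun i => by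
    have hB' : Bᵀ.adjugate ≠ 0 := by
      rw [← adjugate_transpose]
      exact fun h => hB (by simpa using congrArg transpose h)
    refine eq_smul_of_adjugate_ne_zero hB' (by rwa [mulVec_transpose]) hu0 ?_
    have := congrArg (fun A : Matrix n n ℂ => fun j => A i j) (adjugate_mul B)
    rw [hdet, zero_smul] at this
    rw [mulVec_transpose]
    exact this
  choose α hα using hcol
  choose β hβ using hrow
  have h1 : ∀ i j, B.adjugate i j = α j * v i := fun i j => congrFun (hα j) i
  have h2 : ∀ i j, B.adjugate i j = β i * u j := fun i j => congrFun (hβ i) j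
  obtain ⟨k0, hk0⟩ := Function.ne_iff.mp hv0
  simp only [Pi.zero_apply] at hk0
  have h3 : ∀ i j, B.adjugate i j = β k0 / v k0 * (v i * u j) := fun i j => by
    have := h1 k0 j
    rw [h2 k0 j] at this
    rw [h1 i j]
    field_simp
    linear_combination (-v i) * this
  simp only [h3, Finset.mul_sum, Finset.sum_mul]
  exact Finset.sum_congr rfl fun i _ => by ring

/-- Spectral mapping. The left side is polynomial in the entries of `H`, which turns a condition on
all eigenvalues into one that can be tested at a single point of a parameter space. -/
theorem det_aeval_ne_zero_iff [Nonempty n] (H : Matrix n n ℂ) (p : ℂ[X]) :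
    (aeval H p).det ≠ 0 ↔ ∀ z, H.charpoly.IsRoot z → p.eval z ≠ 0 := by
  have h : (aeval H p).det ≠ 0 ↔ (0 : ℂ) ∉ spectrum ℂ (aeval H p) := by
    rw [spectrum.zero_notMem_iff, isUnit_iff_isUnit_det, isUnit_iff_ne_zero]
  rw [h, spectrum.map_polynomial_aeval_of_nonempty]
  · simp only [Set.mem_image, not_exists, not_and, mem_spectrum_iff_isRoot_charpoly]
  · obtain ⟨z, hz⟩ := Complex.exists_root (f := H.charpoly) (by
      rw [charpoly_degree_eq_dim]; exact_mod_cast Fintype.card_pos)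
    exact ⟨z, mem_spectrum_iff_isRoot_charpoly.mpr hz⟩

theorem map_det_aeval {R S : Type*} [CommRing R] [CommRing S] (f : R →+* S) (H : Matrix n n R)
    (p : R[X]) : f (aeval H p).det = (aeval (H.map f) (p.map f)).det := by
  rw [RingHom.map_det]
  congr 1
  rw [aeval_def, aeval_def, hom_eval₂, eval₂_map]
  congr 1
  ext r i j
  by_cases hij : i = j
  · subst hij; simp [algebraMap_matrix_apply]
  · simp [algebraMap_matrix_apply, hij]

/-- The product of the values of the derivative of the characteristic polynomial at its roots. -/
noncomputable def charDisc {R : Type*} [CommRing R] (H : Matrix n n R) : R :=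
  (aeval H (derivative H.charpoly)).det

theorem map_charDisc {R S : Type*} [CommRing R] [CommRing S] (f : R →+* S) (H : Matrix n n R) :
    f (charDisc H) = charDisc (H.map f) := by
  rw [charDisc, map_det_aeval, charDisc, charpoly_map, derivative_map]

theorem charDisc_ne_zero_iff [Nonempty n] (H : Matrix n n ℂ) :
    charDisc H ≠ 0 ↔ H.charpoly.Separable := by
  rw [charDisc, det_aeval_ne_zero_iff, separable_def]
  constructor
  · intro h
    by_contra hc
    rw [← EuclideanDomain.gcd_isUnit_iff] at hc
    have hd : (EuclideanDomain.gcd H.charpoly (derivative H.charpoly)).degree ≠ 0 := fun h0 =>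
      hc (isUnit_iff_degree_eq_zero.mpr h0)
    obtain ⟨z, hz⟩ := IsAlgClosed.exists_root _ hd
    exact h z (hz.dvd (EuclideanDomain.gcd_dvd_left _ _))
      (hz.dvd (EuclideanDomain.gcd_dvd_right _ _))
  · rintro ⟨a, b, hab⟩ z hz h0
    have := congrArg (eval z) hab
    rw [eval_add, eval_mul, eval_mul, h0, hz.eq_zero] at this
    simp at this

/-- If the coordinate `i₀` determines an eigenvector, eigenspaces are lines, and for a Hermitian
matrix this is the algebraic multiplicity. -/
theorem separable_charpoly_of_isHermitian {H : Matrix n n ℂ} (hH : H.IsHermitian) (i₀ : n)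
    (h : ∀ (z : ℂ) (v : n → ℂ), H *ᵥ v = z • v → v i₀ = 0 → v = 0) : H.charpoly.Separable := by
  rw [hH.charpoly_eq, separable_prod_X_sub_C_iff]
  intro i j hij
  by_contra hne
  have hij' : hH.eigenvalues i = hH.eigenvalues j := Complex.ofReal_injective hij
  set v : n → ℂ := (hH.eigenvectorBasis i).ofLp with hv
  set w : n → ℂ := (hH.eigenvectorBasis j).ofLp with hw
  have hvi : H *ᵥ v = (hH.eigenvalues i : ℂ) • v := hH.mulVec_eigenvectorBasis i
  have hwi : H *ᵥ w = (hH.eigenvalues i : ℂ) • w := by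
    rw [hij']; exact hH.mulVec_eigenvectorBasis j
  -- This combination of two eigenvectors vanishes at `i₀`, hence is zero; pairing with the first of
  -- them gives `w i₀ = 0`.
  have hz : w i₀ • v - v i₀ • w = 0 := by
    refine h (hH.eigenvalues i) _ ?_ (by simp [mul_comm])
    rw [mulVec_sub, mulVec_smul, mulVec_smul, hvi, hwi, smul_sub, smul_comm, smul_comm (v i₀)]
  have hz' : w i₀ • hH.eigenvectorBasis i - v i₀ • hH.eigenvectorBasis j = 0 := by
    ext k
    exact congrFun hz k
  have hin := congrArg (fun x => inner ℂ (hH.eigenvectorBasis i) x) hz'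
  have hort := orthonormal_iff_ite.mp hH.eigenvectorBasis.orthonormal
  simp only [inner_sub_right, inner_smul_right, hort, if_pos, if_neg hne, mul_one, mul_zero,
    sub_zero, inner_zero_right] at hin
  have hw0 := h _ w hwi hin
  refine hH.eigenvectorBasis.orthonormal.ne_zero j ?_
  ext k
  exact congrFun hw0 k

end LinearAlgebra

end BaxterTQ

/-! ### Characters of `ℤ/N` for odd `N`. -/

namespace BaxterTQ

/-- The index set `ℤ/N`, `N = 2 M + 1`. -/
abbrev Site (M : ℕ) := ZMod (2 * M + 1)

/-- `1/2` in `ℤ/N`. -/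
def half (M : ℕ) : Site M := ((M + 1 : ℕ) : Site M)

section Characters

variable {M : ℕ}

theorem natCast_site : ((2 * M + 1 : ℕ) : Site M) = 0 := ZMod.natCast_self _

theorem two_mul_half : 2 * half M = 1 := by
  have h := natCast_site (M := M)
  unfold half
  push_cast at h ⊢
  linear_combination h

theorem two_mul_eq_zero_iff {k : Site M} : 2 * k = 0 ↔ k = 0 := by
  refine ⟨fun h => ?_, fun h => by simp [h]⟩
  linear_combination (-k) * two_mul_half (M := M) + half M * h

theorem sum_site : ∑ k : Site M, k = 0 := by
  rw [← two_mul_eq_zero_iff, two_mul]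
  nth_rw 1 [← Equiv.sum_comp (Equiv.neg (Site M))]
  rw [← Finset.sum_add_distrib]
  simp

theorem prod_site {β : Type*} [CommMonoid β] (f : Site M → β) :
    ∏ k, f k = ∏ n ∈ Finset.range (2 * M + 1), f (n : Site M) := by
  refine Finset.prod_nbij' (fun k => k.val) (fun n => (n : Site M)) ?_ ?_ ?_ ?_ ?_
  · intro k _; simpa using ZMod.val_lt k
  · simp
  · intro k _; simp
  · intro n hn; simp only [Finset.mem_range] at hn; exact ZMod.val_cast_of_lt hn
  · intro k _; simp

/-- Since `2` is invertible modulo `N`, steps of two reach every residue. -/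
theorem site_induction {p : Site M → Prop} (k : Site M) (h0 : p k) (h : ∀ n, p n → p (n + 2)) :
    ∀ n, p n := by
  have key : ∀ j : ℕ, p (k + 2 * j) := fun j => by
    induction j with
    | zero => simpa using h0
    | succ j ih =>
      have := h _ ih
      push_cast
      convert this using 1
      ring
  intro n
  have := key ((n - k) * half M).val
  rw [ZMod.natCast_zmod_val] at this
  convert this using 1
  linear_combination (k - n) * two_mul_half (M := M)

variable (χ : AddChar (Site M) ℂ)

theorem chi_ne_zero (k : Site M) : χ k ≠ 0 := by
  intro h
  have := χ.map_add_eq_mul k (-k)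
  rw [h] at this
  simp at this

theorem chi_natCast (n : ℕ) : χ (n : Site M) = χ 1 ^ n := by
  rw [← AddChar.map_nsmul_eq_pow]
  simp

theorem chi_mul_natCast (s : Site M) (n : ℕ) : χ (s * n) = χ s ^ n := by
  rw [← AddChar.map_nsmul_eq_pow, nsmul_eq_mul, mul_comm (n : Site M) s]

theorem chi_pow_card (s : Site M) : χ s ^ (2 * M + 1) = 1 := by
  rw [← chi_mul_natCast, natCast_site, mul_zero, AddChar.map_zero_eq_one]

theorem chi_sum {ι : Type*} (s : Finset ι) (f : ι → Site M) :
    χ (∑ i ∈ s, f i) = ∏ i ∈ s, χ (f i) := by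
  classical
  induction s using Finset.induction_on with
  | empty => simp
  | insert i s hi ih => rw [Finset.sum_insert hi, Finset.prod_insert hi, AddChar.map_add_eq_mul, ih]

theorem prod_chi_mul (a : Site M) : ∏ k, χ (a * k) = 1 := by
  rw [← chi_sum, ← Finset.mul_sum, sum_site, mul_zero, AddChar.map_zero_eq_one]

theorem conj_chi (k : Site M) : (starRingEnd ℂ) (χ k) = χ (-k) := by
  have h : ‖χ k‖ = 1 := Complex.norm_eq_one_of_pow_eq_one (chi_pow_card χ k) (by omega)
  rw [AddChar.map_neg_eq_inv, Complex.inv_eq_conj h]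

variable {χ}

theorem isPrimitiveRoot_chi (hχ : Function.Injective χ) :
    IsPrimitiveRoot (χ 1) (2 * M + 1) := by
  refine ⟨chi_pow_card χ 1, fun l hl => ?_⟩
  rw [← chi_natCast, ← AddChar.map_zero_eq_one χ] at hl
  exact (ZMod.natCast_eq_zero_iff _ _).mp (hχ hl)

theorem prod_one_add_mul_chi (hχ : Function.Injective χ) (y : ℂ) :
    ∏ k, (1 + y * χ k) = 1 + y ^ (2 * M + 1) := by
  have h := (isPrimitiveRoot_chi hχ).pow_add_pow_eq_prod_add_mul 1 y ⟨M, rfl⟩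
  rw [one_pow] at h
  rw [h]
  have himg : nthRootsFinset (2 * M + 1) (1 : ℂ) = Finset.univ.image χ := by
    symm
    apply Finset.eq_of_subset_of_card_le
    · intro z hz
      obtain ⟨k, -, rfl⟩ := Finset.mem_image.mp hz
      rw [mem_nthRootsFinset (by omega)]
      exact chi_pow_card χ k
    · rw [(isPrimitiveRoot_chi hχ).card_nthRootsFinset, Finset.card_image_of_injective _ hχ,
        Finset.card_univ, ZMod.card]
  rw [himg, Finset.prod_image (fun a _ b _ hab => hχ hab)]
  exact Finset.prod_congr rfl fun k _ => by ring

theorem prod_one_add_mul_chi_mul_two (hχ : Function.Injective χ) (y : ℂ) :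
    ∏ k, (1 + y * χ (2 * k)) = 1 + y ^ (2 * M + 1) := by
  rw [← prod_one_add_mul_chi hχ]
  have hb : Function.Bijective fun k : Site M => 2 * k := by
    rw [Fintype.bijective_iff_injective_and_card]
    refine ⟨fun a b hab => ?_, rfl⟩
    have : 2 * (a - b) = 0 := by rw [mul_sub]; exact sub_eq_zero.mpr hab
    exact sub_eq_zero.mp (two_mul_eq_zero_iff.mp this)
  exact hb.prod_comp fun k => 1 + y * χ k

/-- The recursion is solved by partial products; `∏ ρ = 1` is the condition for it to close up
around the cycle. -/
theorem exists_gauge (ρ : Site M → ℂ) (h0 : ∀ k, ρ k ≠ 0) (h1 : ∏ k, ρ k = 1) :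
    ∃ E : Site M → ℂ, (∀ k, E k ≠ 0) ∧ ∀ k, E k = ρ k * E (k - 1) := by
  refine ⟨fun k => ∏ n ∈ Finset.range (k.val + 1), ρ (n : Site M),
    fun k => Finset.prod_ne_zero_iff.mpr fun n _ => h0 _, fun k => ?_⟩
  simp only
  rw [Finset.prod_range_succ, ZMod.natCast_zmod_val, mul_comm]
  congr 1
  -- The predecessor of `0` is `2M`: here the full product `h1` is needed.
  by_cases hk : k = 0
  · subst hk
    have hv : (0 - 1 : Site M).val = 2 * M := by
      have : (0 - 1 : Site M) = ((2 * M : ℕ) : Site M) := by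
        have := natCast_site (M := M)
        push_cast at this ⊢
        linear_combination -this
      rw [this, ZMod.val_cast_of_lt (by omega)]
    rw [hv, ← prod_site, h1, ZMod.val_zero, Finset.prod_range_zero]
  · have hk' : k.val ≠ 0 := by rwa [Ne, ZMod.val_eq_zero]
    have hv : (k - 1).val = k.val - 1 := by
      have : k - 1 = ((k.val - 1 : ℕ) : Site M) := by
        rw [Nat.cast_sub (by omega), ZMod.natCast_zmod_val]; simp
      rw [this, ZMod.val_cast_of_lt (by have := ZMod.val_lt k; omega)]
    rw [hv, Nat.sub_add_cancel (by omega)]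

end Characters

/-! ### Determinants of periodic tridiagonal matrices. -/

section Cyclic

variable {M : ℕ} {R : Type*} [CommRing R]

/-- The periodic tridiagonal matrix with the diagonal `a`, and the entries `-b k` at `(k, k + 1)`
and `-c k` at `(k, k - 1)`. -/
def cyc (a b c : Site M → R) : Matrix (Site M) (Site M) R :=
  Matrix.of fun i j =>
    (if j = i then a i else 0) - (if j = i + 1 then b i else 0) - (if j = i - 1 then c i else 0)

theorem cyc_mulVec (a b c v : Site M → R) (i : Site M) :
    (cyc a b c *ᵥ v) i = a i * v i - b i * v (i + 1) - c i * v (i - 1) := by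
  simp [cyc, mulVec, dotProduct, sub_mul, Finset.sum_sub_distrib, ite_mul]

theorem cyc_transpose (a b c : Site M → R) :
    (cyc a b c)ᵀ = cyc a (fun k => c (k + 1)) fun k => b (k - 1) := by
  ext i j
  simp only [cyc, transpose_apply, of_apply]
  have h1 : (i = j + 1) ↔ (j = i - 1) := by rw [eq_sub_iff_add_eq, eq_comm]
  have h2 : (i = j - 1) ↔ (j = i + 1) := by rw [eq_sub_iff_add_eq, eq_comm]
  simp only [h1, h2, eq_comm (a := i) (b := j)]
  rw [sub_right_comm]
  congr 1
  · congr 1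
    · split_ifs with h
      · rw [h]
      · rfl
    · split_ifs with h
      · rw [h]
      · rfl
  · split_ifs with h
    · rw [h]
    · rfl

theorem vecMul_cyc (a b c v : Site M → R) (i : Site M) :
    (v ᵥ* cyc a b c) i = v i * a i - v (i - 1) * b (i - 1) - v (i + 1) * c (i + 1) := by
  rw [← mulVec_transpose, cyc_transpose, cyc_mulVec]
  ring

theorem map_cyc {S : Type*} [CommRing S] (f : R →+* S) (a b c : Site M → R) :
    (cyc a b c).map f = cyc (f ∘ a) (f ∘ b) (f ∘ c) := by
  ext i j
  simp [cyc, apply_ite f]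

theorem det_cyc_shift (a b c : Site M → R) (t : Site M) :
    (cyc (fun k => a (k + t)) (fun k => b (k + t)) fun k => c (k + t)).det = (cyc a b c).det := by
  rw [← det_submatrix_equiv_self (Equiv.addRight t) (cyc a b c)]
  congr 1
  ext i j
  have h1 : j + t = i + t + 1 ↔ j = i + 1 := by
    constructor <;> intro h <;> linear_combination h
  have h2 : j + t = i + t - 1 ↔ j = i - 1 := by
    constructor <;> intro h <;> linear_combination h
  simp [cyc, h1, h2]

theorem det_cyc_gauge {K : Type*} [CommRing K] [IsDomain K] {a b c b' c' E : Site M → K}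
    (hE : ∀ k, E k ≠ 0)
    (hb : ∀ k, b' k * E (k + 1) = E k * b k) (hc : ∀ k, c' k * E (k - 1) = E k * c k) :
    (cyc a b' c').det = (cyc a b c).det := by
  have h : cyc a b' c' * diagonal E = diagonal E * cyc a b c := by
    ext i j
    rw [mul_diagonal, diagonal_mul]
    simp only [cyc, of_apply, sub_mul, mul_sub, ite_mul, mul_ite, zero_mul, mul_zero]
    congr 1
    · congr 1
      · split_ifs with h
        · subst h; ring
        · rfl
      · split_ifs with h
        · subst h; exact hb i
        · rfl
    · split_ifs with h
      · subst h; exact hc i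
      · rfl
  have h' := congrArg det h
  rw [det_mul, det_mul, mul_comm] at h'
  refine mul_left_cancel₀ ?_ h'
  rw [det_diagonal]
  exact Finset.prod_ne_zero_iff.mpr fun k _ => hE k

/-- Conjugation by a diagonal matrix changes the off-diagonal entries but neither the products `b k
* c (k + 1)` over bonds nor the product of the `c k` around the cycle. When no `c` vanishes these
are the only invariants. -/
theorem det_cyc_eq_of_prod_eq {a b c b' c' : Site M → ℂ} (hc : ∀ k, c k ≠ 0)
    (hc' : ∀ k, c' k ≠ 0)
    (h : ∀ k, b k * c (k + 1) = b' k * c' (k + 1)) (hp : ∏ k, c k = ∏ k, c' k) :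
    (cyc a b' c').det = (cyc a b c).det := by
  obtain ⟨E, hE, hE'⟩ := exists_gauge (fun k => c' k / c k) (fun k => div_ne_zero (hc' k) (hc k))
    (by rw [Finset.prod_div_distrib, hp, div_self]
        exact Finset.prod_ne_zero_iff.mpr fun k _ => hc' k)
  refine det_cyc_gauge hE (fun k => ?_) (fun k => ?_)
  · have := hE' (k + 1)
    rw [add_sub_cancel_right] at this
    rw [this]
    have h1 := hc (k + 1)
    field_simp
    linear_combination (-E k) * h k
  · rw [hE' k]
    have h1 := hc k
    field_simp

/-- If the bond `(-2, -1)` is cut in one direction, the entries in the other direction contribute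
the product around the cycle only. -/
theorem det_cyc_of_cut {a b c c' : Site M → ℂ} (hM : 1 ≤ M) (hb : b (-2) = 0)
    (hc : ∀ k, k ≠ -1 → c' k = c k) (hc' : c' (-1) = 0) :
    (cyc a b c).det = (cyc a b c').det - ∏ k, c k := by
  -- Row `-1` splits into the row with the entry removed and a multiple of a unit vector; the
  -- determinant is linear in it.
  have hA : cyc a b c = (cyc a b c').updateRow (-1)
      ((cyc a b c') (-1) + (-c (-1)) • Pi.single (-2) 1) := by
    ext i j
    by_cases hi : i = -1
    · subst hi
      have h2 : (-1 - 1 : Site M) = -2 := by ring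
      simp only [cyc, of_apply, updateRow_self, Pi.add_apply, Pi.smul_apply, hc', h2, ite_self,
        sub_zero, Pi.single_apply, smul_eq_mul]
      split_ifs <;> ring
    · rw [updateRow_ne hi]
      simp [cyc, hc i hi]
  rw [hA, det_updateRow_add, updateRow_eq_self, det_updateRow_smul, sub_eq_add_neg, ← neg_mul_eq_neg_mul]
  congr 2
  set D := (cyc a b c').updateRow (-1) (Pi.single (-2) 1) with hD
  -- The cyclic shift has odd order `N`, hence is even. Applied to the columns it moves the entries
  -- `-c k` to the diagonal, and the matrix becomes upper triangular in the order `0, …, 2M`.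
  let σ : Equiv.Perm (Site M) := Equiv.subRight 1
  have hsign : Equiv.Perm.sign σ = 1 := by
    have hpow : ∀ n : ℕ, ∀ k, (σ ^ n) k = k - n := fun n => by
      induction n with
      | zero => simp
      | succ n ih =>
        intro k
        rw [pow_succ', Equiv.Perm.mul_apply, ih]
        simp [σ, sub_sub]
    have h1 : σ ^ (2 * M + 1) = 1 := by
      ext1 k
      rw [hpow, natCast_site, sub_zero]; rfl
    have h2 := congrArg Equiv.Perm.sign h1
    rw [map_pow, map_one, pow_add, pow_mul, Int.units_sq, one_pow, one_mul, pow_one] at h2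
    exact h2
  have hdet : D.det = (D.submatrix id σ).det := by
    rw [det_permute', hsign]; simp
  let e : Fin (2 * M + 1) ≃ Site M :=
    { toFun := fun i => ((i : ℕ) : Site M)
      invFun := fun k => ⟨k.val, ZMod.val_lt k⟩
      left_inv := fun i => Fin.ext (ZMod.val_cast_of_lt i.2)
      right_inv := fun k => ZMod.natCast_zmod_val k }
  rw [hdet, ← det_submatrix_equiv_self e, ← e.prod_comp, det_of_isUpperTriangular]
  · have h1 : (-1 : Site M) = e (Fin.last (2 * M)) := by
      have := natCast_site (M := M)
      simp only [e, Equiv.coe_fn_mk, Fin.val_last]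
      push_cast at this ⊢
      linear_combination -this
    rw [h1, Fin.prod_univ_castSucc, Fin.prod_univ_castSucc, mul_comm]
    have hlast : ((D.submatrix id σ).submatrix e e) (Fin.last (2 * M)) (Fin.last (2 * M)) = 1 := by
      simp only [submatrix_apply, ← h1, id, σ, Equiv.subRight_apply, hD, updateRow_self]
      rw [show (-1 - 1 : Site M) = -2 by ring, Pi.single_eq_same]
    rw [hlast, mul_one]
    congr 1
    have hpr : ∀ i : Fin (2 * M), ((D.submatrix id σ).submatrix e e) i.castSucc i.castSucc =
        -1 * c (e i.castSucc) := fun i => by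
      have hi : e i.castSucc ≠ -1 := by
        rw [h1]
        exact fun h => (Fin.castSucc_lt_last i).ne (e.injective h)
      simp only [submatrix_apply, id, σ, Equiv.subRight_apply, hD, updateRow_ne hi, cyc, of_apply]
      rw [hc _ hi, if_neg, if_neg]
      · simp
      · intro h
        have h2 : (2 : Site M) = 0 := by linear_combination -h
        have h3 : (1 : Site M) = 0 := two_mul_eq_zero_iff.mp (by rw [mul_one]; exact h2)
        have := congrArg ZMod.val h3
        rw [ZMod.val_zero, ZMod.val_one''] at this <;> omega
      · intro h
        have h3 : (1 : Site M) = 0 := by linear_combination -h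
        have := congrArg ZMod.val h3
        rw [ZMod.val_zero, ZMod.val_one''] at this <;> omega
    simp_rw [hpr]
    rw [Finset.prod_mul_distrib, Finset.prod_const, Finset.card_univ, Fintype.card_fin, pow_mul]
    simp
  · intro i j hij
    have hij' : (j : ℕ) < i := hij
    have hi2 := i.2
    have hcast : ∀ k l : ℕ, k < 2 * M + 1 → l < 2 * M + 1 → (k : Site M) = l → k = l := by
      intro k l hk hl h
      rw [← ZMod.val_cast_of_lt hk, h, ZMod.val_cast_of_lt hl]
    have hN := natCast_site (M := M)
    push_cast at hN
    simp only [submatrix_apply, id, σ, Equiv.subRight_apply]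
    by_cases hi : e i = -1
    · rw [hi, hD, updateRow_self, Pi.single_eq_of_ne]
      intro h
      have h3 : e j = e i := by rw [hi]; linear_combination h
      exact hij'.ne (congrArg Fin.val (e.injective h3))
    · rw [hD, updateRow_ne hi]
      have hi3 : (i : ℕ) ≠ 2 * M := fun h => hi (by
        simp only [e, Equiv.coe_fn_mk, h]
        push_cast
        linear_combination hN)
      simp only [cyc, of_apply]
      rw [if_neg, if_neg (c := _ = e i - 1)]
      · split_ifs with h
        -- The entry of row `-2` that wraps around the cycle is `b (-2) = 0`.
        · by_cases hi4 : (i : ℕ) = 2 * M - 1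
          · have : e i = -2 := by
              simp only [e, Equiv.coe_fn_mk, hi4]
              rw [Nat.cast_sub (by omega)]
              push_cast
              linear_combination hN
            rw [this, hb]; simp
          · have := hcast j (i + 2) (by omega) (by omega) (by
              simp only [e, Equiv.coe_fn_mk] at h
              push_cast
              linear_combination h)
            omega
        · simp
      · intro h
        exact hij'.ne (congrArg Fin.val (e.injective (by linear_combination h)))
      · intro h
        have := hcast j (i + 1) (by omega) (by omega) (by
              simp only [e, Equiv.coe_fn_mk] at h
              push_cast
              linear_combination h)
        omega

end Cyclic

end BaxterTQ

/-! ### Degrees of determinants of polynomial matrices. -/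

namespace BaxterTQ

section PolynomialMatrix

variable {n : Type*} [Fintype n] [DecidableEq n] {R : Type*} [CommRing R]

theorem natDegree_det_le (A : Matrix n n R[X]) (d : ℕ) (h : ∀ i j, (A i j).natDegree ≤ d) :
    A.det.natDegree ≤ Fintype.card n * d := by
  rw [det_apply']
  refine natDegree_sum_le_of_forall_le _ _ fun σ _ => ?_
  refine (natDegree_mul_le).trans ?_
  rw [natDegree_intCast, zero_add]
  refine (natDegree_prod_le _ _).trans ((Finset.sum_le_sum fun i _ => h _ _).trans ?_)
  simp

theorem coeff_det_of_natDegree_le (A : Matrix n n R[X]) (d : ℕ)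
    (h : ∀ i j, (A i j).natDegree ≤ d) :
    A.det.coeff (Fintype.card n * d) = (A.map fun p => p.coeff d).det := by
  rw [det_apply', det_apply', finsetSum_coeff]
  refine Finset.sum_congr rfl fun σ _ => ?_
  rw [← C_eq_intCast, coeff_C_mul, ← Finset.card_univ, coeff_prod_of_natDegree_le]
  · rfl
  · exact fun i _ => h _ _

end PolynomialMatrix

/-! ### The T-Q equation on an orbit and its determinant. -/

section TQMatrix

variable {M : ℕ} (χ : AddChar (Site M) ℂ) (s : Site M)

section Defs

variable {R S : Type*} [CommRing R] [Algebra ℂ R] [CommRing S] [Algebra ℂ S]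

/-- The polynomial `∏ⱼ (1 + cⱼ x)`. -/
def tqP (c : Fin 4 → R) (x : R) : R := ∏ j, (1 + c j * x)

/-- `Λ(x) = (u + u⁻¹) + λ x² + q⁻² (u + u⁻¹) (∏ⱼ cⱼ) x⁴`, with `u = χ s`. -/
noncomputable def tqL (c : Fin 4 → R) (lam x : R) : R :=
  algebraMap ℂ R (χ s + χ (-s)) + lam * x ^ 2 +
    algebraMap ℂ R (χ (-2) * (χ s + χ (-s))) * (∏ j, c j) * x ^ 4

/-- The T-Q equation on the orbit `{x qᵏ}`, as a periodic tridiagonal matrix. -/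
noncomputable def tqMat (c : Fin 4 → R) (lam x : R) : Matrix (Site M) (Site M) R :=
  cyc (fun k => tqL χ s c lam (x * algebraMap ℂ R (χ k)))
    (fun k => algebraMap ℂ R (χ s) * tqP c (x * algebraMap ℂ R (χ k)))
    fun k => algebraMap ℂ R (χ (-s)) * tqP c (-(x * algebraMap ℂ R (χ (k - 1))))

/-- The reduced Hamiltonian of Hofstadter type. -/
noncomputable def redHam (c : Fin 4 → R) : Matrix (Site M) (Site M) R :=
  cyc
    (fun n => (c 1 * c 2 + c 0 * c 3) *
      algebraMap ℂ R (χ (s + 2 * n - 1) + χ (-(s + 2 * n - 1))))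
    (fun n => -(algebraMap ℂ R (χ (1 - s - 2 * n)) *
      (c 3 + c 0 * algebraMap ℂ R (χ (2 * s + 2 * n))) *
      (c 1 + c 2 * algebraMap ℂ R (χ (2 * n)))))
    fun n => -(algebraMap ℂ R (χ (1 - s - 2 * n)) *
      (c 0 + c 3 * algebraMap ℂ R (χ (2 * s + 2 * n - 2))) *
      (c 2 + c 1 * algebraMap ℂ R (χ (2 * n - 2))))

theorem map_tqMat (f : R →ₐ[ℂ] S) (c : Fin 4 → R) (lam x : R) :
    (tqMat χ s c lam x).map f = tqMat χ s (f ∘ c) (f lam) (f x) := by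
  change (tqMat χ s c lam x).map (f : R →+* S) = _
  rw [tqMat, map_cyc, tqMat]
  congr 1 <;> ext k <;> simp [tqL, tqP, map_prod]

theorem map_redHam (f : R →ₐ[ℂ] S) (c : Fin 4 → R) :
    (redHam χ s c).map f = redHam χ s (f ∘ c) := by
  change (redHam χ s c).map (f : R →+* S) = _
  rw [redHam, map_cyc, redHam]
  congr 1 <;> ext k <;> simp

theorem map_det_tqMat (f : R →ₐ[ℂ] S) (c : Fin 4 → R) (lam x : R) :
    f (tqMat χ s c lam x).det = (tqMat χ s (f ∘ c) (f lam) (f x)).det := by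
  rw [AlgHom.map_det, ← map_tqMat]; rfl

end Defs

variable (c : Fin 4 → ℂ) (lam : ℂ)

theorem det_tqMat_mul_chi (x : ℂ) (t : Site M) :
    (tqMat χ s c lam (x * χ t)).det = (tqMat χ s c lam x).det := by
  refine Eq.trans ?_ (det_cyc_shift _ _ _ t)
  have h : ∀ k : Site M, x * χ t * χ k = x * χ (k + t) := fun k => by
    rw [AddChar.map_add_eq_mul]; ring
  rw [tqMat]
  simp only [Algebra.algebraMap_self, RingHom.id_apply, h, sub_add_eq_add_sub]

theorem tqL_neg (x : ℂ) : tqL χ s c lam (-x) = tqL χ s c lam x := by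
  simp only [tqL]; ring

/-- Transposition exchanges the two off-diagonals and so replaces `x` by `-x`, up to factors
`u^{±2}` that a diagonal gauge removes. -/
theorem det_tqMat_neg (x : ℂ) :
    (tqMat χ s c lam (-x)).det = (tqMat χ s c lam x).det := by
  rw [← det_transpose (tqMat χ s c lam x), tqMat, tqMat, cyc_transpose]
  simp only [neg_mul, tqL_neg, Algebra.algebraMap_self, RingHom.id_apply, neg_neg]
  refine det_cyc_gauge (E := fun k => χ (-(2 * s * k))) (fun k => chi_ne_zero χ _) (fun k => ?_)
    fun k => ?_
  · rw [add_sub_cancel_right]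
    have h : χ s * χ (-(2 * s * (k + 1))) = χ (-(2 * s * k)) * χ (-s) := by
      rw [← AddChar.map_add_eq_mul, ← AddChar.map_add_eq_mul]; congr 1; ring
    linear_combination tqP c (-(x * χ k)) * h
  · have h : χ (-s) * χ (-(2 * s * (k - 1))) = χ (-(2 * s * k)) * χ s := by
      rw [← AddChar.map_add_eq_mul, ← AddChar.map_add_eq_mul]; congr 1; ring
    linear_combination tqP c (x * χ (k - 1)) * h

/-- A diagonal gauge exchanges `u` and `u⁻¹`. Therefore the multipliers `q^m` and `q^{-m}` describe
the same spectrum. -/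
theorem det_tqMat_neg_sector (x : ℂ) :
    (tqMat χ (-s) c lam x).det = (tqMat χ s c lam x).det := by
  have hL : ∀ y, tqL χ (-s) c lam y = tqL χ s c lam y := fun y => by
    simp only [tqL, neg_neg, add_comm (χ (-s)) (χ s)]
  rw [tqMat, tqMat]
  simp only [hL, Algebra.algebraMap_self, RingHom.id_apply, neg_neg]
  refine det_cyc_gauge (E := fun k => χ (2 * s * k)) (fun k => chi_ne_zero χ _) (fun k => ?_)
    fun k => ?_
  · have h : χ (-s) * χ (2 * s * (k + 1)) = χ (2 * s * k) * χ s := by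
      rw [← AddChar.map_add_eq_mul, ← AddChar.map_add_eq_mul]; congr 1; ring
    linear_combination tqP c (x * χ k) * h
  · have h : χ s * χ (2 * s * (k - 1)) = χ (2 * s * k) * χ (-s) := by
      rw [← AddChar.map_add_eq_mul, ← AddChar.map_add_eq_mul]; congr 1; ring
    linear_combination tqP c (-(x * χ (k - 1))) * h

/-- The polynomial in `x` with the values `det (tqMat χ s c lam x)`. -/
noncomputable def tqDetPoly : ℂ[X] := (tqMat χ s (fun j => C (c j)) (C lam) X).det

theorem eval_tqDetPoly (x : ℂ) : (tqDetPoly χ s c lam).eval x = (tqMat χ s c lam x).det := by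
  have := map_det_tqMat χ s (aeval x : ℂ[X] →ₐ[ℂ] ℂ) (fun j => C (c j)) (C lam) X
  rw [coe_aeval_eq_eval] at this
  rw [tqDetPoly, this]
  congr 2
  · ext j; simp
  · simp
  · simp

variable {c} in
theorem natDegree_tqP_le {L : ℕ} (hL : L = 4 ∨ L = 3 ∧ c 3 = 0) {p : ℂ[X]}
    (hp : p.natDegree ≤ 1) : (tqP (fun j => C (c j)) p).natDegree ≤ L := by
  have h1 : ∀ a : ℂ, (1 + C a * p).natDegree ≤ 1 := fun a =>
    (natDegree_add_le _ _).trans (by simpa using (natDegree_C_mul_le a p).trans hp)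
  rw [tqP, Fin.prod_univ_four]
  have h2 := natDegree_mul_le_of_le (natDegree_mul_le_of_le (h1 (c 0)) (h1 (c 1))) (h1 (c 2))
  rcases hL with rfl | ⟨rfl, h3⟩
  · exact natDegree_mul_le_of_le h2 (h1 _)
  · simpa [h3] using h2

variable {c} in
theorem natDegree_tqL_le {L : ℕ} (hL : L = 4 ∨ L = 3 ∧ c 3 = 0) {p : ℂ[X]}
    (hp : p.natDegree ≤ 1) : (tqL χ s (fun j => C (c j)) (C lam) p).natDegree ≤ L := by
  have h2 : (C lam * p ^ 2).natDegree ≤ 2 :=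
    (natDegree_C_mul_le _ _).trans (natDegree_pow_le_of_le 2 hp)
  have h0 : ∀ a : ℂ, (algebraMap ℂ ℂ[X] a).natDegree ≤ 0 := fun a => by simp
  rcases hL with rfl | ⟨rfl, h3⟩
  · refine natDegree_add_le_of_degree_le (natDegree_add_le_of_degree_le ((h0 _).trans (by simp))
      (h2.trans (by simp))) ?_
    rw [algebraMap_eq, ← map_prod, ← C_mul]
    exact (natDegree_C_mul_le _ _).trans (natDegree_pow_le_of_le 4 hp)
  · rw [tqL, Fin.prod_univ_four, h3, C_0, mul_zero, mul_zero, zero_mul, add_zero]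
    exact natDegree_add_le_of_degree_le ((h0 _).trans (by simp)) (h2.trans (by simp))

theorem natDegree_cyc_le {a b c : Site M → ℂ[X]} {d : ℕ} (ha : ∀ k, (a k).natDegree ≤ d)
    (hb : ∀ k, (b k).natDegree ≤ d) (hc : ∀ k, (c k).natDegree ≤ d) (i j : Site M) :
    (cyc a b c i j).natDegree ≤ d := by
  have h : ∀ (p : Prop) [Decidable p] (f : ℂ[X]), f.natDegree ≤ d →
      (if p then f else 0).natDegree ≤ d := fun p _ f hf => by
    split_ifs
    · exact hf
    · simp
  simp only [cyc, of_apply]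
  exact (natDegree_sub_le_of_le (natDegree_sub_le_of_le (h _ _ (ha i)) (h _ _ (hb i)))
    (h _ _ (hc i))).trans (by simp)

variable {c} in
theorem natDegree_tqMat_le {L : ℕ} (hL : L = 4 ∨ L = 3 ∧ c 3 = 0) (i j : Site M) :
    (tqMat χ s (fun j => C (c j)) (C lam) X i j).natDegree ≤ L := by
  have hx : ∀ k : Site M, (X * algebraMap ℂ ℂ[X] (χ k)).natDegree ≤ 1 := fun k => by
    rw [algebraMap_eq, mul_comm]
    exact (natDegree_C_mul_le _ _).trans natDegree_X_le
  refine natDegree_cyc_le (fun k => natDegree_tqL_le χ s lam hL (hx k)) (fun k => ?_)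
    (fun k => ?_) i j
  · rw [algebraMap_eq]
    exact (natDegree_C_mul_le _ _).trans (natDegree_tqP_le hL (hx k))
  · rw [algebraMap_eq]
    exact (natDegree_C_mul_le _ _).trans
      (natDegree_tqP_le hL (by rw [natDegree_neg]; exact hx _))

theorem natDegree_tqDetPoly_le : (tqDetPoly χ s c lam).natDegree ≤ (2 * M + 1) * 4 := by
  have := natDegree_det_le (tqMat χ s (fun j => C (c j)) (C lam) X) 4
    (natDegree_tqMat_le χ s lam (Or.inl rfl))
  rwa [ZMod.card] at this

theorem coeff_tqP_four {p : ℂ[X]} (hp : p.natDegree ≤ 1) :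
    (tqP (fun j => C (c j)) p).coeff 4 = (∏ j, c j) * p.coeff 1 ^ 4 := by
  have h1 : ∀ a : ℂ, (1 + C a * p).natDegree ≤ 1 := fun a =>
    (natDegree_add_le _ _).trans (by simpa using (natDegree_C_mul_le a p).trans hp)
  have := coeff_prod_of_natDegree_le (s := Finset.univ) (fun j : Fin 4 => 1 + C (c j) * p) 1
    fun j _ => h1 _
  rw [Finset.card_univ, Fintype.card_fin, mul_one] at this
  rw [tqP, this]
  simp [coeff_one, Finset.prod_mul_distrib]

theorem coeff_tqL_four {p : ℂ[X]} (hp : p.natDegree ≤ 1) :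
    (tqL χ s (fun j => C (c j)) (C lam) p).coeff 4 =
      χ (-2) * (χ s + χ (-s)) * (∏ j, c j) * p.coeff 1 ^ 4 := by
  have h2 : (C lam * p ^ 2).natDegree ≤ 2 :=
    (natDegree_C_mul_le _ _).trans (natDegree_pow_le_of_le 2 hp)
  rw [tqL, coeff_add, coeff_add, coeff_eq_zero_of_natDegree_lt (h2.trans_lt (by norm_num)),
    algebraMap_eq, coeff_C, if_neg (by norm_num), ← map_prod, ← C_mul, coeff_C_mul]
  have := coeff_pow_of_natDegree_le (n := 1) (m := 4) hp
  rw [mul_one] at this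
  rw [this]
  ring

/-- The coefficient of `x⁴` in `tqL` is normalized so that `x⁻²` is a solution to leading order at
infinity; it gives a kernel vector of the matrix of top coefficients. -/
theorem coeff_tqDetPoly : (tqDetPoly χ s c lam).coeff ((2 * M + 1) * 4) = 0 := by
  have := coeff_det_of_natDegree_le (tqMat χ s (fun j => C (c j)) (C lam) X) 4
    (natDegree_tqMat_le χ s lam (Or.inl rfl))
  rw [ZMod.card] at this
  rw [tqDetPoly, this, ← exists_mulVec_eq_zero_iff]
  refine ⟨fun k => χ (-2 * k), fun h => chi_ne_zero χ _ (congrFun h 0), ?_⟩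
  have hx : ∀ k : Site M, (X * algebraMap ℂ ℂ[X] (χ k)).natDegree ≤ 1 := fun k => by
    rw [algebraMap_eq, mul_comm]
    exact (natDegree_C_mul_le _ _).trans natDegree_X_le
  have hx' : ∀ k : Site M, (-(X * algebraMap ℂ ℂ[X] (χ k))).natDegree ≤ 1 := fun k => by
    rw [natDegree_neg]; exact hx k
  have hmap : (tqMat χ s (fun j => C (c j)) (C lam) X).map (fun p => p.coeff 4) =
      cyc (fun k => χ (-2) * (χ s + χ (-s)) * (∏ j, c j) * χ k ^ 4)
        (fun k => χ s * ((∏ j, c j) * χ k ^ 4))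
        (fun k => χ (-s) * ((∏ j, c j) * χ (k - 1) ^ 4)) := by
    ext i j
    have hz : ∀ (p : Prop) [Decidable p] (f : ℂ[X]),
        (if p then f else 0).coeff 4 = if p then f.coeff 4 else 0 := fun p _ f => by
      split_ifs <;> simp
    simp only [tqMat, cyc, map_apply, of_apply, coeff_sub, hz]
    rw [coeff_tqL_four _ _ _ _ (hx i)]
    simp only [algebraMap_eq] at hx hx' ⊢
    rw [coeff_C_mul, coeff_C_mul, coeff_tqP_four _ (hx i), coeff_tqP_four _ (hx' _)]
    simp [Even.neg_pow (show Even 4 by decide)]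
  rw [hmap]
  ext k
  rw [cyc_mulVec]
  have e1 : χ (-2 * (k + 1)) = χ (-2 * k) * χ (-2) := by
    rw [← AddChar.map_add_eq_mul]; congr 1; ring
  have e2 : χ (k - 1) ^ 4 * χ (-2 * (k - 1)) = χ k ^ 4 * (χ (-2 * k) * χ (-2)) := by
    simp only [← AddChar.map_nsmul_eq_pow, ← AddChar.map_add_eq_mul]; congr 1
    simp only [nsmul_eq_mul]; push_cast; ring
  rw [e1, Pi.zero_apply]
  linear_combination (-χ (-s) * ∏ j, c j) * e2

theorem det_tqMat_zero : (tqMat χ s c lam 0).det = 0 := by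
  rw [← exists_mulVec_eq_zero_iff]
  refine ⟨fun _ => 1, fun h => one_ne_zero (congrFun h 0), ?_⟩
  ext k
  simp [tqMat, cyc_mulVec, tqL, tqP]

variable {χ}

/-- Invariance under `x ↦ q x` and `x ↦ -x` leaves only exponents divisible by `2N`. Of `0`, `2N`,
`4N` the outer two are excluded by the formal solutions `1` at `0` and `x⁻²` at infinity. -/
theorem det_tqMat (hχ : Function.Injective χ) (x : ℂ) :
    (tqMat χ s c lam x).det = (tqMat χ s c lam 1).det * x ^ (2 * (2 * M + 1)) := by
  set f := tqDetPoly χ s c lam with hf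
  have h1 : ∀ n, f.coeff n ≠ 0 → 2 * M + 1 ∣ n := fun n hn => by
    have : f.comp (C (χ 1) * X) = f := Polynomial.funext fun x => by
      rw [eval_comp, eval_mul, eval_C, eval_X, eval_tqDetPoly, eval_tqDetPoly,
        mul_comm (χ 1) x, det_tqMat_mul_chi]
    have := congrArg (fun p => p.coeff n) this
    simp only [comp_C_mul_X_coeff] at this
    have h2 : χ 1 ^ n = 1 := mul_left_cancel₀ hn (by rw [this, mul_one])
    exact (isPrimitiveRoot_chi hχ).dvd_of_pow_eq_one n h2
  have h2 : ∀ n, f.coeff n ≠ 0 → 2 ∣ n := fun n hn => by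
    have : f.comp (C (-1) * X) = f := Polynomial.funext fun x => by
      rw [eval_comp, eval_mul, eval_C, eval_X, eval_tqDetPoly, eval_tqDetPoly, neg_one_mul,
        det_tqMat_neg]
    have := congrArg (fun p => p.coeff n) this
    simp only [comp_C_mul_X_coeff] at this
    have h2 : (-1 : ℂ) ^ n = 1 := mul_left_cancel₀ hn (by rw [this, mul_one])
    rw [neg_one_pow_eq_one_iff_even (by norm_num)] at h2
    exact h2.two_dvd
  have h3 : f = C (f.coeff (2 * (2 * M + 1))) * X ^ (2 * (2 * M + 1)) := by
    ext n
    rw [coeff_C_mul_X_pow]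
    split_ifs with hn
    · rw [hn]
    · by_contra h0
      obtain ⟨a, ha⟩ := h1 n h0
      have hle := (le_natDegree_of_ne_zero h0).trans (natDegree_tqDetPoly_le χ s c lam)
      have h2' := h2 n h0
      rw [ha] at hle hn h0 h2'
      have ha4 : a ≤ 4 := le_of_mul_le_mul_left hle (by omega)
      have ha2 : 2 ∣ a := by
        refine (Nat.Coprime.dvd_of_dvd_mul_left ?_ h2')
        simp
      interval_cases a
      · refine h0 ?_
        rw [mul_zero, coeff_zero_eq_eval_zero, eval_tqDetPoly, det_tqMat_zero]
      · omega
      · exact hn (by ring)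
      · omega
      · exact h0 (coeff_tqDetPoly χ s c lam)
  have h4 : ∀ x, (tqMat χ s c lam x).det = f.coeff (2 * (2 * M + 1)) * x ^ (2 * (2 * M + 1)) :=
    fun x => by
      rw [← eval_tqDetPoly, ← hf]
      nth_rw 1 [h3]
      simp
  rw [h4, h4 1, one_pow, mul_one]

/-- The matrix with the characteristic polynomial `μ ↦ det (tqMat χ s c (q⁻¹ μ) 1)`. -/
noncomputable def tqHam (χ : AddChar (Site M) ℂ) (s : Site M) (c : Fin 4 → ℂ) :
    Matrix (Site M) (Site M) ℂ :=
  -(diagonal (fun k => χ (1 - 2 * k)) * tqMat χ s c 0 1)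

theorem tqMat_eq_add (x : ℂ) :
    tqMat χ s c lam x = tqMat χ s c 0 x + lam • diagonal fun k => (x * χ k) ^ 2 := by
  ext i j
  by_cases h : i = j
  · subst h
    simp [tqMat, cyc, tqL]
    ring
  · simp [tqMat, cyc, h, Ne.symm h]

/-- Multiplying row `k` by `q^{1 - 2k}` turns the term `λ q^{2k}` of the diagonal into `q λ = μ`,
and these factors have product `1`. -/
theorem eval_charpoly_tqHam (μ : ℂ) :
    (tqHam χ s c).charpoly.eval μ = (tqMat χ s c (χ (-1) * μ) 1).det := by
  have h : scalar (Site M) μ - tqHam χ s c =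
      diagonal (fun k => χ (1 - 2 * k)) * tqMat χ s c (χ (-1) * μ) 1 := by
    rw [tqMat_eq_add, mul_add, tqHam, sub_neg_eq_add, add_comm]
    congr 1
    rw [mul_smul_comm, diagonal_mul_diagonal, ← diagonal_smul]
    refine congrArg diagonal (funext fun k => ?_)
    have : χ (1 - 2 * k) * (χ (-1) * χ k ^ 2) = 1 := by
      simp only [← AddChar.map_nsmul_eq_pow, ← AddChar.map_add_eq_mul]
      rw [← AddChar.map_zero_eq_one χ]
      congr 1
      simp only [nsmul_eq_mul]; push_cast; ring
    simp only [Pi.smul_apply, smul_eq_mul, one_mul]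
    change μ = _
    linear_combination (-μ) * this
  rw [eval_charpoly, h, det_mul, det_diagonal]
  have : ∏ k : Site M, χ (1 - 2 * k) = 1 := by
    have h1 : ∀ k : Site M, χ (1 - 2 * k) = χ 1 * χ (-2 * k) := fun k => by
      rw [← AddChar.map_add_eq_mul]; congr 1; ring
    simp_rw [h1]
    rw [Finset.prod_mul_distrib, prod_chi_mul, Finset.prod_const, Finset.card_univ, ZMod.card,
      chi_pow_card, one_mul]
  rw [this, one_mul]

end TQMatrix

end BaxterTQ

namespace BaxterTQ

/-! ### Baxter's vectors at one site. -/

section SiteVector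

variable {M : ℕ} (χ : AddChar (Site M) ℂ) {R S : Type*} [CommRing R] [Algebra ℂ R] [CommRing S]
  [Algebra ℂ S]

/-- The cyclic product with `W y i * (1 + y ωⁱ) = W y (i - 1) * (ωⁱ + y)`. -/
noncomputable def siteW (y : R) (i : Site M) : R :=
  (∏ t ∈ Finset.Ico 1 (i.val + 1), (algebraMap ℂ R (χ (2 * t)) + y)) *
    ∏ t ∈ Finset.Ico (i.val + 1) (2 * M + 1), (1 + y * algebraMap ℂ R (χ (2 * t)))

theorem map_siteW (f : R →ₐ[ℂ] S) (y : R) (i : Site M) :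
    f (siteW χ y i) = siteW χ (f y) i := by
  simp [siteW, map_prod]

variable {χ}

theorem one_add_mul_chi_ne_zero {y : ℂ} (hy : y ^ (2 * M + 1) ≠ -1) (k : Site M) :
    1 + y * χ k ≠ 0 := by
  intro h
  apply hy
  have h1 : y * χ k = -1 := by linear_combination h
  have h2 := congrArg (· ^ (2 * M + 1)) h1
  simp only [mul_pow, chi_pow_card, mul_one] at h2
  rw [h2, Odd.neg_one_pow ⟨M, rfl⟩]

theorem siteW_ne_zero {y : ℂ} (hy : y ^ (2 * M + 1) ≠ -1) (i : Site M) : siteW χ y i ≠ 0 := by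
  refine mul_ne_zero (Finset.prod_ne_zero_iff.mpr fun t _ => ?_)
    (Finset.prod_ne_zero_iff.mpr fun t _ => one_add_mul_chi_ne_zero hy _)
  have h : χ (2 * t) + y = χ (2 * t) * (1 + y * χ (-(2 * t))) := by
    rw [mul_add, mul_one, mul_left_comm, ← AddChar.map_add_eq_mul, add_neg_cancel,
      AddChar.map_zero_eq_one, mul_one]
  simp only [Algebra.algebraMap_self, RingHom.id_apply]
  rw [h]
  exact mul_ne_zero (chi_ne_zero χ _) (one_add_mul_chi_ne_zero hy _)

/-- The recursion closes at `i = 0` because both `∏ (1 + y ωᵗ)` and `∏ (ωᵗ + y)` over the whole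
cycle equal `1 + y^N`. -/
theorem siteW_rec (hχ : Function.Injective χ) (y : ℂ) (i : Site M) :
    siteW χ y i * (1 + y * χ (2 * i)) = siteW χ y (i - 1) * (χ (2 * i) + y) := by
  by_cases hi : i = 0
  · subst hi
    have hv : (0 - 1 : Site M).val = 2 * M := by
      have : (0 - 1 : Site M) = ((2 * M : ℕ) : Site M) := by
        have := natCast_site (M := M)
        push_cast at this ⊢
        linear_combination -this
      rw [this, ZMod.val_cast_of_lt (by omega)]
    have h1 := prod_one_add_mul_chi_mul_two hχ y
    rw [prod_site, Finset.range_eq_Ico, Finset.prod_eq_prod_Ico_succ_bot (by omega)] at h1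
    have h2 : ∏ k : Site M, (χ (2 * k) + y) = 1 + y ^ (2 * M + 1) := by
      have h3 : ∀ k : Site M, χ (2 * k) + y = χ (2 * k) * (1 + y * χ (2 * (-k))) := fun k => by
        rw [mul_add, mul_one, mul_left_comm, ← AddChar.map_add_eq_mul, mul_neg, add_neg_cancel,
          AddChar.map_zero_eq_one, mul_one]
      simp_rw [h3]
      rw [Finset.prod_mul_distrib, prod_chi_mul, one_mul]
      refine (Equiv.prod_comp (Equiv.neg (Site M)) (fun k => 1 + y * χ (2 * k))).trans
        (prod_one_add_mul_chi_mul_two hχ y)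
    rw [prod_site, Finset.range_eq_Ico, Finset.prod_eq_prod_Ico_succ_bot (by omega)] at h2
    simp only [siteW, hv, ZMod.val_zero, Finset.Ico_self, Finset.prod_empty, mul_one, one_mul,
      zero_add, Algebra.algebraMap_self, RingHom.id_apply] at h1 h2 ⊢
    simp only [Nat.cast_zero, mul_zero] at h1 h2 ⊢
    linear_combination h1 - h2
  · have hi' : i.val ≠ 0 := by rwa [Ne, ZMod.val_eq_zero]
    have hv : (i - 1).val = i.val - 1 := by
      have : i - 1 = ((i.val - 1 : ℕ) : Site M) := by
        rw [Nat.cast_sub (by omega), ZMod.natCast_zmod_val]; simp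
      rw [this, ZMod.val_cast_of_lt (by have := ZMod.val_lt i; omega)]
    have hlt := ZMod.val_lt i
    simp only [siteW, hv, Nat.sub_add_cancel (Nat.one_le_iff_ne_zero.mpr hi')]
    rw [Finset.prod_Ico_succ_top (by omega), Finset.prod_eq_prod_Ico_succ_bot hlt,
      ZMod.natCast_zmod_val]
    simp only [Algebra.algebraMap_self, RingHom.id_apply]
    ring

/-- At `y = -q` the factor `ωᵗ - q` vanishes for `t = M + 1` and `1 - q ωᵗ` for `t = M`; only `i =
M` avoids both. At this value Baxter's vectors degenerate to multiples of basis vectors. -/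
theorem siteW_neg_chi_one_ne_zero_iff (hχ : Function.Injective χ) (i : Site M) :
    siteW χ (-χ 1) i ≠ 0 ↔ i = (M : Site M) := by
  have hM : ((M : Site M)).val = M := ZMod.val_cast_of_lt (by omega)
  constructor
  · intro h
    by_contra hi
    apply h
    have hi' : i.val ≠ M := fun h =>
      hi ((ZMod.natCast_zmod_val i).symm.trans (congrArg _ h))
    rcases lt_or_gt_of_ne hi' with hlt | hlt
    · refine mul_eq_zero_of_right _ (Finset.prod_eq_zero (i := M) (by simp; omega) ?_)
      have h1 : (1 : Site M) + 2 * M = 0 := by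
        have := natCast_site (M := M)
        push_cast at this
        linear_combination this
      simp only [Algebra.algebraMap_self, RingHom.id_apply]
      rw [neg_mul, ← AddChar.map_add_eq_mul, h1, AddChar.map_zero_eq_one, add_neg_cancel]
    · refine mul_eq_zero_of_left (Finset.prod_eq_zero (i := M + 1) (by simp; omega) ?_) _
      have h1 := two_mul_half (M := M)
      unfold half at h1
      simp only [Algebra.algebraMap_self, RingHom.id_apply]
      rw [h1, add_neg_cancel]
  · rintro rfl
    refine mul_ne_zero (Finset.prod_ne_zero_iff.mpr fun t ht => ?_)
      (Finset.prod_ne_zero_iff.mpr fun t ht => ?_)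
    · rw [hM, Finset.mem_Ico] at ht
      simp only [Algebra.algebraMap_self, RingHom.id_apply]
      intro h
      have h1 : ((2 * t : ℕ) : Site M) = ((1 : ℕ) : Site M) := by
        push_cast
        exact hχ (by linear_combination h)
      rw [ZMod.natCast_eq_natCast_iff', Nat.mod_eq_of_lt (by omega),
        Nat.mod_eq_of_lt (by omega)] at h1
      omega
    · rw [hM, Finset.mem_Ico] at ht
      simp only [Algebra.algebraMap_self, RingHom.id_apply]
      intro h
      have h1 : ((2 * t + 1 : ℕ) : Site M) = 0 := by
        push_cast
        refine hχ ?_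
        rw [AddChar.map_add_eq_mul, AddChar.map_zero_eq_one]
        linear_combination -h
      rw [ZMod.natCast_eq_zero_iff] at h1
      obtain ⟨a, ha⟩ := h1
      have : a = 1 := by
        have h2 : a < 2 := by by_contra h3; push Not at h3; nlinarith
        interval_cases a <;> omega
      subst this
      omega

/-- The factor `Ψ(k, n)` of the Baxter vectors. -/
noncomputable def baxterPsi (χ : AddChar (Site M) ℂ) (y : ℂ) (k n : Site M) : ℂ :=
  siteW χ (y * χ k) (n * half M)

theorem mul_chi_pow_ne {y : ℂ} (hy : y ^ (2 * M + 1) ≠ -1) (k : Site M) :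
    (y * χ k) ^ (2 * M + 1) ≠ -1 := by
  rwa [mul_pow, chi_pow_card, mul_one]

theorem baxterPsi_ne_zero {y : ℂ} (hy : y ^ (2 * M + 1) ≠ -1) (k n : Site M) :
    baxterPsi χ y k n ≠ 0 :=
  siteW_ne_zero (mul_chi_pow_ne hy k) _

theorem baxterPsi_rec (hχ : Function.Injective χ) (y : ℂ) (k n : Site M) :
    (1 + y * χ (k + n)) * baxterPsi χ y k n =
      χ n * (1 + y * χ (k - n)) * baxterPsi χ y k (n - 2) := by
  have h := siteW_rec hχ (y * χ k) (n * half M)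
  have h1 : 2 * (n * half M) = n := by linear_combination n * two_mul_half (M := M)
  have h2 : (n - 2) * half M = n * half M - 1 := by linear_combination -two_mul_half (M := M)
  have h3 : χ (k - n) * χ n = χ k := by rw [← AddChar.map_add_eq_mul, sub_add_cancel]
  rw [h1] at h
  rw [baxterPsi, baxterPsi, h2, AddChar.map_add_eq_mul]
  linear_combination h - siteW χ (y * χ k) (n * half M - 1) * y * h3

/-- The coefficient of the first term in the Baxter relation. -/
noncomputable def baxterA (χ : AddChar (Site M) ℂ) (y : ℂ) (k : Site M) : ℂ :=
  (1 + y * χ (2 * k)) * baxterPsi χ y k k / (χ (k * half M) * baxterPsi χ y (k - 1) (k - 1))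

/-- The coefficient of the second term in the Baxter relation. -/
noncomputable def baxterB (χ : AddChar (Site M) ℂ) (y : ℂ) (k : Site M) : ℂ :=
  (1 - (y * χ k) ^ 2) * χ (half M) / baxterA χ y (k + 1)

theorem baxterA_ne_zero {y : ℂ} (hy : y ^ (2 * M + 1) ≠ -1) (k : Site M) :
    baxterA χ y k ≠ 0 :=
  div_ne_zero (mul_ne_zero (one_add_mul_chi_ne_zero hy _) (baxterPsi_ne_zero hy _ _))
    (mul_ne_zero (chi_ne_zero χ _) (baxterPsi_ne_zero hy _ _))

/-- The quotients of values of `Ψ` telescope around the cycle. -/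
theorem prod_baxterA (hχ : Function.Injective χ) {y : ℂ} (hy : y ^ (2 * M + 1) ≠ -1) :
    ∏ k, baxterA χ y k = 1 + y ^ (2 * M + 1) := by
  simp only [baxterA]
  rw [Finset.prod_div_distrib, Finset.prod_mul_distrib, Finset.prod_mul_distrib,
    prod_one_add_mul_chi_mul_two hχ]
  simp_rw [mul_comm _ (half M)]
  have hs : ∏ k, baxterPsi χ y (k - 1) (k - 1) = ∏ k, baxterPsi χ y k k :=
    Equiv.prod_comp (Equiv.subRight (1 : Site M)) fun k => baxterPsi χ y k k
  rw [prod_chi_mul, one_mul, hs]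
  exact mul_div_cancel_right₀ _ (Finset.prod_ne_zero_iff.mpr fun k _ => baxterPsi_ne_zero hy _ _)

/-- As functions of `n` both sides satisfy the same first-order recursion with step two, and they
agree at `n = k` by the definition of `baxterA`. -/
theorem baxterPsi_eq_A (hχ : Function.Injective χ) {y : ℂ} (hy : y ^ (2 * M + 1) ≠ -1)
    (k n : Site M) :
    (1 + y * χ (k + n)) * baxterPsi χ y k n =
      baxterA χ y k * χ (n * half M) * baxterPsi χ y (k - 1) (n - 1) := by
  revert n
  refine site_induction k ?_ fun n ih => ?_
  · rw [baxterA, ← two_mul]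
    have h1 := baxterPsi_ne_zero (χ := χ) hy (k - 1) (k - 1)
    have h2 := chi_ne_zero χ (k * half M)
    field_simp
  · have h1 := baxterPsi_rec hχ y k (n + 2)
    have h2 := baxterPsi_rec hχ y (k - 1) (n + 1)
    rw [show n + 2 - 2 = n by ring] at h1
    rw [show n + 1 - 2 = n - 1 by ring, show k - 1 + (n + 1) = k + n by ring,
      show k - 1 - (n + 1) = k - (n + 2) by ring] at h2
    rw [show n + 2 - 1 = n + 1 by ring]
    have h3 : (n + 2) * half M = n * half M + 1 := by linear_combination two_mul_half (M := M)
    have h4 : χ (n + 2) = χ (n + 1) * χ 1 := by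
      rw [← AddChar.map_add_eq_mul]; congr 1; ring
    refine mul_left_cancel₀ (one_add_mul_chi_ne_zero (χ := χ) hy (k + n)) ?_
    rw [h1, h3, AddChar.map_add_eq_mul χ (n * half M) 1, h4]
    linear_combination (χ (n + 1) * χ 1 * (1 + y * χ (k - (n + 2)))) * ih -
      (baxterA χ y k * χ (n * half M) * χ 1) * h2

/-- Follows from `baxterPsi_eq_A` at `(k + 1, n + 1)` and the recursion in `n`. Only the product of
`baxterA` at `k + 1` with `baxterB` at `k` matters later, and it is explicit. -/
theorem baxterPsi_eq_B (hχ : Function.Injective χ) {y : ℂ} (hy : y ^ (2 * M + 1) ≠ -1)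
    (k n : Site M) :
    χ (n * half M) * (baxterPsi χ y k (n - 2) - y * χ k * baxterPsi χ y k n) =
      baxterB χ y k * baxterPsi χ y (k + 1) (n - 1) := by
  have hA := baxterA_ne_zero (χ := χ) hy (k + 1)
  have hn := one_add_mul_chi_ne_zero (χ := χ) hy (k - n)
  have h1 := baxterPsi_eq_A hχ hy (k + 1) (n + 1)
  have h2 := baxterPsi_rec hχ y (k + 1) (n + 1)
  have h3 := baxterPsi_rec hχ y k n
  rw [show n + 1 - 1 = n by ring, show k + 1 - 1 = k by ring] at h1
  rw [show n + 1 - 2 = n - 1 by ring, show k + 1 - (n + 1) = k - n by ring] at h2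
  rw [h2, show (n + 1) * half M = n * half M + half M by ring,
    AddChar.map_add_eq_mul, AddChar.map_add_eq_mul] at h1
  have h5 : χ (half M) * χ (half M) = χ 1 := by
    rw [← AddChar.map_add_eq_mul, ← two_mul, two_mul_half]
  rw [← h5] at h1
  have h6 : baxterA χ y (k + 1) * baxterB χ y k = (1 - (y * χ k) ^ 2) * χ (half M) := by
    rw [baxterB]; field_simp
  have h7 : χ (k - n) * χ n = χ k := by rw [← AddChar.map_add_eq_mul, sub_add_cancel]
  have h8 : χ n * (1 + y * χ (k - n)) *
      (baxterPsi χ y k (n - 2) - y * χ k * baxterPsi χ y k n) =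
      (1 - (y * χ k) ^ 2) * baxterPsi χ y k n := by
    rw [mul_sub, ← h3, AddChar.map_add_eq_mul]
    linear_combination (- y ^ 2 * χ k * baxterPsi χ y k n) * h7
  have h9 := chi_ne_zero χ (half M)
  have h10 : χ n * (1 + y * χ (k - n)) * χ (half M) * baxterPsi χ y (k + 1) (n - 1) =
      baxterA χ y (k + 1) * χ (n * half M) * baxterPsi χ y k n := by
    refine mul_left_cancel₀ h9 ?_
    linear_combination h1
  refine mul_left_cancel₀ (mul_ne_zero (mul_ne_zero (chi_ne_zero χ n) hn)
    (mul_ne_zero hA h9)) ?_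
  linear_combination (χ (n * half M) * baxterA χ y (k + 1) * χ (half M)) * h8 -
    (χ n * (1 + y * χ (k - n)) * χ (half M) * baxterPsi χ y (k + 1) (n - 1)) * h6 -
    (1 - (y * χ k) ^ 2) * χ (half M) * h10

end SiteVector

/-! ### The action of the transfer matrix on Baxter's product vectors. -/

section Chain

variable {M L : ℕ}

theorem tensorOp_mulVec (A : Fin L → SiteOp M) (v : Fin L → Site M → ℂ)
    (i : Fin L → Site M) :
    (tensorOp A *ᵥ fun i => ∏ l, v l (i l)) i = ∏ l, (A l *ᵥ v l) (i l) := by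
  simp only [mulVec, dotProduct, tensorOp, of_apply]
  rw [Finset.prod_univ_sum, Fintype.piFinset_univ]
  exact Finset.sum_congr rfl fun j _ => Finset.prod_mul_distrib.symm

variable (χ : AddChar (Site M) ℂ)

theorem weylX_mulVec (v : Site M → ℂ) (i : Site M) : (weylX M *ᵥ v) i = v (i - 1) := by
  simp [weylX, mulVec, dotProduct]

theorem weylZ_mulVec (v : Site M → ℂ) (i : Site M) :
    (weylZ M (χ 2) *ᵥ v) i = χ (2 * i) * v i := by
  rw [weylZ, mulVec_diagonal, ← chi_mul_natCast, ZMod.natCast_zmod_val]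

theorem weylY_mulVec (v : Site M → ℂ) (i : Site M) :
    (weylY M (χ 2) *ᵥ v) i = χ (2 * i) * v (i - 1) := by
  rw [weylY, ← mulVec_mulVec, weylZ_mulVec, weylX_mulVec]

/-- The parameters `a = d = 1`, `b = c`, with `c` prescribed. -/
def stdParams (c : Fin L → ℂ) (j : Fin L) : Params := ⟨1, c j, c j, 1⟩

theorem normTransfer_stdParams [NeZero L] (ω : ℂ) (c : Fin L → ℂ) (x : ℂ) :
    normTransfer M ω (stdParams c) x = transfer M ω (stdParams c) x := by
  simp [normTransfer, stdParams]

theorem sum_fin_succ {β A : Type*} [Fintype β] [AddCommMonoid A] {n : ℕ} (f : (Fin (n + 1) → β) → A) :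
    ∑ s, f s = ∑ a, ∑ t, f (Fin.cons a t) := by
  rw [← Fintype.sum_prod_type']
  exact (Equiv.sum_comp (Fin.consEquiv fun _ : Fin (n + 1) => β) f).symm

theorem sum_fin_three {A : Type*} [AddCommMonoid A] (f : (Fin 3 → Fin 2) → A) :
    ∑ s, f s = ∑ a, ∑ b, ∑ c, f ![a, b, c] := by
  simp_rw [sum_fin_succ, Fintype.sum_unique]
  rfl

theorem sum_fin_four {A : Type*} [AddCommMonoid A] (f : (Fin 4 → Fin 2) → A) :
    ∑ s, f s = ∑ a, ∑ b, ∑ c, ∑ d, f ![a, b, c, d] := by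
  simp_rw [sum_fin_succ, Fintype.sum_unique]
  rfl

/-- The trace of a cyclic product of matrices which are simultaneously triangular. -/
theorem sum_prod_cyclic [NeZero L] (hL : L = 3 ∨ L = 4) (A : Fin L → Fin 2 → Fin 2 → ℂ)
    (ξ α : Fin L → ℂ) (h0 : ∀ j, A j 0 0 * ξ (j + 1) + A j 0 1 = α j * ξ j)
    (h1 : ∀ j, A j 1 0 * ξ (j + 1) + A j 1 1 = α j) :
    ∑ s : Fin L → Fin 2, ∏ j, A j (s j) (s (j + 1)) =
      ∏ j, α j + ∏ j, (A j 0 0 - ξ j * A j 1 0) := by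
  have e0 : ∀ j, A j 0 1 = α j * ξ j - A j 0 0 * ξ (j + 1) := fun j => by
    linear_combination h0 j
  have e1 : ∀ j, A j 1 1 = α j - A j 1 0 * ξ (j + 1) := fun j => by linear_combination h1 j
  rcases hL with rfl | rfl
  · rw [sum_fin_three]
    have g0 : (0 : Fin 3) + 1 = 1 := rfl
    have g1 : (1 : Fin 3) + 1 = 2 := rfl
    have g2 : (2 : Fin 3) + 1 = 0 := rfl
    have v2 : ∀ a b c : Fin 2, (![a, b, c] : Fin 3 → Fin 2) 2 = c := fun _ _ _ => rfl
    simp only [Fin.prod_univ_three, Fin.sum_univ_two, g0, g1, g2, cons_val_zero, cons_val_one, v2,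
      e0, e1]
    ring
  · rw [sum_fin_four]
    have g0 : (0 : Fin 4) + 1 = 1 := rfl
    have g1 : (1 : Fin 4) + 1 = 2 := rfl
    have g2 : (2 : Fin 4) + 1 = 3 := rfl
    have g3 : (3 : Fin 4) + 1 = 0 := rfl
    have v2 : ∀ a b c d : Fin 2, (![a, b, c, d] : Fin 4 → Fin 2) 2 = c := fun _ _ _ _ => rfl
    have v3 : ∀ a b c d : Fin 2, (![a, b, c, d] : Fin 4 → Fin 2) 3 = d := fun _ _ _ _ => rfl
    simp only [Fin.prod_univ_four, Fin.sum_univ_two, g0, g1, g2, g3, cons_val_zero, cons_val_one,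
      v2, v3, e0, e1]
    ring

variable [NeZero L]

/-- Baxter's product vectors. -/
noncomputable def baxterVec (y : Fin L → ℂ) (k : Site M) (l : Fin L → Site M)
    (i : Fin L → Site M) : ℂ :=
  ∏ j, χ (-(l j * i j)) * baxterPsi χ (y j) k (2 * i j + l (j + 1))

theorem transfer_mulVec (ω : ℂ) (h : Fin L → Params) (x : ℂ) (v : Fin L → Site M → ℂ)
    (i : Fin L → Site M) :
    (transfer M ω h x *ᵥ fun i => ∏ l, v l (i l)) i =
      ∑ s : Fin L → Fin 2, ∏ j, (LOp M ω (h j) x (s j) (s (j + 1)) *ᵥ v j) (i j) := by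
  rw [transfer, sum_mulVec, Finset.sum_apply]
  exact Finset.sum_congr rfl fun s _ => tensorOp_mulVec _ _ _

variable {χ}

theorem sum_shift (l : Fin L → Site M) : ∑ j, l (j + 1) = ∑ j, l j :=
  Equiv.sum_comp (Equiv.addRight (1 : Fin L)) l

/-- On a product vector the L-operators become simultaneously triangular in the auxiliary space
after a gauge by `ξⱼ = χ (l j)`, so the trace is a sum of two products. `baxterPsi_eq_A` and
`baxterPsi_eq_B` identify the two diagonal entries as local vectors at `k - 1` and `k + 1`. -/
theorem transfer_baxterVec (hL : L = 3 ∨ L = 4) (hχ : Function.Injective χ) (c : Fin L → ℂ)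
    (x : ℂ) (hy : ∀ j, (x * c j) ^ (2 * M + 1) ≠ -1) (k : Site M) (l : Fin L → Site M) :
    transfer M (χ 2) (stdParams c) (x * χ k) *ᵥ baxterVec χ (fun j => x * c j) k l =
      χ ((∑ j, l j) * half M) •
        ((∏ j, baxterA χ (x * c j) k) • baxterVec χ (fun j => x * c j) (k - 1) (fun j => l j - 1) +
        (∏ j, baxterB χ (x * c j) k) •
          baxterVec χ (fun j => x * c j) (k + 1) (fun j => l j - 1)) := by
  ext i
  set y : Fin L → ℂ := fun j => x * c j with hydef
  have hyj : ∀ j, y j ^ (2 * M + 1) ≠ -1 := hy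
  refine (transfer_mulVec _ _ _ (fun j i => χ (-(l j * i)) *
    baxterPsi χ (y j) k (2 * i + l (j + 1))) i).trans ?_
  have hσ : (∑ j, l j) * half M = ∑ j, l (j + 1) * half M := by
    rw [← sum_shift, Finset.sum_mul]
  have hσ' : (∑ j, l j) * half M = ∑ j, (l j - l (j + 1) * half M) := by
    rw [Finset.sum_sub_distrib, ← hσ]
    linear_combination (∑ j, l j) * two_mul_half (M := M)
  have hsplit : ∀ (j : Fin L) (n : Site M), χ (-((l j - 1) * n)) = χ (-(l j * n)) * χ n :=
    fun j n => by rw [← AddChar.map_add_eq_mul]; congr 1; ring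
  have hhalf : ∀ (j : Fin L) (n : Site M),
      χ ((2 * n + l (j + 1)) * half M) = χ n * χ (l (j + 1) * half M) := fun j n => by
    rw [← AddChar.map_add_eq_mul]; congr 1
    linear_combination n * two_mul_half (M := M)
  have hα : ∀ j, χ (-(l j * i j)) * ((1 + y j * χ (k + (2 * i j + l (j + 1)))) *
      baxterPsi χ (y j) k (2 * i j + l (j + 1))) = χ (l (j + 1) * half M) * baxterA χ (y j) k *
        (χ (-((l j - 1) * i j)) * baxterPsi χ (y j) (k - 1) (2 * i j + (l (j + 1) - 1))) :=
    fun j => by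
      rw [baxterPsi_eq_A hχ (hyj j), hhalf, hsplit,
        show 2 * i j + l (j + 1) - 1 = 2 * i j + (l (j + 1) - 1) by ring]
      ring
  -- The remaining goals are the triangularity relations, with `αⱼ` the first diagonal entry at site
  -- `j`.
  rw [sum_prod_cyclic hL (fun j a b => (LOp M (χ 2) (stdParams c j) (x * χ k) a b *ᵥ fun i =>
    χ (-(l j * i)) * baxterPsi χ (y j) k (2 * i + l (j + 1))) (i j)) (fun j => χ (l j)) (fun j => χ (l (j + 1) * half M) *
    baxterA χ (y j) k * (χ (-((l j - 1) * i j)) *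
      baxterPsi χ (y j) (k - 1) (2 * i j + (l (j + 1) - 1))))]
  · simp only [Pi.smul_apply, Pi.add_apply, smul_eq_mul, mul_add, baxterVec]
    congr 1
    · rw [hσ, chi_sum, ← Finset.prod_mul_distrib, ← Finset.prod_mul_distrib]
      exact Finset.prod_congr rfl fun j _ => by ring
    · rw [hσ', chi_sum, ← Finset.prod_mul_distrib, ← Finset.prod_mul_distrib]
      refine Finset.prod_congr rfl fun j _ => ?_
      have hB := baxterPsi_eq_B hχ (hyj j) k (2 * i j + l (j + 1))
      rw [hhalf, show 2 * i j + l (j + 1) - 1 = 2 * i j + (l (j + 1) - 1) by ring,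
        show 2 * i j + l (j + 1) - 2 = 2 * (i j - 1) + l (j + 1) by ring] at hB
      have hl : χ (l j - l (j + 1) * half M) * χ (l (j + 1) * half M) = χ (l j) := by
        rw [← AddChar.map_add_eq_mul, sub_add_cancel]
      have h2 : χ (2 * i j) = χ (i j) * χ (i j) := by
        rw [two_mul (i j), AddChar.map_add_eq_mul]
      have hm : χ (-(l j * (i j - 1))) = χ (-(l j * i j)) * χ (l j) := by
        rw [← AddChar.map_add_eq_mul]; congr 1; ring
      rw [hsplit]
      simp only [LOp, stdParams, of_apply, cons_val', cons_val_zero, cons_val_one, cons_val_fin_one,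
        one_smul, smul_mulVec, Pi.smul_apply, smul_eq_mul, weylZ_mulVec, weylY_mulVec]
      rw [hm, h2]
      simp only [hydef] at hB ⊢
      linear_combination (χ (l j - l (j + 1) * half M) * χ (-(l j * i j)) * χ (i j)) * hB -
        (χ (i j) * χ (i j) * χ (-(l j * i j)) *
          (baxterPsi χ (x * c j) k (2 * (i j - 1) + l (j + 1)) -
            x * c j * χ k * baxterPsi χ (x * c j) k (2 * i j + l (j + 1)))) * hl
  · intro j
    rw [← hα]
    have hm : χ (-(l j * (i j - 1))) = χ (-(l j * i j)) * χ (l j) := by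
      rw [← AddChar.map_add_eq_mul]; congr 1; ring
    have hR := baxterPsi_rec hχ (y j) k (2 * i j + l (j + 1))
    rw [hR]
    have h7 : χ (k - (2 * i j + l (j + 1))) * χ (2 * i j + l (j + 1)) = χ k := by
      rw [← AddChar.map_add_eq_mul, sub_add_cancel]
    rw [show 2 * i j + l (j + 1) - 2 = 2 * (i j - 1) + l (j + 1) by ring]
    have h8 : χ (2 * i j + l (j + 1)) = χ (2 * i j) * χ (l (j + 1)) :=
      AddChar.map_add_eq_mul _ _ _
    simp only [LOp, stdParams, of_apply, cons_val', cons_val_zero, cons_val_one, cons_val_fin_one,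
        one_smul, smul_mulVec, Pi.smul_apply, smul_eq_mul, weylX_mulVec, weylY_mulVec]
    rw [hm]
    simp only [hydef]
    linear_combination (-(χ (-(l j * i j)) * χ (l j) *
      baxterPsi χ (x * c j) k (2 * (i j - 1) + l (j + 1)))) * h8 -
      (χ (-(l j * i j)) * χ (l j) *
      baxterPsi χ (x * c j) k (2 * (i j - 1) + l (j + 1)) * x * c j) * h7
  · intro j
    rw [← hα]
    simp only [LOp, stdParams, of_apply, cons_val', cons_val_zero, cons_val_one, cons_val_fin_one,
        one_smul, smul_mulVec, one_mulVec, Pi.smul_apply, smul_eq_mul, weylZ_mulVec]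
    rw [AddChar.map_add_eq_mul, AddChar.map_add_eq_mul]
    simp only [hydef]
    ring

/-- The operator moves all `l j` by `-2`. As `2` is invertible modulo `N`, its eigenvalue on `φ`
makes it possible to undo the shift by `-1` in `transfer_baxterVec`. -/
theorem tensorY_baxterVec (y : Fin L → ℂ) (k : Site M) (l : Fin L → Site M) :
    tensorOp (fun _ => weylY M (χ 2)) *ᵥ baxterVec χ y k l =
      χ (∑ j, l j) • baxterVec χ y k fun j => l j - 2 := by
  ext i
  refine (tensorOp_mulVec _ (fun j i => χ (-(l j * i)) *
    baxterPsi χ (y j) k (2 * i + l (j + 1))) i).trans ?_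
  simp only [Pi.smul_apply, smul_eq_mul, baxterVec, chi_sum, ← Finset.prod_mul_distrib,
    weylY_mulVec]
  refine Finset.prod_congr rfl fun j _ => ?_
  rw [show 2 * (i j - 1) + l (j + 1) = 2 * i j + (l (j + 1) - 2) by ring, ← mul_assoc,
    ← mul_assoc, ← AddChar.map_add_eq_mul, ← AddChar.map_add_eq_mul]
  congr 2
  ring

end Chain

end BaxterTQ

namespace BaxterTQ

/-! ### From an eigenvector of the chain to a vanishing determinant. -/

section Chain

variable {M L : ℕ}

theorem tensorOp_one : tensorOp (fun _ : Fin L => (1 : SiteOp M)) = 1 := by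
  ext i j
  simp only [tensorOp, of_apply, one_apply]
  rw [Finset.prod_ite_zero]
  simp [funext_iff]

theorem tensorOp_smul (a : Fin L → ℂ) (A : Fin L → SiteOp M) :
    tensorOp (fun j => a j • A j) = (∏ j, a j) • tensorOp A := by
  ext i j
  simp [tensorOp, Finset.prod_mul_distrib]

theorem tensorOp_eq_zero {A : Fin L → SiteOp M} (j : Fin L) (h : A j = 0) : tensorOp A = 0 := by
  ext i k
  exact Finset.prod_eq_zero (Finset.mem_univ j) (by rw [h]; rfl)

variable [NeZero L]

/-- The L-operators are diagonal at `x = 0`, so only the two constant auxiliary sequences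
contribute. -/
theorem transfer_zero (ω : ℂ) (h : Fin L → Params) :
    transfer M ω h 0 =
      (∏ j, (h j).a) • tensorOp (fun _ : Fin L => weylY M ω) + (∏ j, (h j).d) • 1 := by
  have hconst : ∀ s : Fin L → Fin 2, (∀ j, s j = s (j + 1)) → s = fun _ => s 0 := by
    intro s hs
    have key : ∀ n : ℕ, s (Fin.ofNat L n) = s 0 := fun n => by
      induction n with
      | zero => rfl
      | succ n ih =>
        rw [← ih, hs (Fin.ofNat L n)]
        congr 1
        ext
        simp [Fin.val_add, Fin.ofNat]
    ext1 j
    rw [← key j.val]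
    congr 1
    ext
    simp [Fin.ofNat, Nat.mod_eq_of_lt j.2]
  rw [transfer, Finset.sum_eq_add (fun _ => (0 : Fin 2)) (fun _ => (1 : Fin 2))]
  · congr 1
    · rw [← tensorOp_smul]; rfl
    · rw [← tensorOp_one, ← tensorOp_smul]; rfl
  · intro h; exact absurd (congrFun h 0) (by decide)
  · rintro s - ⟨h0, h1⟩
    by_cases hs : ∀ j, s j = s (j + 1)
    · exfalso
      have := hconst s hs
      rcases Fin.exists_fin_two.mp ⟨s 0, rfl⟩ with h | h
      · exact h0 (by rw [this, h])
      · exact h1 (by rw [this, h])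
    · push Not at hs
      obtain ⟨j, hj⟩ := hs
      have hoff : ∀ (p : Params) (a b : Fin 2), a ≠ b → LOp M ω p 0 a b = 0 := fun p => by
        simp only [Fin.forall_fin_two]
        simp [LOp]
      exact tensorOp_eq_zero j (hoff _ _ _ hj)
  · simp
  · simp

variable (χ : AddChar (Site M) ℂ) {R S : Type*} [CommRing R] [Algebra ℂ R] [CommRing S]
  [Algebra ℂ S]

/-- The matrix of the Baxter vectors on one orbit. -/
noncomputable def spanMat (y : Fin L → R) : Matrix (Fin L → Site M) (Fin L → Site M) R :=
  of fun i l => ∏ j, algebraMap ℂ R (χ (-(l j * i j))) * siteW χ (y j) (i j + l (j + 1) * half M)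

theorem spanMat_apply (y : Fin L → ℂ) (i l : Fin L → Site M) : spanMat χ y i l =
    ∏ j, χ (-(l j * i j)) * siteW χ (y j) (i j + l (j + 1) * half M) := rfl

theorem map_det_spanMat (f : R →ₐ[ℂ] S) (y : Fin L → R) :
    f (spanMat χ y).det = (spanMat χ (f ∘ y)).det := by
  rw [AlgHom.map_det]
  congr 1
  ext i l
  simp [spanMat, map_prod, map_siteW]

variable {χ}

/-- At `y = -q` each column is supported at one basis index, and `l j = 2 (M - i (j - 1))` reaches
the index `i`. A row vector annihilating all columns therefore vanishes coordinate by coordinate. -/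
theorem det_spanMat_ne_zero (hχ : Function.Injective χ) :
    (spanMat χ fun _ : Fin L => -χ 1).det ≠ 0 := by
  intro h
  obtain ⟨φ, hφ, h⟩ := exists_vecMul_eq_zero_iff.mpr h
  apply hφ
  ext i
  have hi := congrFun h fun j => 2 * (M - i (j - 1))
  rw [vecMul, dotProduct, Finset.sum_eq_single i] at hi
  · refine (mul_eq_zero.mp hi).resolve_right ?_
    rw [spanMat_apply]
    refine Finset.prod_ne_zero_iff.mpr fun j _ => mul_ne_zero (chi_ne_zero χ _) ?_
    rw [siteW_neg_chi_one_ne_zero_iff hχ, add_sub_cancel_right]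
    linear_combination (M - i j) * two_mul_half (M := M)
  · intro i' _ hi'
    refine mul_eq_zero_of_right _ ?_
    by_contra hne
    rw [spanMat_apply] at hne
    apply hi'
    ext1 j
    have := (mul_ne_zero_iff.mp (Finset.prod_ne_zero_iff.mp hne j (Finset.mem_univ _))).2
    rw [siteW_neg_chi_one_ne_zero_iff hχ, add_sub_cancel_right] at this
    linear_combination this - (M - i j) * two_mul_half (M := M)
  · simp

theorem exists_dotProduct_baxterVec_ne_zero {y : Fin L → ℂ} (h : (spanMat χ y).det ≠ 0)
    {φ : (Fin L → Site M) → ℂ} (hφ : φ ≠ 0) : ∃ l, φ ⬝ᵥ baxterVec χ y 0 l ≠ 0 := by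
  by_contra! h0
  apply h
  refine exists_vecMul_eq_zero_iff.mp ⟨φ, hφ, ?_⟩
  ext l
  rw [Pi.zero_apply, ← h0 l, vecMul]
  congr 1
  ext i
  rw [spanMat_apply, baxterVec]
  refine Finset.prod_congr rfl fun j _ => ?_
  rw [baxterPsi, AddChar.map_zero_eq_one, mul_one]
  congr 2
  linear_combination -(i j) * two_mul_half (M := M)

/-- Pairing the two-term relation with `φ` yields a kernel vector, indexed by the orbit, of a cyclic
tridiagonal matrix with coefficients `θ B` and `θ A`. This matrix has the same invariants as the T-Q
matrix at `-x`: equal products over bonds, and equal products around the cycle by `prod_baxterA`. -/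
theorem det_cyc_of_eigenvector (hL : L = 3 ∨ L = 4) (hχ : Function.Injective χ)
    (c : Fin L → ℂ) (x : ℂ) (hy : ∀ j, (x * c j) ^ (2 * M + 1) ≠ -1) (s : Site M) (Λ : ℂ → ℂ)
    (φ : (Fin L → Site M) → ℂ)
    (hφ : ∀ k, φ ᵥ* transfer M (χ 2) (stdParams c) (x * χ k) = (χ s * Λ (x * χ k)) • φ)
    (hY : φ ᵥ* tensorOp (fun _ => weylY M (χ 2)) = χ (2 * s) • φ)
    (hne : ∃ k l, φ ⬝ᵥ baxterVec χ (fun j => x * c j) k l ≠ 0) :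
    (cyc (fun k => Λ (x * χ k)) (fun k => χ s * ∏ j, (1 + c j * -(x * χ k)))
      fun k => χ (-s) * ∏ j, (1 + c j * (x * χ (k - 1)))).det = 0 := by
  set y : Fin L → ℂ := fun j => x * c j with hydef
  obtain ⟨k₀, l, hne⟩ := hne
  have hstep : ∀ (k : Site M) (l : Fin L → Site M), φ ⬝ᵥ baxterVec χ y k (fun j => l j - 2) =
      χ (2 * s - ∑ j, l j) * φ ⬝ᵥ baxterVec χ y k l := fun k l => by
    have h1 := dotProduct_mulVec φ (tensorOp (fun _ => weylY M (χ 2))) (baxterVec χ y k l)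
    rw [hY, tensorY_baxterVec, dotProduct_smul, smul_dotProduct, smul_eq_mul, smul_eq_mul] at h1
    have h2 : χ (2 * s - ∑ j, l j) * χ (∑ j, l j) = χ (2 * s) := by
      rw [← AddChar.map_add_eq_mul, sub_add_cancel]
    refine mul_left_cancel₀ (chi_ne_zero χ (∑ j, l j)) ?_
    rw [h1, ← h2]
    ring
  -- Applying `Y ⊗ ⋯ ⊗ Y` repeatedly moves `l` by `-2 n`; `n = M + 1` gives the shift by one.
  have hiter : ∀ (n : ℕ) (k : Site M), φ ⬝ᵥ baxterVec χ y k (fun j => l j - 2 * n) =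
      χ (2 * s * n - n * ∑ j, l j + L * (n * (n - 1))) * φ ⬝ᵥ baxterVec χ y k l := fun n k => by
    induction n with
    | zero => simp
    | succ n ih =>
      have h := hstep k fun j => l j - 2 * n
      rw [ih, ← mul_assoc, ← AddChar.map_add_eq_mul, Finset.sum_sub_distrib, Finset.sum_const,
        Finset.card_univ, Fintype.card_fin, nsmul_eq_mul] at h
      convert h using 2
      · congr 1
        ext j
        push_cast
        ring
      · congr 1
        push_cast
        ring
  -- The accumulated quadratic phase. Its square cancels the factor `q^{L/2}` of the product of `A`
  -- at `k + 1` and `B` at `k`.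
  set θ := χ (L * (half M * (half M - 1))) with hθ
  have hone : ∀ k, φ ⬝ᵥ baxterVec χ y k (fun j => l j - 1) =
      χ (s - (∑ j, l j) * half M) * θ * φ ⬝ᵥ baxterVec χ y k l := fun k => by
    have h := hiter (M + 1) k
    have e : ((M + 1 : ℕ) : Site M) = half M := rfl
    rw [e, two_mul_half] at h
    rw [h, hθ, ← AddChar.map_add_eq_mul]
    congr 2
    linear_combination s * two_mul_half (M := M)
  have hθ2 : θ * θ * χ (half M) ^ L = 1 := by
    rw [← AddChar.map_nsmul_eq_pow, hθ, ← AddChar.map_add_eq_mul, ← AddChar.map_add_eq_mul,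
      ← AddChar.map_zero_eq_one χ, nsmul_eq_mul]
    congr 1
    linear_combination (L * half M : Site M) * two_mul_half (M := M)
  set A : Site M → ℂ := fun k => ∏ j, baxterA χ (y j) k with hA
  set B : Site M → ℂ := fun k => ∏ j, baxterB χ (y j) k with hB
  have hA0 : ∀ k, A k ≠ 0 := fun k => Finset.prod_ne_zero_iff.mpr fun j _ => baxterA_ne_zero (hy j) k
  have hθ0 : θ ≠ 0 := chi_ne_zero χ _
  have hrel : ∀ k, Λ (x * χ k) * φ ⬝ᵥ baxterVec χ y k l =
      θ * (B k * φ ⬝ᵥ baxterVec χ y (k + 1) l + A k * φ ⬝ᵥ baxterVec χ y (k - 1) l) := fun k => by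
    have h1 := dotProduct_mulVec φ (transfer M (χ 2) (stdParams c) (x * χ k)) (baxterVec χ y k l)
    rw [hφ k, transfer_baxterVec hL hχ c x hy, dotProduct_smul, dotProduct_add, dotProduct_smul,
      dotProduct_smul, smul_dotProduct] at h1
    simp only [smul_eq_mul] at h1
    rw [hone, hone] at h1
    have h2 : χ (s - (∑ j, l j) * half M) * χ ((∑ j, l j) * half M) = χ s := by
      rw [← AddChar.map_add_eq_mul, sub_add_cancel]
    refine mul_left_cancel₀ (chi_ne_zero χ s) ?_
    simp only [hA, hB]
    linear_combination -h1 + (θ * (B k * φ ⬝ᵥ baxterVec χ y (k + 1) l +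
      A k * φ ⬝ᵥ baxterVec χ y (k - 1) l)) * h2
  have hdet : (cyc (fun k => Λ (x * χ k)) (fun k => θ * B k) fun k => θ * A k).det = 0 := by
    refine exists_mulVec_eq_zero_iff.mp ⟨fun k => φ ⬝ᵥ baxterVec χ y k l,
      fun h => hne (congrFun h k₀), ?_⟩
    ext k
    rw [cyc_mulVec, Pi.zero_apply]
    linear_combination hrel k
  rw [← hdet]
  have hs0 : χ s * χ (-s) = 1 := by
    rw [← AddChar.map_add_eq_mul, add_neg_cancel, AddChar.map_zero_eq_one]
  refine det_cyc_eq_of_prod_eq (fun k => mul_ne_zero hθ0 (hA0 k)) (fun k => ?_) (fun k => ?_) ?_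
  · refine mul_ne_zero (chi_ne_zero χ _) (Finset.prod_ne_zero_iff.mpr fun j _ => ?_)
    have := one_add_mul_chi_ne_zero (χ := χ) (hy j) (k - 1)
    intro h
    exact this (by rw [← h]; ring)
  · have h1 : B k * A (k + 1) =
        (∏ j, ((1 + c j * -(x * χ k)) * (1 + c j * (x * χ k)))) * χ (half M) ^ L := by
      have hc : χ (half M) ^ L = ∏ _j : Fin L, χ (half M) := by simp
      rw [hA, hB, hc, ← Finset.prod_mul_distrib, ← Finset.prod_mul_distrib]
      refine Finset.prod_congr rfl fun j _ => ?_
      rw [baxterB, div_mul_cancel₀ _ (baxterA_ne_zero (hy j) _)]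
      simp only [hydef]
      ring
    rw [Finset.prod_mul_distrib] at h1
    rw [add_sub_cancel_right]
    linear_combination θ * θ * h1 + (∏ j, (1 + c j * -(x * χ k))) *
      (∏ j, (1 + c j * (x * χ k))) * (hθ2 - hs0)
  · rw [Finset.prod_mul_distrib, Finset.prod_mul_distrib, Finset.prod_const, Finset.prod_const,
      Finset.card_univ, ZMod.card, hθ, chi_pow_card, chi_pow_card, one_mul, one_mul, hA]
    have h2 : ∏ k : Site M, ∏ j, (1 + c j * (x * χ (k - 1))) =
        ∏ k : Site M, ∏ j, (1 + c j * (x * χ k)) :=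
      Equiv.prod_comp (Equiv.subRight (1 : Site M)) fun k => ∏ j, (1 + c j * (x * χ k))
    rw [h2]
    refine Finset.prod_comm.trans (Eq.trans ?_ Finset.prod_comm)
    refine Finset.prod_congr rfl fun j _ => ?_
    rw [prod_baxterA hχ (hy j), ← prod_one_add_mul_chi hχ]
    refine Finset.prod_congr rfl fun k _ => ?_
    ring

theorem vecMul_tensorY_of_transfer_zero {ω : ℂ} {c : Fin L → ℂ} {φ : (Fin L → Site M) → ℂ}
    {a : ℂ} (h : φ ᵥ* transfer M ω (stdParams c) 0 = (a + 1) • φ) :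
    φ ᵥ* tensorOp (fun _ => weylY M ω) = a • φ := by
  rw [transfer_zero] at h
  simp only [stdParams, Finset.prod_const_one, one_smul, vecMul_add, vecMul_one, add_smul] at h
  exact add_right_cancel h

end Chain

/-! ### Eigenvectors of chains of length four and three. -/

section Reduction

variable {M : ℕ} {χ : AddChar (Site M) ℂ}

/-- The parameters of a chain of three sites, as a degenerate case of four. -/
def extend3 {R : Type*} [Zero R] (c : Fin 3 → R) : Fin 4 → R := ![c 1, c 2, c 0, 0]

/-- Since the determinant is a multiple of `x^{2N}`, a single non-zero `x` at which Baxter's vectors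
span is enough. -/
theorem det_tqMat_of_eigenvector_four (hχ : Function.Injective χ) (c : Fin 4 → ℂ) (x : ℂ)
    (hx : x ≠ 0) (hy : ∀ j, (x * c j) ^ (2 * M + 1) ≠ -1)
    (hspan : (spanMat χ fun j => x * c j).det ≠ 0) (s : Site M) (lam : ℂ)
    (φ : (Fin 4 → Site M) → ℂ) (hφ0 : φ ≠ 0)
    (hφ : ∀ x, φ ᵥ* transfer M (χ 2) (stdParams c) x = (χ s * tqL χ s c lam x) • φ) :
    (tqMat χ s c lam 1).det = 0 := by
  have hY : φ ᵥ* tensorOp (fun _ => weylY M (χ 2)) = χ (2 * s) • φ := by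
    refine vecMul_tensorY_of_transfer_zero ((hφ 0).trans ?_)
    congr 1
    have h1 : χ s * χ (-s) = 1 := by
      rw [← AddChar.map_add_eq_mul, add_neg_cancel, AddChar.map_zero_eq_one]
    rw [two_mul s, AddChar.map_add_eq_mul, ← h1]
    simp [tqL]
    ring
  have h := det_cyc_of_eigenvector (Or.inr rfl) hχ c x hy s (tqL χ s c lam) φ (fun k => hφ _) hY
    ⟨0, exists_dotProduct_baxterVec_ne_zero hspan hφ0⟩
  have h2 : (tqMat χ s c lam (-x)).det = 0 := by
    rw [← h, tqMat]
    simp only [neg_mul, tqL_neg, tqP, Algebra.algebraMap_self, RingHom.id_apply, neg_neg]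
  rw [det_tqMat s c lam hχ] at h2
  exact (mul_eq_zero.mp h2).resolve_right (pow_ne_zero _ (neg_ne_zero.mpr hx))

theorem tqP_extend3 (c : Fin 3 → ℂ) (x : ℂ) : tqP (extend3 c) x = ∏ j, (1 + c j * x) := by
  rw [tqP, Fin.prod_univ_four, Fin.prod_univ_three]
  simp [extend3]
  ring

theorem det_tqMat_of_eigenvector_three (hχ : Function.Injective χ) (c : Fin 3 → ℂ) (x : ℂ)
    (hx : x ≠ 0) (hy : ∀ j, (x * c j) ^ (2 * M + 1) ≠ -1)
    (hspan : (spanMat χ fun j => x * c j).det ≠ 0) (s : Site M) (lam : ℂ)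
    (φ : (Fin 3 → Site M) → ℂ) (hφ0 : φ ≠ 0)
    (hφ : ∀ x, φ ᵥ* transfer M (χ 2) (stdParams c) x =
      (χ s * tqL χ s (extend3 c) lam x) • φ) :
    (tqMat χ s (extend3 c) lam 1).det = 0 := by
  have hY : φ ᵥ* tensorOp (fun _ => weylY M (χ 2)) = χ (2 * s) • φ := by
    refine vecMul_tensorY_of_transfer_zero ((hφ 0).trans ?_)
    congr 1
    have h1 : χ s * χ (-s) = 1 := by
      rw [← AddChar.map_add_eq_mul, add_neg_cancel, AddChar.map_zero_eq_one]
    rw [two_mul s, AddChar.map_add_eq_mul, ← h1]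
    simp [tqL]
    ring
  have h := det_cyc_of_eigenvector (Or.inl rfl) hχ c x hy s (tqL χ s (extend3 c) lam) φ
    (fun k => hφ _) hY ⟨0, exists_dotProduct_baxterVec_ne_zero hspan hφ0⟩
  have h2 : (tqMat χ s (extend3 c) lam (-x)).det = 0 := by
    rw [← h, tqMat]
    simp only [neg_mul, tqL_neg, tqP_extend3, Algebra.algebraMap_self, RingHom.id_apply, neg_neg]
  rw [det_tqMat s (extend3 c) lam hχ] at h2
  exact (mul_eq_zero.mp h2).resolve_right (pow_ne_zero _ (neg_ne_zero.mpr hx))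

end Reduction

end BaxterTQ

namespace BaxterTQ

/-! ### The transfer matrix as a sum of Weyl operators. -/

section Weyl

variable {M L : ℕ} (χ : AddChar (Site M) ℂ)

/-- The operator `|j⟩ ↦ χ(e + α j) |j + d⟩` on one site. -/
noncomputable def siteWeyl (e a d : Site M) : SiteOp M :=
  of fun i j => if i = j + d then χ (e + a * j) else 0

/-- The operator `|j⟩ ↦ χ(e + ∑ αₗ jₗ) |j + δ⟩` on the chain. -/
noncomputable def chainWeyl (e : Site M) (α δ : Fin L → Site M) : ChainOp L M :=
  of fun i j => if i = j + δ then χ (e + ∑ l, α l * j l) else 0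

theorem weylX_eq : weylX M = siteWeyl χ 0 0 1 := by
  ext i j
  simp [weylX, siteWeyl, eq_sub_iff_add_eq, eq_comm]

theorem weylZ_eq : weylZ M (χ 2) = siteWeyl χ 0 2 0 := by
  ext i j
  simp only [weylZ, siteWeyl, diagonal_apply, of_apply, add_zero, zero_add]
  rw [← chi_mul_natCast, ZMod.natCast_zmod_val]
  split_ifs with h
  · rw [h]
  · rfl

theorem siteWeyl_mul (e a d e' a' d' : Site M) :
    siteWeyl χ e a d * siteWeyl χ e' a' d' = siteWeyl χ (e + e' + a * d') (a + a') (d + d') := by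
  ext i k
  rw [mul_apply, Finset.sum_eq_single (k + d')]
  · simp only [siteWeyl, of_apply, if_true, ite_mul, zero_mul]
    rw [show k + d' + d = k + (d + d') by ring]
    refine if_congr Iff.rfl ?_ rfl
    rw [← AddChar.map_add_eq_mul]
    congr 1
    ring
  · intro j _ hj
    simp [siteWeyl, hj]
  · simp

theorem weylY_eq : weylY M (χ 2) = siteWeyl χ 2 2 1 := by
  rw [weylY, weylZ_eq, weylX_eq χ, siteWeyl_mul]
  congr 1 <;> ring

theorem one_eq_siteWeyl : (1 : SiteOp M) = siteWeyl χ 0 0 0 := by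
  ext i j
  simp [siteWeyl, one_apply]

theorem tensorOp_siteWeyl (e a d : Fin L → Site M) :
    tensorOp (fun l => siteWeyl χ (e l) (a l) (d l)) = chainWeyl χ (∑ l, e l) a d := by
  ext i j
  simp only [tensorOp, siteWeyl, chainWeyl, of_apply]
  by_cases h : i = j + d
  · rw [if_pos h, ← Finset.sum_add_distrib, chi_sum]
    exact Finset.prod_congr rfl fun l _ => if_pos (congrFun h l)
  · rw [if_neg h]
    obtain ⟨l, hl⟩ := Function.ne_iff.mp h
    exact Finset.prod_eq_zero (Finset.mem_univ l) (if_neg hl)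

theorem vecMul_chainWeyl (φ : (Fin L → Site M) → ℂ) (e : Site M) (α δ j : Fin L → Site M) :
    (φ ᵥ* chainWeyl χ e α δ) j = φ (j + δ) * χ (e + ∑ l, α l * j l) := by
  simp [vecMul, dotProduct, chainWeyl]

theorem chainWeyl_mul (e e' : Site M) (α δ α' δ' : Fin L → Site M) :
    chainWeyl χ e α δ * chainWeyl χ e' α' δ' =
      chainWeyl χ (e + e' + ∑ l, α l * δ' l) (α + α') (δ + δ') := by
  ext i k
  rw [mul_apply, Finset.sum_eq_single (k + δ')]
  · simp only [chainWeyl, of_apply, if_true, ite_mul, zero_mul]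
    rw [show k + δ' + δ = k + (δ + δ') by rw [add_assoc, add_comm δ' δ]]
    refine if_congr Iff.rfl ?_ rfl
    rw [← AddChar.map_add_eq_mul]
    congr 1
    simp only [Pi.add_apply, mul_add, add_mul, Finset.sum_add_distrib]
    ring
  · intro j _ hj
    simp [chainWeyl, hj]
  · simp

theorem one_eq_chainWeyl : (1 : ChainOp L M) = chainWeyl χ 0 0 0 := by
  ext i j
  simp [chainWeyl, one_apply]

variable [NeZero L]

/-- The coefficients of the entries of the L-operator. -/
def lCoef (h : Params) (x : ℂ) : Fin 2 → Fin 2 → ℂ := ![![h.a, x * h.b], ![x * h.c, h.d]]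

/-- The shift in the entries of the L-operator. -/
def lShift {M : ℕ} : Fin 2 → Site M := ![1, 0]

/-- The row index is the shift and the column index the twist, so one formula covers all terms of
the trace. -/
theorem LOp_eq (h : Params) (x : ℂ) (a b : Fin 2) :
    LOp M (χ 2) h x a b = lCoef h x a b •
      siteWeyl χ (2 * lShift a * lShift b) (2 * lShift b) (lShift a) := by
  revert a b
  simp [Fin.forall_fin_two, LOp, lCoef, lShift, weylY_eq, weylX_eq χ, weylZ_eq,
    one_eq_siteWeyl χ]

theorem transfer_eq (h : Fin L → Params) (x : ℂ) :
    transfer M (χ 2) h x = ∑ s : Fin L → Fin 2, (∏ j, lCoef (h j) x (s j) (s (j + 1))) •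
      chainWeyl χ (∑ j, 2 * lShift (s j) * lShift (s (j + 1))) (fun j => 2 * lShift (s (j + 1)))
        fun j => lShift (s j) := by
  rw [transfer]
  refine Finset.sum_congr rfl fun s _ => ?_
  simp_rw [LOp_eq]
  rw [tensorOp_smul, tensorOp_siteWeyl]

theorem vecMul_transfer (h : Fin L → Params) (x : ℂ) (φ : (Fin L → Site M) → ℂ)
    (j : Fin L → Site M) :
    (φ ᵥ* transfer M (χ 2) h x) j = ∑ s : Fin L → Fin 2, (∏ l, lCoef (h l) x (s l) (s (l + 1))) *
      (φ (j + fun l => lShift (s l)) *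
        χ (∑ l, 2 * lShift (s l) * lShift (s (l + 1)) + ∑ l, 2 * lShift (s (l + 1)) * j l)) := by
  rw [transfer_eq, vecMul_sum, Finset.sum_apply]
  refine Finset.sum_congr rfl fun s _ => ?_
  rw [vecMul_smul, Pi.smul_apply, vecMul_chainWeyl, smul_eq_mul]

end Weyl

/-! ### Embedding the reduced space into the chain. -/

section Embedding

variable {M : ℕ} (χ : AddChar (Site M) ℂ)

/-- The embedding of the reduced quantum space into the chain of length four. -/
noncomputable def embed4 (s : Site M) (g : Site M → ℂ) (i : Fin 4 → Site M) : ℂ :=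
  χ (2 * s * i 0 - 2 * i 0 - 2 * i 0 * i 1 - 2 * i 2 * i 3 - 2 * i 1) * g (i 3 - i 1)

/-- The embedding of the reduced quantum space into the chain of length three. -/
noncomputable def embed3 (s : Site M) (g : Site M → ℂ) (i : Fin 3 → Site M) : ℂ :=
  χ (-2 * i 0 * i 1 - 2 * i 1 * i 2 + i 1 * i 1 + (2 * s - 1) * i 1 - 2 * i 2) * g (i 1 - i 2)

theorem embed4_ne_zero (s : Site M) {g : Site M → ℂ} (hg : g ≠ 0) : embed4 χ s g ≠ 0 := by
  intro h
  apply hg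
  ext n
  have := congrFun h ![0, 0, 0, n]
  simpa [embed4] using this

theorem embed3_ne_zero (s : Site M) {g : Site M → ℂ} (hg : g ≠ 0) : embed3 χ s g ≠ 0 := by
  intro h
  apply hg
  ext n
  have := congrFun h ![0, n, 0]
  simpa [embed3, chi_ne_zero] using this

/-- For the standard parameters the sector is `C = ω⁻¹`; the gauge leading back to `params4` turns
it into `C = 1`. -/
theorem embed4_vecMul_opC (s : Site M) (g : Site M → ℂ) :
    embed4 χ s g ᵥ* opC M (χ 2) = χ (-2) • embed4 χ s g := by
  have h : opC M (χ 2) = chainWeyl χ 0 ![2, 0, 2, 0] ![0, 1, 0, 1] := by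
    have := tensorOp_siteWeyl χ (L := 4) 0 ![2, 0, 2, 0] ![0, 1, 0, 1]
    simp only [Pi.zero_apply, Finset.sum_const_zero] at this
    rw [← this, opC]
    congr 1
    ext l : 1
    fin_cases l <;> simp [weylX_eq χ, weylZ_eq]
  ext j
  rw [h, vecMul_chainWeyl, Pi.smul_apply, smul_eq_mul, embed4, embed4]
  have h2 : ∀ a b c d : Site M, (![a, b, c, d] : Fin 4 → Site M) 2 = c := fun _ _ _ _ => rfl
  have h3 : ∀ a b c d : Site M, (![a, b, c, d] : Fin 4 → Site M) 3 = d := fun _ _ _ _ => rfl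
  simp only [Pi.add_apply, Fin.sum_univ_four, cons_val_zero, cons_val_one, h2, h3]
  rw [mul_right_comm, ← AddChar.map_add_eq_mul, ← mul_assoc, ← AddChar.map_add_eq_mul]
  congr 2
  · ring
  · ring

/-- Multiplied by `u q⁻¹`, the reduced Hamiltonian expands into the monomials that appear as the
`x²` terms of the transfer matrix. -/
theorem redHam_mulVec (s : Site M) (c : Fin 4 → ℂ) (g : Site M → ℂ) (n : Site M) :
    χ (s - 1) * (redHam χ s c *ᵥ g) n =
      (c 1 * c 2 + c 0 * c 3) * (χ (2 * s + 2 * n - 2) + χ (-(2 * n))) * g n +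
      (c 1 * c 3 * χ (-(2 * n)) + c 2 * c 3 + c 0 * c 1 * χ (2 * s) +
        c 0 * c 2 * χ (2 * s + 2 * n)) * g (n + 1) +
      (c 0 * c 2 * χ (-(2 * n)) + c 0 * c 1 * χ (-2) + c 2 * c 3 * χ (2 * s - 2) +
        c 1 * c 3 * χ (2 * s + 2 * n - 4)) * g (n - 1) := by
  have h : ∀ a b d : Site M, a + b = d → χ a * χ b = χ d := fun a b d h => by
    rw [← h, AddChar.map_add_eq_mul]
  have e1 := h (s - 1) (s + 2 * n - 1) (2 * s + 2 * n - 2) (by ring)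
  have e2 := h (s - 1) (-(s + 2 * n - 1)) (-(2 * n)) (by ring)
  have e3 := h (s - 1) (1 - s - 2 * n) (-(2 * n)) (by ring)
  have e4 := h (-(2 * n)) (2 * n) 0 (by ring)
  have e5 := h (-(2 * n)) (2 * s + 2 * n) (2 * s) (by ring)
  have e6 := h (2 * s) (2 * n) (2 * s + 2 * n) (by ring)
  have e7 := h (-(2 * n)) (2 * n - 2) (-2) (by ring)
  have e8 := h (-(2 * n)) (2 * s + 2 * n - 2) (2 * s - 2) (by ring)
  have e9 := h (2 * s - 2) (2 * n - 2) (2 * s + 2 * n - 4) (by ring)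
  rw [AddChar.map_zero_eq_one] at e4
  rw [redHam, cyc_mulVec]
  simp only [Algebra.algebraMap_self, RingHom.id_apply]
  linear_combination (c 1 * c 2 + c 0 * c 3) * g n * (e1 + e2) +
    (c 3 + c 0 * χ (2 * s + 2 * n)) * (c 1 + c 2 * χ (2 * n)) * g (n + 1) * e3 +
    (c 0 + c 3 * χ (2 * s + 2 * n - 2)) * (c 2 + c 1 * χ (2 * n - 2)) * g (n - 1) * e3 +
    g (n + 1) * (c 2 * c 3 * e4 + c 0 * c 1 * e5 + c 0 * c 2 * χ (2 * n) * e5 + c 0 * c 2 * e6) +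
    g (n - 1) * (c 0 * c 1 * e7 + c 2 * c 3 * e8 + c 1 * c 3 * χ (2 * n - 2) * e8 +
      c 1 * c 3 * e9)

theorem chi_mul_tqL (s : Site M) (c : Fin 4 → ℂ) (μ x : ℂ) :
    χ s * tqL χ s c (χ (-1) * μ) x = χ (2 * s) + 1 + χ (s - 1) * μ * x ^ 2 +
      (χ (2 * s - 2) + χ (-2)) * (∏ j, c j) * x ^ 4 := by
  have h : ∀ a b d : Site M, a + b = d → χ a * χ b = χ d := fun a b d h => by
    rw [← h, AddChar.map_add_eq_mul]
  have e1 := h s s (2 * s) (by ring)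
  have e2 := h s (-s) 0 (by ring)
  have e3 := h s (-1) (s - 1) (by ring)
  have e4 := h (2 * s) (-2) (2 * s - 2) (by ring)
  rw [AddChar.map_zero_eq_one] at e2
  simp only [tqL, Algebra.algebraMap_self, RingHom.id_apply]
  linear_combination (1 + χ (-2) * (∏ j, c j) * x ^ 4) * (e1 + e2) + μ * x ^ 2 * e3 +
    (∏ j, c j) * x ^ 4 * e4

/-- The quadratic phase in `embed4` is such that each of the sixteen terms of the trace acts by a
phase depending only on `n = j 3 - j 1`, together with a shift of `g`. The terms in `x⁰` and `x⁴`
are scalars, and those in `x²` add up to `redHam`. -/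
theorem embed4_vecMul_transfer (s : Site M) (c : Fin 4 → ℂ) {g : Site M → ℂ} {μ : ℂ}
    (hg : redHam χ s c *ᵥ g = μ • g) (x : ℂ) :
    embed4 χ s g ᵥ* transfer M (χ 2) (stdParams c) x =
      (χ s * tqL χ s c (χ (-1) * μ) x) • embed4 χ s g := by
  ext j
  set n := j 3 - j 1 with hn
  have hH := redHam_mulVec χ s c g n
  rw [hg, Pi.smul_apply, smul_eq_mul] at hH
  -- The phase of the term with auxiliary sequence `t`, relative to the phase `E` at `j`.
  obtain ⟨p, hp⟩ : ∃ p : Site M → Site M → Site M → Site M → Site M, p = fun t0 t1 t2 t3 =>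
    2 * t1 * t2 + 2 * t0 * t3 + 2 * n * (t0 - t2) + 2 * s * t0 - 2 * t0 - 2 * t1 := ⟨_, rfl⟩
  obtain ⟨E, hE⟩ : ∃ E, E = 2 * s * j 0 - 2 * j 0 - 2 * j 0 * j 1 - 2 * j 2 * j 3 - 2 * j 1 :=
    ⟨_, rfl⟩
  have hterm : ∀ t : Fin 4 → Fin 2, embed4 χ s g (j + fun l => lShift (t l)) *
      χ (∑ l, 2 * lShift (t l) * lShift (t (l + 1)) + ∑ l, 2 * lShift (t (l + 1)) * j l) =
      χ E * (χ (p (lShift (t 0)) (lShift (t 1)) (lShift (t 2)) (lShift (t 3))) *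
        g (n + lShift (t 3) - lShift (t 1))) := fun t => by
    have g0 : (0 : Fin 4) + 1 = 1 := rfl
    have g1 : (1 : Fin 4) + 1 = 2 := rfl
    have g2 : (2 : Fin 4) + 1 = 3 := rfl
    have g3 : (3 : Fin 4) + 1 = 0 := rfl
    simp only [Fin.sum_univ_four, g0, g1, g2, g3, embed4, Pi.add_apply]
    rw [mul_right_comm, ← AddChar.map_add_eq_mul, ← mul_assoc, ← AddChar.map_add_eq_mul]
    congr 2
    · rw [hp, hE, hn]; ring
    · rw [hn]; ring
  rw [vecMul_transfer]
  simp_rw [hterm]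
  rw [sum_fin_four]
  have g0 : (0 : Fin 4) + 1 = 1 := rfl
  have g1 : (1 : Fin 4) + 1 = 2 := rfl
  have g2 : (2 : Fin 4) + 1 = 3 := rfl
  have g3 : (3 : Fin 4) + 1 = 0 := rfl
  have v2 : ∀ a b c d : Fin 2, (![a, b, c, d] : Fin 4 → Fin 2) 2 = c := fun _ _ _ _ => rfl
  have v3 : ∀ a b c d : Fin 2, (![a, b, c, d] : Fin 4 → Fin 2) 3 = d := fun _ _ _ _ => rfl
  have l0 : (lShift 0 : Site M) = 1 := rfl
  have l1 : (lShift 1 : Site M) = 0 := rfl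
  have n1 : n + 1 - 1 = n := by ring
  have p1111 : p 1 1 1 1 = 2 * s := by rw [hp]; ring
  have p0000 : p 0 0 0 0 = 0 := by rw [hp]; ring
  have p1000 : p 1 0 0 0 = 2 * s + 2 * n - 2 := by rw [hp]; ring
  have p0100 : p 0 1 0 0 = -2 := by rw [hp]; ring
  have p0010 : p 0 0 1 0 = -(2 * n) := by rw [hp]; ring
  have p0001 : p 0 0 0 1 = 0 := by rw [hp]; ring
  have p1100 : p 1 1 0 0 = 2 * s + 2 * n - 4 := by rw [hp]; ring
  have p0110 : p 0 1 1 0 = -(2 * n) := by rw [hp]; ring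
  have p0011 : p 0 0 1 1 = -(2 * n) := by rw [hp]; ring
  have p1001 : p 1 0 0 1 = 2 * s + 2 * n := by rw [hp]; ring
  have p1110 : p 1 1 1 0 = 2 * s - 2 := by rw [hp]; ring
  have p0111 : p 0 1 1 1 = -(2 * n) := by rw [hp]; ring
  have p1011 : p 1 0 1 1 = 2 * s := by rw [hp]; ring
  have p1101 : p 1 1 0 1 = 2 * s + 2 * n - 2 := by rw [hp]; ring
  have p1010 : p 1 0 1 0 = 2 * s - 2 := by rw [hp]; ring
  have p0101 : p 0 1 0 1 = -2 := by rw [hp]; ring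
  have hφ : embed4 χ s g j = χ E * g n := by rw [embed4, hE, hn]
  simp only [Fin.sum_univ_two, Fin.prod_univ_four, g0, g1, g2, g3, cons_val_zero, cons_val_one, v2,
    v3, l0, l1, lCoef, stdParams, Pi.smul_apply, smul_eq_mul, hφ, chi_mul_tqL, p1111, p0000, p1000,
    p0100, p0010, p0001, p1100, p0110, p0011, p1001, p1110, p0111, p1011, p1101, p1010, p0101,
    add_zero, sub_zero, n1, AddChar.map_zero_eq_one, one_mul, mul_one]
  linear_combination (-(χ E * x ^ 2)) * hH

theorem embed3_vecMul_transfer (s : Site M) (c : Fin 3 → ℂ) {g : Site M → ℂ} {μ : ℂ}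
    (hg : redHam χ s (extend3 c) *ᵥ g = μ • g) (x : ℂ) :
    embed3 χ s g ᵥ* transfer M (χ 2) (stdParams c) x =
      (χ s * tqL χ s (extend3 c) (χ (-1) * μ) x) • embed3 χ s g := by
  ext j
  set n := j 1 - j 2 with hn
  have hH := redHam_mulVec χ s (extend3 c) g n
  rw [hg, Pi.smul_apply, smul_eq_mul] at hH
  have c0 : extend3 c 0 = c 1 := rfl
  have c1 : extend3 c 1 = c 2 := rfl
  have c2 : extend3 c 2 = c 0 := rfl
  have c3 : extend3 c 3 = 0 := rfl
  obtain ⟨p, hp⟩ : ∃ p : Site M → Site M → Site M → Site M, p = fun t0 t1 t2 =>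
    2 * t0 * t2 + 2 * n * (t1 - t0) + t1 * t1 + (2 * s - 1) * t1 - 2 * t2 := ⟨_, rfl⟩
  obtain ⟨E, hE⟩ : ∃ E, E = -2 * j 0 * j 1 - 2 * j 1 * j 2 + j 1 * j 1 + (2 * s - 1) * j 1 -
    2 * j 2 := ⟨_, rfl⟩
  have g0 : (0 : Fin 3) + 1 = 1 := rfl
  have g1 : (1 : Fin 3) + 1 = 2 := rfl
  have g2 : (2 : Fin 3) + 1 = 0 := rfl
  have hterm : ∀ t : Fin 3 → Fin 2, embed3 χ s g (j + fun l => lShift (t l)) *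
      χ (∑ l, 2 * lShift (t l) * lShift (t (l + 1)) + ∑ l, 2 * lShift (t (l + 1)) * j l) =
      χ E * (χ (p (lShift (t 0)) (lShift (t 1)) (lShift (t 2))) *
        g (n + lShift (t 1) - lShift (t 2))) := fun t => by
    simp only [Fin.sum_univ_three, g0, g1, g2, embed3, Pi.add_apply]
    rw [mul_right_comm, ← AddChar.map_add_eq_mul, ← mul_assoc, ← AddChar.map_add_eq_mul]
    congr 2
    · rw [hp, hE, hn]; ring
    · rw [hn]; ring
  rw [vecMul_transfer]
  simp_rw [hterm]
  rw [sum_fin_three]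
  have v2 : ∀ a b c : Fin 2, (![a, b, c] : Fin 3 → Fin 2) 2 = c := fun _ _ _ => rfl
  have l0 : (lShift 0 : Site M) = 1 := rfl
  have l1 : (lShift 1 : Site M) = 0 := rfl
  have n1 : n + 1 - 1 = n := by ring
  have p111 : p 1 1 1 = 2 * s := by rw [hp]; ring
  have p000 : p 0 0 0 = 0 := by rw [hp]; ring
  have p100 : p 1 0 0 = -(2 * n) := by rw [hp]; ring
  have p010 : p 0 1 0 = 2 * s + 2 * n := by rw [hp]; ring
  have p001 : p 0 0 1 = -2 := by rw [hp]; ring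
  have p110 : p 1 1 0 = 2 * s := by rw [hp]; ring
  have p011 : p 0 1 1 = 2 * s + 2 * n - 2 := by rw [hp]; ring
  have p101 : p 1 0 1 = -(2 * n) := by rw [hp]; ring
  have hφ : embed3 χ s g j = χ E * g n := by rw [embed3, hE, hn]
  rw [c0, c1, c2, c3] at hH
  simp only [Fin.sum_univ_two, Fin.prod_univ_three, Fin.prod_univ_four, g0, g1, g2, cons_val_zero,
    cons_val_one, v2, l0, l1, lCoef, stdParams, Pi.smul_apply, smul_eq_mul, hφ, chi_mul_tqL, p111,
    p000, p100, p010, p001, p110, p011, p101, c0, c1, c2, c3,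
    add_zero, sub_zero, n1, AddChar.map_zero_eq_one, one_mul, mul_one]
  linear_combination (-(χ E * x ^ 2)) * hH

end Embedding

end BaxterTQ

namespace BaxterTQ

/-! ### Jacobi matrices. -/

section OpenChain

variable {M : ℕ}

/-- With `c 1 = 0` the three-term recursion starting at `1` needs no value at `0`, and it runs
through the cycle because `b` does not vanish on the way. -/
theorem eq_zero_of_cyc_mulVec {a b c v : Site M → ℂ} {z : ℂ} (hv : cyc a b c *ᵥ v = z • v)
    (hb : ∀ k, k ≠ 0 → b k ≠ 0) (hc : c 1 = 0) (h1 : v 1 = 0) : v = 0 := by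
  have key : ∀ j : ℕ, j < 2 * M + 1 → v ((j : Site M) + 1) = 0 ∧ (j ≠ 0 → v (j : Site M) = 0) := by
    intro j
    induction j with
    | zero => intro _; simpa using h1
    | succ j ih =>
      intro hj
      obtain ⟨ih1, ih2⟩ := ih (by omega)
      refine ⟨?_, fun _ => by push_cast; exact ih1⟩
      have h := congrFun hv ((j : Site M) + 1)
      rw [cyc_mulVec, Pi.smul_apply, ih1, add_sub_cancel_right] at h
      have h2 : c ((j : Site M) + 1) * v j = 0 := by
        by_cases h0 : j = 0
        · subst h0; simp [hc]
        · rw [ih2 h0, mul_zero]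
      have hk : (j : Site M) + 1 ≠ 0 := by
        intro h
        have h3 : ((j + 1 : ℕ) : Site M) = 0 := by push_cast; exact h
        rw [ZMod.natCast_eq_zero_iff] at h3
        exact absurd (Nat.le_of_dvd (by omega) h3) (by omega)
      have h4 : b ((j : Site M) + 1) * v ((j : Site M) + 1 + 1) = 0 := by
        rw [smul_zero, mul_zero] at h
        linear_combination -h - h2
      push_cast
      exact (mul_eq_zero.mp h4).resolve_left (hb _ hk)
  ext k
  have h := (key (k - 1).val (ZMod.val_lt _)).1
  rw [ZMod.natCast_zmod_val, sub_add_cancel] at h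
  exact h

end OpenChain

/-! ### The characteristic polynomial of the reduced Hamiltonian. -/

section Charpoly

variable {M : ℕ} {χ : AddChar (Site M) ℂ}

/-- The prefactor `χ (1 - s - 2n)` in `redHam` is chosen so that opposite entries are conjugate for
real parameters. -/
theorem isHermitian_redHam (s : Site M) (c : Fin 4 → ℝ) :
    (redHam χ s fun j => (c j : ℂ)).IsHermitian := by
  have h : ∀ a b d : Site M, a + b = d → χ a * χ b = χ d := fun a b d h => by
    rw [← h, AddChar.map_add_eq_mul]
  rw [Matrix.IsHermitian, conjTranspose, redHam, cyc_transpose]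
  change Matrix.map _ (starRingEnd ℂ) = _
  rw [map_cyc]
  congr 1 <;> ext n <;>
    simp only [Algebra.algebraMap_self, RingHom.id_apply, Function.comp_apply, map_mul, map_add,
      map_neg, Complex.conj_ofReal, conj_chi, neg_neg]
  · ring
  · have e1 := h (-(1 - s - 2 * (n + 1))) (-(2 * s + 2 * (n + 1) - 2)) (1 - s) (by ring)
    have e2 := h (1 - s) (-(2 * (n + 1) - 2)) (1 - s - 2 * n) (by ring)
    have e3 := h (-(1 - s - 2 * (n + 1))) (-(2 * (n + 1) - 2)) (1 + s) (by ring)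
    have e4 := h (1 + s) 0 (1 + s) (by ring)
    have e5 := h (1 - s - 2 * n) (2 * s + 2 * n) (1 + s) (by ring)
    have e6 := h (1 - s - 2 * n) (2 * n) (1 - s) (by ring)
    have e7 := h (1 + s) (2 * n) (-(1 - s - 2 * (n + 1))) (by ring)
    linear_combination -(c 3 : ℂ) * e1 * (c 2 : ℂ) + (c 3 : ℂ) * c 2 * e6 - (c 3 : ℂ) * c 1 * e2 -
      (c 3 : ℂ) * c 1 * χ (-(2 * (n + 1) - 2)) * e1 - (c 0 : ℂ) * c 1 * e3 + (c 0 : ℂ) * c 1 * e5 +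
      (c 0 : ℂ) * c 2 * χ (2 * n) * e5 + (c 0 : ℂ) * c 2 * e7
  · have e1 := h (-(1 - s - 2 * (n - 1))) (-(2 * s + 2 * (n - 1))) (-1 - s) (by ring)
    have e2 := h (-1 - s) (-(2 * (n - 1))) (1 - s - 2 * n) (by ring)
    have e3 := h (-(1 - s - 2 * (n - 1))) (-(2 * (n - 1))) (-1 + s) (by ring)
    have e5 := h (1 - s - 2 * n) (2 * s + 2 * n - 2) (-1 + s) (by ring)
    have e6 := h (1 - s - 2 * n) (2 * n - 2) (-1 - s) (by ring)
    have e7 := h (-1 + s) (2 * n - 2) (-(1 - s - 2 * (n - 1))) (by ring)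
    linear_combination -(c 0 : ℂ) * c 1 * e1 + (c 0 : ℂ) * c 1 * e6 - (c 0 : ℂ) * c 2 * e2 -
      (c 0 : ℂ) * c 2 * χ (-(2 * (n - 1))) * e1 - (c 3 : ℂ) * c 2 * e3 + (c 3 : ℂ) * c 2 * e5 +
      (c 3 : ℂ) * c 1 * χ (2 * n - 2) * e5 + (c 3 : ℂ) * c 1 * e7

/-- For these parameters the off-diagonal entries on the bond between `0` and `1` vanish in both
directions, and no others do. What remains is a Hermitian Jacobi matrix, whose spectrum is simple.
-/
theorem separable_charpoly_redHam (hχ : Function.Injective χ) (s : Site M) :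
    (redHam χ s (![1, 1, -1, 0] : Fin 4 → ℂ)).charpoly.Separable := by
  have hc : (![1, 1, -1, 0] : Fin 4 → ℂ) = fun j => ((![1, 1, -1, 0] : Fin 4 → ℝ) j : ℂ) := by
    ext j; fin_cases j <;> simp
  have hH := isHermitian_redHam (χ := χ) s ![1, 1, -1, 0]
  rw [← hc] at hH
  refine separable_charpoly_of_isHermitian hH 1 fun z v hv h1 => ?_
  refine eq_zero_of_cyc_mulVec hv (fun k hk => ?_) ?_ h1
  · have h2 : χ (2 * k) ≠ 1 := by
      rw [← AddChar.map_zero_eq_one χ]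
      exact fun h => hk (two_mul_eq_zero_iff.mp (hχ h))
    have h3 : (1 : ℂ) + -χ (2 * k) ≠ 0 := by
      rw [← sub_eq_add_neg]; exact sub_ne_zero.mpr h2.symm
    simp [chi_ne_zero, h3]
  · simp

theorem isRoot_charpoly_iff {n : Type*} [Fintype n] [DecidableEq n] (H : Matrix n n ℂ) (μ : ℂ) :
    H.charpoly.IsRoot μ ↔ ∃ g : n → ℂ, g ≠ 0 ∧ H *ᵥ g = μ • g := by
  rw [IsRoot, eval_charpoly, ← exists_mulVec_eq_zero_iff]
  simp only [sub_mulVec, sub_eq_zero]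
  refine exists_congr fun g => and_congr_right fun _ => ?_
  rw [show scalar n μ *ᵥ g = μ • g by ext i; simp [scalar_apply, mulVec_diagonal], eq_comm]

theorem eval_charpoly_map {n : Type*} [Fintype n] [DecidableEq n] {R S : Type*} [CommRing R]
    [CommRing S] (f : R →+* S) (H : Matrix n n R) (r : R) :
    f (H.charpoly.eval r) = (H.map f).charpoly.eval (f r) := by
  rw [charpoly_map, eval_map, eval₂_at_apply]

theorem eq_of_separable_of_roots {p r : ℂ[X]} (hp : p.Monic) (hr : r.Monic)
    (hd : p.natDegree = r.natDegree) (hs : p.Separable) (h : ∀ z, p.IsRoot z → r.IsRoot z) :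
    p = r := by
  refine (eq_of_monic_of_dvd_of_natDegree_le hp hr ?_ hd.ge).symm
  rw [(IsAlgClosed.splits p).dvd_iff_roots_le_roots hp.ne_zero hr.ne_zero]
  rw [Multiset.le_iff_subset (nodup_roots hs)]
  intro z hz
  rw [mem_roots hr.ne_zero]
  exact h z (isRoot_of_mem_roots hz)

/-- Each eigenvector of `redHam` embeds into the chain, and Baxter's vectors turn it into a root of
the other polynomial. Simple roots and equal degrees give equality. -/
theorem charpoly_redHam_of_generic (hχ : Function.Injective χ) (s : Site M) (c : Fin 4 → ℂ)
    (hs : (redHam χ s c).charpoly.Separable) (hspan : (spanMat χ c).det ≠ 0)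
    (hy : ∀ j, c j ^ (2 * M + 1) ≠ -1) :
    (redHam χ s c).charpoly = (tqHam χ s c).charpoly := by
  refine eq_of_separable_of_roots (charpoly_monic _) (charpoly_monic _)
    (by rw [charpoly_natDegree_eq_dim, charpoly_natDegree_eq_dim]) hs fun μ hμ => ?_
  obtain ⟨g, hg0, hg⟩ := (isRoot_charpoly_iff _ _).mp hμ
  rw [IsRoot, eval_charpoly_tqHam]
  refine det_tqMat_of_eigenvector_four hχ c 1 one_ne_zero (by simpa using hy) (by simpa using hspan)
    s _ _ (embed4_ne_zero χ s hg0) fun x => embed4_vecMul_transfer χ s c hg x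

theorem aeval_comp_X {σ : Type*} (c : σ → ℂ) :
    (MvPolynomial.aeval c : MvPolynomial σ ℂ →ₐ[ℂ] ℂ) ∘ MvPolynomial.X = c := by
  ext j; simp

/-- Both sides are polynomials in the parameters and agree wherever `G` does not vanish; in a
domain, `P * G = 0` with `G ≠ 0` forces `P = 0`. -/
theorem eval_charpoly_redHam (hχ : Function.Injective χ) (s : Site M) (c : Fin 4 → ℂ) (μ : ℂ) :
    (redHam χ s c).charpoly.eval μ = (tqMat χ s c (χ (-1) * μ) 1).det := by
  set X' : Fin 4 → MvPolynomial (Fin 4) ℂ := MvPolynomial.X with hX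
  set G : MvPolynomial (Fin 4) ℂ := charDisc (redHam χ s X') * (spanMat χ X').det *
    ∏ j, (X' j ^ (2 * M + 1) + 1) with hG
  set P : MvPolynomial (Fin 4) ℂ := (redHam χ s X').charpoly.eval (MvPolynomial.C μ) -
    (tqMat χ s X' (MvPolynomial.C (χ (-1) * μ)) 1).det with hP
  have hev1 : ∀ c : Fin 4 → ℂ, MvPolynomial.aeval c (charDisc (redHam χ s X')) =
      charDisc (redHam χ s c) := fun c => by
    have h := map_charDisc ((MvPolynomial.aeval c : MvPolynomial (Fin 4) ℂ →ₐ[ℂ] ℂ) :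
      MvPolynomial (Fin 4) ℂ →+* ℂ)
      (redHam χ s X')
    have h2 := map_redHam χ s (MvPolynomial.aeval c : MvPolynomial (Fin 4) ℂ →ₐ[ℂ] ℂ) X'
    rw [hX, aeval_comp_X] at h2
    exact h.trans (congrArg charDisc h2)
  have hev2 : ∀ c : Fin 4 → ℂ, MvPolynomial.aeval c (spanMat χ X').det =
      (spanMat χ c).det := fun c => by
    rw [map_det_spanMat, hX, aeval_comp_X]
  have hev3 : ∀ c : Fin 4 → ℂ, MvPolynomial.aeval c (∏ j, (X' j ^ (2 * M + 1) + 1)) =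
      ∏ j, (c j ^ (2 * M + 1) + 1) := fun c => by
    simp [hX, map_prod]
  have hevP : ∀ c : Fin 4 → ℂ, MvPolynomial.aeval c P =
      (redHam χ s c).charpoly.eval μ - (tqMat χ s c (χ (-1) * μ) 1).det := fun c => by
    have h := eval_charpoly_map ((MvPolynomial.aeval c : MvPolynomial (Fin 4) ℂ →ₐ[ℂ] ℂ) :
      MvPolynomial (Fin 4) ℂ →+* ℂ)
      (redHam χ s X') (MvPolynomial.C μ)
    have h2 := map_redHam χ s (MvPolynomial.aeval c : MvPolynomial (Fin 4) ℂ →ₐ[ℂ] ℂ) X'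
    rw [hX, aeval_comp_X] at h2
    rw [hP, map_sub, map_det_tqMat, hX, aeval_comp_X]
    congr 1
    · refine h.trans ?_
      rw [show (redHam χ s X').map ((MvPolynomial.aeval c : MvPolynomial (Fin 4) ℂ →ₐ[ℂ] ℂ) :
        MvPolynomial (Fin 4) ℂ →+* ℂ) = redHam χ s c from h2]
      simp
    · simp
  -- Each factor is non-zero at a point of its own: `(1, 1, -1, 0)`, the constant `-q`, and the
  -- origin.
  have hG0 : G ≠ 0 := by
    refine mul_ne_zero (mul_ne_zero (fun h => ?_) fun h => ?_)
      (Finset.prod_ne_zero_iff.mpr fun j _ h => ?_)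
    · have h1 := hev1 ![1, 1, -1, 0]
      rw [h, map_zero] at h1
      exact (charDisc_ne_zero_iff _).mpr (separable_charpoly_redHam hχ s) h1.symm
    · have h1 := hev2 fun _ => -χ 1
      rw [h, map_zero] at h1
      exact det_spanMat_ne_zero hχ h1.symm
    · have h1 := congrArg (MvPolynomial.aeval fun _ => (0 : ℂ)) h
      simp [hX] at h1
  have hPG : P * G = 0 := by
    refine MvPolynomial.funext fun c => ?_
    have haev : ∀ F : MvPolynomial (Fin 4) ℂ, MvPolynomial.eval c F = MvPolynomial.aeval c F :=
      fun F => by rw [MvPolynomial.aeval_eq_eval]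
    rw [haev, haev, map_mul, map_zero, hG, map_mul, map_mul, hev1, hev2, hev3]
    by_cases h1 : charDisc (redHam χ s c) = 0
    · rw [h1]; ring
    by_cases h2 : (spanMat χ c).det = 0
    · rw [h2]; ring
    by_cases h3 : ∏ j, (c j ^ (2 * M + 1) + 1) = 0
    · rw [h3]; ring
    rw [hevP, charpoly_redHam_of_generic hχ s c ((charDisc_ne_zero_iff _).mp h1) h2 fun j hj => h3
      (Finset.prod_eq_zero (Finset.mem_univ j) (by rw [hj]; ring)), eval_charpoly_tqHam, sub_self,
      zero_mul]
  have h := hevP c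
  rw [(mul_eq_zero.mp hPG).resolve_right hG0, map_zero] at h
  exact (sub_eq_zero.mp h.symm)

end Charpoly

end BaxterTQ

namespace BaxterTQ

/-! ### Polynomial solutions of the T-Q equation. -/

section Solutions

variable {M : ℕ} (χ : AddChar (Site M) ℂ) (s : Site M)

/-- `Λ Q - u P(x) Q(q x) - u⁻¹ P(-q⁻¹ x) Q(q⁻¹ x)`, with `u = χ s`. -/
noncomputable def tqDefect (c : Fin 4 → ℂ) (lam : ℂ) (Q : ℂ[X]) : ℂ[X] :=
  tqL χ s (fun j => C (c j)) (C lam) X * Q -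
    C (χ s) * tqP (fun j => C (c j)) X * Q.comp (C (χ 1) * X) -
    C (χ (-s)) * (tqP (fun j => C (c j)) X).comp (C (-χ (-1)) * X) * Q.comp (C (χ (-1)) * X)

theorem eval_tqP (c : Fin 4 → ℂ) (x : ℂ) : (tqP (fun j => C (c j)) X).eval x = tqP c x := by
  simp [tqP, eval_prod]

theorem eval_tqL (c : Fin 4 → ℂ) (lam x : ℂ) :
    (tqL χ s (fun j => C (c j)) (C lam) X).eval x = tqL χ s c lam x := by
  simp [tqL, eval_prod]

theorem eval_tqDefect (c : Fin 4 → ℂ) (lam x : ℂ) (Q : ℂ[X]) :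
    (tqDefect χ s c lam Q).eval x = tqL χ s c lam x * Q.eval x -
      χ s * tqP c x * Q.eval (x * χ 1) -
      χ (-s) * tqP c (-(x * χ (-1))) * Q.eval (x * χ (-1)) := by
  rw [tqDefect]
  simp only [eval_sub, eval_mul, eval_C, eval_comp, eval_X, eval_tqP, eval_tqL]
  rw [mul_comm (χ 1) x, mul_comm (χ (-1)) x, neg_mul, mul_comm (χ (-1)) x]

/-- `Q` solves the T-Q equation. -/
def IsTQ (c : Fin 4 → ℂ) (lam : ℂ) (Q : ℂ[X]) : Prop := tqDefect χ s c lam Q = 0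

variable {χ s} {c : Fin 4 → ℂ} {lam : ℂ}

theorem isTQ_iff {Q : ℂ[X]} : IsTQ χ s c lam Q ↔ ∀ x, tqL χ s c lam x * Q.eval x =
    χ s * tqP c x * Q.eval (x * χ 1) + χ (-s) * tqP c (-(x * χ (-1))) * Q.eval (x * χ (-1)) := by
  rw [IsTQ]
  constructor
  · intro h x
    have := eval_tqDefect χ s c lam x Q
    rw [h, eval_zero] at this
    linear_combination -this
  · intro h
    refine Polynomial.funext fun x => ?_
    rw [eval_tqDefect, h x, eval_zero]
    ring

theorem IsTQ.sub_C_mul {Q R : ℂ[X]} (hQ : IsTQ χ s c lam Q) (hR : IsTQ χ s c lam R) (a : ℂ) :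
    IsTQ χ s c lam (Q - C a * R) := by
  rw [isTQ_iff] at *
  intro x
  simp only [eval_sub, eval_mul, eval_C]
  linear_combination hQ x - a * hR x

theorem IsTQ.C_mul {Q : ℂ[X]} (hQ : IsTQ χ s c lam Q) (a : ℂ) :
    IsTQ χ s c lam (C a * Q) := by
  rw [isTQ_iff] at *
  intro x
  simp only [eval_mul, eval_C]
  linear_combination a * hQ x

theorem isTQ_mul_iff {g R : ℂ[X]} (hg : g ≠ 0) (h : ∀ x k, g.eval (x * χ k) = g.eval x) :
    IsTQ χ s c lam (g * R) ↔ IsTQ χ s c lam R := by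
  have : tqDefect χ s c lam (g * R) = g * tqDefect χ s c lam R := Polynomial.funext fun x => by
    rw [eval_mul, eval_tqDefect, eval_tqDefect]
    simp only [eval_mul, h]
    ring
  rw [IsTQ, this, mul_eq_zero, or_iff_right hg, IsTQ]

/-- A factor `x^a` only changes `u` to `u q^a`. The hypothesis says that `Λ` is not affected. -/
theorem isTQ_X_pow_mul_iff {a : ℕ} {R : ℂ[X]}
    (h : χ (s + a) + χ (-(s + a)) = χ s + χ (-s)) :
    IsTQ χ s c lam (X ^ a * R) ↔ IsTQ χ (s + a) c lam R := by
  have hL : ∀ x, tqL χ (s + a) c lam x = tqL χ s c lam x := fun x => by simp only [tqL, h]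
  have : tqDefect χ s c lam (X ^ a * R) = X ^ a * tqDefect χ (s + a) c lam R :=
    Polynomial.funext fun x => by
      rw [eval_mul, eval_tqDefect, eval_tqDefect, hL]
      simp only [eval_mul, eval_pow, eval_X, mul_pow]
      have h1 : χ 1 ^ a = χ a := by rw [chi_natCast]
      have h2 : χ (-1) ^ a = χ (-a) := by
        rw [← AddChar.map_nsmul_eq_pow]; congr 1; simp
      rw [h1, h2, neg_add, AddChar.map_add_eq_mul, AddChar.map_add_eq_mul]
      ring
  rw [IsTQ, this, mul_eq_zero, or_iff_right (pow_ne_zero _ X_ne_zero), IsTQ]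

theorem isTQ_X_pow_card_mul_iff {R : ℂ[X]} :
    IsTQ χ s c lam (X ^ (2 * M + 1) * R) ↔ IsTQ χ s c lam R :=
  isTQ_mul_iff (pow_ne_zero _ X_ne_zero) fun x k => by simp [mul_pow, chi_pow_card]

theorem add_inv_eq_iff (hχ : Function.Injective χ) {a b : Site M} :
    χ a + χ (-a) = χ b + χ (-b) ↔ a = b ∨ a = -b := by
  constructor
  · intro h
    have ha : χ a * χ (-a) = 1 := by
      rw [← AddChar.map_add_eq_mul, add_neg_cancel, AddChar.map_zero_eq_one]
    have hb : χ b * χ (-b) = 1 := by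
      rw [← AddChar.map_add_eq_mul, add_neg_cancel, AddChar.map_zero_eq_one]
    have : (χ a - χ b) * (χ a - χ (-b)) = 0 := by
      linear_combination χ a * h - ha + hb
    rcases mul_eq_zero.mp this with h | h
    · exact Or.inl (hχ (sub_eq_zero.mp h))
    · exact Or.inr (hχ (sub_eq_zero.mp h))
  · rintro (rfl | rfl)
    · rfl
    · rw [neg_neg, add_comm]

section Coefficients

variable (χ s) {R S : Type*} [CommRing R] [Algebra ℂ R] [CommRing S] [Algebra ℂ S]

/-- The coefficients of the recursion for the coefficients of `Q`. -/
noncomputable def tqCoeff (c : Fin 4 → R) (lam : R) (t j : ℕ) : R :=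
  (tqP (fun j => C (c j)) (X : R[X])).coeff t *
    algebraMap ℂ R (χ (s + j) + (-1) ^ t * χ (-(s + j + t))) -
    (tqL χ s (fun j => C (c j)) (C lam) (X : R[X])).coeff t

theorem map_tqCoeff (f : R →ₐ[ℂ] S) (c : Fin 4 → R) (lam : R) (t j : ℕ) :
    f (tqCoeff χ s c lam t j) = tqCoeff χ s (f ∘ c) (f lam) t j := by
  have h1 : (tqP (fun j => C (f (c j))) (X : S[X])) =
      (tqP (fun j => C (c j)) (X : R[X])).map (f : R →+* S) := by
    simp [tqP, Polynomial.map_prod]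
  have h2 : tqL χ s (fun j => C (f (c j))) (C (f lam)) (X : S[X]) =
      (tqL χ s (fun j => C (c j)) (C lam) (X : R[X])).map (f : R →+* S) := by
    simp [tqL, Polynomial.map_prod, Polynomial.algebraMap_apply]
  simp only [tqCoeff, Function.comp_apply, map_sub, map_mul, AlgHom.commutes, h1, h2, coeff_map,
    RingHom.coe_coe]

theorem tqP_coeff_zero {R : Type*} [CommRing R] (c : Fin 4 → R) : (tqP (fun j => C (c j)) (X : R[X])).coeff 0 = 1 := by
  simp [tqP, coeff_zero_prod]

theorem tqL_coeff_zero (c : Fin 4 → R) (lam : R) :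
    (tqL χ s (fun j => C (c j)) (C lam) (X : R[X])).coeff 0 = algebraMap ℂ R (χ s + χ (-s)) := by
  simp [tqL, Polynomial.algebraMap_apply, coeff_zero_eq_eval_zero]

theorem tqCoeff_zero (c : Fin 4 → R) (lam : R) (j : ℕ) : tqCoeff χ s c lam 0 j =
    algebraMap ℂ R (χ (s + j) + χ (-(s + j)) - (χ s + χ (-s))) := by
  rw [tqCoeff, tqP_coeff_zero, tqL_coeff_zero]
  simp

end Coefficients

theorem coeff_tqDefect (Q : ℂ[X]) (n : ℕ) : (tqDefect χ s c lam Q).coeff n =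
    -∑ p ∈ Finset.HasAntidiagonal.antidiagonal n, tqCoeff χ s c lam p.1 p.2 * Q.coeff p.2 := by
  rw [tqDefect, coeff_sub, coeff_sub, mul_assoc, mul_assoc, coeff_C_mul, coeff_C_mul, coeff_mul,
    coeff_mul, coeff_mul, Finset.mul_sum, Finset.mul_sum, ← Finset.sum_sub_distrib,
    ← Finset.sum_sub_distrib, ← Finset.sum_neg_distrib]
  refine Finset.sum_congr rfl fun p _ => ?_
  rw [comp_C_mul_X_coeff, comp_C_mul_X_coeff, comp_C_mul_X_coeff, tqCoeff, neg_pow]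
  have h1 : χ (s + p.2) = χ s * χ 1 ^ p.2 := by rw [AddChar.map_add_eq_mul, chi_natCast]
  have h2 : χ (-(s + p.2 + p.1)) = χ (-s) * χ (-1) ^ p.2 * χ (-1) ^ p.1 := by
    rw [← AddChar.map_nsmul_eq_pow, ← AddChar.map_nsmul_eq_pow, ← AddChar.map_add_eq_mul,
      ← AddChar.map_add_eq_mul]
    congr 1
    simp only [nsmul_eq_mul]
    ring
  rw [h1, h2]
  simp only [Algebra.algebraMap_self, RingHom.id_apply]
  ring

theorem IsTQ.sum_tqCoeff {Q : ℂ[X]} (hQ : IsTQ χ s c lam Q) (n : ℕ) :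
    ∑ p ∈ Finset.HasAntidiagonal.antidiagonal n, tqCoeff χ s c lam p.1 p.2 * Q.coeff p.2 = 0 := by
  have := coeff_tqDefect (χ := χ) (s := s) (c := c) (lam := lam) Q n
  rw [hQ, coeff_zero] at this
  linear_combination this

/-- The lowest coefficient gives `u q^a + (u q^a)⁻¹ = u + u⁻¹`, so `a = 0` or `a = -2s` modulo `N`.
In the second case `Q / x^a` solves the equation with `u⁻¹` and has a non-zero constant term, which
`hO` excludes unless `s = 0`. -/
theorem IsTQ.dvd_natTrailingDegree (hχ : Function.Injective χ)
    (hO : s = 0 ∨ ∀ R, IsTQ χ (-s) c lam R → R.coeff 0 = 0) {Q : ℂ[X]}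
    (hQ : IsTQ χ s c lam Q) (hQ0 : Q ≠ 0) : 2 * M + 1 ∣ Q.natTrailingDegree := by
  set a := Q.natTrailingDegree with ha
  have hQa : Q.coeff a ≠ 0 := trailingCoeff_nonzero_iff_nonzero.mpr hQ0
  have h := hQ.sum_tqCoeff a
  rw [Finset.sum_eq_single (0, a)] at h
  · have h0 := (mul_eq_zero.mp h).resolve_right hQa
    simp only [tqCoeff_zero, Algebra.algebraMap_self, RingHom.id_apply, sub_eq_zero] at h0
    rw [← ZMod.natCast_eq_zero_iff]
    rcases (add_inv_eq_iff hχ).mp h0 with h1 | h1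
    · linear_combination h1
    · rcases hO with hs | hO
      · rw [hs] at h1
        linear_combination h1
      · exfalso
        obtain ⟨R, hR⟩ : X ^ a ∣ Q := X_pow_dvd_iff.mpr fun d hd =>
          coeff_eq_zero_of_lt_natTrailingDegree hd
        rw [hR, isTQ_X_pow_mul_iff h0, h1] at hQ
        have h2 := hO R hQ
        apply hQa
        rw [hR, coeff_X_pow_mul', if_pos le_rfl, Nat.sub_self, h2]
  · rintro ⟨t, j⟩ hp hne
    rw [Finset.HasAntidiagonal.mem_antidiagonal] at hp
    simp only at hp
    rw [coeff_eq_zero_of_lt_natTrailingDegree, mul_zero]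
    rw [← ha]
    simp only
    by_contra hj
    exact hne (Prod.ext (by simp only; omega) (by simp only; omega))
  · simp

/-- The determinant vanishes identically in `x`, so there is a polynomial kernel vector `v`. It need
not come from one polynomial evaluated along the orbit; averaging it over the orbit, against a
suitable power of the variable, produces such a polynomial. -/
theorem exists_isTQ_ne_zero (hχ : Function.Injective χ) (h : (tqMat χ s c lam 1).det = 0) :
    ∃ Q, Q ≠ 0 ∧ IsTQ χ s c lam Q := by
  have hdet : (tqMat χ s (fun j => C (c j)) (C lam) X).det = 0 := by
    change tqDetPoly χ s c lam = 0
    refine Polynomial.funext fun x => ?_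
    rw [eval_tqDetPoly, det_tqMat s c lam hχ, h, zero_mul, eval_zero]
  obtain ⟨v, hv0, hv⟩ := exists_mulVec_eq_zero_iff.mpr hdet
  have hrow : ∀ (k : Site M) (x : ℂ), tqL χ s c lam (x * χ k) * (v k).eval x =
      χ s * tqP c (x * χ k) * (v (k + 1)).eval x +
      χ (-s) * tqP c (-(x * χ (k - 1))) * (v (k - 1)).eval x := fun k x => by
    have h1 := congrArg (eval x) (congrFun hv k)
    rw [tqMat, cyc_mulVec] at h1
    have h2 : ∀ y : ℂ[X], (tqP (fun j => C (c j)) y).eval x = tqP c (y.eval x) := fun y => by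
      simp [tqP, eval_prod]
    have h3 : ∀ y : ℂ[X], (tqL χ s (fun j => C (c j)) (C lam) y).eval x =
        tqL χ s c lam (y.eval x) := fun y => by
      simp [tqL, eval_prod]
    simp only [eval_sub, eval_mul, h2, h3, algebraMap_eq, eval_C, eval_X, eval_neg,
      Pi.zero_apply, eval_zero] at h1
    linear_combination h1
  -- Fourier components of the functions `v k (x q^{-k})` in `k`; the factor `x^i` restores
  -- equivariance.
  let w : Site M → ℂ[X] := fun i => ∑ k, C (χ (-(i * k))) * (v k).comp (C (χ (-k)) * X)
  have hw : ∀ (i : Site M) (x : ℂ),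
      (w i).eval x = ∑ k, χ (-(i * k)) * (v k).eval (x * χ (-k)) := fun i x => by
    simp only [w, eval_finsetSum, eval_mul, eval_C, eval_comp, eval_X]
    exact Finset.sum_congr rfl fun k _ => by rw [mul_comm (χ (-k)) x]
  -- By Fourier inversion, `v` would vanish if all components did.
  obtain ⟨i, hi⟩ : ∃ i, w i ≠ 0 := by
    by_contra! h0
    apply hv0
    ext1 l
    refine Polynomial.funext fun x => ?_
    have h1 : ∑ i : Site M, χ (i * l) * (w i).eval (x * χ l) = 0 := by simp [h0]
    simp_rw [hw, Finset.mul_sum] at h1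
    rw [Finset.sum_comm, Finset.sum_eq_single l] at h1
    · simp only [← mul_assoc, ← AddChar.map_add_eq_mul, add_neg_cancel, AddChar.map_zero_eq_one,
        one_mul, Finset.sum_const, Finset.card_univ, ZMod.card] at h1
      rw [mul_assoc, ← AddChar.map_add_eq_mul, add_neg_cancel, AddChar.map_zero_eq_one,
        mul_one, nsmul_eq_mul] at h1
      simpa using (mul_eq_zero.mp h1).resolve_left (by norm_cast)
    · intro k _ hk
      have h2 : ∀ i : Site M, χ (i * l) * (χ (-(i * k)) * (v k).eval (x * χ l * χ (-k))) =
          χ (i * (l - k)) * (v k).eval (x * χ l * χ (-k)) := fun i => by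
        rw [← mul_assoc, ← AddChar.map_add_eq_mul]; congr 2; ring
      simp_rw [h2]
      rw [← Finset.sum_mul]
      refine mul_eq_zero_of_left ?_ _
      have h3 : χ (l - k) ≠ 1 := by
        rw [← AddChar.map_zero_eq_one χ]
        exact fun h => hk (sub_eq_zero.mp (hχ h)).symm
      have h4 : χ (l - k) * ∑ i : Site M, χ (i * (l - k)) = ∑ i : Site M, χ (i * (l - k)) := by
        rw [Finset.mul_sum]
        conv_rhs => rw [← Equiv.sum_comp (Equiv.addRight (1 : Site M))]
        refine Finset.sum_congr rfl fun i _ => ?_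
        rw [← AddChar.map_add_eq_mul, Equiv.coe_addRight]; congr 1; ring
      have h5 : (χ (l - k) - 1) * ∑ i : Site M, χ (i * (l - k)) = 0 := by
        linear_combination h4
      exact (mul_eq_zero.mp h5).resolve_left (sub_ne_zero.mpr h3)
    · simp
  refine ⟨X ^ i.val * w i, mul_ne_zero (pow_ne_zero _ X_ne_zero) hi, ?_⟩
  have hW : ∀ x, (X ^ i.val * w i).eval x =
      ∑ k, (x * χ (-k)) ^ i.val * (v k).eval (x * χ (-k)) := fun x => by
    rw [eval_mul, hw, eval_pow, eval_X, Finset.mul_sum]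
    refine Finset.sum_congr rfl fun k _ => ?_
    rw [mul_pow, ← chi_mul_natCast, ZMod.natCast_zmod_val, neg_mul, mul_comm k i]
    ring
  rw [isTQ_iff]
  intro x
  have h1 : (X ^ i.val * w i).eval (x * χ 1) =
      ∑ k, (x * χ (-k)) ^ i.val * (v (k + 1)).eval (x * χ (-k)) := by
    rw [hW, ← Equiv.sum_comp (Equiv.addRight (1 : Site M))]
    refine Finset.sum_congr rfl fun k _ => ?_
    rw [Equiv.coe_addRight, mul_assoc, ← AddChar.map_add_eq_mul, show 1 + -(k + 1) = -k by ring]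
  have h2 : (X ^ i.val * w i).eval (x * χ (-1)) =
      ∑ k, (x * χ (-k)) ^ i.val * (v (k - 1)).eval (x * χ (-k)) := by
    rw [hW, ← Equiv.sum_comp (Equiv.subRight (1 : Site M))]
    refine Finset.sum_congr rfl fun k _ => ?_
    rw [Equiv.subRight_apply, mul_assoc, ← AddChar.map_add_eq_mul,
      show -1 + -(k - 1) = -k by ring]
  rw [hW, h1, h2, Finset.mul_sum, Finset.mul_sum, Finset.mul_sum, ← Finset.sum_add_distrib]
  refine Finset.sum_congr rfl fun k _ => ?_
  have h3 := hrow k (x * χ (-k))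
  rw [mul_assoc x, mul_assoc x, ← AddChar.map_add_eq_mul, ← AddChar.map_add_eq_mul,
    neg_add_cancel, AddChar.map_zero_eq_one, mul_one, show -k + (k - 1) = -1 by ring] at h3
  linear_combination (x * χ (-k)) ^ i.val * h3

end Solutions

end BaxterTQ

namespace BaxterTQ

section Degree

theorem natDegree_det_le_sum {n : Type*} [Fintype n] [DecidableEq n] {R : Type*} [CommRing R]
    (A : Matrix n n R[X]) (d : n → ℕ) (h : ∀ i j, (A i j).natDegree ≤ d i) :
    A.det.natDegree ≤ ∑ i, d i := by
  rw [det_apply']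
  refine natDegree_sum_le_of_forall_le _ _ fun σ _ => ?_
  refine (natDegree_mul_le).trans ?_
  rw [natDegree_intCast, zero_add]
  refine (natDegree_prod_le _ _).trans ((Finset.sum_le_sum fun i _ => h _ _).trans ?_)
  rw [Equiv.sum_comp σ d]

theorem exists_eq_C_mul_X_pow {W : ℂ[X]} (hW : W ≠ 0) (h : ∀ x, x ≠ 0 → W.eval x ≠ 0) :
    ∃ r e, r ≠ 0 ∧ W = C r * X ^ e := by
  obtain ⟨R, hR⟩ : X ^ W.natTrailingDegree ∣ W := X_pow_dvd_iff.mpr fun d hd =>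
    coeff_eq_zero_of_lt_natTrailingDegree hd
  have hR0 : R.coeff 0 ≠ 0 := by
    have h1 : W.coeff W.natTrailingDegree ≠ 0 := trailingCoeff_nonzero_iff_nonzero.mpr hW
    rw [hR, coeff_X_pow_mul', ← hR, if_pos le_rfl, Nat.sub_self] at h1
    exact h1
  have hd : R.degree = 0 := by
    by_contra hd
    obtain ⟨x, hx⟩ := IsAlgClosed.exists_root R hd
    have hx0 : x ≠ 0 := by
      rintro rfl
      exact hR0 (by rw [coeff_zero_eq_eval_zero]; exact hx)
    refine h x hx0 ?_
    rw [hR, eval_mul, hx.eq_zero, mul_zero]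
  refine ⟨R.coeff 0, W.natTrailingDegree, hR0, ?_⟩
  conv_lhs => rw [hR, eq_C_of_degree_eq_zero hd]
  rw [mul_comm]

end Degree

/-! ### Minimal solutions and the rank-one adjugate. -/

section Structure

variable {M : ℕ} {χ : AddChar (Site M) ℂ} {s : Site M} {c : Fin 4 → ℂ} {lam : ℂ}

theorem exists_minimal_isTQ (hχ : Function.Injective χ) (h : (tqMat χ s c lam 1).det = 0) :
    ∃ Q, Q ≠ 0 ∧ IsTQ χ s c lam Q ∧ ∀ R, R ≠ 0 → IsTQ χ s c lam R → Q.natDegree ≤ R.natDegree := by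
  classical
  obtain ⟨Q₀, hQ₀, hQ₀'⟩ := exists_isTQ_ne_zero hχ h
  have hex : ∃ n, ∃ Q, Q ≠ 0 ∧ IsTQ χ s c lam Q ∧ Q.natDegree = n := ⟨_, Q₀, hQ₀, hQ₀', rfl⟩
  obtain ⟨Q, h0, h1, h2⟩ := Nat.find_spec hex
  exact ⟨Q, h0, h1, fun R hR hR' => h2 ▸ Nat.find_min' hex ⟨R, hR, hR', rfl⟩⟩

theorem exists_eq_X_pow_mul (hχ : Function.Injective χ)
    (hO : s = 0 ∨ ∀ R, IsTQ χ (-s) c lam R → R.coeff 0 = 0) {Q : ℂ[X]}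
    (hQ : IsTQ χ s c lam Q) (hQ0 : Q ≠ 0) (h0 : Q.coeff 0 = 0) :
    ∃ R, R ≠ 0 ∧ IsTQ χ s c lam R ∧ Q.natDegree = R.natDegree + (2 * M + 1) := by
  obtain ⟨k, hk⟩ := hQ.dvd_natTrailingDegree hχ hO hQ0
  have hk0 : k ≠ 0 := by
    rintro rfl
    rw [mul_zero, natTrailingDegree_eq_zero] at hk
    exact hk.elim hQ0 fun h => h h0
  obtain ⟨R, hR⟩ : X ^ (2 * M + 1) ∣ Q := X_pow_dvd_iff.mpr fun d hd =>
    coeff_eq_zero_of_lt_natTrailingDegree (by rw [hk]; exact hd.trans_le (Nat.le_mul_of_pos_right _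
      (Nat.pos_of_ne_zero hk0)))
  have hR0 : R ≠ 0 := by rintro rfl; exact hQ0 (by rw [hR, mul_zero])
  refine ⟨R, hR0, ?_, ?_⟩
  · rw [hR, isTQ_X_pow_card_mul_iff] at hQ
    exact hQ
  · rw [hR, mul_comm, natDegree_mul_X_pow _ hR0]

/-- A solution vanishing on a whole orbit is divisible by the polynomial with these `N` roots. That
polynomial is invariant under `x ↦ q x`, so the quotient is a solution of smaller degree. -/
theorem exists_eval_orbit_ne_zero (hχ : Function.Injective χ) {Q : ℂ[X]} (hQ0 : Q ≠ 0)
    (hQ : IsTQ χ s c lam Q)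
    (hmin : ∀ R, R ≠ 0 → IsTQ χ s c lam R → Q.natDegree ≤ R.natDegree) {x : ℂ} (hx : x ≠ 0) :
    ∃ k, Q.eval (x * χ k) ≠ 0 := by
  by_contra! h
  set g : ℂ[X] := ∏ k : Site M, (X - C (x * χ k)) with hg
  have hgm : g.Monic := monic_prod_of_monic _ _ fun k _ => monic_X_sub_C _
  obtain ⟨R, hR⟩ : g ∣ Q := by
    refine Finset.prod_dvd_of_coprime (fun a _ b _ hab => ?_) fun k _ => dvd_iff_isRoot.mpr (h k)
    refine pairwise_coprime_X_sub_C (s := fun k : Site M => x * χ k) ?_ hab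
    exact fun a b hab => hχ (mul_left_cancel₀ hx hab)
  have hR0 : R ≠ 0 := by rintro rfl; exact hQ0 (by rw [hR, mul_zero])
  have hinv : ∀ y k, g.eval (y * χ k) = g.eval y := fun y k => by
    simp only [hg, eval_prod, eval_sub, eval_X, eval_C]
    rw [← Equiv.prod_comp (Equiv.addRight k)]
    have h1 : ∀ j : Site M, y * χ k - x * χ ((Equiv.addRight k) j) = χ k * (y - x * χ j) :=
      fun j => by rw [Equiv.coe_addRight, AddChar.map_add_eq_mul]; ring
    simp_rw [h1]
    rw [Finset.prod_mul_distrib, Finset.prod_const, Finset.card_univ, ZMod.card, chi_pow_card,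
      one_mul]
  rw [hR, isTQ_mul_iff hgm.ne_zero hinv] at hQ
  have h1 := hmin R hR0 hQ
  have h2 : g.natDegree = 2 * M + 1 := by
    rw [hg, natDegree_prod_of_monic _ _ fun k _ => monic_X_sub_C _]
    simp only [natDegree_X_sub_C, Finset.sum_const, Finset.card_univ, ZMod.card, smul_eq_mul,
      mul_one]
  rw [hR, hgm.natDegree_mul' hR0, h2] at h1
  omega

theorem IsTQ.mulVec_eq_zero {Q : ℂ[X]} (hQ : IsTQ χ s c lam Q) (x : ℂ) :
    tqMat χ s c lam x *ᵥ (fun k => Q.eval (x * χ k)) = 0 := by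
  ext k
  have h := isTQ_iff.mp hQ (x * χ k)
  rw [mul_assoc x, mul_assoc x, ← AddChar.map_add_eq_mul, ← AddChar.map_add_eq_mul,
    ← sub_eq_add_neg] at h
  rw [tqMat, cyc_mulVec, Pi.zero_apply]
  simp only [Algebra.algebraMap_self, RingHom.id_apply]
  linear_combination h

/-- The symmetry behind `det_tqMat_neg`: `Q(-x)` gives a left kernel vector, and the weight `x^{2m}`
produces the gauge factors `u²`. -/
theorem IsTQ.vecMul_eq_zero {m : ℕ} (hs : s = m) {Q : ℂ[X]} (hQ : IsTQ χ s c lam Q) (x : ℂ) :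
    (fun k => (x * χ k) ^ (2 * m) * Q.eval (-(x * χ k))) ᵥ* tqMat χ s c lam x = 0 := by
  ext k
  have h := isTQ_iff.mp hQ (-(x * χ k))
  rw [neg_mul, neg_mul, mul_assoc x, mul_assoc x, ← AddChar.map_add_eq_mul,
    ← AddChar.map_add_eq_mul, ← sub_eq_add_neg, neg_neg, tqL_neg] at h
  rw [tqMat, vecMul_cyc, Pi.zero_apply]
  simp only [Algebra.algebraMap_self, RingHom.id_apply]
  have h1 : (x * χ (k - 1)) ^ (2 * m) * χ s = (x * χ k) ^ (2 * m) * χ (-s) := by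
    rw [mul_pow, mul_pow, ← chi_mul_natCast, ← chi_mul_natCast, mul_assoc, mul_assoc,
      ← AddChar.map_add_eq_mul, ← AddChar.map_add_eq_mul, hs]
    congr 2; push_cast; ring
  have h2 : (x * χ (k + 1)) ^ (2 * m) * χ (-s) = (x * χ k) ^ (2 * m) * χ s := by
    rw [mul_pow, mul_pow, ← chi_mul_natCast, ← chi_mul_natCast, mul_assoc, mul_assoc,
      ← AddChar.map_add_eq_mul, ← AddChar.map_add_eq_mul, hs]
    congr 2; push_cast; ring
  rw [add_sub_cancel_right]
  linear_combination (x * χ k) ^ (2 * m) * h -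
    Q.eval (-(x * χ (k - 1))) * tqP c (x * χ (k - 1)) * h1 -
    Q.eval (-(x * χ (k + 1))) * tqP c (-(x * χ k)) * h2

variable (χ s c lam) in
theorem eval_adjugate (x : ℂ) (i j : Site M) :
    ((tqMat χ s (fun j => C (c j)) (C lam) X).adjugate i j).eval x =
      (tqMat χ s c lam x).adjugate i j := by
  have h := map_tqMat χ s (aeval x : ℂ[X] →ₐ[ℂ] ℂ) (fun j => C (c j)) (C lam) X
  have h2 := RingHom.map_adjugate (evalRingHom x) (tqMat χ s (fun j => C (c j)) (C lam) X)
  have h3 : (aeval x : ℂ[X] →ₐ[ℂ] ℂ) ∘ (fun j => C (c j)) = c := by ext j; simp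
  rw [h3, aeval_C, aeval_X] at h
  have h4 : (evalRingHom x).mapMatrix (tqMat χ s (fun j => C (c j)) (C lam) X) =
      tqMat χ s c lam x := by
    rw [← show _ = tqMat χ s c lam x from h]
    ext i j
    simp [coe_aeval_eq_eval]
  rw [h4] at h2
  exact congrFun (congrFun h2 i) j

theorem natDegree_adjugate_le {L : ℕ} (hL : L = 4 ∨ L = 3 ∧ c 3 = 0) (i j : Site M) :
    ((tqMat χ s (fun j => C (c j)) (C lam) X).adjugate i j).natDegree ≤ 2 * M * L := by
  rw [adjugate_apply]
  refine (natDegree_det_le_sum _ (fun k => if k = j then 0 else L) fun k l => ?_).trans ?_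
  · split_ifs with h
    · subst h
      rw [updateRow_self, Pi.single_apply]
      split_ifs <;> simp
    · rw [updateRow_ne h]
      exact natDegree_tqMat_le χ s lam hL k l
  · rw [Finset.sum_ite, Finset.sum_const_zero, zero_add, Finset.sum_const, smul_eq_mul,
      Finset.filter_ne', Finset.card_erase_of_mem (Finset.mem_univ _), Finset.card_univ, ZMod.card]
    simp

/-- At a simple root, `adj k l * W = f'(λ) x^{2N} Q(x q^k) (x q^l)^{2m} Q(-x q^l)`. A minimal `Q`
vanishes on no orbit, so `W` has no zero except `0` and is a monomial `r x^e`. Its symmetries give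
`2N ∣ e`, and lowest-order terms give `e ≤ 2N + 2m < 4N`; hence `e = 2N`. The degree of `W` then
bounds `deg Q` from below, and the degree of the adjugate from above. -/
theorem exists_isTQ_structure (hχ : Function.Injective χ) {L m : ℕ} (hm : m ≤ M) (hs : s = m)
    (hL : L = 4 ∨ L = 3 ∧ c 3 = 0) (f : ℂ[X]) (hf : ∀ z, (tqMat χ s c z 1).det = f.eval z)
    (hdet : f.eval lam = 0) (hsimple : (derivative f).eval lam ≠ 0)
    (hO : s = 0 ∨ ∀ R, IsTQ χ (-s) c lam R → R.coeff 0 = 0) :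
    ∃ Q, Q.coeff 0 ≠ 0 ∧ IsTQ χ s c lam Q ∧
      (∀ R, R ≠ 0 → IsTQ χ s c lam R → Q.natDegree ≤ R.natDegree) ∧
      2 * M ≤ Q.natDegree + m ∧ Q.natDegree + m ≤ L * M := by
  obtain ⟨Q, hQ0, hQ, hmin⟩ := exists_minimal_isTQ hχ ((hf lam).trans hdet)
  have hQc : Q.coeff 0 ≠ 0 := fun h0 => by
    obtain ⟨R, hR0, hR, hd⟩ := exists_eq_X_pow_mul hχ hO hQ hQ0 h0
    have := hmin R hR0 hR
    omega
  refine ⟨Q, hQc, hQ, hmin, ?_⟩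
  set D := (derivative f).eval lam with hD
  set Qn : ℂ[X] := Q.comp (C (-1) * X) with hQn
  have hQn0 : Qn ≠ 0 := by
    intro h
    have := congrArg (coeff · 0) h
    simp only [hQn, comp_C_mul_X_coeff, coeff_zero, pow_zero, mul_one] at this
    exact hQc this
  have hQnd : Qn.natDegree = Q.natDegree := by
    rw [hQn, natDegree_comp, natDegree_C_mul_X _ (by norm_num), mul_one]
  -- The pairing of the left and right kernel vectors with the weights `(x q^k)²` that multiply `λ`
  -- in `tqMat`.
  set W : ℂ[X] := ∑ k : Site M, (C (χ k) * X) ^ (2 * m + 2) *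
    (Q.comp (C (χ k) * X) * Q.comp (C (-χ k) * X)) with hW
  have hWe : ∀ x, W.eval x = ∑ k, (x * χ k) ^ (2 * m + 2) *
      (Q.eval (x * χ k) * Q.eval (-(x * χ k))) := fun x => by
    simp only [hW, eval_finsetSum, eval_mul, eval_pow, eval_C, eval_X, eval_comp,
      mul_comm _ x, mul_neg]
  have hadj : ∀ x, x ≠ 0 → ∀ k l, (tqMat χ s c lam x).adjugate k l * W.eval x =
      D * x ^ (2 * (2 * M + 1)) *
        (Q.eval (x * χ k) * ((x * χ l) ^ (2 * m) * Q.eval (-(x * χ l)))) := fun x hx k l => by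
    have hsum := sum_mul_adjugate_of_det_eq (tqMat χ s c 0 x) (fun k => (x * χ k) ^ 2)
      (C (x ^ (2 * (2 * M + 1))) * f) (fun z => by
        rw [← tqMat_eq_add, det_tqMat s c z hχ, hf, eval_mul, eval_C, mul_comm]) lam
    rw [← tqMat_eq_add, derivative_C_mul, eval_mul, eval_C, ← hD] at hsum
    obtain ⟨k₁, hk₁⟩ := exists_eval_orbit_ne_zero hχ hQ0 hQ hmin hx
    obtain ⟨k₂, hk₂⟩ := exists_eval_orbit_ne_zero hχ hQ0 hQ hmin (neg_ne_zero.mpr hx)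
    have h := adjugate_mul_sum_eq (hQ.mulVec_eq_zero x) (fun h => hk₁ (congrFun h k₁))
      (hQ.vecMul_eq_zero hs x) (fun h => by
        have := congrFun h k₂
        rw [← neg_mul] at this
        exact hk₂ ((mul_eq_zero.mp this).resolve_left
          (pow_ne_zero _ (mul_ne_zero hx (chi_ne_zero χ _))))) (fun k => (x * χ k) ^ 2) k l
    rw [hsum] at h
    have h2 : W.eval x = ∑ i : Site M, (x * χ i) ^ 2 *
        ((x * χ i) ^ (2 * m) * Q.eval (-(x * χ i)) * Q.eval (x * χ i)) := by
      rw [hWe]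
      exact Finset.sum_congr rfl fun i _ => by ring
    rw [h2, h]
    ring
  have hWne : ∀ x, x ≠ 0 → W.eval x ≠ 0 := fun x hx h0 => by
    obtain ⟨k₁, hk₁⟩ := exists_eval_orbit_ne_zero hχ hQ0 hQ hmin hx
    obtain ⟨k₂, hk₂⟩ := exists_eval_orbit_ne_zero hχ hQ0 hQ hmin (neg_ne_zero.mpr hx)
    have h := hadj x hx k₁ k₂
    rw [h0, mul_zero] at h
    rw [neg_mul] at hk₂
    exact mul_ne_zero (mul_ne_zero hsimple (pow_ne_zero _ hx)) (mul_ne_zero hk₁ (mul_ne_zero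
      (pow_ne_zero _ (mul_ne_zero hx (chi_ne_zero χ _))) hk₂)) h.symm
  have hW0 : W ≠ 0 := fun h => hWne 1 one_ne_zero (by rw [h, eval_zero])
  obtain ⟨r, e, hr, hWre⟩ := exists_eq_C_mul_X_pow hW0 hWne
  have hWr : ∀ x, W.eval x = r * x ^ e := fun x => by rw [hWre]; simp
  have he0 : e ≠ 0 := by
    rintro rfl
    have h1 := hWr 0
    rw [hWe] at h1
    simp at h1
    exact hr h1.symm
  have heN : 2 * M + 1 ∣ e := by
    have h1 : W.eval (1 * χ 1) = W.eval 1 := by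
      rw [hWe, hWe, ← Equiv.sum_comp (Equiv.addRight (1 : Site M)) fun k => (1 * χ k) ^ (2 * m + 2) *
        (Q.eval (1 * χ k) * Q.eval (-(1 * χ k)))]
      refine Finset.sum_congr rfl fun k _ => ?_
      rw [Equiv.coe_addRight, mul_assoc, ← AddChar.map_add_eq_mul, add_comm (1 : Site M) k]
    rw [hWr, hWr, one_pow, mul_one, one_mul] at h1
    exact (isPrimitiveRoot_chi hχ).dvd_of_pow_eq_one e
      (mul_left_cancel₀ hr (by rw [h1, mul_one]))
  have he2 : Even e := by
    have h1 : W.eval (-1) = W.eval 1 := by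
      rw [hWe, hWe]
      refine Finset.sum_congr rfl fun k _ => ?_
      rw [neg_mul, neg_neg, Even.neg_pow (by simp [parity_simps])]
      ring
    rw [hWr, hWr, one_pow, mul_one] at h1
    rw [← neg_one_pow_eq_one_iff_even (R := ℂ) (by norm_num)]
    exact mul_left_cancel₀ hr (by rw [h1, mul_one])
  have he : 2 * (2 * M + 1) ∣ e := by
    refine Nat.Coprime.mul_dvd_of_dvd_of_dvd ?_ he2.two_dvd heN
    simp
  set A := (tqMat χ s (fun j => C (c j)) (C lam) X).adjugate 0 0 with hA
  have hpoly : A * C r * X ^ e =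
      C D * (Q * Qn) * X ^ (2 * (2 * M + 1) + 2 * m) := by
    rw [mul_assoc, ← hWre]
    refine Polynomial.funext fun x => ?_
    simp only [eval_mul, eval_C, eval_pow, eval_X, hA, eval_adjugate, hQn, eval_comp]
    by_cases hx : x = 0
    · subst hx
      rw [hWr, zero_pow he0, zero_pow (by omega)]
      ring
    · rw [hadj x hx 0 0, AddChar.map_zero_eq_one, mul_one, pow_add]
      rw [neg_one_mul]
      ring
  -- Otherwise the coefficient of `x^{2N + 2m}` would vanish on the left, while on the right it is
  -- `f'(λ) Q(0)²`.
  have hle : e ≤ 2 * (2 * M + 1) + 2 * m := by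
    by_contra hlt
    push Not at hlt
    have h1 := congrArg (coeff · (2 * (2 * M + 1) + 2 * m)) hpoly
    simp only [coeff_mul_X_pow', if_neg (not_le.mpr hlt), le_refl, if_true, Nat.sub_self] at h1
    rw [coeff_C_mul, mul_coeff_zero, hQn, comp_C_mul_X_coeff, pow_zero, mul_one] at h1
    exact mul_ne_zero hsimple (mul_ne_zero hQc hQc) h1.symm
  have hee : e = 2 * (2 * M + 1) := by
    obtain ⟨k, hk⟩ := he
    have hk2 : k < 2 := by
      by_contra h
      push Not at h
      have : 2 * (2 * M + 1) * 2 ≤ e := by rw [hk]; exact Nat.mul_le_mul_left _ h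
      omega
    interval_cases k
    · omega
    · omega
  have hpoly2 : A * C r = C D * (Q * Qn) * X ^ (2 * m) := by
    rw [hee, pow_add, mul_comm (X ^ (2 * (2 * M + 1))), ← mul_assoc] at hpoly
    exact mul_right_cancel₀ (pow_ne_zero _ X_ne_zero) hpoly
  constructor
  · have h1 : W.natDegree = e := by rw [hWre, natDegree_C_mul_X_pow _ _ hr]
    have h2 : W.natDegree ≤ 2 * m + 2 + 2 * Q.natDegree := by
      rw [hW]
      refine natDegree_sum_le_of_forall_le _ _ fun k _ => ?_
      have hlin : ∀ a : ℂ, (C a * X).natDegree ≤ 1 := fun a =>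
        (natDegree_C_mul_le _ _).trans natDegree_X_le
      have hcomp : ∀ a : ℂ, (Q.comp (C a * X)).natDegree ≤ Q.natDegree := fun a =>
        natDegree_comp_le.trans (by simpa using Nat.mul_le_mul_left Q.natDegree (hlin a))
      refine (natDegree_mul_le_of_le (natDegree_pow_le_of_le _ (hlin _))
        (natDegree_mul_le_of_le (hcomp _) (hcomp _))).trans ?_
      omega
    omega
  · have h1 := congrArg natDegree hpoly2
    rw [natDegree_mul_X_pow _ (mul_ne_zero (C_ne_zero.mpr hsimple) (mul_ne_zero hQ0 hQn0)),
      natDegree_C_mul hsimple, natDegree_mul hQ0 hQn0, hQnd, natDegree_mul_C hr] at h1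
    have h2 := natDegree_adjugate_le (χ := χ) (s := s) (lam := lam) hL 0 0
    rw [← hA] at h2
    have h3 : 2 * M * L = 2 * (L * M) := by ring
    omega

end Structure

end BaxterTQ

namespace BaxterTQ

/-! ### Exact degrees, reflection and uniqueness. -/

section Degrees

variable {M : ℕ} {χ : AddChar (Site M) ℂ} {s : Site M} {c : Fin 4 → ℂ} {lam : ℂ}

/-- The condition on the exponent at infinity: in the top coefficient of the equation only the
leading coefficient of `Q` survives. -/
theorem IsTQ.tqCoeff_natDegree_eq_zero {L : ℕ} (hL : L = 4 ∨ L = 3 ∧ c 3 = 0) {Q : ℂ[X]}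
    (hQ : IsTQ χ s c lam Q) (hQ0 : Q ≠ 0) : tqCoeff χ s c lam L Q.natDegree = 0 := by
  have h := hQ.sum_tqCoeff (L + Q.natDegree)
  rw [Finset.sum_eq_single (L, Q.natDegree)] at h
  · exact (mul_eq_zero.mp h).resolve_right (leadingCoeff_ne_zero.mpr hQ0)
  · rintro ⟨t, j⟩ hp hne
    rw [Finset.HasAntidiagonal.mem_antidiagonal] at hp
    simp only at hp ⊢
    rcases lt_or_ge Q.natDegree j with hj | hj
    · rw [coeff_eq_zero_of_natDegree_lt hj, mul_zero]
    · have ht : L < t := by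
        by_contra ht
        exact hne (Prod.ext (by simp only; omega) (by simp only; omega))
      rw [tqCoeff, coeff_eq_zero_of_natDegree_lt
        ((natDegree_tqP_le hL natDegree_X_le).trans_lt ht), coeff_eq_zero_of_natDegree_lt
        ((natDegree_tqL_le χ s lam hL natDegree_X_le).trans_lt ht)]
      ring
  · intro h
    exact absurd (Finset.HasAntidiagonal.mem_antidiagonal (a := (L, Q.natDegree)).mpr rfl) h

/-- At infinity `u q^d = (u q^{d + 3})⁻¹`, that is, `N` divides `2m + 2d + 3`. By the degree bounds
this number lies between `4M + 3` and `6M + 3 = 3N`, so it is `3N`. -/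
theorem IsTQ.natDegree_eq_three (hχ : Function.Injective χ) {m : ℕ} (hs : s = m) (h3 : c 3 = 0)
    (hc : c 0 * c 1 * c 2 ≠ 0) {Q : ℂ[X]} (hQ : IsTQ χ s c lam Q) (hQ0 : Q ≠ 0)
    (h1 : 2 * M ≤ Q.natDegree + m) (h2 : Q.natDegree + m ≤ 3 * M) :
    Q.natDegree + m = 3 * M := by
  have h := hQ.tqCoeff_natDegree_eq_zero (Or.inr ⟨rfl, h3⟩) hQ0
  have hP : (tqP (fun j => C (c j)) (X : ℂ[X])).coeff 3 = c 0 * c 1 * c 2 := by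
    have : tqP (fun j => C (c j)) (X : ℂ[X]) = C (c 0 * c 1 * c 2) * X ^ 3 +
        C (c 0 * c 1 + c 0 * c 2 + c 1 * c 2) * X ^ 2 + C (c 0 + c 1 + c 2) * X ^ 1 + C 1 := by
      rw [tqP, Fin.prod_univ_four, h3]
      simp only [Polynomial.C_mul, C_add, C_0, C_1]
      ring
    rw [this]
    simp only [coeff_add, coeff_C_mul, coeff_X_pow, coeff_C]
    norm_num
  have hΛ : (tqL χ s (fun j => C (c j)) (C lam) (X : ℂ[X])).coeff 3 = 0 := by
    rw [tqL, Fin.prod_univ_four, h3, algebraMap_eq]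
    simp only [C_0, mul_zero, zero_mul, add_zero, coeff_add, coeff_C_mul, coeff_X_pow, coeff_C]
    norm_num
  rw [tqCoeff, hP, hΛ, sub_zero] at h
  have h0 := (mul_eq_zero.mp h).resolve_left hc
  simp only [Algebra.algebraMap_self, RingHom.id_apply] at h0
  have h4 : s + Q.natDegree = -(s + Q.natDegree + 3) := hχ (by
    push_cast at h0
    linear_combination h0)
  have h5 : 2 * M + 1 ∣ 2 * m + 2 * Q.natDegree + 3 := by
    rw [← ZMod.natCast_eq_zero_iff]
    push_cast
    rw [← hs]
    linear_combination h4
  obtain ⟨k, hk⟩ := h5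
  have hk1 : 2 < k := by
    by_contra h
    have := Nat.mul_le_mul_left (2 * M + 1) (not_lt.mp h)
    omega
  have hk2 : k < 4 := by
    by_contra h
    have := Nat.mul_le_mul_left (2 * M + 1) (not_lt.mp h)
    omega
  interval_cases k
  omega

/-- The T-Q equation is invariant under `x ↦ x⁻¹`. -/
def IsReciprocal (χ : AddChar (Site M) ℂ) (c : Fin 4 → ℂ) : Prop :=
  ∏ j, c j = χ 2 ∧ ∀ x : ℂ, x ≠ 0 → x ^ 4 * tqP c x⁻¹ = χ 2 * tqP c (-(x * χ (-1)))

theorem eval_reflect {n : ℕ} {Q : ℂ[X]} (hQ : Q.natDegree ≤ n) {x : ℂ} (hx : x ≠ 0) :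
    (reflect n Q).eval x = x ^ n * Q.eval x⁻¹ := by
  let _ : Invertible x⁻¹ := invertibleOfNonzero (inv_ne_zero hx)
  have h := eval₂_reflect_mul_pow (RingHom.id ℂ) x⁻¹ n Q hQ
  rw [invOf_eq_inv, inv_inv] at h
  rw [← eval₂_id, ← eval₂_id (p := Q), ← h, inv_pow, mul_comm, mul_assoc,
    inv_mul_cancel₀ (pow_ne_zero _ hx), mul_one]

theorem isTQ_of_forall_ne_zero {Q : ℂ[X]} (h : ∀ x, x ≠ 0 → tqL χ s c lam x * Q.eval x =
    χ s * tqP c x * Q.eval (x * χ 1) + χ (-s) * tqP c (-(x * χ (-1))) * Q.eval (x * χ (-1))) :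
    IsTQ χ s c lam Q := by
  have : X * tqDefect χ s c lam Q = 0 := Polynomial.funext fun x => by
    by_cases hx : x = 0
    · simp [hx]
    · rw [eval_mul, eval_tqDefect, h x hx, eval_zero]
      ring
  exact (mul_eq_zero.mp this).resolve_left X_ne_zero

/-- Under `x ↦ x⁻¹` the two terms on the right of the equation are interchanged; the powers of `q`
match exactly when `n = -2 - 2s` modulo `N`. -/
theorem IsTQ.reflect (hc : IsReciprocal χ c) {n : ℕ} (hn : (n : Site M) = -2 - 2 * s) {Q : ℂ[X]}
    (hQ : IsTQ χ s c lam Q) (hd : Q.natDegree ≤ n) : IsTQ χ s c lam (reflect n Q) := by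
  refine isTQ_of_forall_ne_zero fun x hx => ?_
  have h1 := mul_ne_zero hx (chi_ne_zero χ 1)
  have h2 := mul_ne_zero hx (chi_ne_zero χ (-1))
  have hinv : ∀ a : Site M, (χ a)⁻¹ = χ (-a) := fun a => by rw [AddChar.map_neg_eq_inv]
  have hcomb : ∀ a b d : Site M, a + b = d → χ a * χ b = χ d := fun a b d h => by
    rw [← h, AddChar.map_add_eq_mul]
  rw [eval_reflect hd hx, eval_reflect hd h1, eval_reflect hd h2, mul_inv, mul_inv, hinv, hinv,
    neg_neg, mul_pow, mul_pow, ← chi_mul_natCast, ← chi_mul_natCast, hn]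
  have h := isTQ_iff.mp hQ x⁻¹
  have hL : x ^ 4 * tqL χ s c lam x⁻¹ = tqL χ s c lam x := by
    simp only [tqL, hc.1, Algebra.algebraMap_self, RingHom.id_apply]
    have := hcomb (-2) 2 0 (by ring)
    rw [AddChar.map_zero_eq_one] at this
    have hx4 : x ^ 4 * x⁻¹ ^ 4 = 1 := by rw [← mul_pow, mul_inv_cancel₀ hx, one_pow]
    have hx2 : x ^ 4 * x⁻¹ ^ 2 = x ^ 2 := by
      rw [show x ^ 4 = x ^ 2 * x ^ 2 by ring, mul_assoc, ← mul_pow, mul_inv_cancel₀ hx, one_pow,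
        mul_one]
    linear_combination lam * hx2 + (χ s + χ (-s)) * (1 - x ^ 4) * this +
      χ (-2) * (χ s + χ (-s)) * χ 2 * hx4
  have hP1 := hc.2 x hx
  have hP2 := hc.2 (-(x * χ 1)) (neg_ne_zero.mpr h1)
  rw [inv_neg, mul_inv, hinv, neg_mul, neg_neg, mul_assoc x, hcomb 1 (-1) 0 (by ring),
    AddChar.map_zero_eq_one, mul_one, Even.neg_pow (by decide), mul_pow, ← AddChar.map_nsmul_eq_pow] at hP2
  have e1 := hcomb s (1 * (-2 - 2 * s)) (-s - 2) (by ring)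
  have e2 := hcomb (-s) (-1 * (-2 - 2 * s)) (s + 2) (by ring)
  have e3 := hcomb s 2 (s + 2) (by ring)
  have e4 : χ (-s) * χ (-2) = χ (-s - 2) := hcomb _ _ _ (by ring)
  have e5 : χ (4 • (1 : Site M)) * χ (-2) = χ 2 := hcomb _ _ _ (by
    simp only [nsmul_eq_mul, Nat.cast_ofNat]; ring)
  have e6 := hcomb 2 (-2) 0 (by ring)
  rw [AddChar.map_zero_eq_one] at e6
  have hP2' : x ^ 4 * tqP c (-(x⁻¹ * χ (-1))) = χ (-2) * tqP c x := by
    refine mul_left_cancel₀ (chi_ne_zero χ 2) ?_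
    linear_combination χ (-2) * hP2 - x ^ 4 * tqP c (-(x⁻¹ * χ (-1))) * e5
  rw [← hL]
  linear_combination x ^ n * x ^ 4 * h + x ^ n * χ s * Q.eval (x⁻¹ * χ 1) * hP1 +
    x ^ n * χ (-s) * Q.eval (x⁻¹ * χ (-1)) * hP2' +
    x ^ n * tqP c (-(x * χ (-1))) * Q.eval (x⁻¹ * χ 1) * (e3 - e2) +
    x ^ n * tqP c x * Q.eval (x⁻¹ * χ (-1)) * (e4 - e1)

theorem natTrailingDegree_reflect {n : ℕ} {Q : ℂ[X]} (hQ0 : Q ≠ 0) (hd : Q.natDegree ≤ n) :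
    (reflect n Q).natTrailingDegree = n - Q.natDegree := by
  have hne : (reflect n Q).coeff (n - Q.natDegree) ≠ 0 := by
    rw [coeff_reflect, revAt_le (Nat.sub_le _ _), Nat.sub_sub_self hd]
    exact leadingCoeff_ne_zero.mpr hQ0
  refine le_antisymm (natTrailingDegree_le_of_ne_zero hne) ?_
  refine le_natTrailingDegree (fun h => hne (by rw [h, coeff_zero])) fun k hk => ?_
  rw [coeff_reflect, revAt_le (by omega)]
  exact coeff_eq_zero_of_natDegree_lt (by omega)

/-- At infinity `d + 2 = 0` or `d + 2 = -2m` modulo `N`. The second alternative and the degree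
bounds give `d = 4M - 2m`; for `m = 0` both coincide. -/
theorem IsTQ.natDegree_eq_four (hχ : Function.Injective χ) {m : ℕ} (hm : m ≤ M) (hM : 1 ≤ M)
    (hs : s = m) (hc : IsReciprocal χ c)
    (hO : s = 0 ∨ ∀ R, IsTQ χ (-s) c lam R → R.coeff 0 = 0)
    {Q : ℂ[X]} (hQ : IsTQ χ s c lam Q) (hQ0 : Q ≠ 0)
    (h1 : 2 * M ≤ Q.natDegree + m) (h2 : Q.natDegree + m ≤ 4 * M) :
    Q.natDegree + 2 * m = 4 * M := by
  have h := hQ.tqCoeff_natDegree_eq_zero (Or.inl rfl) hQ0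
  rw [tqCoeff, coeff_tqP_four _ natDegree_X_le, coeff_tqL_four _ _ _ _ natDegree_X_le, hc.1] at h
  simp only [coeff_X_one, one_pow, mul_one, Algebra.algebraMap_self, RingHom.id_apply] at h
  have hcomb : ∀ a b d : Site M, a + b = d → χ a * χ b = χ d := fun a b d h => by
    rw [← h, AddChar.map_add_eq_mul]
  have e1 := hcomb 2 (s + Q.natDegree) (s + Q.natDegree + 2) (by ring)
  have e2 := hcomb 2 (-(s + Q.natDegree + (4 : ℕ))) (-(s + Q.natDegree + 2)) (by push_cast; ring)
  have e3 := hcomb 2 (-2) 0 (by ring)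
  rw [AddChar.map_zero_eq_one] at e3
  have h3 : χ (s + Q.natDegree + 2) + χ (-(s + Q.natDegree + 2)) = χ s + χ (-s) := by
    linear_combination h - e1 - e2 + (χ s + χ (-s)) * e3
  have hmul : ∀ k r : ℕ, (2 * M + 1) * k = r → 0 < r → r ≤ 6 * M + 2 → k = 1 ∨ k = 2 := by
    intro k r hk hr1 hr2
    have hk1 : 0 < k := by
      by_contra h
      have := Nat.mul_le_mul_left (2 * M + 1) (not_lt.mp h)
      omega
    have hk2 : k < 3 := by
      by_contra h
      have := Nat.mul_le_mul_left (2 * M + 1) (not_lt.mp h)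
      omega
    omega
  rcases (add_inv_eq_iff hχ).mp h3 with h4 | h4
  · have h5 : 2 * M + 1 ∣ Q.natDegree + 2 := by
      rw [← ZMod.natCast_eq_zero_iff]
      push_cast
      linear_combination h4
    by_cases hm0 : m = 0
    · subst hm0
      obtain ⟨k, hk⟩ := h5
      rcases hmul k _ hk.symm (by omega) (by omega) with rfl | rfl <;> omega
    -- The other alternative leaves only `d = 2M - 1`. Then the reflected solution starts with the
    -- exponent `N - 2m`, which is not divisible by `N`.
    · exfalso
      have hd : Q.natDegree = 2 * M - 1 := by
        obtain ⟨k, hk⟩ := h5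
        rcases hmul k _ hk.symm (by omega) (by omega) with rfl | rfl <;> omega
      have hn : ((4 * M - 2 * m : ℕ) : Site M) = -2 - 2 * s := by
        rw [Nat.cast_sub (by omega), hs]
        have := natCast_site (M := M)
        push_cast at this ⊢
        linear_combination 2 * this
      have hR := hQ.reflect hc hn (by omega)
      have h6 := hR.dvd_natTrailingDegree hχ hO (by rwa [Ne, reflect_eq_zero_iff])
      rw [natTrailingDegree_reflect hQ0 (by omega), hd] at h6
      have := Nat.le_of_dvd (by omega) h6
      omega
  · have h5 : 2 * M + 1 ∣ Q.natDegree + 2 + 2 * m := by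
      rw [← ZMod.natCast_eq_zero_iff]
      push_cast
      rw [← hs]
      linear_combination h4
    obtain ⟨k, hk⟩ := h5
    rcases hmul k _ hk.symm (by omega) (by omega) with rfl | rfl <;> omega

/-- Subtracting the multiple of `Q` with the same constant term leaves a solution divisible by
`x^N`. Unless it is zero, its quotient is a solution of degree below the minimal one. -/
theorem IsTQ.eq_C_mul (hχ : Function.Injective χ)
    (hO : s = 0 ∨ ∀ R, IsTQ χ (-s) c lam R → R.coeff 0 = 0) {Q R : ℂ[X]}
    (hQ : IsTQ χ s c lam Q) (hQ0 : Q.coeff 0 ≠ 0)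
    (hmin : ∀ R, R ≠ 0 → IsTQ χ s c lam R → Q.natDegree ≤ R.natDegree)
    (hR : IsTQ χ s c lam R) (hd : R.natDegree < Q.natDegree + (2 * M + 1)) :
    ∃ a, R = C a * Q := by
  refine ⟨R.coeff 0 / Q.coeff 0, ?_⟩
  by_contra hne
  set P := R - C (R.coeff 0 / Q.coeff 0) * Q with hP
  have hP0 : P ≠ 0 := sub_ne_zero.mpr hne
  obtain ⟨S, hS0, hS, hdS⟩ := exists_eq_X_pow_mul hχ hO (hR.sub_C_mul hQ _) hP0
    (by rw [coeff_sub, coeff_C_mul, div_mul_cancel₀ _ hQ0, sub_self])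
  have h1 := hmin S hS0 hS
  have h2 : P.natDegree ≤ max R.natDegree Q.natDegree :=
    (natDegree_sub_le _ _).trans (max_le_max le_rfl (natDegree_C_mul_le _ _))
  rw [← hP] at hdS
  omega

/-- The monic generator of the space of solutions. -/
theorem exists_monic_isTQ_three (hχ : Function.Injective χ) {m : ℕ} (hm : m ≤ M) (hs : s = m)
    (h3 : c 3 = 0) (hc : c 0 * c 1 * c 2 ≠ 0) (f : ℂ[X])
    (hf : ∀ z, (tqMat χ s c z 1).det = f.eval z)
    (hdet : f.eval lam = 0) (hsimple : (derivative f).eval lam ≠ 0)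
    (hO : s = 0 ∨ ∀ R, IsTQ χ (-s) c lam R → R.coeff 0 = 0) :
    ∃ Q, Q.Monic ∧ Q.natDegree = 3 * M - m ∧ Q.coeff 0 ≠ 0 ∧ IsTQ χ s c lam Q ∧
      ∀ R, R.natDegree ≤ M * 3 - m → IsTQ χ s c lam R → ∃ a, R = C a * Q := by
  obtain ⟨Q, hQc, hQ, hmin, h1, h2⟩ := exists_isTQ_structure hχ hm hs (Or.inr ⟨rfl, h3⟩) f hf hdet
    hsimple hO
  have hQ0 : Q ≠ 0 := fun h => hQc (by rw [h, coeff_zero])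
  have hd := hQ.natDegree_eq_three hχ hs h3 hc hQ0 h1 h2
  have hl : Q.leadingCoeff⁻¹ ≠ 0 := inv_ne_zero (leadingCoeff_ne_zero.mpr hQ0)
  refine ⟨C Q.leadingCoeff⁻¹ * Q, ?_, ?_, ?_, hQ.C_mul _, fun R hRd hR => ?_⟩
  · rw [mul_comm]; exact monic_mul_leadingCoeff_inv hQ0
  · rw [natDegree_C_mul hl]; omega
  · rw [coeff_C_mul]; exact mul_ne_zero hl hQc
  · obtain ⟨a, rfl⟩ := hQ.eq_C_mul hχ hO hQc hmin hR (by omega)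
    refine ⟨a * Q.leadingCoeff, ?_⟩
    rw [← mul_assoc, ← C_mul, mul_inv_cancel_right₀ (leadingCoeff_ne_zero.mpr hQ0)]

theorem exists_monic_isTQ_four (hχ : Function.Injective χ) {m : ℕ} (hm : m ≤ M) (hM : 1 ≤ M)
    (hs : s = m) (hc : IsReciprocal χ c) (f : ℂ[X])
    (hf : ∀ z, (tqMat χ s c z 1).det = f.eval z)
    (hdet : f.eval lam = 0) (hsimple : (derivative f).eval lam ≠ 0)
    (hO : s = 0 ∨ ∀ R, IsTQ χ (-s) c lam R → R.coeff 0 = 0) :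
    ∃ Q, Q.Monic ∧ Q.natDegree = 4 * M - 2 * m ∧ Q.coeff 0 ≠ 0 ∧ IsTQ χ s c lam Q ∧
      (Q.reverse = Q ∨ Q.reverse = -Q) ∧
      ∀ R, R.natDegree ≤ M * 4 - m → IsTQ χ s c lam R → ∃ a, R = C a * Q := by
  obtain ⟨Q₁, hQ₁c, hQ₁, hmin, h1, h2⟩ := exists_isTQ_structure hχ hm hs (Or.inl rfl) f hf hdet
    hsimple hO
  have hQ₁0 : Q₁ ≠ 0 := fun h => hQ₁c (by rw [h, coeff_zero])
  have hd₁ := hQ₁.natDegree_eq_four hχ hm hM hs hc hO hQ₁0 h1 h2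
  have hl : Q₁.leadingCoeff⁻¹ ≠ 0 := inv_ne_zero (leadingCoeff_ne_zero.mpr hQ₁0)
  obtain ⟨Q, hQdef⟩ : ∃ Q, Q = C Q₁.leadingCoeff⁻¹ * Q₁ := ⟨_, rfl⟩
  have hmon : Q.Monic := by rw [hQdef, mul_comm]; exact monic_mul_leadingCoeff_inv hQ₁0
  have hd : Q.natDegree = 4 * M - 2 * m := by rw [hQdef, natDegree_C_mul hl]; omega
  have hQc : Q.coeff 0 ≠ 0 := by rw [hQdef, coeff_C_mul]; exact mul_ne_zero hl hQ₁c
  have hQ : IsTQ χ s c lam Q := by rw [hQdef]; exact hQ₁.C_mul _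
  have huniq : ∀ R, R.natDegree ≤ M * 4 - m → IsTQ χ s c lam R → ∃ a, R = C a * Q := by
    intro R hRd hR
    obtain ⟨a, rfl⟩ := hQ₁.eq_C_mul hχ hO hQ₁c hmin hR (by omega)
    refine ⟨a * Q₁.leadingCoeff, ?_⟩
    rw [hQdef, ← mul_assoc, ← C_mul, mul_inv_cancel_right₀ (leadingCoeff_ne_zero.mpr hQ₁0)]
  refine ⟨Q, hmon, hd, hQc, hQ, ?_, huniq⟩
  have hn : ((4 * M - 2 * m : ℕ) : Site M) = -2 - 2 * s := by
    rw [Nat.cast_sub (by omega), hs]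
    have := natCast_site (M := M)
    push_cast at this ⊢
    linear_combination 2 * this
  have hrev : Q.reverse = Polynomial.reflect (4 * M - 2 * m) Q := by rw [reverse, hd]
  have hR := hQ.reflect hc hn hd.le
  rw [← hrev] at hR
  -- The reverse polynomial is again a solution, hence `a Q`. Comparing the two outermost
  -- coefficients gives `a² = 1`.
  obtain ⟨a, ha⟩ := huniq _ ((reverse_natDegree_le Q).trans (by omega)) hR
  have e1 : 1 = a * Q.coeff 0 := by
    rw [← coeff_C_mul, ← ha, coeff_zero_reverse, hmon.leadingCoeff]
  have e2 : Q.coeff 0 = a := by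
    have h3 := congrArg (coeff · Q.natDegree) ha
    simp only [coeff_C_mul] at h3
    rw [hmon.coeff_natDegree, mul_one] at h3
    rw [← h3, coeff_reverse, revAt_le le_rfl, Nat.sub_self]
  have e3 : (a - 1) * (a + 1) = 0 := by
    rw [e2] at e1
    linear_combination -e1
  rcases mul_eq_zero.mp e3 with h | h
  · left
    rw [ha, sub_eq_zero.mp h, C_1, one_mul]
  · right
    rw [ha, eq_neg_of_add_eq_zero_left h, C_neg, C_1, neg_one_mul]

end Degrees

end BaxterTQ

namespace BaxterTQ

/-! ### Excluding solutions with the inverse multiplier. -/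

section Obstruction

variable {M : ℕ} (χ : AddChar (Site M) ℂ) (s : Site M)

section Defs

variable {R S : Type*} [CommRing R] [Algebra ℂ R] [CommRing S] [Algebra ℂ S]

/-- The recursion for the first coefficients of a solution of the T-Q equation. -/
noncomputable def tqRec (c : Fin 4 → R) (lam : R) (n : ℕ) : Matrix (Fin n) (Fin n) R :=
  of fun i j => if (j : ℕ) ≤ i + 1 then tqCoeff χ s c lam (i + 1 - j) j else 0

theorem map_det_tqRec (f : R →ₐ[ℂ] S) (c : Fin 4 → R) (lam : R) (n : ℕ) :
    f (tqRec χ s c lam n).det = (tqRec χ s (f ∘ c) (f lam) n).det := by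
  rw [AlgHom.map_det]
  congr 1
  ext i j
  simp only [tqRec, AlgHom.mapMatrix_apply, map_apply, of_apply, apply_ite f, map_tqCoeff, map_zero]

/-- It vanishes if some eigenvalue of the reduced Hamiltonian admits a solution with the inverse
multiplier. -/
noncomputable def tqObstruction (c : Fin 4 → R) (n : ℕ) : R :=
  (aeval (redHam χ s c)
    (tqRec χ (-s) (fun j => C (c j)) (algebraMap ℂ R[X] (χ (-1)) * X) n).det).det

theorem map_tqObstruction (f : R →ₐ[ℂ] S) (c : Fin 4 → R) (n : ℕ) :
    f (tqObstruction χ s c n) = tqObstruction χ s (f ∘ c) n := by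
  have h := map_det_aeval (f : R →+* S) (redHam χ s c)
    (tqRec χ (-s) (fun j => C (c j)) (algebraMap ℂ R[X] (χ (-1)) * X) n).det
  have h2 := map_redHam χ s f c
  have h3 := map_det_tqRec χ (-s) (mapAlgHom f) (fun j => C (c j))
    (algebraMap ℂ R[X] (χ (-1)) * X) n
  have h4 : (mapAlgHom f) ∘ (fun j => C (c j)) = fun j => C ((f ∘ c) j) := by ext1 j; simp
  rw [h4, map_mul, AlgHom.commutes] at h3
  have h5 : mapAlgHom f (X : R[X]) = X := by simp
  rw [h5] at h3
  rw [tqObstruction, tqObstruction, ← h2, ← h3]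
  exact h

end Defs

variable {χ s} {c : Fin 4 → ℂ} {lam : ℂ}

theorem tqObstruction_ne_zero_iff (n : ℕ) : tqObstruction χ s c n ≠ 0 ↔
    ∀ μ, (redHam χ s c).charpoly.IsRoot μ → (tqRec χ (-s) c (χ (-1) * μ) n).det ≠ 0 := by
  rw [tqObstruction, det_aeval_ne_zero_iff]
  refine forall_congr' fun μ => imp_congr_right fun _ => not_congr ?_
  have h := map_det_tqRec χ (-s) (aeval μ : ℂ[X] →ₐ[ℂ] ℂ) (fun j => C (c j))
    (algebraMap ℂ ℂ[X] (χ (-1)) * X) n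
  have h4 : (aeval μ : ℂ[X] →ₐ[ℂ] ℂ) ∘ (fun j => C (c j)) = c := by ext1 j; simp
  rw [h4, map_mul, AlgHom.commutes, aeval_X, coe_aeval_eq_eval] at h
  rw [h]
  simp

/-- With the multiplier `u⁻¹` the exponent `2m` is resonant: the coefficient of `R` at `2m` drops
out of equation `2m`. So the first `2m` coefficients satisfy a closed square system. -/
theorem coeff_zero_of_det_tqRec_ne_zero {m : ℕ} (hm : 1 ≤ m) (hs : s = m)
    (h : (tqRec χ (-s) c lam (2 * m)).det ≠ 0) {R : ℂ[X]} (hR : IsTQ χ (-s) c lam R) :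
    R.coeff 0 = 0 := by
  by_contra h0
  apply h
  refine exists_mulVec_eq_zero_iff.mp ⟨fun j => R.coeff j, fun h =>
    h0 (congrFun h ⟨0, by omega⟩), ?_⟩
  ext i
  have hsum := hR.sum_tqCoeff (i + 1)
  rw [Finset.Nat.sum_antidiagonal_eq_sum_range_succ_mk, ← Finset.sum_range_reflect] at hsum
  have hterm : ∀ j ∈ Finset.range (i + 1 + 1), tqCoeff χ (-s) c lam (i + 1 + 1 - 1 - j)
      (i + 1 - (i + 1 + 1 - 1 - j)) * R.coeff (i + 1 - (i + 1 + 1 - 1 - j)) =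
      tqCoeff χ (-s) c lam (i + 1 - j) j * R.coeff j := fun j hj => by
    rw [Finset.mem_range] at hj
    rw [show (i : ℕ) + 1 - (i + 1 + 1 - 1 - j) = j by omega,
      show (i : ℕ) + 1 + 1 - 1 - j = i + 1 - j by omega]
  rw [Finset.sum_congr rfl hterm] at hsum
  have hlast : tqCoeff χ (-s) c lam 0 (2 * m) = 0 := by
    rw [tqCoeff_zero]
    have : -s + (2 * m : ℕ) = s := by rw [hs]; push_cast; ring
    rw [this, neg_neg, add_comm (χ (-s))]
    simp
  rw [Pi.zero_apply, mulVec, dotProduct]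
  have hfin : ∑ j : Fin (2 * m), tqRec χ (-s) c lam (2 * m) i j * R.coeff j =
      ∑ j ∈ Finset.range (2 * m), (if j ≤ i + 1 then
        tqCoeff χ (-s) c lam (i + 1 - j) j * R.coeff j else 0) := by
    rw [Finset.sum_range]
    refine Finset.sum_congr rfl fun j _ => ?_
    simp only [tqRec, of_apply, ite_mul, zero_mul]
  rw [hfin, ← Finset.sum_filter]
  rcases Nat.lt_or_ge (i + 1) (2 * m) with hi | hi
  · rw [← hsum]
    refine Finset.sum_congr ?_ fun _ _ => rfl
    ext j
    simp only [Finset.mem_filter, Finset.mem_range]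
    omega
  · have hi' : (i : ℕ) + 1 = 2 * m := by have := i.2; omega
    rw [Finset.sum_range_succ, hi', Nat.sub_self, hlast, zero_mul, add_zero] at hsum
    rw [hi', ← hsum]
    refine Finset.sum_congr ?_ fun _ _ => rfl
    ext j
    simp only [Finset.mem_filter, Finset.mem_range]
    omega

theorem natCast_ne_zero_of_lt {n : ℕ} (h0 : 0 < n) (h : n < 2 * M + 1) : (n : Site M) ≠ 0 := by
  rw [Ne, ZMod.natCast_eq_zero_iff]
  exact Nat.not_dvd_of_pos_of_lt h0 h

/-- Here `redHam` is zero and `P = 1 + x`, so the recursion matrix is upper triangular, with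
diagonal entries `q^{i - m} - q^{m - i - 1}`. -/
theorem tqObstruction_three_ne_zero (hχ : Function.Injective χ) {m : ℕ} (hm : m ≤ M) (hs : s = m) :
    tqObstruction χ s (![1, 0, 0, 0] : Fin 4 → ℂ) (2 * m) ≠ 0 := by
  rw [tqObstruction_ne_zero_iff]
  intro μ hμ
  obtain ⟨g, hg0, hg⟩ := (isRoot_charpoly_iff _ _).mp hμ
  have hH : redHam χ s (![1, 0, 0, 0] : Fin 4 → ℂ) = 0 := by
    ext i j
    simp [redHam, cyc]
  have hμ0 : μ = 0 := by
    rw [hH, zero_mulVec] at hg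
    exact (smul_eq_zero.mp hg.symm).resolve_right hg0
  have hP : tqP (fun j => C ((![1, 0, 0, 0] : Fin 4 → ℂ) j)) (X : ℂ[X]) = C 1 + C 1 * X ^ 1 := by
    rw [tqP, Fin.prod_univ_four]
    simp
  have hΛ : tqL χ (-s) (fun j => C ((![1, 0, 0, 0] : Fin 4 → ℂ) j)) (C 0) (X : ℂ[X]) =
      C (χ (-s) + χ s) := by
    rw [tqL, Fin.prod_univ_four]
    simp
  rw [hμ0, mul_zero, det_of_isUpperTriangular]
  · refine Finset.prod_ne_zero_iff.mpr fun i _ => ?_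
    have hi := i.2
    simp only [tqRec, of_apply, if_pos (Nat.le_succ (i : ℕ)), Nat.add_sub_cancel_left, tqCoeff, hP,
      hΛ]
    simp only [coeff_add, coeff_C_mul, coeff_X_pow, coeff_C, Algebra.algebraMap_self,
      RingHom.id_apply]
    norm_num
    rw [← sub_eq_add_neg, sub_eq_zero]
    intro h
    -- Impossible: `2i + 1` and `2m` have different parity and differ by less than `N`.
    have h1 : (2 * (i : ℕ) + 1 : Site M) = 2 * m := by
      have := hχ h
      rw [hs] at this
      linear_combination this
    rcases Nat.lt_or_ge (2 * i + 1) (2 * m) with h2 | h2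
    · refine natCast_ne_zero_of_lt (M := M) (n := 2 * m - (2 * i + 1)) (by omega) (by omega) ?_
      rw [Nat.cast_sub (by omega)]
      push_cast
      linear_combination -h1
    · refine natCast_ne_zero_of_lt (M := M) (n := 2 * i + 1 - 2 * m) (by omega) (by omega) ?_
      rw [Nat.cast_sub (by omega)]
      push_cast
      linear_combination h1
  · intro i j hij
    simp only [id] at hij
    have hij' : (j : ℕ) < i := hij
    have h2 : 2 ≤ (i : ℕ) + 1 - j := by omega
    simp only [tqRec, of_apply, tqCoeff, hP, hΛ, coeff_add, coeff_C_mul, coeff_X_pow, coeff_C]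
    rw [if_neg (show ¬ (i : ℕ) + 1 - j = 0 by omega), if_neg (show ¬ (i : ℕ) + 1 - j = 1 by omega)]
    rw [if_neg (show ¬ (i : ℕ) + 1 - j = 0 by omega), mul_zero, add_zero, zero_mul, sub_zero,
      ite_self]

/-! ### The obstruction in the symmetric family. -/

section Pair

theorem eq_zero_of_antiperiodic {w : ℂ} (hw : w ^ (2 * M + 1) = -1) {f : Site M → ℂ}
    (hf : ∀ n, f (n + 1) = w * f n) : f = 0 := by
  have h : ∀ (k : ℕ) n, f (n + k) = w ^ k * f n := fun k n => by
    induction k with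
    | zero => simp
    | succ k ih =>
      push_cast
      rw [← add_assoc, hf, ih]
      ring
  ext n
  have h1 := h (2 * M + 1) n
  rw [natCast_site, add_zero, hw] at h1
  rw [Pi.zero_apply]
  linear_combination (1 / 2 : ℂ) * h1

/-- A quadratic phase turns the eigenvalue equation into one with constant coefficients. If `λ` were
`q^a + q^{-a}`, it would factor into two first-order recursions with ratios `-q^{±a}`. Their `N`-th
powers are `-1`, so they have no non-zero solution on the cycle. -/
theorem redHam_pair_eigenvalue_ne {r : ℂ} (hr : r ^ 2 = -χ 1) {μ : ℂ} {g : Site M → ℂ}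
    (hg0 : g ≠ 0) (hg : redHam χ s ![r, 0, r, 0] *ᵥ g = μ • g) (a : Site M) :
    χ a + χ (-a) ≠ χ (-1) * μ := by
  intro h
  have hcomb : ∀ a b d : Site M, a + b = d → χ a * χ b = χ d := fun a b d h => by
    rw [← h, AddChar.map_add_eq_mul]
  have ha := hcomb a (-a) 0 (by ring)
  have h1 := hcomb 1 (-1) 0 (by ring)
  rw [AddChar.map_zero_eq_one] at ha h1
  have hμ : μ = χ 1 * (χ a + χ (-a)) := by rw [h]; linear_combination (-μ) * h1
  have hrec : ∀ n, χ (1 + s + 2 * n) * g (n + 1) + χ (1 - s - 2 * n) * g (n - 1) =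
      -(χ a + χ (-a)) * g n := fun n => by
    have h2 := redHam_mulVec χ s ![r, 0, r, 0] g n
    rw [hg] at h2
    have h3 : (![r, 0, r, 0] : Fin 4 → ℂ) 3 = 0 := rfl
    have h4 : (![r, 0, r, 0] : Fin 4 → ℂ) 2 = r := rfl
    simp only [Pi.smul_apply, smul_eq_mul, cons_val_zero, cons_val_one, h3, h4] at h2
    have e1 := hcomb (1 - s) (2 * s + 2 * n) (1 + s + 2 * n) (by ring)
    have e2 := hcomb (1 - s) (-(2 * n)) (1 - s - 2 * n) (by ring)
    have e3 := hcomb (1 - s) (s - 1) 0 (by ring)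
    rw [AddChar.map_zero_eq_one] at e3
    refine mul_left_cancel₀ (chi_ne_zero χ 1) ?_
    linear_combination χ (1 - s) * h2 + (χ (1 - s) * (χ (2 * s + 2 * n) * g (n + 1) +
      χ (-(2 * n)) * g (n - 1))) * hr - χ 1 * g (n + 1) * e1 - χ 1 * g (n - 1) * e2 -
      μ * g n * e3 - g n * hμ
  set f : Site M → ℂ := fun n => χ (n * n + s * n) * g n with hf
  have hrec2 : ∀ n, f (n + 1) + f (n - 1) = -(χ a + χ (-a)) * f n := fun n => by
    have e1 := hcomb (n * n + s * n) (1 + s + 2 * n) ((n + 1) * (n + 1) + s * (n + 1)) (by ring)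
    have e2 := hcomb (n * n + s * n) (1 - s - 2 * n) ((n - 1) * (n - 1) + s * (n - 1)) (by ring)
    simp only [hf]
    linear_combination χ (n * n + s * n) * hrec n - g (n + 1) * e1 - g (n - 1) * e2
  have hw : ∀ b : Site M, (-χ b) ^ (2 * M + 1) = -1 := fun b => by
    rw [Odd.neg_pow ⟨M, rfl⟩, chi_pow_card]
  -- The inner factor of the second-order recursion; it obeys a first-order recursion itself.
  have hk : (fun n => f (n + 1) + χ a * f n) = 0 :=
    eq_zero_of_antiperiodic (hw (-a)) fun n => by
      have := hrec2 (n + 1)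
      rw [add_sub_cancel_right] at this
      linear_combination this + f n * ha
  have hf0 : f = 0 := eq_zero_of_antiperiodic (hw a) fun n => by
    have := congrFun hk n
    simp only [Pi.zero_apply] at this
    linear_combination this
  apply hg0
  ext n
  exact (mul_eq_zero.mp (congrFun hf0 n)).resolve_left (chi_ne_zero χ _)

/-- The coefficients of a series with `(1 + r x) h(q x) = (1 - r x) h(x)` up to `xᴺ`. -/
noncomputable def gaugeCoeff (q r : ℂ) : ℕ → ℂ
  | 0 => 1
  | n + 1 => -r * (1 + q ^ n) * gaugeCoeff q r n / (q ^ (n + 1) - 1)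

/-- The recursion for the coefficients of the series can be solved up to order `2M`, since `q^n ≠ 1`
for `0 < n < N`. Truncation leaves an error in `x^N` only. -/
theorem exists_gauge_polynomial (hχ : Function.Injective χ) (r : ℂ) :
    ∃ (H : ℂ[X]) (e : ℂ), H.coeff 0 = 1 ∧
      (1 + C r * X) * H.comp (C (χ 1) * X) = (1 - C r * X) * H + C e * X ^ (2 * M + 1) := by
  have hq := isPrimitiveRoot_chi hχ
  set h := gaugeCoeff (χ 1) r with hh
  refine ⟨∑ n ∈ Finset.range (2 * M + 1), C (h n) * X ^ n,
    r * (1 + χ 1 ^ (2 * M)) * h (2 * M), ?_, ?_⟩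
  · rw [finsetSum_coeff, Finset.sum_eq_single 0]
    · simp [hh, gaugeCoeff]
    · intro n _ hn
      simp [hn.symm]
    · simp
  · set H : ℂ[X] := ∑ n ∈ Finset.range (2 * M + 1), C (h n) * X ^ n with hH
    have hc : ∀ n, H.coeff n = if n < 2 * M + 1 then h n else 0 := fun n => by
      rw [hH, finsetSum_coeff]
      simp only [coeff_C_mul, coeff_X_pow, mul_ite, mul_one, mul_zero, Finset.sum_ite_eq,
        Finset.mem_range]
    have hrec : ∀ n, n + 1 < 2 * M + 1 →
        h (n + 1) * (χ 1 ^ (n + 1) - 1) = -r * (1 + χ 1 ^ n) * h n := fun n hn => by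
      have : χ 1 ^ (n + 1) - 1 ≠ 0 := sub_ne_zero.mpr fun h1 =>
        Nat.not_dvd_of_pos_of_lt (Nat.succ_pos n) hn (hq.dvd_of_pow_eq_one _ h1)
      rw [hh, gaugeCoeff]
      field_simp
    ext n
    rw [add_mul, sub_mul, one_mul, one_mul, coeff_add, coeff_add, coeff_sub, mul_assoc, mul_assoc,
      coeff_C_mul, coeff_C_mul, comp_C_mul_X_coeff, coeff_C_mul_X_pow]
    cases n with
    | zero => simp
    | succ n =>
      rw [coeff_X_mul, coeff_X_mul, comp_C_mul_X_coeff, hc, hc]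
      rcases lt_trichotomy (n + 1) (2 * M + 1) with h1 | h1 | h1
      · rw [if_pos h1, if_pos (by omega), if_neg (by omega)]
        linear_combination hrec n h1
      · have h2 : n = 2 * M := by omega
        subst h2
        rw [if_neg (by omega), if_pos (by omega), if_pos rfl]
        ring
      · rw [if_neg (by omega), if_neg (by omega), if_neg (by omega)]
        ring

theorem tqDefect_X_pow_card_mul (R : ℂ[X]) : tqDefect χ s c lam (X ^ (2 * M + 1) * R) =
    X ^ (2 * M + 1) * tqDefect χ s c lam R := Polynomial.funext fun x => by
  rw [eval_mul, eval_tqDefect, eval_tqDefect]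
  simp only [eval_mul, eval_pow, eval_X, mul_pow, chi_pow_card]
  ring

theorem tqDefect_add (Q R : ℂ[X]) : tqDefect χ s c lam (Q + R) =
    tqDefect χ s c lam Q + tqDefect χ s c lam R := by
  simp only [tqDefect, add_comp]
  ring

/-- Multiplication by `H` exchanges a factor `1 + r x` for `1 - r x`: modulo `x^N` it reduces `P =
(1 + r x)²` to `P = 1 - r² x²`, for which the recursion has step two. -/
theorem dvd_tqDefect_gauge {r e : ℂ} {H : ℂ[X]}
    (hH : (1 + C r * X) * H.comp (C (χ 1) * X) = (1 - C r * X) * H + C e * X ^ (2 * M + 1))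
    (F : ℂ[X]) : X ^ (2 * M + 1) ∣
      tqDefect χ s ![r, 0, r, 0] lam (H * F) - H * tqDefect χ s ![r, -r, 0, 0] lam F := by
  have hHe : ∀ x, (1 + r * x) * H.eval (x * χ 1) = (1 - r * x) * H.eval x + e * x ^ (2 * M + 1) :=
    fun x => by
      have := congrArg (eval x) hH
      simp only [eval_mul, eval_add, eval_sub, eval_one, eval_C, eval_X, eval_comp, eval_pow] at this
      rw [mul_comm x]
      exact this
  refine ⟨-(C (χ s * e) * (1 + C r * X) * F.comp (C (χ 1) * X)) +
    C (χ (-s) * e) * (1 - C (r * χ (-1)) * X) * F.comp (C (χ (-1)) * X), ?_⟩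
  refine Polynomial.funext fun x => ?_
  have h1 := hHe x
  have h2 := hHe (x * χ (-1))
  rw [mul_assoc x, ← AddChar.map_add_eq_mul, neg_add_cancel, AddChar.map_zero_eq_one, mul_one,
    mul_pow, chi_pow_card, mul_one] at h2
  have hP1 : ∀ y, tqP (![r, 0, r, 0] : Fin 4 → ℂ) y = (1 + r * y) ^ 2 := fun y => by
    rw [tqP, Fin.prod_univ_four]
    simp only [cons_val_zero, cons_val_one, show (![r, 0, r, 0] : Fin 4 → ℂ) 2 = r from rfl,
      show (![r, 0, r, 0] : Fin 4 → ℂ) 3 = 0 from rfl]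
    ring
  have hP2 : ∀ y, tqP (![r, -r, 0, 0] : Fin 4 → ℂ) y = (1 + r * y) * (1 - r * y) := fun y => by
    rw [tqP, Fin.prod_univ_four]
    simp only [cons_val_zero, cons_val_one, show (![r, -r, 0, 0] : Fin 4 → ℂ) 2 = 0 from rfl,
      show (![r, -r, 0, 0] : Fin 4 → ℂ) 3 = 0 from rfl]
    ring
  have hL : tqL χ s (![r, -r, 0, 0] : Fin 4 → ℂ) lam x = tqL χ s ![r, 0, r, 0] lam x := by
    simp [tqL, Fin.prod_univ_four]
  simp only [eval_sub, eval_mul, eval_tqDefect, hP1, hP2, hL, eval_pow, eval_X, eval_add, eval_neg,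
    eval_C, eval_comp, eval_one, mul_comm (χ _) x]
  linear_combination -(χ s * (1 + r * x) * F.eval (x * χ 1)) * h1 +
    χ (-s) * (1 - r * (x * χ (-1))) * F.eval (x * χ (-1)) * h2

theorem tqCoeff_pair_zero_iff (hχ : Function.Injective χ) {m n : ℕ} (hs : s = m) :
    tqCoeff χ (-s) c lam 0 n = 0 ↔ (n : Site M) = 0 ∨ (n : Site M) = 2 * m := by
  rw [tqCoeff_zero]
  simp only [Algebra.algebraMap_self, RingHom.id_apply, sub_eq_zero]
  rw [add_inv_eq_iff hχ]
  refine or_congr ?_ ?_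
  · exact ⟨fun h => by linear_combination h, fun h => by linear_combination h⟩
  · rw [hs]
    exact ⟨fun h => by linear_combination h, fun h => by linear_combination h⟩

/-- Converse to `coeff_zero_of_det_tqRec_ne_zero`: a kernel vector is a truncated solution, and the
resonance at `2m` provides one further order. -/
theorem exists_dvd_tqDefect_of_det_tqRec_eq_zero (hχ : Function.Injective χ) {m : ℕ}
    (hs : s = m) (hdet : (tqRec χ (-s) c lam (2 * m)).det = 0) :
    ∃ R : ℂ[X], X ^ (2 * m + 1) ∣ tqDefect χ (-s) c lam R ∧ ¬ X ^ (2 * m) ∣ R := by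
  obtain ⟨v, hv0, hv⟩ := exists_mulVec_eq_zero_iff.mpr hdet
  set R : ℂ[X] := ∑ j : Fin (2 * m), C (v j) * X ^ (j : ℕ) with hR
  have hRc : ∀ n, R.coeff n = if h : n < 2 * m then v ⟨n, h⟩ else 0 := fun n => by
    rw [hR, finsetSum_coeff]
    simp only [coeff_C_mul, coeff_X_pow, mul_ite, mul_one, mul_zero]
    split_ifs with h
    · rw [Finset.sum_eq_single ⟨n, h⟩]
      · simp
      · intro j _ hj
        rw [if_neg]
        rintro rfl
        exact hj rfl
      · simp
    · refine Finset.sum_eq_zero fun j _ => ?_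
      rw [if_neg]
      rintro rfl
      exact h j.2
  refine ⟨R, ?_, fun hR0 => hv0 ?_⟩
  · rw [X_pow_dvd_iff]
    intro n hn
    rw [coeff_tqDefect, neg_eq_zero]
    have h2m : tqCoeff χ (-s) c lam 0 0 = 0 :=
      (tqCoeff_pair_zero_iff hχ hs).mpr (Or.inl (by simp))
    cases n with
    | zero => simp [h2m]
    | succ n =>
      have hrow := congrFun hv ⟨n, by omega⟩
      rw [Pi.zero_apply, mulVec, dotProduct] at hrow
      rw [Finset.Nat.sum_antidiagonal_eq_sum_range_succ_mk, ← Finset.sum_range_reflect]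
      have hterm : ∀ j ∈ Finset.range (n + 1 + 1), tqCoeff χ (-s) c lam
          (n + 1 + 1 - 1 - j) (n + 1 - (n + 1 + 1 - 1 - j)) *
          R.coeff (n + 1 - (n + 1 + 1 - 1 - j)) =
          tqCoeff χ (-s) c lam (n + 1 - j) j * R.coeff j := fun j hj => by
        rw [Finset.mem_range] at hj
        rw [show n + 1 - (n + 1 + 1 - 1 - j) = j by omega,
          show n + 1 + 1 - 1 - j = n + 1 - j by omega]
      rw [Finset.sum_congr rfl hterm, ← hrow]
      have hfin : ∑ j : Fin (2 * m), tqRec χ (-s) c lam (2 * m) ⟨n, by omega⟩ j * v j =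
          ∑ j ∈ Finset.range (2 * m), (if j ≤ n + 1 then
            tqCoeff χ (-s) c lam (n + 1 - j) j * R.coeff j else 0) := by
        rw [Finset.sum_range]
        refine Finset.sum_congr rfl fun j _ => ?_
        rw [hRc, dif_pos j.2]
        simp only [tqRec, of_apply, ite_mul, zero_mul]
      rw [hfin, ← Finset.sum_filter]
      symm
      refine Finset.sum_subset (fun j hj => ?_) (fun j hj hj' => ?_)
      · simp only [Finset.mem_filter, Finset.mem_range] at hj ⊢
        omega
      · simp only [Finset.mem_filter, Finset.mem_range] at hj hj'
        rw [hRc, dif_neg (by omega), mul_zero]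
  · ext j
    have h1 := X_pow_dvd_iff.mp hR0 j j.2
    rw [hRc, dif_pos j.2] at h1
    exact h1

/-- As `-r² = q`, the recursion relates the coefficients at `n` and `n + 2`, and the factor at `n`
is `q^a + q^{-a} - λ` with `a = n + 1 - s`, never zero by `hne`. -/
theorem X_pow_dvd_of_dvd_tqDefect (hχ : Function.Injective χ) {m : ℕ} (hm : m ≤ M)
    (hs : s = m) {r : ℂ} (hr : r ^ 2 = -χ 1) (hne : ∀ a, χ a + χ (-a) ≠ lam) {F : ℂ[X]}
    (hG : X ^ (2 * m + 1) ∣ tqDefect χ (-s) ![r, -r, 0, 0] lam F) : X ^ (2 * m) ∣ F := by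
  have hP : tqP (fun j => C ((![r, -r, 0, 0] : Fin 4 → ℂ) j)) (X : ℂ[X]) =
      C 1 + C (-r ^ 2) * X ^ 2 := by
    rw [tqP, Fin.prod_univ_four]
    simp only [cons_val_zero, cons_val_one, show (![r, -r, 0, 0] : Fin 4 → ℂ) 2 = 0 from rfl,
      show (![r, -r, 0, 0] : Fin 4 → ℂ) 3 = 0 from rfl, C_neg, C_0, C_1, C_pow]
    ring
  have hΛ : tqL χ (-s) (fun j => C ((![r, -r, 0, 0] : Fin 4 → ℂ) j)) (C lam) (X : ℂ[X]) =
      C (χ (-s) + χ s) + C lam * X ^ 2 := by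
    rw [tqL, Fin.prod_univ_four]
    simp
  have hK2 : ∀ j : ℕ, tqCoeff χ (-s) (![r, -r, 0, 0] : Fin 4 → ℂ) lam 2 j ≠ 0 := fun j => by
    rw [tqCoeff, hP, hΛ]
    simp only [coeff_add, coeff_C_mul, coeff_X_pow, coeff_C, Algebra.algebraMap_self,
      RingHom.id_apply]
    norm_num
    rw [hr, neg_mul, neg_neg, mul_add, ← AddChar.map_add_eq_mul, ← AddChar.map_add_eq_mul, sub_eq_zero]
    have := hne (1 + (-s + j))
    convert this using 3
    ring_nf
  have hKt : ∀ t j : ℕ, t ≠ 0 → t ≠ 2 →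
      tqCoeff χ (-s) (![r, -r, 0, 0] : Fin 4 → ℂ) lam t j = 0 := fun t j h0 h2 => by
    rw [tqCoeff, hP, hΛ]
    simp only [coeff_add, coeff_C_mul, coeff_X_pow, coeff_C, if_neg h0, if_neg h2, mul_zero, add_zero,
      zero_mul, sub_zero]
  have hstep : ∀ n, n + 2 < 2 * m + 1 →
      tqCoeff χ (-s) (![r, -r, 0, 0] : Fin 4 → ℂ) lam 0 (n + 2) * F.coeff (n + 2) +
      tqCoeff χ (-s) (![r, -r, 0, 0] : Fin 4 → ℂ) lam 2 n * F.coeff n = 0 := fun n hn => by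
    have h1 := X_pow_dvd_iff.mp hG (n + 2) hn
    rw [coeff_tqDefect, neg_eq_zero, Finset.sum_eq_add (0, n + 2) (2, n)] at h1
    · exact h1
    · simp
    · rintro ⟨t, j⟩ hp ⟨h3, h4⟩
      rw [Finset.HasAntidiagonal.mem_antidiagonal] at hp
      simp only at hp
      rw [hKt, zero_mul]
      · rintro rfl; exact h3 (Prod.ext rfl (by simp only at hp ⊢; omega))
      · rintro rfl; exact h4 (Prod.ext rfl (by simp only at hp ⊢; omega))
    · intro h; exact absurd (Finset.HasAntidiagonal.mem_antidiagonal.mpr (by simp)) h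
    · intro h; exact absurd (Finset.HasAntidiagonal.mem_antidiagonal.mpr (by simp; omega)) h
  -- Downwards from `2m`, where the resonance removes the upper coefficient.
  have heven : ∀ k, k < m → F.coeff (2 * m - 2 - 2 * k) = 0 := fun k => by
    induction k with
    | zero =>
      intro hk
      have h1 := hstep (2 * m - 2) (by omega)
      rw [show 2 * m - 2 + 2 = 2 * m by omega,
        (tqCoeff_pair_zero_iff hχ hs).mpr (Or.inr (by push_cast; rfl)), zero_mul, zero_add] at h1
      exact (mul_eq_zero.mp h1).resolve_left (hK2 _)
    | succ k ih =>
      intro hk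
      have h1 := hstep (2 * m - 2 - 2 * (k + 1)) (by omega)
      rw [show 2 * m - 2 - 2 * (k + 1) + 2 = 2 * m - 2 - 2 * k by omega, ih (by omega), mul_zero,
        zero_add] at h1
      exact (mul_eq_zero.mp h1).resolve_left (hK2 _)
  have hK0 : ∀ n : ℕ, 0 < n → n < 2 * m →
      tqCoeff χ (-s) (![r, -r, 0, 0] : Fin 4 → ℂ) lam 0 n ≠ 0 := fun n h0 h1 h => by
    rcases (tqCoeff_pair_zero_iff hχ hs).mp h with h2 | h2
    · exact natCast_ne_zero_of_lt h0 (by omega) h2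
    · refine natCast_ne_zero_of_lt (M := M) (n := 2 * m - n) (by omega) (by omega) ?_
      rw [Nat.cast_sub h1.le]
      push_cast
      rw [h2, sub_self]
  -- Upwards from `1`, where no odd exponent below `2m` is resonant.
  have hodd : ∀ k, 2 * k + 1 < 2 * m → F.coeff (2 * k + 1) = 0 := fun k => by
    induction k with
    | zero =>
      intro hk
      have h1 := X_pow_dvd_iff.mp hG 1 (by omega)
      rw [coeff_tqDefect, neg_eq_zero, Finset.Nat.antidiagonal_succ] at h1
      simp only [Finset.Nat.antidiagonal_zero, Finset.map_singleton, Finset.sum_cons,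
        Finset.sum_singleton, Function.Embedding.prodMap] at h1
      simp only [Function.Embedding.coeFn_mk, Prod.map, Function.Embedding.refl_apply] at h1
      rw [hKt (Nat.succ 0) 0 (by decide) (by decide), zero_mul, add_zero] at h1
      exact (mul_eq_zero.mp h1).resolve_left (hK0 1 (by omega) (by omega))
    | succ k ih =>
      intro hk
      have h1 := hstep (2 * k + 1) (by omega)
      rw [ih (by omega), mul_zero, add_zero] at h1
      exact (mul_eq_zero.mp h1).resolve_left (hK0 _ (by omega) (by omega))
  rw [X_pow_dvd_iff]
  intro n hn
  rcases Nat.even_or_odd' n with ⟨k, rfl | rfl⟩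
  · have := heven (m - 1 - k) (by omega)
    rwa [show 2 * m - 2 - 2 * (m - 1 - k) = 2 * k by omega] at this
  · exact hodd k hn

/-- A truncated solution `R` would be `H F` modulo `x^N`. Then `F` is a truncated solution for `(r,
-r, 0, 0)` and is divisible by `x^{2m}`, hence so is `R`, a contradiction. -/
theorem tqObstruction_pair_ne_zero (hχ : Function.Injective χ) {m : ℕ} (hm : m ≤ M)
    (hs : s = m) {r : ℂ} (hr : r ^ 2 = -χ 1) :
    tqObstruction χ s (![r, 0, r, 0] : Fin 4 → ℂ) (2 * m) ≠ 0 := by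
  rw [tqObstruction_ne_zero_iff]
  intro μ hμ hdet
  obtain ⟨g, hg0, hg⟩ := (isRoot_charpoly_iff _ _).mp hμ
  have hne := redHam_pair_eigenvalue_ne hr hg0 hg
  obtain ⟨R, hdefect, hR⟩ := exists_dvd_tqDefect_of_det_tqRec_eq_zero hχ hs hdet
  generalize χ (-1) * μ = lam at *
  obtain ⟨H, e, hH0, hH⟩ := exists_gauge_polynomial hχ r
  -- `H` has constant term `1` and is invertible modulo `x^N`.
  have hcop : IsCoprime H (X ^ (2 * M + 1)) := by
    refine IsCoprime.pow_right ?_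
    refine ((irreducible_X (R := ℂ)).coprime_iff_not_dvd.mpr fun h => ?_).symm
    rw [X_dvd_iff, hH0] at h
    exact one_ne_zero h
  obtain ⟨A, B, hAB⟩ := hcop
  set F := A * R with hF
  have hRF : R = H * F + X ^ (2 * M + 1) * (B * R) := by
    rw [hF]; linear_combination (-R) * hAB
  have hX : (X : ℂ[X]) ^ (2 * m + 1) ∣ X ^ (2 * M + 1) := pow_dvd_pow _ (by omega)
  refine hR ?_
  rw [hRF]
  refine dvd_add (Dvd.dvd.mul_left (X_pow_dvd_of_dvd_tqDefect hχ hm hs hr hne ?_) _)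
    ((pow_dvd_pow _ (by omega)).mul_right _)
  have h1 := (hX.trans (dvd_tqDefect_gauge (s := -s) (lam := lam) hH F))
  have h2 : X ^ (2 * m + 1) ∣ tqDefect χ (-s) ![r, 0, r, 0] lam (H * F) := by
    have h3 := hdefect
    rw [hRF, tqDefect_add, tqDefect_X_pow_card_mul] at h3
    exact (dvd_add_left (hX.trans (dvd_mul_right _ _))).mp h3
  have h4 : X ^ (2 * m + 1) ∣ H * tqDefect χ (-s) ![r, -r, 0, 0] lam F := by
    have := dvd_sub h2 h1
    rwa [sub_sub_cancel] at this
  refine IsCoprime.dvd_of_dvd_mul_left ?_ h4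
  exact (IsCoprime.of_isCoprime_of_dvd_right (⟨A, B, hAB⟩ : IsCoprime H _) hX).symm

end Pair

end Obstruction

end BaxterTQ

namespace BaxterTQ

/-! ### Simple roots from real-rootedness. -/

section RealRooted

/-- Laguerre's inequality for real-rooted polynomials, strict away from the roots, by induction on
the linear factors. -/
theorem laguerre_nonneg {ι : Type*} (S : Finset ι) (e : ι → ℝ) (t : ℝ) :
    0 ≤ (derivative (∏ i ∈ S, (X - C (e i)))).eval t ^ 2 - (∏ i ∈ S, (X - C (e i))).eval t *
      (derivative (derivative (∏ i ∈ S, (X - C (e i))))).eval t ∧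
    (S.Nonempty → (∏ i ∈ S, (X - C (e i))).eval t ≠ 0 →
      0 < (derivative (∏ i ∈ S, (X - C (e i)))).eval t ^ 2 - (∏ i ∈ S, (X - C (e i))).eval t *
        (derivative (derivative (∏ i ∈ S, (X - C (e i))))).eval t) := by
  classical
  induction S using Finset.induction_on with
  | empty => simp
  | insert i S hi ih =>
    rw [Finset.prod_insert hi]
    set h := ∏ i ∈ S, (X - C (e i))
    have key : (derivative ((X - C (e i)) * h)).eval t ^ 2 - ((X - C (e i)) * h).eval t *
        (derivative (derivative ((X - C (e i)) * h))).eval t = h.eval t ^ 2 + (t - e i) ^ 2 *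
          ((derivative h).eval t ^ 2 - h.eval t * (derivative (derivative h)).eval t) := by
      simp only [derivative_mul, derivative_add, derivative_sub, derivative_X, derivative_C,
        eval_mul, eval_add, eval_sub, eval_X, eval_C, derivative_one, eval_one, eval_zero,
        derivative_zero]
      ring
    rw [key]
    refine ⟨add_nonneg (sq_nonneg _) (mul_nonneg (sq_nonneg _) ih.1), fun _ h0 => ?_⟩
    rw [eval_mul] at h0
    exact add_pos_of_pos_of_nonneg (pow_pos_of_ne_zero (right_ne_zero_of_mul h0))
      (mul_nonneg (sq_nonneg _) ih.1)
where
  pow_pos_of_ne_zero {x : ℝ} (h : x ≠ 0) : 0 < x ^ 2 := by positivity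

/-- Suppose `p`, `p - α` and `p + β` are all real-rooted. At a double root of `p`, Laguerre's
inequality for the two shifts gives `α p'' > 0` and `-β p'' > 0`, a contradiction. -/
theorem separable_charpoly_of_shifts_isHermitian {n : Type*} [Fintype n] [DecidableEq n] [Nonempty n]
    {A B D : Matrix n n ℂ} (hA : A.IsHermitian) (hB : B.IsHermitian) (hD : D.IsHermitian)
    {α β : ℝ} (hα : 0 < α) (hβ : 0 < β) (hAB : A.charpoly = B.charpoly - C (α : ℂ))
    (hDB : D.charpoly = B.charpoly + C (β : ℂ)) : B.charpoly.Separable := by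
  have hreal : ∀ {H : Matrix n n ℂ} (hH : H.IsHermitian),
      H.charpoly = (∏ i, (X - C (hH.eigenvalues i))).map Complex.ofRealHom := fun {H} hH => by
    rw [hH.charpoly_eq, Polynomial.map_prod]
    simp
  have hinj := Polynomial.map_injective Complex.ofRealHom Complex.ofRealHom.injective
  set p := ∏ i, (X - C (hB.eigenvalues i)) with hp
  have h1 : ∏ i, (X - C (hA.eigenvalues i)) = p - C α := hinj <| by
    rw [← hreal hA, hAB, hreal hB, Polynomial.map_sub, map_C]
    rfl
  have h2 : ∏ i, (X - C (hD.eigenvalues i)) = p + C β := hinj <| by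
    rw [← hreal hD, hDB, hreal hB, Polynomial.map_add, map_C]
    rfl
  rw [hreal hB]
  refine Separable.map (separable_prod_X_sub_C_iff.mpr fun i j hij => ?_)
  by_contra hne
  set t := hB.eigenvalues i with ht
  have hdvd : (X - C t) * (X - C t) ∣ p := by
    have : (X - C t) * (X - C t) = ∏ l ∈ {i, j}, (X - C (hB.eigenvalues l)) := by
      rw [Finset.prod_pair hne, ← hij]
    rw [this]
    exact Finset.prod_dvd_prod_of_subset _ _ _ (Finset.subset_univ _)
  obtain ⟨g, hg⟩ := hdvd
  have hp0 : p.eval t = 0 := by rw [hg]; simp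
  have hp1 : (derivative p).eval t = 0 := by rw [hg]; simp [derivative_mul]
  have l1 := (laguerre_nonneg Finset.univ hA.eigenvalues t).2 Finset.univ_nonempty
  have l2 := (laguerre_nonneg Finset.univ hD.eigenvalues t).2 Finset.univ_nonempty
  rw [h1] at l1
  rw [h2] at l2
  simp only [derivative_sub, derivative_add, derivative_C, eval_sub, eval_add, eval_C, hp0, hp1,
    sub_zero, add_zero, zero_sub, zero_add] at l1 l2
  have m1 := l1 (by linarith)
  have m2 := l2 hβ.ne'
  have n1 : 0 < eval t (derivative (derivative p)) := by
    by_contra h; push Not at h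
    nlinarith
  nlinarith

theorem separable_C_mul_comp {p : ℂ[X]} (hp : p.Separable) {a b : ℂ} (ha : a ≠ 0) (hb : b ≠ 0) :
    (C a * p.comp (C b * X)).Separable := by
  obtain ⟨u, v, h⟩ := hp
  have h' := congrArg (fun f => f.comp (C b * X)) h
  simp only [add_comp, mul_comp, one_comp] at h'
  refine ⟨C a⁻¹ * u.comp (C b * X), C (a * b)⁻¹ * v.comp (C b * X), ?_⟩
  have e1 : C a⁻¹ * C a = (1 : ℂ[X]) := by rw [← C_mul, inv_mul_cancel₀ ha, C_1]
  have e2 : C (a * b)⁻¹ * (C a * C b) = (1 : ℂ[X]) := by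
    rw [← C_mul, ← C_mul, inv_mul_cancel₀ (mul_ne_zero ha hb), C_1]
  rw [derivative_C_mul, derivative_comp, derivative_C_mul, derivative_X, mul_one]
  linear_combination h' + u.comp (C b * X) * p.comp (C b * X) * e1 +
    v.comp (C b * X) * (derivative p).comp (C b * X) * e2

end RealRooted

/-! ### Rescaling the parameters. -/

section Scaling

variable {M : ℕ} {χ : AddChar (Site M) ℂ} {s : Site M}

/-- A common factor of the parameters is absorbed into `x` and `λ`, so only their ratios matter for
genericity. -/
theorem tqMat_mul {t : ℂ} (ht : t ≠ 0) (c : Fin 4 → ℂ) (lam x : ℂ) :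
    tqMat χ s (fun j => t * c j) lam x = tqMat χ s c (lam / t ^ 2) (t * x) := by
  have hP : ∀ y, tqP (fun j => t * c j) y = tqP c (t * y) := fun y =>
    Finset.prod_congr rfl fun j _ => by ring
  have hL : ∀ y, tqL χ s (fun j => t * c j) lam y = tqL χ s c (lam / t ^ 2) (t * y) := fun y => by
    rw [tqL, tqL, Finset.prod_mul_distrib, Finset.prod_const, Finset.card_univ, Fintype.card_fin]
    field_simp
  simp only [tqMat, hP, hL, mul_assoc, mul_neg]

theorem charpoly_redHam_mul (hχ : Function.Injective χ) {t : ℂ} (ht : t ≠ 0) (c : Fin 4 → ℂ) :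
    (redHam χ s fun j => t * c j).charpoly =
      C (t ^ (2 * (2 * M + 1))) * (redHam χ s c).charpoly.comp (C (t ^ 2)⁻¹ * X) :=
  Polynomial.funext fun μ => by
    rw [eval_charpoly_redHam hχ, tqMat_mul ht, det_tqMat s c _ hχ, eval_mul, eval_C, eval_comp,
      eval_charpoly_redHam hχ]
    simp only [eval_mul, eval_C, eval_X, mul_one]
    rw [mul_div_assoc, div_eq_inv_mul, mul_comm (_ ^ _)]

theorem isTQ_mul_param_iff {t : ℂ} (ht : t ≠ 0) (c : Fin 4 → ℂ) (lam : ℂ) (R : ℂ[X]) :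
    IsTQ χ s (fun j => t * c j) lam R ↔ IsTQ χ s c (lam / t ^ 2) (R.comp (C t⁻¹ * X)) := by
  have hP : ∀ y, tqP (fun j => t * c j) y = tqP c (t * y) := fun y =>
    Finset.prod_congr rfl fun j _ => by ring
  have hL : ∀ y, tqL χ s (fun j => t * c j) lam y = tqL χ s c (lam / t ^ 2) (t * y) := fun y => by
    rw [tqL, tqL, Finset.prod_mul_distrib, Finset.prod_const, Finset.card_univ, Fintype.card_fin]
    field_simp
  rw [isTQ_iff, isTQ_iff]
  simp only [hP, hL, eval_comp, eval_mul, eval_C, eval_X]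
  constructor
  · intro h x
    have := h (t⁻¹ * x)
    simp only [mul_assoc, mul_neg, mul_inv_cancel_left₀ ht] at this ⊢
    exact this
  · intro h x
    have := h (t * x)
    simp only [mul_assoc, mul_neg, inv_mul_cancel_left₀ ht] at this ⊢
    exact this

end Scaling

/-! ### Determinants of a cycle cut at one bond. -/

section Cut

variable {M : ℕ}

/-- On a bond cut in one direction, the entry in the other direction contributes only the product
around the cycle. Adding this product leaves a function of the uncut bonds. -/
theorem det_cyc_add_prod_eq_of_cut (hM : 1 ≤ M) {a b c b' c' : Site M → ℂ} (hb : b (-2) = 0)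
    (hb' : b' (-2) = 0) (hc : ∀ k, k ≠ -1 → c k ≠ 0) (hc' : ∀ k, k ≠ -1 → c' k ≠ 0)
    (h : ∀ k, k ≠ -2 → b k * c (k + 1) = b' k * c' (k + 1)) :
    (cyc a b c).det + ∏ k, c k = (cyc a b' c').det + ∏ k, c' k := by
  have key : ∀ {b c : Site M → ℂ}, b (-2) = 0 → (∀ k, k ≠ -1 → c k ≠ 0) →
      ∃ d : Site M → ℂ, (∀ k, d k ≠ 0) ∧ (∀ k, k ≠ -1 → d k = c k) ∧ ∏ k, d k = 1 ∧
        (cyc a b c).det + ∏ k, c k = (cyc a b d).det + 1 := fun {b c} hb hc => by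
    set P := ∏ k ∈ Finset.univ.erase (-1), c k with hP
    have hP0 : P ≠ 0 := Finset.prod_ne_zero_iff.mpr fun k hk => hc k (Finset.ne_of_mem_erase hk)
    -- The entry at `-1` is free; it is chosen to make the product around the cycle `1`.
    set d := Function.update c (-1) P⁻¹ with hd
    have hdc : ∀ k, k ≠ -1 → d k = c k := fun k hk => Function.update_of_ne hk _ _
    have hd1 : ∏ k, d k = 1 := by
      rw [← Finset.mul_prod_erase _ _ (Finset.mem_univ (-1)), Finset.prod_congr rfl fun k hk =>
        hdc k (Finset.ne_of_mem_erase hk), hd, Function.update_self, inv_mul_cancel₀ hP0]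
    refine ⟨d, fun k => ?_, hdc, hd1, ?_⟩
    · by_cases hk : k = -1
      · rw [hk, hd, Function.update_self]
        exact inv_ne_zero hP0
      · rw [hdc k hk]
        exact hc k hk
    · have h1 := det_cyc_of_cut (a := a) (c := c) (c' := Function.update c (-1) 0) hM hb
        (fun k hk => Function.update_of_ne hk _ _) (Function.update_self _ _ _)
      have h2 := det_cyc_of_cut (a := a) (c := d) (c' := Function.update c (-1) 0) hM hb
        (fun k hk => by rw [hdc k hk]; exact Function.update_of_ne hk _ _)
        (Function.update_self _ _ _)
      rw [hd1] at h2
      linear_combination h1 - h2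
  obtain ⟨d, hd0, hdc, hd1, hdet⟩ := key hb hc
  obtain ⟨d', hd0', hdc', hd1', hdet'⟩ := key hb' hc'
  rw [hdet, hdet', det_cyc_eq_of_prod_eq hd0' hd0 (fun k => ?_) (hd1'.trans hd1.symm)]
  by_cases hk : k = -2
  · rw [hk, hb, hb', zero_mul, zero_mul]
  · have hk1 : k + 1 ≠ -1 := fun h => hk (by linear_combination h)
    rw [hdc _ hk1, hdc' _ hk1, h k hk]

end Cut

/-! ### Simple spectrum in the symmetric family. -/

section Separable

variable {M : ℕ} {χ : AddChar (Site M) ℂ}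

theorem prod_tqP_neg (hχ : Function.Injective χ) (s : Site M) (c : Fin 4 → ℂ) (x : ℂ) :
    ∏ k : Site M, χ (-s) * tqP c (-(x * χ (k - 1))) = ∏ j, (1 - (c j * x) ^ (2 * M + 1)) := by
  rw [Finset.prod_mul_distrib, Finset.prod_const, Finset.card_univ, ZMod.card, chi_pow_card,
    one_mul]
  rw [show ∏ k : Site M, tqP c (-(x * χ (k - 1))) = ∏ k : Site M, tqP c (-(x * χ k)) from
    Equiv.prod_comp (Equiv.subRight 1) fun k : Site M => tqP c (-(x * χ k))]
  simp only [tqP]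
  rw [Finset.prod_comm]
  refine Finset.prod_congr rfl fun j _ => ?_
  have := prod_one_add_mul_chi hχ (-(c j * x))
  rw [Odd.neg_pow ⟨M, rfl⟩, ← sub_eq_add_neg] at this
  rw [← this]
  exact Finset.prod_congr rfl fun k _ => by ring

/-- Parameters with the same `P(x) P(-x)` and the same product give the same determinant up to a
constant. -/
theorem det_tqMat_add_eq (hχ : Function.Injective χ) (hM : 1 ≤ M) (s : Site M) {c c' : Fin 4 → ℂ}
    (hP : ∀ x, tqP c x * tqP c (-x) = tqP c' x * tqP c' (-x)) (hp : ∏ j, c j = ∏ j, c' j)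
    (h0 : c 0 = 1) (h0' : c' 0 = 1)
    (h1 : ∀ k : Site M, k ≠ -1 → tqP c (χ (k + 1)) ≠ 0)
    (h1' : ∀ k : Site M, k ≠ -1 → tqP c' (χ (k + 1)) ≠ 0) (lam : ℂ) :
    (tqMat χ s c lam 1).det + ∏ j, (1 + c j ^ (2 * M + 1)) =
      (tqMat χ s c' lam 1).det + ∏ j, (1 + c' j ^ (2 * M + 1)) := by
  -- At `x = -ω` the determinant is the same as at `1`, and the bond `-2` is cut: there the argument
  -- of `P` is `-1`, a zero because `c 0 = 1`.
  have hx : (-χ 2) ^ (2 * (2 * M + 1)) = 1 := by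
    rw [pow_mul, neg_sq, ← pow_mul, pow_mul', chi_pow_card, one_pow]
  have hdet : ∀ c : Fin 4 → ℂ, (tqMat χ s c lam (-χ 2)).det = (tqMat χ s c lam 1).det := fun c => by
    rw [det_tqMat s c lam hχ, hx, mul_one]
  have hprod : ∀ c : Fin 4 → ℂ, ∏ k : Site M, χ (-s) * tqP c (-(-χ 2 * χ (k - 1))) =
      ∏ j, (1 + c j ^ (2 * M + 1)) := fun c => by
    rw [prod_tqP_neg hχ]
    refine Finset.prod_congr rfl fun j _ => ?_
    rw [mul_pow, Odd.neg_pow ⟨M, rfl⟩, chi_pow_card]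
    ring
  have hy : ∀ k : Site M, -(-χ 2 * χ (k - 1)) = χ (k + 1) := fun k => by
    rw [neg_mul, neg_neg, ← AddChar.map_add_eq_mul]
    congr 1; ring
  rw [← hdet, ← hdet, ← hprod, ← hprod, tqMat, tqMat]
  simp only [Algebra.algebraMap_self, RingHom.id_apply]
  have hL : ∀ y, tqL χ s c' lam y = tqL χ s c lam y := fun y => by rw [tqL, tqL, hp]
  simp only [hL]
  have hb : ∀ c : Fin 4 → ℂ, c 0 = 1 → χ s * tqP c (-χ 2 * χ (-2)) = 0 := fun c h => by
    rw [neg_mul, ← AddChar.map_add_eq_mul, add_neg_cancel, AddChar.map_zero_eq_one, tqP,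
      Finset.prod_eq_zero (Finset.mem_univ 0), mul_zero]
    rw [h]; ring
  refine det_cyc_add_prod_eq_of_cut hM (hb c h0) (hb c' h0') (fun k hk => ?_) (fun k hk => ?_)
    fun k _ => ?_
  · rw [hy]
    exact mul_ne_zero (chi_ne_zero χ _) (h1 k hk)
  · rw [hy]
    exact mul_ne_zero (chi_ne_zero χ _) (h1' k hk)
  · rw [add_sub_cancel_right]
    linear_combination χ s * χ (-s) * hP (-χ 2 * χ k)

theorem one_add_chi_ne_zero (k : Site M) : 1 + χ k ≠ 0 := by
  intro h
  have h1 : χ k = -1 := by linear_combination h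
  have h2 := chi_pow_card χ k
  rw [h1, Odd.neg_pow ⟨M, rfl⟩, one_pow] at h2
  norm_num at h2

theorem one_add_two_mul_chi_ne_zero {ε : ℂ} (hε : ε ^ 2 = 1) (k : Site M) : 1 + ε * 2 * χ k ≠ 0 := by
  intro h
  have h1 : (ε * 2 * χ k) ^ (2 * (2 * M + 1)) = 1 := by
    rw [show ε * 2 * χ k = -1 by linear_combination h, pow_mul]
    norm_num
  rw [mul_pow, mul_pow, pow_mul ε, hε, one_pow, one_mul, Nat.mul_comm, pow_mul (χ k), chi_pow_card,
    one_pow, mul_one] at h1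
  have h2 : ((2 : ℕ) ^ ((2 * M + 1) * 2) : ℕ) = 1 := by exact_mod_cast h1
  have := Nat.one_lt_two_pow (n := (2 * M + 1) * 2) (by omega)
  omega

theorem tqP_vec (a b d e x : ℂ) : tqP (![a, b, d, e] : Fin 4 → ℂ) x =
    (1 + a * x) * (1 + b * x) * (1 + d * x) * (1 + e * x) := by
  rw [tqP, Fin.prod_univ_four]; rfl

/-- The three real parameter choices have the same product and the same `P(x) P(-x) = (1 - x²)² (1 -
4x²)²`, so their Hermitian matrices have characteristic polynomials differing by constants. The
values `4 (1 + 2^N)²`, `4 (1 - 2^N)²` and `0` of `∏ (1 + cⱼ^N)` place the polynomial of `c₂`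
strictly between the other two. -/
theorem separable_charpoly_redHam_pair (hχ : Function.Injective χ) (hM : 1 ≤ M) (s : Site M) :
    (redHam χ s (![1, -2, 1, -2] : Fin 4 → ℂ)).charpoly.Separable := by
  set c₁ : Fin 4 → ℂ := ![1, 2, 1, 2] with h1
  set c₂ : Fin 4 → ℂ := ![1, -2, 1, -2] with h2
  set c₃ : Fin 4 → ℂ := ![1, 2, -1, -2] with h3
  have hH : ∀ c : Fin 4 → ℝ, (redHam χ s fun j => (c j : ℂ)).IsHermitian := isHermitian_redHam s
  have e1 : c₁ = fun j => ((![1, 2, 1, 2] : Fin 4 → ℝ) j : ℂ) := by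
    ext j; fin_cases j <;> simp [h1]
  have e2 : c₂ = fun j => ((![1, -2, 1, -2] : Fin 4 → ℝ) j : ℂ) := by
    ext j; fin_cases j <;> simp [h2]
  have e3 : c₃ = fun j => ((![1, 2, -1, -2] : Fin 4 → ℝ) j : ℂ) := by
    ext j; fin_cases j <;> simp [h3]
  have H1 := hH ![1, 2, 1, 2]
  have H2 := hH ![1, -2, 1, -2]
  have H3 := hH ![1, 2, -1, -2]
  rw [← e1] at H1
  rw [← e2] at H2
  rw [← e3] at H3
  have hp1 : ∀ k : Site M, k ≠ -1 → tqP c₁ (χ (k + 1)) ≠ 0 := fun k hk => by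
    rw [h1, tqP_vec]
    have a1 := one_add_chi_ne_zero (χ := χ) (k + 1)
    have a2 := one_add_two_mul_chi_ne_zero (χ := χ) (ε := 1) (by norm_num) (k + 1)
    rw [one_mul] at a2
    rw [one_mul]
    exact mul_ne_zero (mul_ne_zero (mul_ne_zero a1 a2) a1) a2
  have hp2 : ∀ k : Site M, k ≠ -1 → tqP c₂ (χ (k + 1)) ≠ 0 := fun k hk => by
    rw [h2, tqP_vec]
    have a1 := one_add_chi_ne_zero (χ := χ) (k + 1)
    have a2 := one_add_two_mul_chi_ne_zero (χ := χ) (ε := -1) (by norm_num) (k + 1)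
    rw [neg_one_mul] at a2
    rw [one_mul]
    exact mul_ne_zero (mul_ne_zero (mul_ne_zero a1 a2) a1) a2
  have hp3 : ∀ k : Site M, k ≠ -1 → tqP c₃ (χ (k + 1)) ≠ 0 := fun k hk => by
    rw [h3, tqP_vec]
    have a1 := one_add_chi_ne_zero (χ := χ) (k + 1)
    have a2 := one_add_two_mul_chi_ne_zero (χ := χ) (ε := -1) (by norm_num) (k + 1)
    have a3 := one_add_two_mul_chi_ne_zero (χ := χ) (ε := 1) (by norm_num) (k + 1)
    have a4 : 1 + -1 * χ (k + 1) ≠ 0 := by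
      rw [neg_one_mul, ← sub_eq_add_neg, sub_ne_zero, ← AddChar.map_zero_eq_one χ]
      intro h
      exact hk (by linear_combination -hχ h)
    rw [neg_one_mul] at a2
    rw [one_mul] at a3 ⊢
    exact mul_ne_zero (mul_ne_zero (mul_ne_zero a1 a3) a4) a2
  have d1 := det_tqMat_add_eq hχ hM s (c := c₁) (c' := c₂)
    (fun x => by rw [h1, h2]; simp only [tqP_vec]; ring)
    (by rw [h1, h2]; simp [Fin.prod_univ_four]) rfl rfl hp1 hp2
  have d3 := det_tqMat_add_eq hχ hM s (c := c₃) (c' := c₂)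
    (fun x => by rw [h3, h2]; simp only [tqP_vec]; ring)
    (by rw [h3, h2]; simp [Fin.prod_univ_four]) rfl rfl hp3 hp2
  have hneg : ∀ x : ℂ, (-x) ^ (2 * M + 1) = -x ^ (2 * M + 1) := fun x => Odd.neg_pow ⟨M, rfl⟩ x
  have v1 : ∏ j, (1 + c₁ j ^ (2 * M + 1)) = 4 * (1 + 2 ^ (2 * M + 1)) ^ 2 := by
    rw [h1, Fin.prod_univ_four]
    change (1 + (1 : ℂ) ^ (2 * M + 1)) * (1 + 2 ^ (2 * M + 1)) * (1 + 1 ^ (2 * M + 1)) *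
      (1 + 2 ^ (2 * M + 1)) = _
    rw [one_pow]; ring
  have v2 : ∏ j, (1 + c₂ j ^ (2 * M + 1)) = 4 * (1 - 2 ^ (2 * M + 1)) ^ 2 := by
    rw [h2, Fin.prod_univ_four]
    change (1 + (1 : ℂ) ^ (2 * M + 1)) * (1 + (-2) ^ (2 * M + 1)) * (1 + 1 ^ (2 * M + 1)) *
      (1 + (-2) ^ (2 * M + 1)) = _
    rw [one_pow, hneg]; ring
  have v3 : ∏ j, (1 + c₃ j ^ (2 * M + 1)) = 0 :=
    Finset.prod_eq_zero (Finset.mem_univ 2) (by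
      change 1 + (-1 : ℂ) ^ (2 * M + 1) = 0
      rw [hneg, one_pow]; ring)
  rw [v1, v2] at d1
  rw [v3, v2] at d3
  refine separable_charpoly_of_shifts_isHermitian H1 H2 H3 (α := 16 * 2 ^ (2 * M + 1))
    (β := 4 * (1 - 2 ^ (2 * M + 1)) ^ 2) (by positivity) ?_ (Polynomial.funext fun μ => ?_)
    (Polynomial.funext fun μ => ?_)
  · have : (1 : ℝ) < 2 ^ (2 * M + 1) := one_lt_pow₀ (by norm_num) (by omega)
    have h : (1 : ℝ) - 2 ^ (2 * M + 1) ≠ 0 := by linarith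
    positivity
  · rw [eval_sub, eval_C, eval_charpoly_redHam hχ, eval_charpoly_redHam hχ]
    push_cast
    linear_combination d1 (χ (-1) * μ)
  · rw [eval_add, eval_C, eval_charpoly_redHam hχ, eval_charpoly_redHam hχ]
    push_cast
    linear_combination d3 (χ (-1) * μ)

end Separable

end BaxterTQ

namespace BaxterTQ

/-! ### Eigenvalues and eigenspaces of the T-Q equation. -/

section Eigenvalues

variable {M : ℕ} {χ : AddChar (Site M) ℂ} {s : Site M} {c : Fin 4 → ℂ} {lam : ℂ}

variable (χ s c) in
/-- The eigenvalue polynomial with the coefficient `lam` of `x²`. -/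
noncomputable def tqLambda (lam : ℂ) : ℂ[X] := tqL χ s (fun j => C (c j)) (C lam) X

theorem eval_tqLambda (x : ℂ) : (tqLambda χ s c lam).eval x = tqL χ s c lam x :=
  eval_tqL χ s c lam x

variable (χ s c) in
theorem tqLambda_injective : Function.Injective (tqLambda χ s c) := fun a b h => by
  have := congrArg (eval 1) h
  rw [eval_tqLambda, eval_tqLambda, tqL, tqL] at this
  linear_combination this

theorem tqLambda_eq : tqLambda χ s c lam = C (χ s + χ (-s)) + C lam * X ^ 2 +
    C (χ (-2) * (χ s + χ (-s)) * ∏ j, c j) * X ^ 4 := Polynomial.funext fun x => by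
  rw [eval_tqLambda, tqL]
  simp only [eval_add, eval_mul, eval_C, eval_pow, eval_X, Algebra.algebraMap_self,
    RingHom.id_apply]

theorem tqEquation_iff {L : ℕ} {q : ℂ} {m : ℕ} {cs : Fin L → ℂ} {Λ Q : ℂ[X]} :
    TQEquation q m cs Λ Q ↔ ∀ x, Λ.eval x * Q.eval x =
      (q ^ m)⁻¹ * (∏ j, (1 + cs j * -(x * q⁻¹))) * Q.eval (x * q⁻¹) +
        q ^ m * (∏ j, (1 + cs j * x)) * Q.eval (x * q) := by
  have key : ∀ x, (C ((q ^ m)⁻¹) * (∏ j, (1 - C (cs j * q⁻¹) * X)) * Q.comp (C q⁻¹ * X) +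
      C (q ^ m) * (∏ j, (1 + C (cs j) * X)) * Q.comp (C q * X)).eval x =
      (q ^ m)⁻¹ * (∏ j, (1 + cs j * -(x * q⁻¹))) * Q.eval (x * q⁻¹) +
        q ^ m * (∏ j, (1 + cs j * x)) * Q.eval (x * q) := fun x => by
    simp only [eval_mul, eval_add, eval_sub, eval_one, eval_C, eval_X, eval_comp, eval_prod]
    rw [mul_comm x, mul_comm x]
    congr 3
    exact Finset.prod_congr rfl fun j _ => by ring
  simp only [← key, ← eval_mul]
  exact ⟨fun h x => congrArg (eval x) h, Polynomial.funext⟩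

theorem tqEquation_iff_isTQ {L : ℕ} {m : ℕ} {cs : Fin L → ℂ} {Q : ℂ[X]}
    (hP : ∀ x, tqP c x = ∏ j, (1 + cs j * x)) :
    TQEquation (χ 1) m cs (tqLambda χ m c lam) Q ↔ IsTQ χ m c lam Q := by
  rw [tqEquation_iff, isTQ_iff]
  refine forall_congr' fun x => ?_
  rw [eval_tqLambda, hP, hP, AddChar.map_neg_eq_inv, AddChar.map_neg_eq_inv, chi_natCast]
  constructor <;> intro h <;> linear_combination h

theorem det_tqMat_eq_zero_of_isTQ (hχ : Function.Injective χ) {Q : ℂ[X]} (hQ0 : Q ≠ 0)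
    (hQ : IsTQ χ s c lam Q) : (tqMat χ s c lam 1).det = 0 := by
  -- The factor `X` provides a non-zero `x`, so that `x^{2N}` can be cancelled.
  obtain ⟨x, hx⟩ : ∃ x, (X * Q).eval x ≠ 0 := by
    by_contra! h
    exact mul_ne_zero X_ne_zero hQ0 (Polynomial.funext fun x => by rw [h x, eval_zero])
  rw [eval_mul, eval_X] at hx
  have h : (tqMat χ s c lam x).det = 0 := exists_mulVec_eq_zero_iff.mp
    ⟨_, fun h => right_ne_zero_of_mul hx (by simpa using congrFun h 0), hQ.mulVec_eq_zero x⟩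
  rw [det_tqMat s c lam hχ] at h
  exact (mul_eq_zero.mp h).resolve_right (pow_ne_zero _ (left_ne_zero_of_mul hx))

variable (χ s c) in
/-- The polynomial whose roots are the coefficients of `x²` of the eigenvalues. -/
noncomputable def spectralPoly : ℂ[X] := C 1 * (redHam χ s c).charpoly.comp (C (χ 1) * X)

theorem eval_spectralPoly (hχ : Function.Injective χ) (z : ℂ) :
    (tqMat χ s c z 1).det = (spectralPoly χ s c).eval z := by
  rw [spectralPoly, eval_mul, eval_C, one_mul, eval_comp, eval_charpoly_redHam hχ]
  simp only [eval_mul, eval_C, eval_X]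
  rw [← mul_assoc, ← AddChar.map_add_eq_mul, neg_add_cancel, AddChar.map_zero_eq_one, one_mul]

theorem separable_spectralPoly (h : (redHam χ s c).charpoly.Separable) :
    (spectralPoly χ s c).Separable :=
  separable_C_mul_comp h one_ne_zero (chi_ne_zero χ 1)

theorem natDegree_spectralPoly : (spectralPoly χ s c).natDegree = 2 * M + 1 := by
  rw [spectralPoly, natDegree_C_mul one_ne_zero, natDegree_comp, charpoly_natDegree_eq_dim,
    ZMod.card, natDegree_C_mul_X _ (chi_ne_zero χ 1), mul_one]

variable (χ s c) in
/-- The coefficients of `x²` of the eigenvalues. -/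
def spectrumTQ : Set ℂ := {lam | (tqMat χ s c lam 1).det = 0}

theorem spectrumTQ_eq_rootSet (hχ : Function.Injective χ) :
    spectrumTQ χ s c = (spectralPoly χ s c).rootSet ℂ := by
  have h0 : spectralPoly χ s c ≠ 0 := fun h => by
    have := natDegree_spectralPoly (χ := χ) (s := s) (c := c)
    rw [h, natDegree_zero] at this
    omega
  ext z
  rw [spectrumTQ, Set.mem_ofPred_eq, eval_spectralPoly hχ, mem_rootSet_of_ne h0, coe_aeval_eq_eval]

theorem ncard_spectrumTQ (hχ : Function.Injective χ) (h : (redHam χ s c).charpoly.Separable) :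
    (spectrumTQ χ s c).ncard = 2 * M + 1 := by
  rw [spectrumTQ_eq_rootSet hχ, ← Nat.card_coe_set_eq, Nat.card_eq_fintype_card,
    card_rootSet_eq_natDegree (separable_spectralPoly h) (IsAlgClosed.splits _),
    natDegree_spectralPoly]

theorem derivative_spectralPoly_ne_zero (hχ : Function.Injective χ)
    (h : (redHam χ s c).charpoly.Separable)
    (hlam : lam ∈ spectrumTQ χ s c) : (derivative (spectralPoly χ s c)).eval lam ≠ 0 := by
  obtain ⟨u, v, huv⟩ := separable_spectralPoly h
  intro h0
  have h1 := congrArg (eval lam) huv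
  rw [spectrumTQ, Set.mem_ofPred_eq, eval_spectralPoly hχ] at hlam
  rw [eval_add, eval_mul, eval_mul, hlam, h0] at h1
  simp at h1

theorem spectrumTQ_neg : spectrumTQ χ (-s) c = spectrumTQ χ s c := by
  ext z
  rw [spectrumTQ, spectrumTQ, Set.mem_ofPred_eq, Set.mem_ofPred_eq, det_tqMat_neg_sector]

theorem admissible_three_iff {m : ℕ} {cs : Fin 3 → ℂ} {Λ : ℂ[X]} :
    Admissible 3 (χ 1) m Λ ↔ ∃ lam, Λ = tqLambda χ m (extend3 cs) lam := by
  have hc : ∏ j, extend3 cs j = 0 := Finset.prod_eq_zero (Finset.mem_univ 3) rfl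
  have hq : χ (m : Site M) + χ (-(m : Site M)) = χ 1 ^ m + (χ 1 ^ m)⁻¹ := by
    rw [AddChar.map_neg_eq_inv, chi_natCast]
  constructor
  · rintro ⟨h1, h2, h3⟩
    have hev : ∀ x, Λ.eval x = Λ.coeff 0 + Λ.coeff 1 * x + Λ.coeff 2 * x ^ 2 := fun x => by
      rw [eval_eq_sum_range' (n := 3) (by omega)]
      simp [Finset.sum_range_succ]
    have h4 := congrArg (eval 1) h2
    rw [eval_comp, eval_neg, eval_X, hev, hev] at h4
    rw [hev] at h3
    refine ⟨Λ.coeff 2, Polynomial.funext fun x => ?_⟩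
    rw [hev, tqLambda_eq, hc, hq]
    simp only [eval_add, eval_mul, eval_C, eval_pow, eval_X]
    linear_combination h3 - x / 2 * h4
  · rintro ⟨lam, rfl⟩
    rw [tqLambda_eq, hc, mul_zero, C_0, zero_mul, add_zero, hq]
    refine ⟨?_, ?_, ?_⟩
    · refine natDegree_add_le_of_degree_le ?_ ?_
      · rw [natDegree_C]; exact Nat.zero_le _
      · exact natDegree_C_mul_X_pow_le _ _
    · simp
    · simp

theorem reciprocal_iff {m : ℕ} (hc : ∏ j, c j = χ 2) {Λ : ℂ[X]} :
    Reciprocal (χ 1) m Λ ↔ ∃ lam, Λ = tqLambda χ m c lam := by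
  have h2 : χ (-2) * χ 2 = 1 := by
    rw [← AddChar.map_add_eq_mul, neg_add_cancel, AddChar.map_zero_eq_one]
  refine exists_congr fun lam => ?_
  rw [tqLambda_eq, hc, mul_right_comm, h2, one_mul, AddChar.map_neg_eq_inv, chi_natCast]

/-- The spectrum is simple, and there is no solution with the inverse multiplier and a
nonzero constant term. -/
structure IsGenericTQ (χ : AddChar (Site M) ℂ) (m : ℕ) (c : Fin 4 → ℂ) : Prop where
  separable : (redHam χ m c).charpoly.Separable
  coeff_zero : m = 0 ∨ ∀ lam ∈ spectrumTQ χ m c, ∀ R, IsTQ χ (-(m : Site M)) c lam R →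
    R.coeff 0 = 0

theorem isGenericTQ_of_ne_zero (hχ : Function.Injective χ) {m : ℕ}
    (h : (redHam χ m c).charpoly.Separable)
    (hO : m = 0 ∨ tqObstruction χ m c (2 * m) ≠ 0) : IsGenericTQ χ m c := by
  refine ⟨h, ?_⟩
  rcases Nat.eq_zero_or_pos m with hm | hm
  · exact Or.inl hm
  refine Or.inr fun lam hlam R hR => ?_
  have h1 := (tqObstruction_ne_zero_iff _).mp (hO.resolve_left hm.ne') (χ 1 * lam) (by
    rw [IsRoot, eval_charpoly_redHam hχ, ← mul_assoc, ← AddChar.map_add_eq_mul, neg_add_cancel,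
      AddChar.map_zero_eq_one, one_mul]
    exact hlam)
  rw [← mul_assoc, ← AddChar.map_add_eq_mul, neg_add_cancel, AddChar.map_zero_eq_one,
    one_mul] at h1
  exact coeff_zero_of_det_tqRec_ne_zero hm rfl h1 hR

theorem tqEigenspace_eq_span {L m : ℕ} {cs : Fin L → ℂ} (hP : ∀ x, tqP c x = ∏ j, (1 + cs j * x))
    {Q : ℂ[X]} (hQ : IsTQ χ m c lam Q) (hd : Q.natDegree ≤ M * L - m)
    (hu : ∀ R, R.natDegree ≤ M * L - m → IsTQ χ m c lam R → ∃ a, R = C a * Q) :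
    tqEigenspace M (χ 1) m cs (tqLambda χ m c lam) = Submodule.span ℂ {Q} := by
  ext R
  rw [Submodule.mem_span_singleton]
  have hR : R ∈ tqEigenspace M (χ 1) m cs (tqLambda χ m c lam) ↔
      R.natDegree ≤ M * L - m ∧ IsTQ χ m c lam R := and_congr_right fun _ => tqEquation_iff_isTQ hP
  rw [hR]
  constructor
  · rintro ⟨h1, h2⟩
    obtain ⟨a, rfl⟩ := hu R h1 h2
    exact ⟨a, smul_eq_C_mul _⟩
  · rintro ⟨a, rfl⟩
    rw [smul_eq_C_mul]
    exact ⟨(natDegree_C_mul_le _ _).trans hd, hQ.C_mul a⟩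

theorem mem_spectrumTQ_of_tqEigenspace_ne_bot (hχ : Function.Injective χ) {L m : ℕ}
    {cs : Fin L → ℂ} (hP : ∀ x, tqP c x = ∏ j, (1 + cs j * x))
    (h : tqEigenspace M (χ 1) m cs (tqLambda χ m c lam) ≠ ⊥) : lam ∈ spectrumTQ χ m c := by
  obtain ⟨Q, ⟨_, hQ⟩, hQ0⟩ := Submodule.exists_mem_ne_zero_of_ne_bot h
  exact det_tqMat_eq_zero_of_isTQ hχ hQ0 ((tqEquation_iff_isTQ hP).mp hQ)

theorem span_singleton_ne_bot {Q : ℂ[X]} (hQ : Q.Monic) : Submodule.span ℂ {Q} ≠ ⊥ := by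
  rw [Ne, Submodule.span_singleton_eq_bot]
  exact hQ.ne_zero

theorem extend3_prod (cs : Fin 3 → ℂ) (x : ℂ) : tqP (extend3 cs) x = ∏ j, (1 + cs j * x) :=
  tqP_extend3 cs x

section Three

variable {m : ℕ} {cs : Fin 3 → ℂ}

theorem exists_monic_tqEigenspace_three (hχ : Function.Injective χ) (hm : m ≤ M)
    (hcs : cs 0 * cs 1 * cs 2 ≠ 0) (hG : IsGenericTQ χ m (extend3 cs))
    (hlam : lam ∈ spectrumTQ χ m (extend3 cs)) : ∃ Q : ℂ[X], Q.Monic ∧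
      Q.natDegree = 3 * M - m ∧ Q.eval 0 ≠ 0 ∧
      tqEigenspace M (χ 1) m cs (tqLambda χ m (extend3 cs) lam) = Submodule.span ℂ {Q} := by
  obtain ⟨Q, h1, h2, h3, h4, h5⟩ := exists_monic_isTQ_three hχ hm rfl (show extend3 cs 3 = 0 from rfl)
    (by change cs 1 * cs 2 * cs 0 ≠ 0; rwa [show cs 1 * cs 2 * cs 0 = cs 0 * cs 1 * cs 2 by ring])
    _ (eval_spectralPoly hχ) (by rw [← eval_spectralPoly hχ]; exact hlam)
    (derivative_spectralPoly_ne_zero hχ hG.separable hlam)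
    (hG.coeff_zero.imp (fun h => by rw [h, Nat.cast_zero]) fun h => h lam hlam)
  refine ⟨Q, h1, h2, by rwa [← coeff_zero_eq_eval_zero], ?_⟩
  exact tqEigenspace_eq_span (extend3_prod cs) h4 (by omega) h5

theorem tqEigenvalues_three (hχ : Function.Injective χ) (hm : m ≤ M)
    (hcs : cs 0 * cs 1 * cs 2 ≠ 0) (hG : IsGenericTQ χ m (extend3 cs)) :
    tqEigenvalues M (χ 1) m cs = tqLambda χ m (extend3 cs) '' spectrumTQ χ m (extend3 cs) := by
  ext Λ
  constructor
  · rintro ⟨h1, h2⟩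
    obtain ⟨lam, rfl⟩ := (admissible_three_iff (cs := cs)).mp h1
    exact ⟨lam, mem_spectrumTQ_of_tqEigenspace_ne_bot hχ (extend3_prod cs) h2, rfl⟩
  · rintro ⟨lam, hlam, rfl⟩
    obtain ⟨Q, h1, h2, h3, h4⟩ := exists_monic_tqEigenspace_three hχ hm hcs hG hlam
    exact ⟨admissible_three_iff.mpr ⟨lam, rfl⟩, by rw [h4]; exact span_singleton_ne_bot h1⟩

end Three

/-! ### The symmetric equation and the signs of the reflection. -/

section Four

variable {m : ℕ}

theorem exists_monic_tqEigenspace_four (hχ : Function.Injective χ) (hm : m ≤ M) (hM : 1 ≤ M)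
    (hc : IsReciprocal χ c) (hG : IsGenericTQ χ m c)
    (hlam : lam ∈ spectrumTQ χ m c) : ∃ Q : ℂ[X], Q.Monic ∧
      Q.natDegree = 4 * M - 2 * m ∧ Q.eval 0 ≠ 0 ∧ (Q.reverse = Q ∨ Q.reverse = -Q) ∧
      tqEigenspace M (χ 1) m c (tqLambda χ m c lam) = Submodule.span ℂ {Q} := by
  obtain ⟨Q, h1, h2, h3, h4, h5, h6⟩ := exists_monic_isTQ_four hχ hm hM rfl hc
    _ (eval_spectralPoly hχ) (by rw [← eval_spectralPoly hχ]; exact hlam)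
    (derivative_spectralPoly_ne_zero hχ hG.separable hlam)
    (hG.coeff_zero.imp (fun h => by rw [h, Nat.cast_zero]) fun h => h lam hlam)
  refine ⟨Q, h1, h2, by rwa [← coeff_zero_eq_eval_zero], h5, ?_⟩
  exact tqEigenspace_eq_span (fun _ => rfl) h4 (by omega) h6

theorem symTQEigenvalues_eq (hχ : Function.Injective χ) (hm : m ≤ M) (hM : 1 ≤ M)
    (hc : IsReciprocal χ c) (hG : IsGenericTQ χ m c) :
    symTQEigenvalues M (χ 1) m c = tqLambda χ m c '' spectrumTQ χ m c := by
  ext Λ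
  constructor
  · rintro ⟨h1, h2⟩
    obtain ⟨lam, rfl⟩ := (reciprocal_iff hc.1).mp h1
    exact ⟨lam, mem_spectrumTQ_of_tqEigenspace_ne_bot hχ (fun _ => rfl) h2, rfl⟩
  · rintro ⟨lam, hlam, rfl⟩
    obtain ⟨Q, h1, h2, h3, h4, h5⟩ := exists_monic_tqEigenspace_four hχ hm hM hc hG hlam
    exact ⟨(reciprocal_iff hc.1).mpr ⟨lam, rfl⟩, by rw [h5]; exact span_singleton_ne_bot h1⟩

/-- The reflection `x ↦ x⁻¹` on the orbit of `1`, acting on polynomials of degree `d`. -/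
noncomputable def orbitReflection (χ : AddChar (Site M) ℂ) (d : ℕ) : Matrix (Site M) (Site M) ℂ :=
  of fun k l => if l = -k then χ (d * k) else 0

theorem orbitReflection_mulVec (d : ℕ) (v : Site M → ℂ) (k : Site M) :
    (orbitReflection χ d *ᵥ v) k = χ (d * k) * v (-k) := by
  simp [orbitReflection, mulVec, dotProduct, ite_mul]

/-- For odd `N` the only fixed point of `k ↦ -k` is `0`. -/
theorem trace_orbitReflection (d : ℕ) : (orbitReflection χ d).trace = 1 := by
  rw [Matrix.trace, Finset.sum_eq_single 0]
  · simp [orbitReflection]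
  · intro k _ hk
    simp only [orbitReflection, diag_apply, of_apply]
    rw [if_neg]
    intro h
    exact hk (two_mul_eq_zero_iff.mp (by linear_combination h))
  · simp

theorem orbitReflection_mulVec_eval (Q : ℂ[X]) {ε : ℂ} (h : Q.reverse = C ε * Q) :
    orbitReflection χ Q.natDegree *ᵥ (fun k => Q.eval (χ k)) = ε • fun k => Q.eval (χ k) := by
  ext k
  rw [orbitReflection_mulVec, Pi.smul_apply, smul_eq_mul]
  have h1 := eval_reflect (le_refl Q.natDegree) (chi_ne_zero χ k)
  rw [show reflect Q.natDegree Q = Q.reverse from rfl, h, eval_mul, eval_C,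
    ← AddChar.map_neg_eq_inv, ← chi_mul_natCast] at h1
  rw [h1, mul_comm k]

theorem card_eq_of_sum_eq_one {ι : Type*} [Fintype ι] {ε : ι → ℂ} (h1 : ∑ i, ε i = 1)
    (h2 : ∀ i, ε i = 1 ∨ ε i = -1) (hN : Fintype.card ι = 2 * M + 1) :
    {i | ε i = 1}.ncard = M + 1 ∧ {i | ε i = -1}.ncard = M := by
  classical
  have hc : ∀ z : ℂ, {i | ε i = z}.ncard = (Finset.univ.filter fun i => ε i = z).card := fun z => by
    rw [Set.ncard_eq_toFinset_card', Set.toFinset_ofPred]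
  rw [hc, hc]
  have hneg : (Finset.univ.filter fun i => ¬ ε i = 1) = Finset.univ.filter fun i => ε i = -1 :=
    Finset.filter_congr fun i _ => ⟨(h2 i).resolve_left, fun h h' => by
      rw [h] at h'; norm_num at h'⟩
  have hcard := Finset.card_filter_add_card_filter_not (s := Finset.univ) (p := fun i => ε i = 1)
  have hsum := Finset.sum_filter_add_sum_filter_not Finset.univ (fun i => ε i = 1) ε
  rw [hneg, Finset.card_univ, hN] at hcard
  rw [hneg, h1, Finset.sum_congr rfl fun i hi => (Finset.mem_filter.mp hi).2,
    Finset.sum_congr (s₁ := Finset.univ.filter fun i => ε i = -1) rfl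
      fun i hi => (Finset.mem_filter.mp hi).2, Finset.sum_const, Finset.sum_const] at hsum
  simp only [nsmul_eq_mul, mul_one, mul_neg] at hsum
  have : (Finset.univ.filter fun i => ε i = 1).card =
      (Finset.univ.filter fun i => ε i = -1).card + 1 := by
    have h3 : ((Finset.univ.filter fun i => ε i = 1).card : ℂ) =
      (Finset.univ.filter fun i => ε i = -1).card + 1 := by linear_combination hsum
    exact_mod_cast h3
  omega

/-- The values of the `Q i` on the orbit of `1` are eigenvectors of `tqHam` with `N` different
eigenvalues, hence a basis. The reflection is diagonal in it with entries `ε i`, and its trace is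
`1`. -/
theorem sum_reflection_sign_eq_one {ι : Type*} [Fintype ι] (hcard : Fintype.card ι = 2 * M + 1)
    {z : ι → ℂ} (hz : Function.Injective z) {Q : ι → ℂ[X]} {ε : ι → ℂ} {d : ℕ}
    (hdeg : ∀ i, (Q i).natDegree = d) (hrev : ∀ i, (Q i).reverse = C (ε i) * Q i)
    (hTQ : ∀ i, IsTQ χ s c (z i) (Q i)) (hQ0 : ∀ i, ∃ k, (Q i).eval (χ k) ≠ 0) :
    ∑ i, ε i = 1 := by
  have heig : ∀ i, Module.End.HasEigenvector (tqHam χ s c).toLin' (χ 1 * z i)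
      (fun k => (Q i).eval (χ k)) := fun i => by
    obtain ⟨k, hk⟩ := hQ0 i
    refine ⟨Module.End.mem_eigenspace_iff.mpr ?_, fun h => hk (congrFun h k)⟩
    have h1 := (hTQ i).mulVec_eq_zero 1
    simp only [one_mul] at h1
    rw [tqMat_eq_add, add_mulVec, smul_mulVec] at h1
    rw [toLin'_apply, tqHam, neg_mulVec, ← mulVec_mulVec, eq_neg_of_add_eq_zero_left h1, mulVec_neg,
      neg_neg, mulVec_smul]
    ext k
    simp only [Pi.smul_apply, mulVec_diagonal, smul_eq_mul, one_mul]
    have h3 : χ (1 - 2 * k) * χ k ^ 2 = χ 1 := by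
      rw [← AddChar.map_nsmul_eq_pow, ← AddChar.map_add_eq_mul]
      congr 1
      simp
    linear_combination z i * (Q i).eval (χ k) * h3
  have hli := Module.End.eigenvectors_linearIndependent' _ (fun i => χ 1 * z i)
    (fun i j h => hz (mul_left_cancel₀ (chi_ne_zero χ 1) h)) _ heig
  have : Nonempty ι := Fintype.card_pos_iff.mp (by omega)
  have hfr : Fintype.card ι = Module.finrank ℂ (Site M → ℂ) := by
    rw [Module.finrank_fintype_fun_eq_card, ZMod.card]; exact hcard
  obtain ⟨b, hb⟩ : ∃ b : Module.Basis ι ℂ (Site M → ℂ), ∀ i, b i = fun k => (Q i).eval (χ k) :=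
    ⟨basisOfLinearIndependentOfCardEqFinrank hli hfr, fun i => by
      rw [coe_basisOfLinearIndependentOfCardEqFinrank]⟩
  have hJ : ∀ i, (orbitReflection χ d).toLin' (b i) = ε i • b i := fun i => by
    rw [hb, toLin'_apply, ← hdeg i]
    exact orbitReflection_mulVec_eval _ (hrev i)
  classical
  rw [← trace_orbitReflection (χ := χ) d, ← trace_toLin'_eq,
    LinearMap.trace_eq_matrix_trace ℂ b, Matrix.trace]
  refine Finset.sum_congr rfl fun i _ => ?_
  rw [diag_apply, LinearMap.toMatrix_apply, hJ, map_smul, b.repr_self]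
  simp

/-- One-dimensionality of the eigenspace makes `Q` a solution of minimal degree, which cannot vanish
on an orbit. -/
theorem exists_eval_chi_ne_zero (hχ : Function.Injective χ) {Q : ℂ[X]} (hQ : Q.Monic)
    (hTQ : IsTQ χ m c lam Q)
    (hspan : tqEigenspace M (χ 1) m c (tqLambda χ m c lam) = Submodule.span ℂ {Q}) :
    ∃ k, Q.eval (χ k) ≠ 0 := by
  have hmem : Q ∈ tqEigenspace M (χ 1) m c (tqLambda χ m c lam) := by
    rw [hspan]; exact Submodule.mem_span_singleton_self _
  obtain ⟨k, hk⟩ := exists_eval_orbit_ne_zero hχ hQ.ne_zero hTQ (fun R hR0 hR => by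
    by_contra! hd
    have hR' : R ∈ tqEigenspace M (χ 1) m c (tqLambda χ m c lam) :=
      ⟨hd.le.trans hmem.1, (tqEquation_iff_isTQ fun _ => rfl).mpr hR⟩
    rw [hspan, Submodule.mem_span_singleton] at hR'
    obtain ⟨a, rfl⟩ := hR'
    have ha : a ≠ 0 := by rintro rfl; exact hR0 (zero_smul _ _)
    rw [smul_eq_C_mul, natDegree_C_mul ha] at hd
    exact lt_irrefl _ hd) one_ne_zero
  rw [one_mul] at hk
  exact ⟨k, hk⟩

theorem eq_of_monic_of_mem_span {P Q : ℂ[X]} (hP : P.Monic) (hQ : Q.Monic)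
    (h : P ∈ Submodule.span ℂ {Q}) : P = Q := by
  obtain ⟨a, rfl⟩ := Submodule.mem_span_singleton.mp h
  have h1 := hP.leadingCoeff
  rw [smul_eq_C_mul, leadingCoeff_mul, leadingCoeff_C, hQ.leadingCoeff, mul_one] at h1
  rw [h1, one_smul]

theorem ncard_reverse (hχ : Function.Injective χ) (hm : m ≤ M) (hM : 1 ≤ M)
    (hc : IsReciprocal χ c) (hG : IsGenericTQ χ m c) :
    {Q ∈ symTQEigenpolynomials M (χ 1) m c | Q.reverse = Q}.ncard = M + 1 ∧
    {Q ∈ symTQEigenpolynomials M (χ 1) m c | Q.reverse = -Q}.ncard = M := by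
  have hex : ∀ i : spectrumTQ χ m c, ∃ (Q : ℂ[X]) (ε : ℂ), Q.Monic ∧
      Q.natDegree = 4 * M - 2 * m ∧ (ε = 1 ∨ ε = -1) ∧ Q.reverse = C ε * Q ∧
      tqEigenspace M (χ 1) m c (tqLambda χ m c i.1) = Submodule.span ℂ {Q} := fun i => by
    obtain ⟨Q, h1, h2, h3, h4, h5⟩ := exists_monic_tqEigenspace_four hχ hm hM hc hG i.2
    rcases h4 with h4 | h4
    · exact ⟨Q, 1, h1, h2, Or.inl rfl, by rw [h4, C_1, one_mul], h5⟩
    · exact ⟨Q, -1, h1, h2, Or.inr rfl, by rw [h4, C_neg, C_1, neg_one_mul], h5⟩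
  choose Q ε hmon hdeg hε hrev hspan using hex
  have hfin : (spectrumTQ χ m c).Finite := by
    rw [spectrumTQ_eq_rootSet hχ]; exact rootSet_finite _ _
  have : Fintype (spectrumTQ χ m c) := hfin.fintype
  have hcard : Fintype.card (spectrumTQ χ m c) = 2 * M + 1 := by
    refine Eq.trans ?_ (ncard_spectrumTQ hχ hG.separable)
    rw [← Nat.card_coe_set_eq, Nat.card_eq_fintype_card]
  have hmem : ∀ i : spectrumTQ χ m c, Q i ∈ tqEigenspace M (χ 1) m c (tqLambda χ m c i.1) :=
    fun i => by rw [hspan]; exact Submodule.mem_span_singleton_self _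
  have hTQ : ∀ i : spectrumTQ χ m c, IsTQ χ m c i.1 (Q i) := fun i =>
    (tqEquation_iff_isTQ fun _ => rfl).mp (hmem i).2
  have htr : ∑ i, ε i = 1 := sum_reflection_sign_eq_one hcard (z := fun i => i.1)
    Subtype.val_injective hdeg hrev hTQ
    fun i => exists_eval_chi_ne_zero hχ (hmon i) (hTQ i) (hspan i)
  obtain ⟨c1, c2⟩ := card_eq_of_sum_eq_one htr hε hcard
  have hinj : Function.Injective Q := fun i j hij => by
    have h1 := (hmem i).2
    have h2 := (hmem j).2
    rw [hij] at h1
    exact Subtype.ext (tqLambda_injective χ m c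
      (mul_right_cancel₀ (hmon j).ne_zero (h1.trans h2.symm)))
  have hset : ∀ z : ℂ, {P ∈ symTQEigenpolynomials M (χ 1) m c | P.reverse = C z * P} =
      Q '' {i | ε i = z} := fun z => by
    ext P
    constructor
    · rintro ⟨⟨h1, Λ, h2, h3⟩, h4⟩
      rw [symTQEigenvalues_eq hχ hm hM hc hG] at h2
      obtain ⟨lam, hlam, rfl⟩ := h2
      have h5 := hspan ⟨lam, hlam⟩
      rw [h5] at h3
      have h6 := eq_of_monic_of_mem_span h1 (hmon ⟨lam, hlam⟩) h3
      refine ⟨⟨lam, hlam⟩, ?_, h6.symm⟩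
      rw [h6, hrev] at h4
      exact C_injective (mul_right_cancel₀ (hmon ⟨lam, hlam⟩).ne_zero h4)
    · rintro ⟨i, rfl, rfl⟩
      refine ⟨⟨hmon i, tqLambda χ m c i.1, ?_, hmem i⟩, hrev i⟩
      rw [symTQEigenvalues_eq hχ hm hM hc hG]
      exact ⟨i.1, i.2, rfl⟩
  have hs1 := hset 1
  have hs2 := hset (-1)
  simp only [C_neg, C_1, neg_mul, one_mul] at hs1 hs2
  rw [hs1, hs2, Set.ncard_image_of_injective _ hinj, Set.ncard_image_of_injective _ hinj]
  exact ⟨c1, c2⟩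

end Four

end Eigenvalues

end BaxterTQ

namespace BaxterTQ

/-! ### Gauge reduction of rational parameters. -/

section Gauge

variable {M L : ℕ} {χ : AddChar (Site M) ℂ}

theorem exists_chi_eq (hχ : Function.Injective χ) {η : ℂ} (h : η ^ (2 * M + 1) = 1) :
    ∃ e, χ e = η := by
  obtain ⟨i, _, hi⟩ := (isPrimitiveRoot_chi hχ).eq_pow_of_pow_eq_one h
  exact ⟨i, by rw [chi_natCast, hi]⟩

theorem weylX_gauge (e i k : Site M) :
    χ (-(e * i)) * weylX M i k * χ (e * k) = χ (-e) * weylX M i k := by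
  simp only [weylX, of_apply]
  split_ifs with h
  · rw [mul_one, mul_one, ← AddChar.map_add_eq_mul, h]
    congr 1; ring
  · ring

theorem diagonal_gauge (v : Site M → ℂ) (e i k : Site M) :
    χ (-(e * i)) * diagonal v i k * χ (e * k) = diagonal v i k := by
  by_cases h : i = k
  · subst h
    rw [mul_right_comm, ← AddChar.map_add_eq_mul, neg_add_cancel, AddChar.map_zero_eq_one, one_mul]
  · rw [diagonal_apply_ne _ h, mul_zero, zero_mul]

theorem weylY_apply (ω : ℂ) (i k : Site M) : weylY M ω i k = ω ^ i.val * weylX M i k := by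
  rw [weylY, weylZ, diagonal_mul]

/-- Conjugation by a character of the site multiplies `X` by a phase and fixes `Z`. Together with
the auxiliary gauge `diag(ρ, 1)` this normalizes to `a = d = 1`, `b = c`. -/
theorem LOp_gauge {ω : ℂ} {h : Params} {ρ ρ' : ℂ} {e : Site M} (hρ' : ρ' ≠ 0)
    (ha : χ e * (ρ' * h.a) = ρ * h.d) (hb : χ e * h.b = ρ * ρ' * h.c) (hd : h.d ≠ 0)
    (x : ℂ) (s t : Fin 2) (i k : Site M) :
    LOp M ω h x s t i k = h.d * (![ρ, 1] s / ![ρ', 1] t) * (χ (-(e * i)) *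
      LOp M ω ⟨1, h.c * ρ' / h.d, h.c * ρ' / h.d, 1⟩ x s t i k * χ (e * k)) := by
  have h1 : χ e * χ (-e) = 1 := by
    rw [← AddChar.map_add_eq_mul, add_neg_cancel, AddChar.map_zero_eq_one]
  have hX := weylX_gauge (χ := χ) e i k
  have hZ := diagonal_gauge (χ := χ) (fun k : Site M => ω ^ k.val) e i k
  have hI := diagonal_gauge (χ := χ) (fun _ : Site M => (1 : ℂ)) e i k
  fin_cases s <;> fin_cases t
  · simp only [LOp, Fin.zero_eta, of_apply, cons_val_zero, cons_val', Matrix.smul_apply, weylY_apply,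
      smul_eq_mul, cons_val_fin_one]
    field_simp
    linear_combination χ (-e) * ω ^ i.val * weylX M i k * ha -
      ρ' * h.a * ω ^ i.val * weylX M i k * h1 - h.d * ρ * ω ^ i.val * hX
  · simp only [LOp, Fin.zero_eta, Fin.mk_one, of_apply, cons_val_zero, cons_val_one, cons_val',
      Matrix.smul_apply, smul_eq_mul, cons_val_fin_one]
    field_simp
    linear_combination x * χ (-e) * weylX M i k * hb - x * h.b * weylX M i k * h1 -
      x * ρ * ρ' * h.c * hX
  · simp only [LOp, Fin.zero_eta, Fin.mk_one, of_apply, cons_val_zero, cons_val_one, cons_val',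
      Matrix.smul_apply, smul_eq_mul, cons_val_fin_one, weylZ]
    field_simp
    linear_combination -x * h.c * hZ
  · simp only [LOp, Fin.mk_one, of_apply, cons_val_one, cons_val',
      Matrix.smul_apply, smul_eq_mul, cons_val_fin_one]
    rw [show (1 : SiteOp M) = diagonal fun _ => 1 from rfl]
    linear_combination -h.d * hI

theorem IsRational.ne_zero [NeZero L] {q : ℂ} {h : Fin L → Params} {r : Fin L → ℂ}
    (hr : IsRational M q h r) (j : Fin L) : r j ≠ 0 := by
  have h1 := hr.2.1 (j - 1)
  rw [sub_add_cancel] at h1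
  obtain ⟨ha, hb, hc, hd⟩ := hr.1 (j - 1)
  intro h0
  rw [h0] at h1
  exact div_ne_zero (mul_ne_zero hb hd) (mul_ne_zero ha hc) (by rw [← h1]; simp)

/-- At `x = 0` the spectral curve says that `r j * d` and `r (j + 1) * a` have equal `N`-th powers,
so their ratio is a power of `q`. -/
theorem IsRational.exists_gauge [NeZero L] (hχ : Function.Injective χ) {q : ℂ}
    {h : Fin L → Params} {r : Fin L → ℂ} (hr : IsRational M q h r) :
    ∃ e : Fin L → Site M, ∀ j, χ (e j) * (r (j + 1) * (h j).a) = r j * (h j).d := by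
  have key : ∀ j, ∃ e : Site M, χ e * (r (j + 1) * (h j).a) = r j * (h j).d := fun j => by
    have h0 := mul_ne_zero (hr.ne_zero (j + 1)) (hr.1 j).1
    have h1 := hr.2.2 0 0 j
    simp only [pow_zero, mul_one, zero_pow (Nat.succ_ne_zero (2 * M)), mul_zero, zero_mul, zero_sub,
      sub_zero, Odd.neg_one_pow (⟨M, rfl⟩ : Odd (2 * M + 1))] at h1
    obtain ⟨e, he⟩ := exists_chi_eq hχ (η := r j * (h j).d / (r (j + 1) * (h j).a)) (by
      rw [div_pow, mul_pow, mul_pow, div_eq_one_iff_eq (by rw [← mul_pow]; exact pow_ne_zero _ h0)]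
      linear_combination -h1)
    exact ⟨e, by rw [he, div_mul_cancel₀ _ h0]⟩
  exact ⟨fun j => (key j).choose, fun j => (key j).choose_spec⟩

/-- The auxiliary gauge factors telescope in the trace, leaving a conjugation of the chain by a
character. -/
theorem normTransfer_gauge [NeZero L] {ω q : ℂ} {h : Fin L → Params} {r : Fin L → ℂ}
    (hr : IsRational M q h r) {e : Fin L → Site M}
    (he : ∀ j, χ (e j) * (r (j + 1) * (h j).a) = r j * (h j).d) (x : ℂ) (i k : Fin L → Site M) :
    normTransfer M ω h x i k = χ (-∑ l, e l * i l) *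
      normTransfer M ω (stdParams (cStar h r)) x i k * χ (∑ l, e l * k l) := by
  have hb : ∀ j, χ (e j) * (h j).b = r j * r (j + 1) * (h j).c := fun j => by
    obtain ⟨ha, hb, hc, hd⟩ := hr.1 j
    have h1 := hr.2.1 j
    rw [eq_div_iff (mul_ne_zero ha hc)] at h1
    refine mul_right_cancel₀ hd ?_
    linear_combination -χ (e j) * h1 + r (j + 1) * (h j).c * he j
  have hterm : ∀ s : Fin L → Fin 2,
      tensorOp (fun j => LOp M ω (h j) x (s j) (s (j + 1))) i k = (∏ j, (h j).d) *
        (χ (-∑ l, e l * i l) * tensorOp (fun j => LOp M ω (stdParams (cStar h r) j) x (s j)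
          (s (j + 1))) i k * χ (∑ l, e l * k l)) := fun s => by
    have htel : ∏ j, (![r j, (1 : ℂ)] (s j) / ![r (j + 1), (1 : ℂ)] (s (j + 1))) = 1 := by
      have h2 : ∏ j, ![r (j + 1), (1 : ℂ)] (s (j + 1)) = ∏ j, ![r j, (1 : ℂ)] (s j) :=
        Equiv.prod_comp (Equiv.addRight (1 : Fin L)) fun j => ![r j, (1 : ℂ)] (s j)
      rw [Finset.prod_div_distrib, h2, div_self]
      refine Finset.prod_ne_zero_iff.mpr fun j _ => ?_
      generalize s j = t
      fin_cases t
      · exact hr.ne_zero j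
      · exact one_ne_zero
    have hchi : ∀ f : Fin L → Site M, χ (∑ l, f l) = ∏ l, χ (f l) := fun f => by
      induction (Finset.univ : Finset (Fin L)) using Finset.cons_induction with
      | empty => simp
      | cons a S ha ih => rw [Finset.sum_cons, Finset.prod_cons, AddChar.map_add_eq_mul, ih]
    simp only [tensorOp, of_apply]
    rw [Finset.prod_congr rfl fun j _ => LOp_gauge (hr.ne_zero (j + 1)) (he j) (hb j)
      (hr.1 j).2.2.2 x (s j) (s (j + 1)) (i j) (k j)]
    rw [Finset.prod_mul_distrib, Finset.prod_mul_distrib, htel, mul_one, Finset.prod_mul_distrib,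
      Finset.prod_mul_distrib, ← Finset.sum_neg_distrib, hchi, hchi]
    rfl
  have hd : ∏ j, (h j).d ≠ 0 := Finset.prod_ne_zero_iff.mpr fun j _ => (hr.1 j).2.2.2
  have hd' : ∏ j, (stdParams (cStar h r) j).d = 1 := Finset.prod_eq_one fun _ _ => rfl
  rw [normTransfer, normTransfer, hd', inv_one, one_smul, Matrix.smul_apply, transfer, transfer, Matrix.sum_apply,
    Matrix.sum_apply, Finset.sum_congr rfl fun s _ => hterm s, ← Finset.mul_sum, ← Finset.sum_mul,
    ← Finset.mul_sum, smul_eq_mul, inv_mul_cancel_left₀ hd]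

/-- Multiplication by a character of the chain. -/
noncomputable def gaugeVec (χ : AddChar (Site M) ℂ) (e : Fin L → Site M) (φ : (Fin L → Site M) → ℂ) :
    (Fin L → Site M) → ℂ := fun i => χ (∑ l, e l * i l) * φ i

theorem gaugeVec_neg (e : Fin L → Site M) (φ : (Fin L → Site M) → ℂ) :
    gaugeVec χ (-e) (gaugeVec χ e φ) = φ := by
  ext i
  simp only [gaugeVec, Pi.neg_apply, neg_mul, Finset.sum_neg_distrib]
  rw [← mul_assoc, ← AddChar.map_add_eq_mul, neg_add_cancel, AddChar.map_zero_eq_one, one_mul]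

theorem gaugeVec_ne_zero {e : Fin L → Site M} {φ : (Fin L → Site M) → ℂ} (h : φ ≠ 0) :
    gaugeVec χ e φ ≠ 0 := by
  obtain ⟨i, hi⟩ := Function.ne_iff.mp h
  exact fun h => mul_ne_zero (chi_ne_zero χ _) hi (congrFun h i)

theorem gaugeVec_vecMul {e : Fin L → Site M} {φ : (Fin L → Site M) → ℂ} {A B : ChainOp L M}
    (hAB : ∀ i k, A i k = χ (-∑ l, e l * i l) * B i k * χ (∑ l, e l * k l)) {z : ℂ} :
    gaugeVec χ e φ ᵥ* A = z • gaugeVec χ e φ ↔ φ ᵥ* B = z • φ := by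
  have h1 : gaugeVec χ e φ ᵥ* A = gaugeVec χ e (φ ᵥ* B) := by
    ext k
    simp only [vecMul, dotProduct, gaugeVec, Finset.mul_sum]
    refine Finset.sum_congr rfl fun i _ => ?_
    have h2 : χ (∑ l, e l * i l) * χ (-∑ l, e l * i l) = 1 := by
      rw [← AddChar.map_add_eq_mul, add_neg_cancel, AddChar.map_zero_eq_one]
    rw [hAB]
    linear_combination φ i * B i k * χ (∑ l, e l * k l) * h2
  have h2 : z • gaugeVec χ e φ = gaugeVec χ e (z • φ) := by
    ext k
    simp only [Pi.smul_apply, gaugeVec, smul_eq_mul]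
    ring
  rw [h1, h2]
  refine ⟨fun h => ?_, fun h => by rw [h]⟩
  have := congrArg (gaugeVec χ (-e)) h
  rwa [gaugeVec_neg, gaugeVec_neg] at this

theorem isEigenvector_gaugeVec_iff [NeZero L] {ω q : ℂ} {h : Fin L → Params} {r : Fin L → ℂ}
    (hr : IsRational M q h r) {e : Fin L → Site M}
    (he : ∀ j, χ (e j) * (r (j + 1) * (h j).a) = r j * (h j).d)
    {φ : (Fin L → Site M) → ℂ} {Λ : ℂ[X]} :
    IsEigenvector M ω h (gaugeVec χ e φ) Λ ↔
      IsEigenvector M ω (stdParams (cStar h r)) φ Λ := by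
  refine and_congr ⟨fun h0 hφ => h0 ?_, gaugeVec_ne_zero⟩ (forall_congr' fun x =>
    gaugeVec_vecMul (normTransfer_gauge hr he x))
  rw [hφ]
  ext i
  simp [gaugeVec]

theorem gaugeVec_gaugeVec_neg (e : Fin L → Site M) (φ : (Fin L → Site M) → ℂ) :
    gaugeVec χ e (gaugeVec χ (-e) φ) = φ := by
  have := gaugeVec_neg (χ := χ) (-e) φ
  rwa [neg_neg] at this

theorem gaugeVec_vecMul_opC {e : Fin 4 → Site M} {φ : (Fin 4 → Site M) → ℂ} (he : e 1 + e 3 = 2) :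
    gaugeVec χ e φ ᵥ* opC M (χ 2) = gaugeVec χ e φ ↔ φ ᵥ* opC M (χ 2) = χ (-2) • φ := by
  have h : ∀ i k, (χ 2 • opC M (χ 2)) i k = χ 2 * (χ 2 * (χ (-∑ l, e l * i l) * opC M (χ 2) i k *
      χ (∑ l, e l * k l))) := fun i k => by
    have hs : ∀ f : Fin 4 → Site M, χ (∑ l, f l) = χ (f 0) * χ (f 1) * χ (f 2) * χ (f 3) :=
      fun f => by
        rw [Fin.sum_univ_four, AddChar.map_add_eq_mul, AddChar.map_add_eq_mul,
          AddChar.map_add_eq_mul]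
    have h0 := diagonal_gauge (χ := χ) (fun k : Site M => χ 2 ^ k.val) (e 0) (i 0) (k 0)
    have h1 := weylX_gauge (χ := χ) (e 1) (i 1) (k 1)
    have h2 := diagonal_gauge (χ := χ) (fun k : Site M => χ 2 ^ k.val) (e 2) (i 2) (k 2)
    have h3 := weylX_gauge (χ := χ) (e 3) (i 3) (k 3)
    have h4 : χ 2 * (χ (-e 1) * χ (-e 3)) = 1 := by
      rw [← AddChar.map_add_eq_mul, ← AddChar.map_add_eq_mul, ← he,
        ← AddChar.map_zero_eq_one χ]
      congr 1; ring
    have hC : opC M (χ 2) i k = weylZ M (χ 2) (i 0) (k 0) * weylX M (i 1) (k 1) *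
        weylZ M (χ 2) (i 2) (k 2) * weylX M (i 3) (k 3) := by
      simp only [opC, tensorOp, of_apply, Fin.prod_univ_four]; rfl
    rw [Matrix.smul_apply, smul_eq_mul, hC, ← Finset.sum_neg_distrib, hs, hs]
    simp only [weylZ]
    congr 1
    calc _ = χ 2 * (χ (-e 1) * χ (-e 3)) * (diagonal (fun k : Site M => χ 2 ^ k.val) (i 0) (k 0) *
          weylX M (i 1) (k 1) * diagonal (fun k : Site M => χ 2 ^ k.val) (i 2) (k 2) *
          weylX M (i 3) (k 3)) := by rw [h4, one_mul]
      _ = χ 2 * (diagonal (fun k : Site M => χ 2 ^ k.val) (i 0) (k 0) *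
          (χ (-e 1) * weylX M (i 1) (k 1)) *
          diagonal (fun k : Site M => χ 2 ^ k.val) (i 2) (k 2) *
          (χ (-e 3) * weylX M (i 3) (k 3))) := by ring
      _ = _ := by
        conv_lhs => rw [← h0, ← h1, ← h2, ← h3]
        ring
  have h' : ∀ i k, opC M (χ 2) i k = χ (-∑ l, e l * i l) * (χ 2 • opC M (χ 2)) i k *
      χ (∑ l, e l * k l) := fun i k => by
    have := h i k
    rw [Matrix.smul_apply, smul_eq_mul] at this
    rw [Matrix.smul_apply, smul_eq_mul]
    linear_combination mul_left_cancel₀ (chi_ne_zero χ 2) this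
  have key := gaugeVec_vecMul (φ := φ) h' (z := 1)
  rw [one_smul, one_smul, vecMul_smul] at key
  rw [key]
  have h2 : χ (-2) * χ 2 = 1 := by
    rw [← AddChar.map_add_eq_mul, neg_add_cancel, AddChar.map_zero_eq_one]
  constructor
  · intro h3
    rw [← h3, smul_smul, h2, one_smul, h3]
  · intro h3
    rw [h3, smul_smul, mul_comm (χ 2), h2, one_smul]

end Gauge

end BaxterTQ

namespace BaxterTQ

/-! ### Solutions of the T-Q equation and eigenvectors of the chain. -/

section Correspondence

variable {M : ℕ} {χ : AddChar (Site M) ℂ} {s : Site M} {lam : ℂ}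

/-- The Baxter vectors of some orbit span the space of states. -/
def BaxterSpan {L : ℕ} [NeZero L] (χ : AddChar (Site M) ℂ) (c : Fin L → ℂ) : Prop :=
  ∃ x : ℂ, x ≠ 0 ∧ (∀ j, (x * c j) ^ (2 * M + 1) ≠ -1) ∧ (spanMat χ fun j => x * c j).det ≠ 0

theorem exists_eigenvector_redHam (hχ : Function.Injective χ) {c : Fin 4 → ℂ}
    (h : lam ∈ spectrumTQ χ s c) : ∃ g : Site M → ℂ, g ≠ 0 ∧ redHam χ s c *ᵥ g = (χ 1 * lam) • g := by
  rw [← isRoot_charpoly_iff, IsRoot, eval_charpoly_redHam hχ, ← mul_assoc,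
    ← AddChar.map_add_eq_mul, neg_add_cancel, AddChar.map_zero_eq_one, one_mul]
  exact h

theorem chi_neg_one_mul (z : ℂ) : χ (-1) * (χ 1 * z) = z := by
  rw [← mul_assoc, ← AddChar.map_add_eq_mul, neg_add_cancel, AddChar.map_zero_eq_one, one_mul]

theorem tqLambda_neg (c : Fin 4 → ℂ) : tqLambda χ (-s) c lam = tqLambda χ s c lam := by
  rw [tqLambda_eq, tqLambda_eq, neg_neg, add_comm (χ (-s))]

/-- Baxter's vectors give one direction and the embedding of the reduced space the other. The
embedded vectors lie in the sector of `C`, so restricting to that sector loses no eigenvalue. -/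
theorem exists_eigenvector_four_iff (hχ : Function.Injective χ) {c : Fin 4 → ℂ}
    (hc : BaxterSpan χ c) (s : Site M) :
    (∃ φ, φ ᵥ* opC M (χ 2) = χ (-2) • φ ∧
      IsEigenvector M (χ 2) (stdParams c) φ (C (χ s) * tqLambda χ s c lam)) ↔
      lam ∈ spectrumTQ χ s c := by
  simp only [IsEigenvector, normTransfer_stdParams, eval_mul, eval_C, eval_tqLambda]
  constructor
  · rintro ⟨φ, _, h0, h1⟩
    obtain ⟨x, hx, hy, hspan⟩ := hc
    exact det_tqMat_of_eigenvector_four hχ c x hx hy hspan s lam φ h0 h1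
  · intro h
    obtain ⟨g, hg0, hg⟩ := exists_eigenvector_redHam hχ h
    refine ⟨embed4 χ s g, embed4_vecMul_opC χ s g, embed4_ne_zero χ s hg0, fun x => ?_⟩
    rw [embed4_vecMul_transfer χ s c hg, chi_neg_one_mul]

theorem exists_eigenvector_three_iff (hχ : Function.Injective χ) {c : Fin 3 → ℂ}
    (hc : BaxterSpan χ c) (s : Site M) :
    (∃ φ, IsEigenvector M (χ 2) (stdParams c) φ (C (χ s) * tqLambda χ s (extend3 c) lam)) ↔
      lam ∈ spectrumTQ χ s (extend3 c) := by
  simp only [IsEigenvector, normTransfer_stdParams, eval_mul, eval_C, eval_tqLambda]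
  constructor
  · rintro ⟨φ, h0, h1⟩
    obtain ⟨x, hx, hy, hspan⟩ := hc
    exact det_tqMat_of_eigenvector_three hχ c x hx hy hspan s lam φ h0 h1
  · intro h
    obtain ⟨g, hg0, hg⟩ := exists_eigenvector_redHam hχ h
    refine ⟨embed3 χ s g, embed3_ne_zero χ s hg0, fun x => ?_⟩
    rw [embed3_vecMul_transfer χ s c hg, chi_neg_one_mul]

theorem C_chi_neg (m : ℕ) : C (χ 1 ^ m)⁻¹ = C (χ (-(m : Site M))) := by
  rw [AddChar.map_neg_eq_inv, chi_natCast]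

theorem mem_tqEigenvalues_three_iff (hχ : Function.Injective χ) {m : ℕ} (hm : m ≤ M)
    {h : Fin 3 → Params} {r : Fin 3 → ℂ} (hr : IsRational M (χ 1) h r)
    (hcs : cStar h r 0 * cStar h r 1 * cStar h r 2 ≠ 0) (hB : BaxterSpan χ (cStar h r))
    (hG : IsGenericTQ χ m (extend3 (cStar h r))) {Λ : ℂ[X]} (hΛ : Admissible 3 (χ 1) m Λ) :
    (Λ ∈ tqEigenvalues M (χ 1) m (cStar h r) ↔
      ∃ φ, IsEigenvector M (χ 2) h φ (C (χ 1 ^ m) * Λ)) ∧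
    (Λ ∈ tqEigenvalues M (χ 1) m (cStar h r) ↔
      ∃ φ, IsEigenvector M (χ 2) h φ (C (χ 1 ^ m)⁻¹ * Λ)) := by
  obtain ⟨e, he⟩ := hr.exists_gauge hχ
  obtain ⟨lam, rfl⟩ := (admissible_three_iff (cs := cStar h r)).mp hΛ
  have hE : ∀ Λ : ℂ[X], (∃ φ, IsEigenvector M (χ 2) h φ Λ) ↔
      ∃ φ, IsEigenvector M (χ 2) (stdParams (cStar h r)) φ Λ := fun Λ => by
    constructor
    · rintro ⟨φ, hφ⟩
      rw [← gaugeVec_gaugeVec_neg e φ] at hφ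
      exact ⟨_, (isEigenvector_gaugeVec_iff hr he).mp hφ⟩
    · rintro ⟨φ, hφ⟩
      exact ⟨_, (isEigenvector_gaugeVec_iff hr he).mpr hφ⟩
  rw [tqEigenvalues_three hχ hm hcs hG, (tqLambda_injective χ m _).mem_set_image, hE, hE, C_chi_neg]
  constructor
  · rw [← chi_natCast, exists_eigenvector_three_iff hχ hB]
  · rw [← tqLambda_neg, exists_eigenvector_three_iff hχ hB, spectrumTQ_neg]

end Correspondence

/-! ### Generic parameters. -/

section Genericity

variable {M : ℕ} {χ : AddChar (Site M) ℂ}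

section Defs

variable {R S : Type*} [CommRing R] [Algebra ℂ R] [CommRing S] [Algebra ℂ S]

variable (χ) in
/-- The parameters are generic if this does not vanish. -/
noncomputable def genericTQ (m : ℕ) (c : Fin 4 → R) : R :=
  charDisc (redHam χ m c) * tqObstruction χ m c (2 * m)

theorem map_genericTQ (f : R →ₐ[ℂ] S) (m : ℕ) (c : Fin 4 → R) :
    f (genericTQ χ m c) = genericTQ χ m (f ∘ c) := by
  rw [genericTQ, map_mul, map_tqObstruction, genericTQ]
  congr 1
  have h := map_charDisc (f : R →+* S) (redHam χ m c)
  have h2 := map_redHam χ m f c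
  exact h.trans (congrArg charDisc h2)

end Defs

theorem isGenericTQ_of_genericTQ_ne_zero (hχ : Function.Injective χ) {m : ℕ} {c : Fin 4 → ℂ}
    (h : genericTQ χ m c ≠ 0) : IsGenericTQ χ m c :=
  isGenericTQ_of_ne_zero hχ ((charDisc_ne_zero_iff _).mp (left_ne_zero_of_mul h))
    (Or.inr (right_ne_zero_of_mul h))

theorem exists_generic_three (hχ : Function.Injective χ) :
    ∃ G : MvPolynomial (Fin 3) ℂ, G ≠ 0 ∧ ∀ cs, MvPolynomial.eval cs G ≠ 0 →
      cs 0 * cs 1 * cs 2 ≠ 0 ∧ BaxterSpan χ cs ∧ ∀ m ≤ M, IsGenericTQ χ m (extend3 cs) := by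
  set X' : Fin 3 → MvPolynomial (Fin 3) ℂ := MvPolynomial.X with hX
  have haev : ∀ c : Fin 3 → ℂ, (MvPolynomial.aeval c : MvPolynomial (Fin 3) ℂ →ₐ[ℂ] ℂ) ∘ X' = c :=
    aeval_comp_X
  have hext : ∀ c : Fin 3 → ℂ, (MvPolynomial.aeval c : MvPolynomial (Fin 3) ℂ →ₐ[ℂ] ℂ) ∘ extend3 X' =
      extend3 c := fun c => by
    ext j; fin_cases j <;> simp [extend3, hX]
  have hev1 : ∀ (c : Fin 3 → ℂ) (m : ℕ), MvPolynomial.aeval c (genericTQ χ m (extend3 X')) =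
      genericTQ χ m (extend3 c) := fun c m => by rw [map_genericTQ, hext]
  have hev2 : ∀ c : Fin 3 → ℂ, MvPolynomial.aeval c (spanMat χ X').det = (spanMat χ c).det :=
    fun c => by rw [map_det_spanMat, haev]
  have hev3 : ∀ c : Fin 3 → ℂ, MvPolynomial.aeval c (∏ j, (X' j ^ (2 * M + 1) + 1)) =
      ∏ j, (c j ^ (2 * M + 1) + 1) := fun c => by
    simp [hX, map_prod]
  have hev4 : ∀ c : Fin 3 → ℂ, MvPolynomial.aeval c (X' 0 * X' 1 * X' 2) = c 0 * c 1 * c 2 :=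
    fun c => by simp [hX]
  have hev5 : ∀ (c : Fin 3 → ℂ) (m : ℕ), MvPolynomial.aeval c (charDisc (redHam χ m (extend3 X'))) =
      charDisc (redHam χ m (extend3 c)) := fun c m => by
    have h := map_charDisc ((MvPolynomial.aeval c : MvPolynomial (Fin 3) ℂ →ₐ[ℂ] ℂ) :
      MvPolynomial (Fin 3) ℂ →+* ℂ) (redHam χ m (extend3 X'))
    have h2 := map_redHam χ m (MvPolynomial.aeval c : MvPolynomial (Fin 3) ℂ →ₐ[ℂ] ℂ) (extend3 X')
    rw [hext] at h2
    exact h.trans (congrArg charDisc h2)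
  refine ⟨(∏ m ∈ Finset.range (M + 1), genericTQ χ m (extend3 X')) * (spanMat χ X').det *
    (∏ j, (X' j ^ (2 * M + 1) + 1)) * (X' 0 * X' 1 * X' 2), ?_, fun cs hcs => ?_⟩
  · refine mul_ne_zero (mul_ne_zero (mul_ne_zero (Finset.prod_ne_zero_iff.mpr fun m hm => ?_)
      fun h => ?_) (Finset.prod_ne_zero_iff.mpr fun j _ h => ?_)) fun h => ?_
    · refine mul_ne_zero (fun h => ?_) fun h => ?_
      -- These parameters extend to `(1, 1, -1, 0)`.
      · have h1 := hev5 ![-1, 1, 1] m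
        rw [h, map_zero] at h1
        exact (charDisc_ne_zero_iff _).mpr (separable_charpoly_redHam hχ m) h1.symm
      -- These parameters extend to `(1, 0, 0, 0)`.
      · have h1 := map_tqObstruction χ m (MvPolynomial.aeval ![0, 1, 0] :
          MvPolynomial (Fin 3) ℂ →ₐ[ℂ] ℂ) (extend3 X') (2 * m)
        rw [h, map_zero, hext] at h1
        exact tqObstruction_three_ne_zero hχ (Nat.lt_succ_iff.mp (Finset.mem_range.mp hm)) rfl h1.symm
    · have h1 := hev2 fun _ => -χ 1
      rw [h, map_zero] at h1
      exact det_spanMat_ne_zero hχ h1.symm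
    · have h1 := congrArg (MvPolynomial.aeval fun _ => (0 : ℂ)) h
      simp [hX] at h1
    · have h1 := hev4 fun _ => 1
      rw [h, map_zero] at h1
      norm_num at h1
  · have hcs' : MvPolynomial.aeval cs ((∏ m ∈ Finset.range (M + 1), genericTQ χ m (extend3 X')) *
        (spanMat χ X').det * (∏ j, (X' j ^ (2 * M + 1) + 1)) * (X' 0 * X' 1 * X' 2)) ≠ 0 := by
      rwa [MvPolynomial.aeval_eq_eval]
    rw [map_mul, map_mul, map_mul, hev2, hev3, hev4, map_prod] at hcs'
    obtain ⟨h1, h2⟩ := mul_ne_zero_iff.mp hcs'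
    obtain ⟨h1, h3⟩ := mul_ne_zero_iff.mp h1
    obtain ⟨h1, h4⟩ := mul_ne_zero_iff.mp h1
    refine ⟨h2, ⟨1, one_ne_zero, fun j hj => ?_, by simpa using h4⟩, fun m hm => ?_⟩
    · rw [one_mul] at hj
      exact Finset.prod_ne_zero_iff.mp h3 j (Finset.mem_univ j) (by rw [hj]; ring)
    · have h5 := Finset.prod_ne_zero_iff.mp h1 m (Finset.mem_range.mpr (by omega))
      rw [hev1] at h5
      exact isGenericTQ_of_genericTQ_ne_zero hχ h5

theorem IsGenericTQ.mul (hχ : Function.Injective χ) {m : ℕ} {c : Fin 4 → ℂ}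
    (h : IsGenericTQ χ m c) {t : ℂ} (ht : t ≠ 0) : IsGenericTQ χ m fun j => t * c j := by
  refine ⟨?_, h.coeff_zero.imp_right fun h lam hlam R hR => ?_⟩
  · rw [charpoly_redHam_mul hχ ht]
    exact separable_C_mul_comp h.separable (pow_ne_zero _ ht) (inv_ne_zero (pow_ne_zero _ ht))
  · rw [isTQ_mul_param_iff ht] at hR
    have h1 : lam / t ^ 2 ∈ spectrumTQ χ m c := by
      change (tqMat χ m (fun j => t * c j) lam 1).det = 0 at hlam
      rw [tqMat_mul ht, det_tqMat _ _ _ hχ, mul_one] at hlam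
      exact (mul_eq_zero.mp hlam).resolve_right (pow_ne_zero _ ht)
    have h2 := h _ h1 _ hR
    rwa [comp_C_mul_X_coeff, pow_zero, mul_one] at h2

/-- By scaling, only the ratio `k` matters, so a polynomial in one variable suffices. The scale is
`r` for the conditions on the T-Q equation and another value `z` for the spanning condition. -/
theorem exists_generic_pair (hχ : Function.Injective χ) (hM : 1 ≤ M) :
    ∃ G : ℂ[X], G ≠ 0 ∧ ∀ k t : ℂ, G.eval k ≠ 0 → t ≠ 0 →
      BaxterSpan χ ![t, t * k, t, t * k] ∧ ∀ m ≤ M, IsGenericTQ χ m ![t, t * k, t, t * k] := by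
  obtain ⟨r, hr⟩ : ∃ r : ℂ, r ^ 2 = -χ 1 := IsAlgClosed.exists_pow_nat_eq _ two_pos
  have hr0 : r ≠ 0 := by
    rintro rfl
    exact chi_ne_zero χ 1 (by linear_combination hr)
  set cX : Fin 4 → ℂ[X] := ![C r, C r * X, C r, C r * X] with hcX
  have hmap : ∀ a k : ℂ, (aeval k : ℂ[X] →ₐ[ℂ] ℂ) ∘ ![C a, C a * X, C a, C a * X] =
      ![a, a * k, a, a * k] := fun a k => by
    ext j; fin_cases j <;> simp
  obtain ⟨z, hz⟩ : ∃ z : ℂ, ((spanMat χ fun _ : Fin 4 => (X : ℂ[X])).det *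
      (X ^ (2 * M + 1) + 1) * X).eval z ≠ 0 := by
    by_contra! h
    refine mul_ne_zero (mul_ne_zero (fun h => ?_) (fun h => ?_)) X_ne_zero
      (Polynomial.funext fun x => by rw [h x, eval_zero])
    · have h1 := map_det_spanMat χ (aeval (-χ 1) : ℂ[X] →ₐ[ℂ] ℂ) fun _ : Fin 4 => X
      rw [h, map_zero, show (aeval (-χ 1) : ℂ[X] →ₐ[ℂ] ℂ) ∘ (fun _ : Fin 4 => X) = fun _ => -χ 1 by
        ext; simp] at h1
      exact det_spanMat_ne_zero hχ h1.symm
    · simpa using congrArg (eval 0) h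
  rw [eval_mul, eval_mul, eval_X, eval_add, eval_pow, eval_X, eval_one] at hz
  have hz0 := right_ne_zero_of_mul hz
  have hz1 := right_ne_zero_of_mul (left_ne_zero_of_mul hz)
  have hz2 : (spanMat χ fun _ : Fin 4 => z).det ≠ 0 := by
    have h1 := map_det_spanMat χ (aeval z : ℂ[X] →ₐ[ℂ] ℂ) fun _ : Fin 4 => X
    rw [show (aeval z : ℂ[X] →ₐ[ℂ] ℂ) ∘ (fun _ : Fin 4 => X) = fun _ => z by
      ext; simp, coe_aeval_eq_eval] at h1
    rw [← h1]
    exact left_ne_zero_of_mul (left_ne_zero_of_mul hz)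
  refine ⟨(∏ m ∈ Finset.range (M + 1), genericTQ χ m cX) *
    (spanMat χ ![C z, C z * X, C z, C z * X]).det * ((C z * X) ^ (2 * M + 1) + 1), ?_, ?_⟩
  · refine mul_ne_zero (mul_ne_zero (Finset.prod_ne_zero_iff.mpr fun m hm => ?_)
      fun h => ?_) fun h => ?_
    · refine mul_ne_zero (fun h => ?_) fun h => ?_
      -- At `k = -2` the parameters are `r (1, -2, 1, -2)`.
      · have h1 := map_charDisc ((aeval (-2 : ℂ) : ℂ[X] →ₐ[ℂ] ℂ) : ℂ[X] →+* ℂ) (redHam χ m cX)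
        have h2 := map_redHam χ m (aeval (-2 : ℂ) : ℂ[X] →ₐ[ℂ] ℂ) cX
        rw [hcX, hmap] at h2
        rw [h, map_zero] at h1
        refine (charDisc_ne_zero_iff (redHam χ m ![r, r * -2, r, r * -2])).mpr ?_
          (h1.trans (congrArg charDisc h2)).symm
        have h3 : (![r, r * -2, r, r * -2] : Fin 4 → ℂ) =
            fun j => r * (![1, -2, 1, -2] : Fin 4 → ℂ) j := by
          ext j; fin_cases j <;> simp
        rw [h3, charpoly_redHam_mul hχ hr0]
        exact separable_C_mul_comp (separable_charpoly_redHam_pair hχ hM m) (pow_ne_zero _ hr0)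
          (inv_ne_zero (pow_ne_zero _ hr0))
      -- At `k = 0` the parameters are `(r, 0, r, 0)` with `r² = -q`.
      · have h1 := map_tqObstruction χ m (aeval (0 : ℂ) : ℂ[X] →ₐ[ℂ] ℂ) cX (2 * m)
        rw [h, map_zero, hcX, hmap, mul_zero] at h1
        exact tqObstruction_pair_ne_zero hχ (Nat.lt_succ_iff.mp (Finset.mem_range.mp hm)) rfl hr
          h1.symm
    · have h1 := map_det_spanMat χ (aeval (1 : ℂ) : ℂ[X] →ₐ[ℂ] ℂ) ![C z, C z * X, C z, C z * X]
      rw [h, map_zero, hmap, mul_one] at h1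
      refine hz2 (Eq.trans ?_ h1.symm)
      congr 2
      ext j; fin_cases j <;> rfl
    · have := congrArg (eval 0) h
      simp at this
  · intro k t hG ht
    rw [eval_mul, eval_mul, eval_prod] at hG
    obtain ⟨h1, h2⟩ := mul_ne_zero_iff.mp hG
    obtain ⟨h1, h3⟩ := mul_ne_zero_iff.mp h1
    constructor
    · have hvec : (fun j => z / t * (![t, t * k, t, t * k] : Fin 4 → ℂ) j) =
          ![z, z * k, z, z * k] := by
        ext j; fin_cases j <;> simp <;> field_simp
      have h4 : ∀ j, z / t * (![t, t * k, t, t * k] : Fin 4 → ℂ) j =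
          (![z, z * k, z, z * k] : Fin 4 → ℂ) j := fun j => congrFun hvec j
      refine ⟨z / t, div_ne_zero hz0 ht, fun j => ?_, ?_⟩
      · rw [h4]
        have h5 : z ^ (2 * M + 1) ≠ -1 := fun h => hz1 (by rw [h]; ring)
        have h6 : (z * k) ^ (2 * M + 1) ≠ -1 := fun h => h2 (by
          simp only [eval_add, eval_pow, eval_mul, eval_C, eval_X, eval_one, h]; ring)
        fin_cases j
        exacts [h5, h6, h5, h6]
      · rw [hvec]
        have h5 := map_det_spanMat χ (aeval k : ℂ[X] →ₐ[ℂ] ℂ) ![C z, C z * X, C z, C z * X]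
        rw [hmap, coe_aeval_eq_eval] at h5
        rw [← h5]
        exact h3
    · intro m hm
      have h5 := Finset.prod_ne_zero_iff.mp h1 m (Finset.mem_range.mpr (by omega))
      have h6 := map_genericTQ (χ := χ) (aeval k : ℂ[X] →ₐ[ℂ] ℂ) m cX
      rw [hcX, hmap, coe_aeval_eq_eval] at h6
      rw [h6] at h5
      have h7 := (isGenericTQ_of_genericTQ_ne_zero hχ h5).mul hχ (div_ne_zero ht hr0)
      have h8 : (fun j => t / r * (![r, r * k, r, r * k] : Fin 4 → ℂ) j) =
          ![t, t * k, t, t * k] := by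
        ext j; fin_cases j <;> simp <;> field_simp
      rwa [h8] at h7

end Genericity

/-! ### The parameters of the sine-Gordon model. -/

section SineGordon

variable {M : ℕ} {χ : AddChar (Site M) ℂ} {κ : ℂ} {r : Fin 4 → ℂ}

/-- All `r j` have square `-q`, which determines the gauge exponent up to doubling; as `N` is odd,
the exponent is `1` and all `r j` coincide. -/
theorem IsRational.gauge_params4 (hχ : Function.Injective χ) (hr : IsRational M (χ 1) (params4 (χ 1) κ) r)
    (j : Fin 4) : χ 1 * (r (j + 1) * (params4 (χ 1) κ j).a) = r j * (params4 (χ 1) κ j).d ∧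
      r j ^ 2 = -χ 1 := by
  have hκ : κ ≠ 0 := (hr.1 1).2.2.1
  have hq := chi_ne_zero χ 1
  have hsq : ∀ j, r (j + 1) ^ 2 = -χ 1 := fun j => by
    rw [hr.2.1 j]
    fin_cases j <;> simp [params4] <;> field_simp
  have hsq' : ∀ j, r j ^ 2 = -χ 1 := fun j => by
    have := hsq (j - 1)
    rwa [sub_add_cancel] at this
  refine ⟨?_, hsq' j⟩
  obtain ⟨e, he⟩ := hr.exists_gauge hχ
  have h1 := he j
  have ha : (params4 (χ 1) κ j).a = (χ 1)⁻¹ := by fin_cases j <;> rfl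
  have hd : (params4 (χ 1) κ j).d = 1 := by fin_cases j <;> rfl
  rw [ha, hd, mul_one] at h1 ⊢
  have h2 : χ (2 * e j) = χ 2 := by
    have h3 := congrArg (· ^ 2) h1
    simp only [mul_pow, hsq, hsq', inv_pow] at h3
    have h4 : χ (2 * e j) = χ (e j) ^ 2 := by
      rw [← AddChar.map_nsmul_eq_pow]; congr 1; simp
    have h5 : χ 2 = χ 1 ^ 2 := by
      rw [← AddChar.map_nsmul_eq_pow]; congr 1; simp
    rw [h4, h5]
    field_simp at h3
    linear_combination -h3
  have h3 : e j = 1 := by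
    have h4 : 2 * (e j - 1) = 0 := by linear_combination hχ h2
    exact sub_eq_zero.mp (two_mul_eq_zero_iff.mp h4)
  rw [h3] at h1
  exact h1

theorem cStar_params4 (hχ : Function.Injective χ)
    (hr : IsRational M (χ 1) (params4 (χ 1) κ) r) :
    cStar (params4 (χ 1) κ) r = ![κ⁻¹ * r 0, κ⁻¹ * r 0 * κ ^ 2, κ⁻¹ * r 0, κ⁻¹ * r 0 * κ ^ 2] := by
  have hκ : κ ≠ 0 := (hr.1 1).2.2.1
  have hstep : ∀ j, r (j + 1) = r j := fun j => by
    have h1 := (hr.gauge_params4 hχ j).1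
    have ha : (params4 (χ 1) κ j).a = (χ 1)⁻¹ := by fin_cases j <;> rfl
    have hd : (params4 (χ 1) κ j).d = 1 := by fin_cases j <;> rfl
    rw [ha, hd, mul_comm (r (j + 1)), mul_inv_cancel_left₀ (chi_ne_zero χ 1), mul_one] at h1
    exact h1
  have h1 : r 1 = r 0 := hstep 0
  have h2 : r 2 = r 0 := (hstep 1).trans h1
  have h3 : r 3 = r 0 := (hstep 2).trans h2
  ext j
  fin_cases j
  · change κ⁻¹ * r 1 / 1 = κ⁻¹ * r 0
    rw [h1, div_one]
  · change κ * r 2 / 1 = κ⁻¹ * r 0 * κ ^ 2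
    rw [h2]; field_simp
  · change κ⁻¹ * r 3 / 1 = κ⁻¹ * r 0
    rw [h3, div_one]
  · change κ * r 0 / 1 = κ⁻¹ * r 0 * κ ^ 2
    field_simp

theorem isReciprocal_cStar (hχ : Function.Injective χ)
    (hr : IsRational M (χ 1) (params4 (χ 1) κ) r) :
    IsReciprocal χ (cStar (params4 (χ 1) κ) r) := by
  have hκ : κ ≠ 0 := (hr.1 1).2.2.1
  have hq := chi_ne_zero χ 1
  have hr2 := (hr.gauge_params4 hχ 0).2
  have h2 : χ 2 = χ 1 ^ 2 := by
    rw [← AddChar.map_nsmul_eq_pow]; congr 1; simp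
  rw [cStar_params4 hχ hr]
  constructor
  · rw [Fin.prod_univ_four]
    change κ⁻¹ * r 0 * (κ⁻¹ * r 0 * κ ^ 2) * (κ⁻¹ * r 0) * (κ⁻¹ * r 0 * κ ^ 2) = _
    rw [h2]
    field_simp
    linear_combination (r 0 ^ 2 - χ 1) * hr2
  · intro x hx
    rw [tqP_vec, tqP_vec, h2, AddChar.map_neg_eq_inv]
    have hχ1 : χ 1 = -r 0 ^ 2 := by rw [hr2, neg_neg]
    have hr0 : r 0 ≠ 0 := fun h => hq (by rw [hχ1, h]; ring)
    rw [hχ1]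
    field_simp
    ring

theorem mem_symTQEigenvalues_iff (hχ : Function.Injective χ) (hM : 1 ≤ M) {m : ℕ} (hm : m ≤ M)
    (hr : IsRational M (χ 1) (params4 (χ 1) κ) r)
    (hB : BaxterSpan χ (cStar (params4 (χ 1) κ) r))
    (hG : IsGenericTQ χ m (cStar (params4 (χ 1) κ) r)) {Λ : ℂ[X]} (hΛ : Reciprocal (χ 1) m Λ) :
    (Λ ∈ symTQEigenvalues M (χ 1) m (cStar (params4 (χ 1) κ) r) ↔
      ∃ φ, φ ᵥ* opC M (χ 2) = φ ∧ IsEigenvector M (χ 2) (params4 (χ 1) κ) φ (C (χ 1 ^ m) * Λ)) ∧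
    (Λ ∈ symTQEigenvalues M (χ 1) m (cStar (params4 (χ 1) κ) r) ↔
      ∃ φ, φ ᵥ* opC M (χ 2) = φ ∧
        IsEigenvector M (χ 2) (params4 (χ 1) κ) φ (C (χ 1 ^ m)⁻¹ * Λ)) := by
  have hc := isReciprocal_cStar hχ hr
  have he : ∀ j, χ ((1 : Fin 4 → Site M) j) * (r (j + 1) * (params4 (χ 1) κ j).a) =
      r j * (params4 (χ 1) κ j).d := fun j => (hr.gauge_params4 hχ j).1
  have hC : (1 : Fin 4 → Site M) 1 + (1 : Fin 4 → Site M) 3 = 2 := one_add_one_eq_two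
  obtain ⟨lam, rfl⟩ := (reciprocal_iff hc.1).mp hΛ
  have hE : ∀ Λ : ℂ[X], (∃ φ, φ ᵥ* opC M (χ 2) = φ ∧
      IsEigenvector M (χ 2) (params4 (χ 1) κ) φ Λ) ↔
      ∃ φ, φ ᵥ* opC M (χ 2) = χ (-2) • φ ∧
        IsEigenvector M (χ 2) (stdParams (cStar (params4 (χ 1) κ) r)) φ Λ := fun Λ => by
    constructor
    · rintro ⟨φ, h1, hφ⟩
      rw [← gaugeVec_gaugeVec_neg 1 φ] at hφ h1
      exact ⟨_, (gaugeVec_vecMul_opC hC).mp h1, (isEigenvector_gaugeVec_iff hr he).mp hφ⟩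
    · rintro ⟨φ, h1, hφ⟩
      exact ⟨_, (gaugeVec_vecMul_opC hC).mpr h1, (isEigenvector_gaugeVec_iff hr he).mpr hφ⟩
  rw [symTQEigenvalues_eq hχ hm hM hc hG, (tqLambda_injective χ m _).mem_set_image, hE, hE,
    C_chi_neg]
  constructor
  · rw [← chi_natCast, exists_eigenvector_four_iff hχ hB]
  · rw [← tqLambda_neg, exists_eigenvector_four_iff hχ hB, spectrumTQ_neg]

/-- The value at `x = 0` of the eigenvalue determines the action of `D`. -/
theorem vecMul_opD_of_isEigenvector {φ : (Fin 4 → Site M) → ℂ} {Λ : ℂ[X]}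
    (hφ : IsEigenvector M (χ 2) (params4 (χ 1) κ) φ Λ) :
    φ ᵥ* opD 4 M (χ 2) (χ 1) = (Λ.eval 0 - 1) • φ := by
  have h := hφ.2 0
  rw [normTransfer, transfer_zero, Fin.prod_univ_four, Fin.prod_univ_four] at h
  change φ ᵥ* (((1 : ℂ) * 1 * 1 * 1)⁻¹ • (((χ 1)⁻¹ * (χ 1)⁻¹ * (χ 1)⁻¹ * (χ 1)⁻¹) •
    tensorOp (fun _ : Fin 4 => weylY M (χ 2)) + ((1 : ℂ) * 1 * 1 * 1) • 1)) = _ at h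
  have h4 : (χ 1)⁻¹ * (χ 1)⁻¹ * (χ 1)⁻¹ * (χ 1)⁻¹ = (χ 1 ^ 4)⁻¹ := by
    rw [← inv_pow]; ring
  simp only [one_mul, inv_one, one_smul, vecMul_add, vecMul_one, h4] at h
  rw [opD, sub_smul, one_smul, ← h, add_sub_cancel_right]

end SineGordon

end BaxterTQ

namespace BaxterTQ

/-! ### Symmetrically ordered Weyl operators. -/

section WeylGroup

variable {M L : ℕ} (χ : AddChar (Site M) ℂ)

/-- The symmetrically ordered product `χ(t) ∏ₗ Z^{aₗ} X^{δₗ}`. -/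
noncomputable def weylU (t : Site M) (a δ : Fin L → Site M) : ChainOp L M :=
  chainWeyl χ (t + ∑ l, a l * δ l) (fun l => 2 * a l) δ

/-- In symmetric ordering the phase of a product is the symplectic form. It vanishes on multiples of
one vector, so powers and inverses carry no extra phase. -/
theorem weylU_mul (t t' : Site M) (a δ a' δ' : Fin L → Site M) :
    weylU χ t a δ * weylU χ t' a' δ' =
      weylU χ (t + t' + ∑ l, (a l * δ' l - a' l * δ l)) (a + a') (δ + δ') := by
  rw [weylU, weylU, chainWeyl_mul, weylU]
  congr 1
  · simp only [Pi.add_apply, add_mul, mul_add, Finset.sum_add_distrib, Finset.sum_sub_distrib,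
      mul_assoc, ← Finset.mul_sum]
    ring
  · ext l
    simp only [Pi.add_apply]
    ring

theorem weylU_zero : weylU χ 0 0 0 = (1 : ChainOp L M) := by
  rw [one_eq_chainWeyl χ, weylU]
  simp [Pi.zero_def]

theorem weylU_mul_neg (t : Site M) (a δ : Fin L → Site M) :
    weylU χ t a δ * weylU χ (-t) (-a) (-δ) = 1 := by
  rw [weylU_mul, ← weylU_zero χ]
  simp

theorem inv_weylU (t : Site M) (a δ : Fin L → Site M) :
    (weylU χ t a δ)⁻¹ = weylU χ (-t) (-a) (-δ) :=
  inv_eq_right_inv (weylU_mul_neg χ t a δ)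

theorem weylU_pow (t : Site M) (a δ : Fin L → Site M) (n : ℕ) :
    weylU χ t a δ ^ n = weylU χ (n * t) (fun l => n * a l) (fun l => n * δ l) := by
  induction n with
  | zero =>
    rw [pow_zero, ← weylU_zero χ]
    simp [Pi.zero_def]
  | succ n ih =>
    rw [pow_succ, ih, weylU_mul]
    have h : ∀ l, (n : Site M) * a l * δ l - a l * (n * δ l) = 0 := fun l => by ring
    simp only [h, Finset.sum_const_zero]
    congr 1
    · push_cast; ring
    · ext l; simp only [Pi.add_apply]; push_cast; ring
    · ext l; simp only [Pi.add_apply]; push_cast; ring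

theorem weylU_pow_card (t : Site M) (a δ : Fin L → Site M) :
    weylU χ t a δ ^ (2 * M + 1) = 1 := by
  rw [weylU_pow, natCast_site, ← weylU_zero χ]
  simp [Pi.zero_def]

theorem chi_smul_weylU (c t : Site M) (a δ : Fin L → Site M) :
    χ c • weylU χ t a δ = weylU χ (c + t) a δ := by
  ext i j
  simp only [weylU, chainWeyl, Matrix.smul_apply, of_apply, smul_eq_mul, mul_ite, mul_zero,
    ← AddChar.map_add_eq_mul, add_assoc]

theorem conjTranspose_weylU (t : Site M) (a δ : Fin L → Site M) :
    (weylU χ t a δ)ᴴ = weylU χ (-t) (-a) (-δ) := by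
  ext i j
  simp only [conjTranspose_apply, weylU, chainWeyl, of_apply]
  by_cases h : j = i + δ
  · rw [if_pos h, if_pos (by rw [h]; simp)]
    change starRingEnd ℂ _ = _
    rw [conj_chi, h]
    congr 1
    simp only [Pi.neg_apply, Pi.add_apply, neg_add, ← Finset.sum_neg_distrib, add_assoc,
      ← Finset.sum_add_distrib]
    congr 1
    refine Finset.sum_congr rfl fun l _ => ?_
    ring
  · rw [if_neg h, if_neg (fun h' => h (by rw [h']; simp)), star_zero]

theorem weylU_mem_unitaryGroup (t : Site M) (a δ : Fin L → Site M) :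
    weylU χ t a δ ∈ unitaryGroup (Fin L → Site M) ℂ := by
  rw [mem_unitaryGroup_iff, star_eq_conjTranspose, conjTranspose_weylU, weylU_mul_neg]

theorem weylU_commute (t t' : Site M) {a δ a' δ' : Fin L → Site M}
    (h : ∑ l, (a l * δ' l - a' l * δ l) = 1) :
    weylU χ t a δ * weylU χ t' a' δ' = χ 2 • (weylU χ t' a' δ' * weylU χ t a δ) := by
  have h' : ∑ l, (a' l * δ l - a l * δ' l) = -1 := by
    rw [← h, ← Finset.sum_neg_distrib]
    exact Finset.sum_congr rfl fun l _ => by ring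
  rw [weylU_mul, weylU_mul, chi_smul_weylU, h, h', add_comm a, add_comm δ]
  congr 1
  ring

theorem tensorOp_eq_weylU {A : Fin L → SiteOp M} (t a δ : Fin L → Site M)
    (h : ∀ l, A l = siteWeyl χ (t l + a l * δ l) (2 * a l) (δ l)) :
    tensorOp A = weylU χ (∑ l, t l) a δ := by
  rw [show A = _ from funext h, tensorOp_siteWeyl, Finset.sum_add_distrib, weylU]

theorem opD_eq : opD L M (χ 2) (χ 1) = weylU χ 0 1 1 := by
  rw [opD, tensorOp_eq_weylU χ (fun _ => 1) (fun _ => 1) (fun _ => 1) fun l => by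
    rw [weylY_eq χ]; norm_num]
  rw [← chi_natCast, ← AddChar.map_neg_eq_inv, chi_smul_weylU]
  simp
  rfl

theorem natCast_eq_neg_half : (M : Site M) = -half M := by
  have h1 : ((M + 1 : ℕ) : Site M) = half M := rfl
  have h2 := natCast_site (M := M)
  push_cast at h1 h2
  linear_combination h2 - h1

theorem sqrtD_eq : sqrtD L M (χ 2) (χ 1) = weylU χ 0 (fun _ => half M) fun _ => half M := by
  rw [sqrtD, opD_eq, weylU_pow, show ((M + 1 : ℕ) : Site M) = half M from rfl]
  simp

theorem invSqrtD_eq : invSqrtD L M (χ 2) (χ 1) =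
    weylU χ 0 (fun _ => -half M) fun _ => -half M := by
  rw [invSqrtD, opD_eq, weylU_pow, natCast_eq_neg_half]
  simp

/-- The expansion of the normalized `T(x) D^{-1/2}`. -/
theorem transferStar_eq [NeZero L] (h : Fin L → Params) (x : ℂ) :
    transferStar M (χ 2) (χ 1) h x = (∏ j, (h j).d)⁻¹ • ∑ s : Fin L → Fin 2,
      (∏ j, lCoef (h j) x (s j) (s (j + 1))) •
        weylU χ (∑ j, lShift (s j) * lShift (s (j + 1))) (fun j => lShift (s (j + 1)) - half M)
          fun j => lShift (s j) - half M := by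
  rw [transferStar, normTransfer, transfer_eq χ, invSqrtD_eq, smul_mul, Finset.sum_mul]
  congr 1
  refine Finset.sum_congr rfl fun s _ => ?_
  rw [smul_mul]
  congr 1
  have h1 : chainWeyl χ (∑ j, 2 * lShift (s j) * lShift (s (j + 1)))
      (fun j => 2 * lShift (s (j + 1))) (fun j => lShift (s j)) =
      weylU χ (∑ j, lShift (s j) * lShift (s (j + 1))) (fun j => lShift (s (j + 1)))
        fun j => lShift (s j) := by
    rw [weylU, ← Finset.sum_add_distrib]
    congr 1
    exact Finset.sum_congr rfl fun j _ => by ring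
  have h2 : ∑ j, lShift (M := M) (s (j + 1)) = ∑ j, lShift (s j) :=
    Equiv.sum_comp (Equiv.addRight (1 : Fin L)) fun j => lShift (s j)
  rw [h1, weylU_mul]
  congr 1
  · rw [Finset.sum_sub_distrib, ← Finset.sum_mul, ← Finset.mul_sum, h2]
    ring
  · ext j; exact (sub_eq_add_neg _ _).symm
  · ext j; exact (sub_eq_add_neg _ _).symm

end WeylGroup

/-! ### The Hofstadter type Hamiltonian. -/

section Hofstadter

variable {M : ℕ} {χ : AddChar (Site M) ℂ} {h : Fin 3 → Params} {r : Fin 3 → ℂ}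

/-- The Weyl operators in the expansion of `T*(x)` for `L = 3`. -/
noncomputable def weyl3 (χ : AddChar (Site M) ℂ) (t a b c : Site M) : ChainOp 3 M :=
  weylU χ t ![b - half M, c - half M, a - half M] ![a - half M, b - half M, c - half M]

theorem weyl3_inv (t a b c : Site M) :
    (weyl3 χ t a b c)⁻¹ = weyl3 χ (-t) (1 - a) (1 - b) (1 - c) := by
  have hh := two_mul_half (M := M)
  rw [weyl3, inv_weylU, weyl3]
  congr 1 <;> ext j <;> fin_cases j <;> simp <;> linear_combination hh

/-- A closed auxiliary sequence changes its value an even number of times, so `x` enters only as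
`x⁰` or `x²`. The six sequences with two changes form three pairs of complementary ones, whose Weyl
operators are mutually inverse. -/
theorem transferStar_three (h : Fin 3 → Params) (x : ℂ) : transferStar M (χ 2) (χ 1) h x =
    transferStar M (χ 2) (χ 1) h 0 + x ^ 2 • ((∏ j, (h j).d)⁻¹ •
      ((((h 2).c * (h 0).b * (h 1).d) • weyl3 χ 0 1 0 0 +
        (χ 1 * ((h 2).b * (h 0).c * (h 1).a)) • weyl3 χ 0 0 1 1) +
      (((h 0).c * (h 1).b * (h 2).d) • weyl3 χ 0 0 1 0 +
        (χ 1 * ((h 0).b * (h 1).c * (h 2).a)) • weyl3 χ 0 1 0 1) +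
      (((h 1).c * (h 2).b * (h 0).d) • weyl3 χ 0 0 0 1 +
        (χ 1 * ((h 1).b * (h 2).c * (h 0).a)) • weyl3 χ 0 1 1 0))) := by
  have hw : ∀ a b c : Fin 2, weylU χ
      (∑ j, lShift ((![a, b, c] : Fin 3 → Fin 2) j) * lShift ((![a, b, c] : Fin 3 → Fin 2) (j + 1)))
      (fun j => lShift ((![a, b, c] : Fin 3 → Fin 2) (j + 1)) - half M)
      (fun j => lShift ((![a, b, c] : Fin 3 → Fin 2) j) - half M) =
      χ (lShift a * lShift b + lShift b * lShift c + lShift c * lShift a) •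
        weyl3 χ 0 (lShift a) (lShift b) (lShift c) := fun a b c => by
    rw [weyl3, chi_smul_weylU, add_zero, Fin.sum_univ_three]
    congr 1 <;> ext j <;> fin_cases j <;> rfl
  have hl : ∀ a b c : Fin 2, ∏ j, lCoef (h j) x ((![a, b, c] : Fin 3 → Fin 2) j)
      ((![a, b, c] : Fin 3 → Fin 2) (j + 1)) =
      lCoef (h 0) x a b * lCoef (h 1) x b c * lCoef (h 2) x c a := fun a b c => by
    rw [Fin.prod_univ_three]; rfl
  have hl0 : ∀ a b c : Fin 2, ∏ j, lCoef (h j) 0 ((![a, b, c] : Fin 3 → Fin 2) j)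
      ((![a, b, c] : Fin 3 → Fin 2) (j + 1)) =
      lCoef (h 0) 0 a b * lCoef (h 1) 0 b c * lCoef (h 2) 0 c a := fun a b c => by
    rw [Fin.prod_univ_three]; rfl
  rw [transferStar_eq, transferStar_eq, smul_comm (x ^ 2), ← smul_add]
  congr 1
  rw [sum_fin_three, sum_fin_three]
  simp only [Fin.sum_univ_two, hw, hl, hl0]
  simp only [lCoef, lShift, cons_val_zero, cons_val_one, cons_val_fin_one, mul_zero, zero_mul, mul_one,
    add_zero, zero_add, AddChar.map_zero_eq_one, one_smul, zero_smul]
  module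

/-- By the gauge relations the two coefficients of each pair differ by a power of `q`. Half of its
exponent is absorbed into the Weyl operator, which makes the two coefficients equal. -/
theorem IsRational.hofstadter (hχ : Function.Injective χ) (hr : IsRational M (χ 1) h r) :
    ∃ (μ ν ρ : ℂ) (U V W : ChainOp 3 M), IsWeylTriple (2 * M + 1) (χ 2) U V W ∧
      ∀ x : ℂ, transferStar M (χ 2) (χ 1) h x = transferStar M (χ 2) (χ 1) h 0 +
        x ^ 2 • hofstadter μ ν ρ 1 1 1 U V W := by
  obtain ⟨e, he⟩ := hr.exists_gauge hχ
  have hb : ∀ j, χ (e j) * (h j).b = r j * r (j + 1) * (h j).c := fun j => by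
    obtain ⟨ha, hb, hc, hd⟩ := hr.1 j
    have h1 := hr.2.1 j
    rw [eq_div_iff (mul_ne_zero ha hc)] at h1
    refine mul_right_cancel₀ hd ?_
    linear_combination -χ (e j) * h1 + r (j + 1) * (h j).c * he j
  have hratio : ∀ i j k : Fin 3, j = i + 1 → k = j + 1 → i = k + 1 →
      (h i).c * (h j).b * (h k).d =
        χ (e i + e k - e j - 1) * (χ 1 * ((h i).b * (h j).c * (h k).a)) := by
    rintro i j k rfl rfl hi
    have b1 := hb i
    have b2 := hb (i + 1)
    have a3 := he (i + 1 + 1)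
    rw [← hi] at a3
    have r1 := hr.ne_zero i
    have r2 := hr.ne_zero (i + 1)
    have r3 := hr.ne_zero (i + 1 + 1)
    have e1 := chi_ne_zero χ (e i)
    have e2 := chi_ne_zero χ (e (i + 1))
    have hχ1 := chi_ne_zero χ 1
    rw [AddChar.map_sub_eq_div, AddChar.map_sub_eq_div, AddChar.map_add_eq_mul]
    have b1' : (h i).b = r i * r (i + 1) * (h i).c / χ (e i) := by
      rw [eq_div_iff e1, mul_comm, b1]
    have b2' : (h (i + 1)).b = r (i + 1) * r (i + 1 + 1) * (h (i + 1)).c / χ (e (i + 1)) := by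
      rw [eq_div_iff e2, mul_comm, b2]
    rw [b1', b2']
    field_simp
    linear_combination (-(h i).c * (h (i + 1)).c) * a3
  have hh := two_mul_half (M := M)
  -- Halving the exponent is possible because `2` is invertible modulo `N`.
  have hcoef : ∀ (i j k : Fin 3) (t : Site M), j = i + 1 → k = j + 1 → i = k + 1 →
      t = (e i + e k - e j - 1) * half M →
      (h i).c * (h j).b * (h k).d = (χ t * (χ 1 * ((h i).b * (h j).c * (h k).a))) * χ t ∧
      χ 1 * ((h i).b * (h j).c * (h k).a) =
        (χ t * (χ 1 * ((h i).b * (h j).c * (h k).a))) * χ (-t) := by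
    rintro i j k t h1 h2 h3 ht
    have e1 : χ t * χ t = χ (e i + e k - e j - 1) := by
      rw [← AddChar.map_add_eq_mul, ht]
      congr 1
      linear_combination (e i + e k - e j - 1) * hh
    have e2 : χ t * χ (-t) = 1 := by
      rw [← AddChar.map_add_eq_mul, add_neg_cancel, AddChar.map_zero_eq_one]
    rw [hratio i j k h1 h2 h3, ← e1]
    constructor
    · ring
    · linear_combination (-(χ 1 * ((h i).b * (h j).c * (h k).a))) * e2
  set t₀ := (e 2 + e 1 - e 0 - 1) * half M with ht₀
  set t₁ := (e 0 + e 2 - e 1 - 1) * half M with ht₁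
  set t₂ := (e 1 + e 0 - e 2 - 1) * half M with ht₂
  obtain ⟨c0, c0'⟩ := hcoef 2 0 1 t₀ rfl rfl rfl ht₀
  obtain ⟨c1, c1'⟩ := hcoef 0 1 2 t₁ rfl rfl rfl ht₁
  obtain ⟨c2, c2'⟩ := hcoef 1 2 0 t₂ rfl rfl rfl ht₂
  refine ⟨(∏ j, (h j).d)⁻¹ * (χ t₁ * (χ 1 * ((h 0).b * (h 1).c * (h 2).a))),
    (∏ j, (h j).d)⁻¹ * (χ t₀ * (χ 1 * ((h 2).b * (h 0).c * (h 1).a))),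
    (∏ j, (h j).d)⁻¹ * (χ t₂ * (χ 1 * ((h 1).b * (h 2).c * (h 0).a))),
    weyl3 χ t₁ 0 1 0, weyl3 χ t₀ 1 0 0, weyl3 χ t₂ 0 0 1, ?_, fun x => ?_⟩
  · refine ⟨weylU_mem_unitaryGroup _ _ _ _, weylU_mem_unitaryGroup _ _ _ _,
      weylU_mem_unitaryGroup _ _ _ _, weylU_commute _ _ _ ?_, weylU_commute _ _ _ ?_,
      weylU_commute _ _ _ ?_, weylU_pow_card _ _ _ _, weylU_pow_card _ _ _ _,
      weylU_pow_card _ _ _ _⟩ <;>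
    · simp only [Fin.sum_univ_three, cons_val_zero, cons_val_one, cons_val]
      ring
  · have hs : ∀ t a b c : Site M, weyl3 χ t a b c = χ t • weyl3 χ 0 a b c := fun t a b c => by
      rw [weyl3, weyl3, chi_smul_weylU, add_zero]
    have hterm : ∀ {A B : ℂ} {t : Site M} (V W : ChainOp 3 M), A = χ t * B * χ t →
        B = χ t * B * χ (-t) → A • V + B • W = (χ t * B) • (χ t • V + χ (-t) • W) :=
      fun V W h1 h2 => by rw [smul_add, smul_smul, smul_smul, ← h1, ← h2]
    rw [transferStar_three, BaxterTQ.hofstadter, hterm _ _ c0 c0', hterm _ _ c1 c1',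
      hterm _ _ c2 c2', inv_one, weyl3_inv, weyl3_inv, weyl3_inv]
    simp only [hs t₀, hs t₁, hs t₂, hs (-t₀), hs (-t₁), hs (-t₂), sub_zero, sub_self]
    module

end Hofstadter

end BaxterTQ

namespace BaxterTQ

/-! ### The discrete sine-Gordon model and the quantum pendulum. -/

section SineGordon

variable {M : ℕ} (χ : AddChar (Site M) ℂ)

theorem opC_eq : opC M (χ 2) = weylU χ 0 ![1, 0, 1, 0] ![0, 1, 0, 1] := by
  rw [opC, tensorOp_eq_weylU χ 0 ![1, 0, 1, 0] ![0, 1, 0, 1] fun l => by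
    fin_cases l <;> simp [weylX_eq χ, weylZ_eq χ]]
  simp

theorem opU1_eq : opU1 M (χ 2) = weylU χ 0 ![1, 0, 0, 0] ![0, 1, 0, 0] := by
  rw [opU1, tensorOp_eq_weylU χ 0 ![1, 0, 0, 0] ![0, 1, 0, 0] fun l => by
    fin_cases l <;> simp [weylX_eq χ, weylZ_eq χ, one_eq_siteWeyl χ]]
  simp

theorem opU2_eq : opU2 M (χ 2) = weylU χ 0 ![0, 1, 0, 0] ![0, 0, 1, 0] := by
  rw [opU2, tensorOp_eq_weylU χ 0 ![0, 1, 0, 0] ![0, 0, 1, 0] fun l => by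
    fin_cases l <;> simp [weylX_eq χ, weylZ_eq χ, one_eq_siteWeyl χ]]
  simp

theorem opU3_eq : opU3 M (χ 2) = weylU χ 0 ![0, 0, 1, 0] ![0, 0, 0, 1] := by
  rw [opU3, tensorOp_eq_weylU χ 0 ![0, 0, 1, 0] ![0, 0, 0, 1] fun l => by
    fin_cases l <;> simp [weylX_eq χ, weylZ_eq χ, one_eq_siteWeyl χ]]
  simp

theorem opU4_eq : opU4 M (χ 2) = weylU χ 0 ![0, 0, 0, 1] ![1, 0, 0, 0] := by
  rw [opU4, tensorOp_eq_weylU χ 0 ![0, 0, 0, 1] ![1, 0, 0, 0] fun l => by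
    fin_cases l <;> simp [weylX_eq χ, weylZ_eq χ, one_eq_siteWeyl χ]]
  simp

theorem opV1_eq : opV1 M (χ 2) = weylU χ 1 ![0, 1, 1, 0] ![0, 0, 1, 1] := by
  rw [opV1, tensorOp_eq_weylU χ ![0, 0, 1, 0] ![0, 1, 1, 0] ![0, 0, 1, 1] fun l => by
    fin_cases l <;> norm_num [weylX_eq χ, weylZ_eq χ, weylY_eq χ]
    exact one_eq_siteWeyl χ]
  simp [Fin.sum_univ_four]

theorem opV4_eq : opV4 M (χ 2) = weylU χ 1 ![1, 1, 0, 0] ![0, 1, 1, 0] := by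
  rw [opV4, tensorOp_eq_weylU χ ![0, 1, 0, 0] ![1, 1, 0, 0] ![0, 1, 1, 0] fun l => by
    fin_cases l <;> norm_num [weylX_eq χ, weylZ_eq χ, weylY_eq χ]
    exact one_eq_siteWeyl χ]
  simp [Fin.sum_univ_four]

/-- The Weyl operators in the expansion of `T*(x)` for `L = 4`. -/
noncomputable def weyl4 (χ : AddChar (Site M) ℂ) (a b c d : Site M) : ChainOp 4 M :=
  weylU χ 0 ![b - half M, c - half M, d - half M, a - half M]
    ![a - half M, b - half M, c - half M, d - half M]

theorem invSqrtD_eq_weyl4 : invSqrtD 4 M (χ 2) (χ 1) = weyl4 χ 0 0 0 0 := by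
  rw [invSqrtD_eq, weyl4]
  congr 1 <;> ext j <;> fin_cases j <;> simp

theorem sqrtD_eq_weyl4 : sqrtD 4 M (χ 2) (χ 1) = weyl4 χ 1 1 1 1 := by
  have hh := two_mul_half (M := M)
  rw [sqrtD_eq, weyl4]
  congr 1 <;> ext j <;> fin_cases j <;> simp <;> linear_combination hh

theorem invSqrtD_mul_weylU (t t' : Site M) (a b c d : Site M) (ht : t' = t) :
    invSqrtD 4 M (χ 2) (χ 1) * weylU χ t ![b, c, d, a] ![a, b, c, d] =
      χ t' • weyl4 χ a b c d := by
  rw [invSqrtD_eq, weylU_mul, weyl4, chi_smul_weylU]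
  congr 1
  · simp [Fin.sum_univ_four, ht]
    ring
  · ext j; fin_cases j <;> simp <;> ring
  · ext j; fin_cases j <;> simp <;> ring

theorem sqrtD_mul_inv_weylU (t : Site M) (a b c d : Site M) :
    sqrtD 4 M (χ 2) (χ 1) * (weylU χ t ![b, c, d, a] ![a, b, c, d])⁻¹ =
      χ (-t) • weyl4 χ (1 - a) (1 - b) (1 - c) (1 - d) := by
  have hh := two_mul_half (M := M)
  rw [inv_weylU, sqrtD_eq, weylU_mul, weyl4, chi_smul_weylU]
  congr 1
  · simp [Fin.sum_univ_four]
    ring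
  · ext j; fin_cases j <;> simp <;> linear_combination hh
  · ext j; fin_cases j <;> simp <;> linear_combination hh

theorem opC_mul_weyl4 (a b c d : Site M) :
    opC M (χ 2) * weyl4 χ a b c d = weyl4 χ a (b + 1) c (d + 1) := by
  rw [opC_eq, weyl4, weylU_mul, weyl4]
  congr 1
  · simp [Fin.sum_univ_four]
    ring
  · ext j; fin_cases j <;> simp <;> ring
  · ext j; fin_cases j <;> simp <;> ring

theorem opD_mul_weyl4 (a b c d : Site M) :
    opD 4 M (χ 2) (χ 1) * weyl4 χ a b c d = weyl4 χ (a + 1) (b + 1) (c + 1) (d + 1) := by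
  rw [opD_eq, weyl4, weylU_mul, weyl4]
  congr 1
  · simp [Fin.sum_univ_four]
    ring
  · ext j; fin_cases j <;> simp <;> ring
  · ext j; fin_cases j <;> simp <;> ring

theorem opC_mul_inv : opC M (χ 2) * (opC M (χ 2))⁻¹ = 1 := by
  rw [opC_eq, inv_weylU, weylU_mul_neg]

theorem inv_opC_mul_weyl4 (a b c d : Site M) :
    (opC M (χ 2))⁻¹ * weyl4 χ a (b + 1) c (d + 1) = weyl4 χ a b c d := by
  rw [← opC_mul_weyl4, ← mul_assoc, mul_eq_one_comm.mp (opC_mul_inv χ), one_mul]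

variable {κ : ℂ}

theorem sineGordon_eq (hκ : κ ≠ 0) : sineGordon M (χ 2) (χ 1) (κ ^ 2)
    (fun j => (params4 (χ 1) κ j).c) (fun j => (params4 (χ 1) κ j).d) =
    (weyl4 χ 0 1 0 0 + weyl4 χ 0 0 1 0 + weyl4 χ 0 0 0 1 + weyl4 χ 1 0 0 0 +
      weyl4 χ 1 0 1 1 + weyl4 χ 1 1 0 1 + weyl4 χ 1 1 1 0 + weyl4 χ 0 1 1 1) +
    κ ^ 2 • (weyl4 χ 0 0 1 1 + weyl4 χ 1 1 0 0) +
    (κ ^ 2)⁻¹ • (weyl4 χ 0 1 1 0 + weyl4 χ 1 0 0 1) := by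
  have hq := chi_ne_zero χ 1
  have hq' : χ (-1) = (χ 1)⁻¹ := AddChar.map_neg_eq_inv χ 1
  have c0 : (params4 (χ 1) κ 0).c = κ⁻¹ := rfl
  have c1 : (params4 (χ 1) κ 1).c = κ := rfl
  have c2 : (params4 (χ 1) κ 2).c = κ⁻¹ := rfl
  have c3 : (params4 (χ 1) κ 3).c = κ := rfl
  have d0 : (params4 (χ 1) κ 0).d = 1 := rfl
  have d1 : (params4 (χ 1) κ 1).d = 1 := rfl
  have d2 : (params4 (χ 1) κ 2).d = 1 := rfl
  have d3 : (params4 (χ 1) κ 3).d = 1 := rfl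
  simp only [sineGordon, c0, c1, c2, c3, d0, d1, d2, d3, opU1_eq, opU2_eq, opU3_eq, opU4_eq,
    opV1_eq, opV4_eq, invSqrtD_mul_weylU χ _ _ _ _ _ _ rfl, sqrtD_mul_inv_weylU, neg_zero,
    AddChar.map_zero_eq_one, one_smul, sub_zero, sub_self, hq']
  match_scalars <;> field_simp

/-- The `x⁴` terms come from the two alternating auxiliary sequences, which give `C D^{-1/2}` and
`C⁻¹ D^{1/2}`; the constant sequences give `D^{±1/2}`. -/
theorem transferStar_params4 (hκ : κ ≠ 0) (x : ℂ) :
    transferStar M (χ 2) (χ 1) (params4 (χ 1) κ) x =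
      (sqrtD 4 M (χ 2) (χ 1) + invSqrtD 4 M (χ 2) (χ 1)) +
      x ^ 4 • (opC M (χ 2) * invSqrtD 4 M (χ 2) (χ 1) +
        (opC M (χ 2))⁻¹ * sqrtD 4 M (χ 2) (χ 1)) -
      x ^ 2 • sineGordon M (χ 2) (χ 1) (κ ^ 2) (fun j => (params4 (χ 1) κ j).c)
        (fun j => (params4 (χ 1) κ j).d) := by
  have hq := chi_ne_zero χ 1
  have hw : ∀ a b c d : Fin 2, weylU χ
      (∑ j, lShift ((![a, b, c, d] : Fin 4 → Fin 2) j) *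
        lShift ((![a, b, c, d] : Fin 4 → Fin 2) (j + 1)))
      (fun j => lShift ((![a, b, c, d] : Fin 4 → Fin 2) (j + 1)) - half M)
      (fun j => lShift ((![a, b, c, d] : Fin 4 → Fin 2) j) - half M) =
      χ (lShift a * lShift b + lShift b * lShift c + lShift c * lShift d + lShift d * lShift a) •
        weyl4 χ (lShift a) (lShift b) (lShift c) (lShift d) := fun a b c d => by
    rw [weyl4, chi_smul_weylU, add_zero, Fin.sum_univ_four]
    congr 1 <;> ext j <;> fin_cases j <;> rfl
  have hl : ∀ a b c d : Fin 2, ∏ j, lCoef (params4 (χ 1) κ j) x ((![a, b, c, d] : Fin 4 → Fin 2) j)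
      ((![a, b, c, d] : Fin 4 → Fin 2) (j + 1)) =
      (!![(χ 1)⁻¹, x * -κ⁻¹; x * κ⁻¹, 1] : Matrix (Fin 2) (Fin 2) ℂ) a b *
      (!![(χ 1)⁻¹, x * -κ; x * κ, 1] : Matrix (Fin 2) (Fin 2) ℂ) b c *
      (!![(χ 1)⁻¹, x * -κ⁻¹; x * κ⁻¹, 1] : Matrix (Fin 2) (Fin 2) ℂ) c d *
      (!![(χ 1)⁻¹, x * -κ; x * κ, 1] : Matrix (Fin 2) (Fin 2) ℂ) d a := fun a b c d => by
    rw [Fin.prod_univ_four]; rfl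
  have hd : ∏ j, (params4 (χ 1) κ j).d = 1 := by
    rw [Fin.prod_univ_four]; simp [params4]
  have h2 : χ (1 + 1) = χ 1 ^ 2 := by rw [AddChar.map_add_eq_mul, sq]
  have h4 : χ (1 + 1 + 1 + 1) = χ 1 ^ 4 := by simp only [AddChar.map_add_eq_mul]; ring
  rw [transferStar_eq, sineGordon_eq χ hκ, sqrtD_eq_weyl4, invSqrtD_eq_weyl4,
    opC_mul_weyl4, show weyl4 χ 1 1 1 1 = weyl4 χ 1 (0 + 1) 1 (0 + 1) by rw [zero_add],
    inv_opC_mul_weyl4, zero_add, hd, inv_one, one_smul, sum_fin_four]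
  simp only [Fin.sum_univ_two, hw, hl]
  simp only [lShift, cons_val_zero, cons_val_one, cons_val_fin_one, mul_zero,
    mul_one, add_zero, zero_add, AddChar.map_zero_eq_one, one_smul, of_apply, cons_val', h2, h4]
  match_scalars <;> field_simp

variable {χ} {φ : (Fin 4 → Site M) → ℂ}

theorem vecMul_mul_of_vecMul_eq {n : Type*} [Fintype n] {v : n → ℂ} {A : Matrix n n ℂ}
    (h : v ᵥ* A = v) (B : Matrix n n ℂ) : v ᵥ* (A * B) = v ᵥ* B := by
  rw [← vecMul_vecMul, h]

theorem vecMul_pow_of_vecMul_eq {n : Type*} [Fintype n] [DecidableEq n] {v : n → ℂ}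
    {A : Matrix n n ℂ} (h : v ᵥ* A = v) (k : ℕ) : v ᵥ* A ^ k = v := by
  induction k with
  | zero => rw [pow_zero, vecMul_one]
  | succ k ih => rw [pow_succ, ← vecMul_vecMul, ih, h]

/-- The discrete sine-Gordon model is the sector `C = 1`. -/
theorem vecMul_transferStar_params4 (hκ : κ ≠ 0) (hC : φ ᵥ* opC M (χ 2) = φ) (x : ℂ) :
    φ ᵥ* transferStar M (χ 2) (χ 1) (params4 (χ 1) κ) x =
      φ ᵥ* ((1 + x ^ 4) • (sqrtD 4 M (χ 2) (χ 1) + invSqrtD 4 M (χ 2) (χ 1)) -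
        x ^ 2 • sineGordon M (χ 2) (χ 1) (κ ^ 2) (fun j => (params4 (χ 1) κ j).c)
          (fun j => (params4 (χ 1) κ j).d)) := by
  have hC' : φ ᵥ* (opC M (χ 2))⁻¹ = φ := by
    rw [← vecMul_mul_of_vecMul_eq hC, opC_mul_inv χ, vecMul_one]
  rw [transferStar_params4 χ hκ, vecMul_sub, vecMul_sub, vecMul_add, vecMul_smul, vecMul_smul,
    vecMul_smul, vecMul_add, vecMul_add, vecMul_mul_of_vecMul_eq hC,
    vecMul_mul_of_vecMul_eq hC']
  module

theorem vecMul_invSqrtD_mul_opU2 (hC : φ ᵥ* opC M (χ 2) = φ) :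
    φ ᵥ* (invSqrtD 4 M (χ 2) (χ 1) * opU2 M (χ 2)) =
      φ ᵥ* (sqrtD 4 M (χ 2) (χ 1) * (opU4 M (χ 2))⁻¹) := by
  rw [opU2_eq, opU4_eq, invSqrtD_mul_weylU χ _ _ _ _ _ _ rfl, sqrtD_mul_inv_weylU, neg_zero,
    sub_self, sub_zero, AddChar.map_zero_eq_one, one_smul, one_smul,
    ← vecMul_mul_of_vecMul_eq hC (weyl4 χ 0 0 1 0), opC_mul_weyl4, zero_add]

/-- On `D = 1` the operator `D^{-1/2}` may be inserted freely, which puts every Weyl operator into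
the form `weyl4`. -/
theorem vecMul_weylU (hD : φ ᵥ* opD 4 M (χ 2) (χ 1) = φ) (t a b c d : Site M) :
    φ ᵥ* weylU χ t ![b, c, d, a] ![a, b, c, d] = χ t • (φ ᵥ* weyl4 χ a b c d) := by
  rw [← vecMul_smul, ← invSqrtD_mul_weylU χ t t a b c d rfl, invSqrtD,
    vecMul_mul_of_vecMul_eq (vecMul_pow_of_vecMul_eq hD M)]

theorem vecMul_weyl4_opC (hC : φ ᵥ* opC M (χ 2) = φ) (a b c d : Site M) :
    φ ᵥ* weyl4 χ a (b + 1) c (d + 1) = φ ᵥ* weyl4 χ a b c d := by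
  rw [← opC_mul_weyl4, vecMul_mul_of_vecMul_eq hC]

theorem vecMul_weyl4_opD (hD : φ ᵥ* opD 4 M (χ 2) (χ 1) = φ) (a b c d : Site M) :
    φ ᵥ* weyl4 χ (a + 1) (b + 1) (c + 1) (d + 1) = φ ᵥ* weyl4 χ a b c d := by
  rw [← opD_mul_weyl4, vecMul_mul_of_vecMul_eq hD]

theorem inv_opU2 : (opU2 M (χ 2))⁻¹ = weylU χ 0 ![0, -1, 0, 0] ![0, 0, -1, 0] := by
  rw [opU2_eq, inv_weylU]
  congr 1 <;> simp

theorem inv_opU3 : (opU3 M (χ 2))⁻¹ = weylU χ 0 ![0, 0, -1, 0] ![0, 0, 0, -1] := by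
  rw [opU3_eq, inv_weylU]
  congr 1 <;> simp

theorem vecMul_opU2 (hC : φ ᵥ* opC M (χ 2) = φ) (hD : φ ᵥ* opD 4 M (χ 2) (χ 1) = φ) :
    φ ᵥ* opU2 M (χ 2) = φ ᵥ* (opU4 M (χ 2))⁻¹ := by
  have h := vecMul_invSqrtD_mul_opU2 hC
  rwa [invSqrtD, sqrtD, vecMul_mul_of_vecMul_eq (vecMul_pow_of_vecMul_eq hD _),
    vecMul_mul_of_vecMul_eq (vecMul_pow_of_vecMul_eq hD _)] at h

theorem vecMul_inv_opU1 (hC : φ ᵥ* opC M (χ 2) = φ) (hD : φ ᵥ* opD 4 M (χ 2) (χ 1) = φ) :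
    φ ᵥ* (opU1 M (χ 2))⁻¹ = φ ᵥ* opU3 M (χ 2) := by
  have h := sqrtD_mul_inv_weylU χ 0 0 1 0 0
  rw [← opU1_eq] at h
  rw [← vecMul_mul_of_vecMul_eq (vecMul_pow_of_vecMul_eq hD (M + 1)), ← sqrtD, h, opU3_eq,
    vecMul_weylU hD, neg_zero, AddChar.map_zero_eq_one, one_smul, one_smul,
    ← vecMul_weyl4_opD hD 0 0 0 1, ← vecMul_weyl4_opC hC, sub_zero, sub_self, zero_add]

/-- The discrete quantum pendulum is the sector `C = D = 1`. -/
theorem vecMul_transferStar_pendulum (hκ : κ ≠ 0) (hC : φ ᵥ* opC M (χ 2) = φ)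
    (hD : φ ᵥ* opD 4 M (χ 2) (χ 1) = φ) (x : ℂ) :
    φ ᵥ* transferStar M (χ 2) (χ 1) (params4 (χ 1) κ) x =
      φ ᵥ* ((2 * (1 + x ^ 4)) • (1 : ChainOp 4 M) -
        x ^ 2 • pendulum (χ 1) (κ ^ 2) (opU2 M (χ 2)) (opU3 M (χ 2))) := by
  have hq : χ 1 * χ (-1) = 1 := by
    rw [← AddChar.map_add_eq_mul, add_neg_cancel, AddChar.map_zero_eq_one]
  have hq' : (χ 1)⁻¹ * χ 1 = 1 := inv_mul_cancel₀ (chi_ne_zero χ 1)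
  have hAB : opU2 M (χ 2) * opU3 M (χ 2) = weylU χ (-1) ![0, 1, 1, 0] ![0, 0, 1, 1] := by
    rw [opU2_eq, opU3_eq, weylU_mul]
    congr 1 <;> simp [Fin.sum_univ_four]
  have hBA : (opU3 M (χ 2))⁻¹ * (opU2 M (χ 2))⁻¹ =
      weylU χ 1 ![0, -1, -1, 0] ![0, 0, -1, -1] := by
    rw [inv_opU2, inv_opU3, weylU_mul]
    congr 1 <;> simp [Fin.sum_univ_four]
  have hBA' : opU3 M (χ 2) * (opU2 M (χ 2))⁻¹ =
      weylU χ (-1) ![0, -1, 1, 0] ![0, 0, -1, 1] := by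
    rw [inv_opU2, opU3_eq, weylU_mul]
    congr 1 <;> simp [Fin.sum_univ_four]
  have hAB' : opU2 M (χ 2) * (opU3 M (χ 2))⁻¹ =
      weylU χ 1 ![0, 1, -1, 0] ![0, 0, 1, -1] := by
    rw [inv_opU3, opU2_eq, weylU_mul]
    congr 1 <;> simp [Fin.sum_univ_four]
  -- On `C = D = 1` the indices count only modulo `(0, 1, 0, 1)` and `(1, 1, 1, 1)`. Making the
  -- first two zero leaves words in `U₂` and `U₃`.
  have e0 : φ ᵥ* weyl4 χ 1 1 1 0 = φ ᵥ* weyl4 χ 0 0 0 (-1) := by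
    simpa using vecMul_weyl4_opD hD 0 0 0 (-1)
  have e1 : φ ᵥ* weyl4 χ 0 1 0 0 = φ ᵥ* weyl4 χ 0 0 0 (-1) := by
    simpa using vecMul_weyl4_opC hC 0 0 0 (-1)
  have e2 : φ ᵥ* weyl4 χ 0 1 1 1 = φ ᵥ* weyl4 χ 0 0 1 0 := by
    simpa using vecMul_weyl4_opC hC 0 0 1 0
  have e3 : φ ᵥ* weyl4 χ 1 0 1 1 = φ ᵥ* weyl4 χ 0 0 0 1 := by
    have h := vecMul_weyl4_opC hC 1 0 1 1
    rw [← vecMul_weyl4_opD hD 0 0 0 1]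
    simpa using h.symm
  have e4 : φ ᵥ* weyl4 χ 1 1 0 1 = φ ᵥ* weyl4 χ 0 0 (-1) 0 := by
    simpa using vecMul_weyl4_opD hD 0 0 (-1) 0
  have e5 : φ ᵥ* weyl4 χ 1 0 0 0 = φ ᵥ* weyl4 χ 0 0 (-1) 0 := by
    rw [← e4]
    simpa using (vecMul_weyl4_opC hC 1 0 0 0).symm
  have e6 : φ ᵥ* weyl4 χ 1 1 0 0 = φ ᵥ* weyl4 χ 0 0 (-1) (-1) := by
    simpa using vecMul_weyl4_opD hD 0 0 (-1) (-1)
  have e7 : φ ᵥ* weyl4 χ 1 0 0 1 = φ ᵥ* weyl4 χ 0 0 (-1) 1 := by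
    have h := vecMul_weyl4_opC hC 1 0 0 1
    rw [← vecMul_weyl4_opD hD 0 0 (-1) 1]
    simpa using h.symm
  have e8 : φ ᵥ* weyl4 χ 0 1 1 0 = φ ᵥ* weyl4 χ 0 0 1 (-1) := by
    simpa using vecMul_weyl4_opC hC 0 0 1 (-1)
  rw [vecMul_transferStar_params4 hκ hC, sineGordon_eq χ hκ, pendulum, hAB, hBA, hBA', hAB',
    inv_opU2, inv_opU3, opU2_eq, opU3_eq]
  simp only [vecMul_sub, vecMul_smul, vecMul_add, vecMul_weylU hD, vecMul_one, sqrtD, invSqrtD,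
    vecMul_pow_of_vecMul_eq hD, e0, e1, e2, e3, e4, e5, e6, e7, e8, AddChar.map_zero_eq_one,
    one_smul, smul_smul, hq, hq']
  module

end SineGordon

end BaxterTQ

/-! ### Assembly. -/

namespace BaxterTQ

/-- The character is `k ↦ q^k`; it is faithful because `M + 1` is prime to `2M + 1`. Arguments of
`χ` are exponents of `q`, so `ω = q²` is `χ 2`, and `half` serves as the exponent of `q^{1/2}`. -/
theorem exists_addChar {M : ℕ} {ω : ℂ} (hω : IsPrimitiveRoot ω (2 * M + 1)) :
    ∃ χ : AddChar (Site M) ℂ, Function.Injective χ ∧ χ 1 = ω ^ (M + 1) ∧ χ 2 = ω := by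
  have hq : IsPrimitiveRoot (ω ^ (M + 1)) (2 * M + 1) :=
    hω.pow_of_coprime _ (by
      rw [show 2 * M + 1 = M + (M + 1) by ring, Nat.coprime_add_self_right]
      exact (Nat.coprime_self_add_left (m := M) (n := 1)).mpr (Nat.coprime_one_left M))
  refine ⟨AddChar.zmodChar _ hq.pow_eq_one, fun a b hab => ?_, ?_, ?_⟩
  · rw [AddChar.zmodChar_apply, AddChar.zmodChar_apply] at hab
    exact ZMod.val_injective _ (hq.pow_inj (ZMod.val_lt a) (ZMod.val_lt b) hab)
  · simpa using AddChar.zmodChar_apply' hq.pow_eq_one 1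
  · refine (AddChar.zmodChar_apply' hq.pow_eq_one 2).trans ?_
    rw [← pow_mul, show (M + 1) * 2 = 2 * M + 1 + 1 by ring, pow_succ, hω.pow_eq_one, one_mul]

end BaxterTQ

open BaxterTQ in
theorem theorem2 (M : ℕ) (hM : 1 ≤ M) (ω q : ℂ) (hω : IsPrimitiveRoot ω (2 * M + 1))
    (hq : q = ω ^ (M + 1)) :
    -- (i) `L = 3`
    (∃ G : MvPolynomial (Fin 3) ℂ, G ≠ 0 ∧
      ∀ cs : Fin 3 → ℂ, MvPolynomial.eval cs G ≠ 0 →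
        (∀ m ≤ M,
          (tqEigenvalues M q m cs).ncard = 2 * M + 1 ∧
          ∀ Λ ∈ tqEigenvalues M q m cs, ∃ Q : ℂ[X],
            Q.Monic ∧ Q.natDegree = 3 * M - m ∧ Q.eval 0 ≠ 0 ∧
            tqEigenspace M q m cs Λ = Submodule.span ℂ {Q}) ∧
        -- the corresponding Hamiltonian
        ∀ (h : Fin 3 → Params) (r : Fin 3 → ℂ), IsRational M q h r → cStar h r = cs →
          (∃ (μ ν ρ : ℂ) (U V W : ChainOp 3 M), IsWeylTriple (2 * M + 1) ω U V W ∧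
            ∀ x : ℂ, transferStar M ω q h x =
              transferStar M ω q h 0 + x ^ 2 • hofstadter μ ν ρ 1 1 1 U V W) ∧
          ∀ m ≤ M, ∀ Λ : ℂ[X], Admissible 3 q m Λ →
            (Λ ∈ tqEigenvalues M q m cs ↔
              ∃ φ, IsEigenvector M ω h φ (C (q ^ m) * Λ)) ∧
            (Λ ∈ tqEigenvalues M q m cs ↔
              ∃ φ, IsEigenvector M ω h φ (C (q ^ m)⁻¹ * Λ))) ∧
    -- (ii) `L = 4`
    (∃ G : ℂ[X], G ≠ 0 ∧
      ∀ k κ : ℂ, k ≠ 0 → κ ^ 2 = k → G.eval k ≠ 0 →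
      ∀ r : Fin 4 → ℂ, IsRational M q (params4 q κ) r →
        (∀ m ≤ M,
          (symTQEigenvalues M q m (cStar (params4 q κ) r)).ncard = 2 * M + 1 ∧
          (∀ Λ ∈ symTQEigenvalues M q m (cStar (params4 q κ) r), ∃ Q : ℂ[X],
            Q.Monic ∧ Q.natDegree = 4 * M - 2 * m ∧ Q.eval 0 ≠ 0 ∧
            (Q.reverse = Q ∨ Q.reverse = -Q) ∧
            tqEigenspace M q m (cStar (params4 q κ) r) Λ = Submodule.span ℂ {Q}) ∧
          {Q ∈ symTQEigenpolynomials M q m (cStar (params4 q κ) r) |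
            Q.reverse = Q}.ncard = M + 1 ∧
          {Q ∈ symTQEigenpolynomials M q m (cStar (params4 q κ) r) |
            Q.reverse = -Q}.ncard = M) ∧
        -- the sine-Gordon model is the sector `C = 1`, for all `m`
        (∀ φ : (Fin 4 → ZMod (2 * M + 1)) → ℂ, φ ᵥ* opC M ω = φ →
          φ ᵥ* (invSqrtD 4 M ω q * opU2 M ω) = φ ᵥ* (sqrtD 4 M ω q * (opU4 M ω)⁻¹) ∧
          ∀ x : ℂ, φ ᵥ* transferStar M ω q (params4 q κ) x =
            φ ᵥ* ((1 + x ^ 4) • (sqrtD 4 M ω q + invSqrtD 4 M ω q) -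
              x ^ 2 • sineGordon M ω q k (fun j => (params4 q κ j).c)
                (fun j => (params4 q κ j).d))) ∧
        (∀ m ≤ M, ∀ Λ : ℂ[X], Reciprocal q m Λ →
          (Λ ∈ symTQEigenvalues M q m (cStar (params4 q κ) r) ↔
            ∃ φ, φ ᵥ* opC M ω = φ ∧
              IsEigenvector M ω (params4 q κ) φ (C (q ^ m) * Λ)) ∧
          (Λ ∈ symTQEigenvalues M q m (cStar (params4 q κ) r) ↔
            ∃ φ, φ ᵥ* opC M ω = φ ∧
              IsEigenvector M ω (params4 q κ) φ (C (q ^ m)⁻¹ * Λ))) ∧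
        -- the discrete quantum pendulum is the sector `C = 1`, `D = 1`, that is, `m = 0`
        (∀ φ : (Fin 4 → ZMod (2 * M + 1)) → ℂ, φ ᵥ* opC M ω = φ → φ ᵥ* opD 4 M ω q = φ →
          φ ᵥ* opU2 M ω = φ ᵥ* (opU4 M ω)⁻¹ ∧ φ ᵥ* (opU1 M ω)⁻¹ = φ ᵥ* opU3 M ω ∧
          ∀ x : ℂ, φ ᵥ* transferStar M ω q (params4 q κ) x =
            φ ᵥ* ((2 * (1 + x ^ 4)) • (1 : ChainOp 4 M) -
              x ^ 2 • pendulum q k (opU2 M ω) (opU3 M ω))) ∧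
        (∀ Λ : ℂ[X], Reciprocal q 0 Λ →
          (Λ ∈ symTQEigenvalues M q 0 (cStar (params4 q κ) r) ↔
            ∃ φ, φ ᵥ* opC M ω = φ ∧ φ ᵥ* opD 4 M ω q = φ ∧
              IsEigenvector M ω (params4 q κ) φ Λ))) := by
  obtain ⟨χ, hχ, h1, h2⟩ := exists_addChar hω
  obtain rfl : χ 1 = q := h1.trans hq.symm
  obtain rfl : χ 2 = ω := h2
  clear hω hq h1
  constructor
  · obtain ⟨G, hG, hgen⟩ := exists_generic_three hχ
    refine ⟨G, hG, fun cs hcs => ?_⟩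
    obtain ⟨hcs0, hB, hgen⟩ := hgen cs hcs
    refine ⟨fun m hm => ⟨?_, fun Λ hΛ => ?_⟩, ?_⟩
    · rw [tqEigenvalues_three hχ hm hcs0 (hgen m hm),
        Set.ncard_image_of_injective _ (tqLambda_injective χ m (extend3 cs)),
        ncard_spectrumTQ hχ (hgen m hm).separable]
    · rw [tqEigenvalues_three hχ hm hcs0 (hgen m hm)] at hΛ
      obtain ⟨lam, hlam, rfl⟩ := hΛ
      exact exists_monic_tqEigenspace_three hχ hm hcs0 (hgen m hm) hlam
    · rintro h r hr rfl
      exact ⟨hr.hofstadter hχ, fun m hm Λ hΛ =>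
        mem_tqEigenvalues_three_iff hχ hm hr hcs0 hB (hgen m hm) hΛ⟩
  · obtain ⟨G, hG, hgen⟩ := exists_generic_pair hχ hM
    refine ⟨G, hG, ?_⟩
    rintro _ κ hk rfl hGk r hr
    have hκ : κ ≠ 0 := (hr.1 1).2.2.1
    have hrec := isReciprocal_cStar hχ hr
    -- By `cStar_params4` the parameters are `(t, t k, t, t k)` with `t = κ⁻¹ r 0`.
    obtain ⟨hB, hgen⟩ := hgen (κ ^ 2) (κ⁻¹ * r 0) hGk
      (mul_ne_zero (inv_ne_zero hκ) (hr.ne_zero 0))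
    rw [← cStar_params4 hχ hr] at hB hgen
    refine ⟨fun m hm => ⟨?_, fun Λ hΛ => ?_, ncard_reverse hχ hm hM hrec (hgen m hm)⟩,
      fun φ hC => ⟨vecMul_invSqrtD_mul_opU2 hC, vecMul_transferStar_params4 hκ hC⟩,
      fun m hm Λ hΛ => mem_symTQEigenvalues_iff hχ hM hm hr hB (hgen m hm) hΛ,
      fun φ hC hD => ⟨vecMul_opU2 hC hD, vecMul_inv_opU1 hC hD,
        vecMul_transferStar_pendulum hκ hC hD⟩, fun Λ hΛ => ?_⟩
    · rw [symTQEigenvalues_eq hχ hm hM hrec (hgen m hm),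
        Set.ncard_image_of_injective _ (tqLambda_injective χ m _),
        ncard_spectrumTQ hχ (hgen m hm).separable]
    · rw [symTQEigenvalues_eq hχ hm hM hrec (hgen m hm)] at hΛ
      obtain ⟨lam, hlam, rfl⟩ := hΛ
      exact exists_monic_tqEigenspace_four hχ hm hM hrec (hgen m hm) hlam
    · rw [(mem_symTQEigenvalues_iff hχ hM (Nat.zero_le M) hr hB (hgen 0 (Nat.zero_le M)) hΛ).1,
        pow_zero, C_1, one_mul]
      refine exists_congr fun φ => and_congr_right fun _ =>
        ⟨fun hφ => ⟨?_, hφ⟩, fun hφ => hφ.2⟩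
      obtain ⟨lam, rfl⟩ := hΛ
      -- `D` acts by `Λ(0) - 1`, and `Λ(0) = 2` for `m = 0`.
      rw [vecMul_opD_of_isEigenvector hφ]
      norm_num
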